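/- Let $\mathbb{T}^2=\mathbb{R}^2/2\pi\mathbb{Z}^2$, and let $\nu>0$, $\lambda>0$ and $T>0$. For $s\in\mathbb{R}$ let $H^s(\mathbb{T}^2)$ be the Sobolev space with norm $\big(\sum_{k\in\mathbb{Z}^2}(1+|k|^2)^s|\hat f(k)|^2\big)^{1/2}$, and let $(\cdot,\cdot)$ denote the $L^2(\mathbb{T}^2)$ pairing, extended to the duality pairing of distributions with smooth functions. The reduced Kuramoto–Sivashinsky system for $u=(u_1,u_2)$ is $$\partial_t u_1+(u\cdot\nabla)u_1=\nu\Delta u_1,\qquad \partial_t u_2+(u\cdot\nabla)u_2=-\lambda\Delta u_2-\Delta^2u_2,\qquad u(\cdot,0)=u^{in}.$$ A strong solution over $[0,T]$ with initial data $u^{in}$ is a function $u=(u_1,u_2)$, real-valued in each component, with $$u\in L^\infty(0,T;H^1),\quad u_1\in L^2(0,T;H^2),\quad u_2\in L^2(0,T;H^3),$$ $$u\in C([0,T];H^s)\ \text{ for every } s\in[0,1),\quad \partial_t u\in L^2(0,T;H^{-1}),$$ (all spaces over $\mathbb{T}^2$, $\partial_t$ in the sense of distributions), with $u(0)=u^{in}$,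 and such that for all $\phi_1,\phi_2\in C^\infty(\mathbb{T}^2)$ and almost every $t\in[0,T]$ $$(\partial_t u_1,\phi_1)+\nu(\nabla u_1,\nabla\phi_1)+(u\cdot\nabla u_1,\phi_1)=0,$$ $$(\partial_t u_2,\phi_2)+(\Delta u_2,\Delta\phi_2)+(u\cdot\nabla u_2,\phi_2)=\lambda(\nabla u_2,\nabla\phi_2).$$ Theorem. For every $u^{in}=(u_1^{in},u_2^{in})\in H^1(\mathbb{T}^2)$ with $u_1^{in}\in L^\infty(\mathbb{T}^2)$ and every $T>0$ there exists a unique strong solution over $[0,T]$ with initial data $u^{in}$. -/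

import Mathlib

open MeasureTheory Set
open scoped ENNReal ContDiff ComplexConjugate

namespace RKSE

noncomputable section

/-! ### The torus, smooth functions, Fourier coefficients -/

instance two_pi_pos_fact : Fact ((0 : ℝ) < 2 * Real.pi) := ⟨Real.two_pi_pos⟩

/-- The torus `𝕋² = ℝ² / 2πℤ²`, with Lebesgue measure (total mass `(2π)²`) as `volume`. -/
abbrev Torus : Type := Fin 2 → AddCircle (2 * Real.pi)

/-- The real Hilbert space `L²(𝕋²)`. -/
abbrev L2 : Type := Lp ℝ 2 (volume : Measure Torus)

/-- `φ ∈ C^∞(𝕋²)`: the `2π`-periodic function on `ℝ²` that `φ` lifts to is smooth. -/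
def IsSmooth (φ : Torus → ℝ) : Prop :=
  ContDiff ℝ ∞ (fun x : Fin 2 → ℝ => φ (fun i => (x i : AddCircle (2 * Real.pi))))

/-- The classical partial derivative `∂ⱼ φ` of a function on the torus. -/
def pderiv (j : Fin 2) (φ : Torus → ℝ) (x : Torus) : ℝ :=
  deriv (fun h : ℝ => φ (x + Pi.single j (h : AddCircle (2 * Real.pi)))) 0

/-- The classical Laplacian `Δ φ = ∂₁ ∂₁ φ + ∂₂ ∂₂ φ` of a function on the torus. -/
def lap (φ : Torus → ℝ) (x : Torus) : ℝ :=
  ∑ j : Fin 2, pderiv j (pderiv j φ) x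

/-- The Fourier coefficient `f̂(k) = (2π)⁻² ∫ f(x) e^{-i k·x} dx`. -/
def fcoeff (f : Torus → ℝ) (k : Fin 2 → ℤ) : ℂ :=
  (((2 * Real.pi) ^ 2)⁻¹ : ℝ) * ∫ x : Torus, (f x : ℂ) * ∏ j : Fin 2, fourier (-(k j)) (x j)

/-! ### Sobolev spaces -/

/-- The weight `(1 + |k|²)^{s/2}`. -/
def weight (s : ℝ) (k : Fin 2 → ℤ) : ℝ := (1 + ∑ j : Fin 2, (k j : ℝ) ^ 2) ^ (s / 2)

lemma weight_pos (s : ℝ) (k : Fin 2 → ℤ) : 0 < weight s k :=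
  Real.rpow_pos_of_pos (by positivity) _

/-- A real periodic distribution is identified with the family `c` of its Fourier coefficients.
It belongs to `H^s` if `∑ₖ (1 + |k|²)^s |c(k)|² < ∞`; it is real if `c(-k)` is the conjugate of
`c(k)`. -/
def sobolevSubmodule (s : ℝ) : Submodule ℝ ((Fin 2 → ℤ) → ℂ) where
  carrier := {c | Memℓp (fun k => weight s k • c k) 2 ∧ ∀ k, c (-k) = conj (c k)}
  add_mem' := by
    rintro a b ⟨ha, ha'⟩ ⟨hb, hb'⟩
    refine ⟨?_, fun k => by simp [ha', hb']⟩
    have h := ha.add hb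
    convert h using 1
    funext k
    simp
  zero_mem' := by
    refine ⟨?_, fun k => by simp⟩
    have h : Memℓp (0 : (k : Fin 2 → ℤ) → ℂ) 2 := zero_memℓp
    convert h using 1
    funext k
    simp
  smul_mem' := by
    rintro r a ⟨ha, ha'⟩
    refine ⟨?_, fun k => by simp [ha']⟩
    have h := ha.const_smul r
    convert h using 1
    funext k
    simp only [Pi.smul_apply, smul_comm r]

/-- The Sobolev space `H^s(𝕋²)`, for any real `s`, with the norm
`‖c‖ = (∑ₖ (1 + |k|²)^s |c(k)|²)^{1/2}`. -/
def Sobolev (s : ℝ) : Type := sobolevSubmodule s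

instance (s : ℝ) : AddCommGroup (Sobolev s) := inferInstanceAs (AddCommGroup (sobolevSubmodule s))

instance (s : ℝ) : Module ℝ (Sobolev s) := inferInstanceAs (Module ℝ (sobolevSubmodule s))

/-- The `k`-th Fourier coefficient of an element of `H^s`. -/
def Sobolev.coeff {s : ℝ} (c : Sobolev s) (k : Fin 2 → ℤ) : ℂ := c.1 k

/-- The map `c ↦ ((1 + |k|²)^{s/2} c(k))ₖ` from `H^s` to `ℓ²(ℤ²)`, from which `H^s` has its norm. -/
def Sobolev.toSeq (s : ℝ) : Sobolev s →ₗ[ℝ] lp (fun _ : Fin 2 → ℤ => ℂ) 2 where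
  toFun c := ⟨fun k => weight s k • c.coeff k, c.2.1⟩
  map_add' a b := by
    ext k
    exact smul_add (weight s k) (a.coeff k) (b.coeff k)
  map_smul' r a := by
    ext k
    exact smul_comm (weight s k) r (a.coeff k)

lemma Sobolev.toSeq_injective (s : ℝ) : Function.Injective (Sobolev.toSeq s) := by
  intro a b h
  refine Subtype.ext (funext fun k => ?_)
  have hk := congrArg (fun v : lp (fun _ : Fin 2 → ℤ => ℂ) 2 => v k) h
  exact smul_right_injective ℂ (weight_pos s k).ne' hk

instance (s : ℝ) : NormedAddCommGroup (Sobolev s) :=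
  NormedAddCommGroup.induced _ _ (Sobolev.toSeq s) (Sobolev.toSeq_injective s)

instance (s : ℝ) : NormedSpace ℝ (Sobolev s) := NormedSpace.induced ℝ _ _ (Sobolev.toSeq s)

/-- The duality pairing `⟨c, φ⟩` of a distribution `c ∈ H^s` with a smooth function `φ`, which
extends `(f, φ) = ∫ f φ`. The sum is real because `c` and `φ` are. -/
def Sobolev.pairing {s : ℝ} (c : Sobolev s) (φ : Torus → ℝ) : ℝ :=
  (2 * Real.pi) ^ 2 * (∑' k, c.coeff k * conj (fcoeff φ k)).re

/-- The element `c` of `H^s` is the function `f ∈ L²`. -/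
def Represents {s : ℝ} (c : Sobolev s) (f : L2) : Prop := ∀ k, c.coeff k = fcoeff f k

/-- `f ∈ H^s(𝕋²)`, for `f ∈ L²(𝕋²)`. -/
def MemSobolev (s : ℝ) (f : L2) : Prop := ∃ c : Sobolev s, Represents c f

/-! ### Functions of time with values in Sobolev spaces -/

/-- Lebesgue measure on the time interval `[0,T]`. -/
abbrev timeMeasure (T : ℝ) : Measure ℝ := volume.restrict (Icc 0 T)

/-- `f ∈ L^p([0,T]; H^s(𝕋²))`. -/
def MemBochner (p : ℝ≥0∞) (T s : ℝ) (f : ℝ → L2) : Prop :=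
  ∃ c : ℝ → Sobolev s, MemLp c p (timeMeasure T) ∧ ∀ᵐ t ∂(timeMeasure T), Represents (c t) (f t)

/-- `f ∈ C([0,T]; H^s(𝕋²))`. -/
def MemCont (T s : ℝ) (f : ℝ → L2) : Prop :=
  ∃ c : ℝ → Sobolev s, ContinuousOn c (Icc 0 T) ∧ ∀ t ∈ Icc 0 T, Represents (c t) (f t)

/-- `∂ₜ f = g` in the sense of distributions on `(0,T) × 𝕋²`. -/
def IsTimeDeriv {s : ℝ} (T : ℝ) (f : ℝ → L2) (g : ℝ → Sobolev s) : Prop :=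
  ∀ φ : Torus → ℝ, IsSmooth φ → ∀ ψ : ℝ → ℝ, ContDiff ℝ ∞ ψ → HasCompactSupport ψ →
    tsupport ψ ⊆ Ioo 0 T →
    ∫ t in Icc 0 T, deriv ψ t * ∫ x, f t x * φ x = - ∫ t in Icc 0 T, ψ t * (g t).pairing φ

/-! ### Weak spatial derivatives -/

/-- `g` is the weak partial derivative `∂ⱼ f`. -/
def IsWeakPartial (j : Fin 2) (f g : L2) : Prop :=
  ∀ φ : Torus → ℝ, IsSmooth φ → ∫ x, f x * pderiv j φ x = - ∫ x, g x * φ x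

open Classical in
/-- The weak partial derivative `∂ⱼ f`, used where it exists in `L²` (it is then unique). -/
def wpartial (j : Fin 2) (f : L2) : L2 :=
  if h : ∃ g, IsWeakPartial j f g then h.choose else 0

/-- The weak Laplacian. -/
def wlap (f : L2) : L2 := ∑ j : Fin 2, wpartial j (wpartial j f)

/-- `(∇ f, ∇ φ)`. -/
def gradInner (f : L2) (φ : Torus → ℝ) : ℝ :=
  ∑ j : Fin 2, ∫ x, wpartial j f x * pderiv j φ x

/-- `(Δ f, Δ φ)`. -/
def lapInner (f : L2) (φ : Torus → ℝ) : ℝ := ∫ x, wlap f x * lap φ x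

/-- `((u · ∇) f, φ)`. -/
def advInner (u : Fin 2 → L2) (f : L2) (φ : Torus → ℝ) : ℝ :=
  ∫ x, (∑ j : Fin 2, u j x * wpartial j f x) * φ x

/-! ### Strong solutions -/

/-- `u = (u 0, u 1)` is a strong solution on `[0,T]`, with initial data `uin`, of
`∂ₜ u₁ + (u·∇) u₁ = ν Δ u₁`, `∂ₜ u₂ + (u·∇) u₂ = -lam Δ u₂ - Δ² u₂`. -/
structure IsStrongSolution (ν lam T : ℝ) (uin : Fin 2 → L2) (u : ℝ → Fin 2 → L2) : Prop where
  initial : u 0 = uin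
  mem_H1 : ∀ i, MemBochner ∞ T 1 (fun t => u t i)
  mem_H2 : MemBochner 2 T 2 (fun t => u t 0)
  mem_H3 : MemBochner 2 T 3 (fun t => u t 1)
  mem_cont : ∀ s : ℝ, 0 ≤ s → s < 1 → ∀ i, MemCont T s (fun t => u t i)
  equation : ∃ g : ℝ → Fin 2 → Sobolev (-1),
    (∀ i, MemLp (fun t => g t i) 2 (timeMeasure T)) ∧
    (∀ i, IsTimeDeriv T (fun t => u t i) (fun t => g t i)) ∧
    ∀ φ : Fin 2 → Torus → ℝ, (∀ i, IsSmooth (φ i)) → ∀ᵐ t ∂(timeMeasure T),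
      (g t 0).pairing (φ 0) + ν * gradInner (u t 0) (φ 0) + advInner (u t) (u t 0) (φ 0) = 0 ∧
      (g t 1).pairing (φ 1) + lapInner (u t 1) (φ 1) + advInner (u t) (u t 1) (φ 1)
        = lam * gradInner (u t 1) (φ 1)

end

end RKSE

/-!
The whole proof takes place in Fourier coefficients. With `sobSq s c = ∑ₖ (1 + |k|²)^s |c(k)|²`, the
system says that each coefficient satisfies the integrated ordinary differential equation
`ModeSol`, with the symbol `rate` of the linear part and the coefficient of the advection term
`(u·∇)u` as forcing (`PairSol`). Both symbols are at least `c (1 + |k|²) - C`, so that summing over the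
modes gives a parabolic energy estimate in every `H^s` (`energy_sobSq`, `PairSol.energy`). That a
strong solution solves these equations follows by testing with `Re (c e^{i k·x})` and from the lemma
of du Bois-Reymond (`IsStrongSolution.pairSol`, `IsPrim.of_integral_deriv_mul`); the converse holds
for solutions with the right bounds (`PairSol.isStrongSolution`).

*Stability.* The difference `w = u - v` of two solutions is estimated in `H^{1/2}`. The difference of
the advection terms, measured in `L²`, is bounded by Hölder's inequality and the embedding
`H^{5/4} ⊆ L^∞`; interpolation leaves a small multiple of `‖w‖²_{3/2}`, which the dissipation absorbs,
and a multiple of `‖w‖²_{1/2}` with a coefficient that is integrable in time as soon as the solutions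
are in `L^∞H¹ ∩ L²H²`. Grönwall's inequality yields `exists_stability`. No condition on the divergence
of the velocity is involved. Uniqueness is immediate (`IsStrongSolution.eq`).

*Existence.* In the velocity the first component is replaced by `θ(u₀)`, `θ` being the projection onto
`[-M, M]` and `M` a bound for the initial value of `u₀`. The Galerkin approximations of this system
exist globally (`exists_isGalerkin`) and have uniform bounds (`exists_galerkin_bounds`): tested with
`u₁`, the term `u₁ ∂₁u₁` vanishes and `θ(u₀) ∂₀u₁` is bounded by `M |∂₀u₁|`, so the fourth order
equation gives a bound for `u₁` in `L²H² ⊆ L²L^∞`. As the velocity is now in `L²L^∞`, the `H¹` estimate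
of both components closes. The stability estimate, with the truncation as an error term, shows that
the approximations converge, and their limit solves the cut-off system (`exists_galerkin_limit`).

It remains to see that the cut-off is inactive, that is `|u₀| ≤ M`: a maximum principle. The Galerkin
approximations do not satisfy it pointwise, so it is proved through integrals `∫ Γ(u₀)`, where the
convex function `Γ` vanishes exactly on `(-∞, M]` or on `[-M, ∞)`. If `γ = Γ'` satisfies
`γ² ≤ 2 Γ'' Γ`, then the diffusion absorbs the advection term in the equation for `∫ Γ(u₀)`, at the cost
of `‖velocity‖²_{L^∞} ∫ Γ(u₀)` (`IsEntropy.inner_grad_field_le`). The truncation contributes an error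
which tends to zero because `γ(u₀)` is bounded in `H¹` (`integral_entropy_nonpos`). Hence the limit
solves the system without cut-off (`exists_pairSol`).
-/

namespace RKSE

noncomputable section

/-! ### Exponentials and Fourier coefficients -/

/-- The exponential `x ↦ e^{i k·x}` on the torus. -/
def expMode (k : Fin 2 → ℤ) : C(Torus, ℂ) where
  toFun x := ∏ j : Fin 2, fourier (k j) (x j)
  continuous_toFun := by fun_prop

lemma expMode_apply (k : Fin 2 → ℤ) (x : Torus) :
    expMode k x = ∏ j : Fin 2, fourier (k j) (x j) := rfl

lemma expMode_neg (k : Fin 2 → ℤ) (x : Torus) : expMode (-k) x = conj (expMode k x) := by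
  simp only [expMode_apply, Pi.neg_apply, fourier_neg, map_prod]

lemma expMode_add (k l : Fin 2 → ℤ) (x : Torus) :
    expMode (k + l) x = expMode k x * expMode l x := by
  simp only [expMode_apply, Pi.add_apply, fourier_add, Finset.prod_mul_distrib]

lemma expMode_zero : expMode 0 = 1 := by
  ext x
  simp [expMode_apply]

lemma norm_expMode (k : Fin 2 → ℤ) (x : Torus) : ‖expMode k x‖ = 1 := by
  simp only [expMode_apply, norm_prod, fourier_apply, Circle.norm_coe, Finset.prod_const_one]

lemma fcoeff_eq (f : Torus → ℝ) (k : Fin 2 → ℤ) :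
    fcoeff f k = (((2 * Real.pi) ^ 2)⁻¹ : ℝ) * ∫ x : Torus, (f x : ℂ) * expMode (-k) x := rfl

lemma expMode_single_smul (k : Fin 2 → ℤ) (j : Fin 2) (h : ℝ) :
    expMode k (Pi.single j (h : AddCircle (2 * Real.pi))) = Complex.exp (Complex.I * k j * h) := by
  have hpi : (Real.pi : ℂ) ≠ 0 := by exact_mod_cast Real.pi_ne_zero
  have h0 : ∀ n : ℤ, ∀ h : ℝ, fourier n (h : AddCircle (2 * Real.pi)) =
      Complex.exp (Complex.I * n * h) := by
    intro n h
    rw [fourier_coe_apply]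
    congr 1
    push_cast
    field_simp
  rw [expMode_apply, Finset.prod_eq_single j, Pi.single_eq_same, h0]
  · intro i _ hi
    rw [Pi.single_eq_of_ne hi, fourier_eval_zero]
  · simp

lemma expMode_shift (k : Fin 2 → ℤ) (x y : Torus) :
    expMode k (x + y) = expMode k x * expMode k y := by
  simp [expMode_apply, fourier_apply, Finset.prod_mul_distrib, AddCircle.toCircle_add]

/-! ### Classical partial derivatives -/

/-- `ψ` is the classical partial derivative `∂ⱼ φ`, for functions on the torus with values in a
normed space. -/
def HasPD {E : Type*} [NormedAddCommGroup E] [NormedSpace ℝ E] (j : Fin 2) (φ ψ : Torus → E) :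
    Prop :=
  ∀ x, HasDerivAt (fun h : ℝ => φ (x + Pi.single j (h : AddCircle (2 * Real.pi)))) (ψ x) 0

section HasPD

variable {E : Type*} [NormedAddCommGroup E] [NormedSpace ℝ E] {j : Fin 2}

lemma HasPD.hasDerivAt {φ ψ : Torus → E} (hφ : HasPD j φ ψ) (x : Torus) (h : ℝ) :
    HasDerivAt (fun h : ℝ => φ (x + Pi.single j (h : AddCircle (2 * Real.pi))))
      (ψ (x + Pi.single j (h : AddCircle (2 * Real.pi)))) h := by
  have h1 := hφ (x + Pi.single j (h : AddCircle (2 * Real.pi)))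
  rw [← sub_self h] at h1
  have h2 := h1.comp_sub_const h h
  refine h2.congr_of_eventuallyEq (Filter.Eventually.of_forall fun s => ?_)
  simp only [add_assoc, ← Pi.single_add]
  congr 3
  rw [← AddCircle.coe_add]
  congr 1
  ring

lemma HasPD.integral_eq_zero {φ ψ : Torus → E} (hφ : HasPD j φ ψ) (hc : Continuous φ)
    (hc' : Continuous ψ) : ∫ x, ψ x = 0 := by
  obtain ⟨C, hC⟩ := isCompact_univ.exists_bound_of_continuousOn (hc'.continuousOn (s := univ))
  have hint : ∀ g : Torus → E, Continuous g → Integrable g := fun g hg =>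
    hg.integrable_of_hasCompactSupport (HasCompactSupport.of_compactSpace g)
  have key := hasDerivAt_integral_of_dominated_loc_of_deriv_le (μ := (volume : Measure Torus))
    (F := fun h x => φ (x + Pi.single j ((h : ℝ) : AddCircle (2 * Real.pi))))
    (F' := fun h x => ψ (x + Pi.single j ((h : ℝ) : AddCircle (2 * Real.pi))))
    (x₀ := (0 : ℝ)) (bound := fun _ => C) (s := univ) Filter.univ_mem
    (Filter.Eventually.of_forall fun h => (hint _ (by fun_prop)).aestronglyMeasurable)
    (hint _ (by fun_prop)) (hint _ (by fun_prop)).aestronglyMeasurable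
    (Filter.Eventually.of_forall fun x h _ => hC _ (mem_univ _))
    (integrable_const C)
    (Filter.Eventually.of_forall fun x h _ => hφ.hasDerivAt x h)
  have h2 := key.2
  simp only [integral_add_right_eq_self] at h2
  exact h2.unique (hasDerivAt_const _ _)

lemma HasPD.mul {A : Type*} [NormedRing A] [NormedAlgebra ℝ A] {φ ψ φ' ψ' : Torus → A}
    (hφ : HasPD j φ φ') (hψ : HasPD j ψ ψ') :
    HasPD j (fun x => φ x * ψ x) (fun x => φ' x * ψ x + φ x * ψ' x) := by
  intro x
  have h := (hφ x).fun_mul (hψ x)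
  simp only [AddCircle.coe_zero, Pi.single_zero, add_zero] at h
  exact h

lemma HasPD.comp {φ φ' : Torus → ℝ} {g g' : ℝ → ℝ} (hg : ∀ s, HasDerivAt g (g' s) s)
    (hφ : HasPD j φ φ') : HasPD j (fun x => g (φ x)) (fun x => g' (φ x) * φ' x) := by
  intro x
  have h := (hg (φ (x + Pi.single j ((0 : ℝ) : AddCircle (2 * Real.pi))))).comp (0 : ℝ) (hφ x)
  simpa [Function.comp_def] using h

lemma HasPD.clm {F : Type*} [NormedAddCommGroup F] [NormedSpace ℝ F] {φ φ' : Torus → E}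
    (L : E →L[ℝ] F) (hφ : HasPD j φ φ') : HasPD j (fun x => L (φ x)) (fun x => L (φ' x)) :=
  fun x => L.hasFDerivAt.comp_hasDerivAt (0 : ℝ) (hφ x)

lemma HasPD.sum {ι : Type*} {φ φ' : ι → Torus → E} {s : Finset ι}
    (hφ : ∀ i ∈ s, HasPD j (φ i) (φ' i)) :
    HasPD j (fun x => ∑ i ∈ s, φ i x) (fun x => ∑ i ∈ s, φ' i x) := by
  intro x
  exact HasDerivAt.fun_sum fun i hi => hφ i hi x

lemma HasPD.pderiv_eq {φ ψ : Torus → ℝ} (hφ : HasPD j φ ψ) : pderiv j φ = ψ :=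
  funext fun x => (hφ x).deriv

lemma hasPD_const_mul_expMode (c : ℂ) (k : Fin 2 → ℤ) (j : Fin 2) :
    HasPD j (fun x => c * expMode k x) (fun x => Complex.I * k j * (c * expMode k x)) := by
  intro x
  simp only [expMode_shift, expMode_single_smul]
  have h1 : HasDerivAt (fun h : ℝ => Complex.exp (Complex.I * k j * h)) (Complex.I * k j) 0 := by
    have h2 : HasDerivAt (fun z : ℂ => Complex.exp (Complex.I * k j * z))
        (Complex.exp (Complex.I * k j * (0 : ℝ)) * (Complex.I * k j * 1)) ((0 : ℝ) : ℂ) :=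
      ((hasDerivAt_id _).const_mul _).cexp
    have h3 := h2.comp_ofReal
    simpa using h3
  have h4 := (h1.const_mul (expMode k x)).const_mul c
  exact h4.congr_deriv (by ring)

lemma hasPD_expMode (k : Fin 2 → ℤ) (j : Fin 2) :
    HasPD j (expMode k) (fun x => Complex.I * k j * expMode k x) := by
  simpa using hasPD_const_mul_expMode 1 k j

end HasPD

lemma volume_torus : (volume : Measure Torus) univ = ENNReal.ofReal ((2 * Real.pi) ^ 2) := by
  rw [MeasureTheory.volume_pi, Measure.pi_univ]
  simp only [AddCircle.measure_univ, Finset.prod_const, Finset.card_univ, Fintype.card_fin]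
  rw [ENNReal.ofReal_pow (by positivity)]

lemma continuous_integrable {E : Type*} [NormedAddCommGroup E] {g : Torus → E}
    (hg : Continuous g) : Integrable g :=
  hg.integrable_of_hasCompactSupport (HasCompactSupport.of_compactSpace g)

lemma integral_expMode (k : Fin 2 → ℤ) :
    ∫ x, expMode k x = if k = 0 then (((2 * Real.pi) ^ 2 : ℝ) : ℂ) else 0 := by
  split_ifs with hk
  · subst hk
    rw [expMode_zero]
    simp only [ContinuousMap.one_apply, integral_const, Measure.real, volume_torus]
    rw [ENNReal.toReal_ofReal (by positivity)]
    simp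
  · obtain ⟨j, hj⟩ := Function.ne_iff.mp hk
    have h := (hasPD_expMode k j).integral_eq_zero (expMode k).continuous (by fun_prop)
    rw [integral_const_mul] at h
    rcases mul_eq_zero.mp h with h | h
    · exfalso
      simp at h
      exact hj h
    · exact h

/-! ### The Fourier basis -/

/-- The complex Hilbert space `L²(𝕋²; ℂ)`. -/
abbrev L2C : Type := Lp ℂ 2 (volume : Measure Torus)

/-- The normalised exponential `(2π)⁻¹ e^{i k·x}` as an element of `L²(𝕋²; ℂ)`. -/
def modeLp (k : Fin 2 → ℤ) : L2C :=
  ContinuousMap.toLp (E := ℂ) 2 volume ℂ ((((2 * Real.pi)⁻¹ : ℝ) : ℂ) • expMode k)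

lemma coeFn_modeLp (k : Fin 2 → ℤ) :
    modeLp k =ᵐ[volume] fun x => (((2 * Real.pi)⁻¹ : ℝ) : ℂ) * expMode k x := by
  filter_upwards [ContinuousMap.coeFn_toLp (p := 2) (𝕜 := ℂ) (volume : Measure Torus)
    ((((2 * Real.pi)⁻¹ : ℝ) : ℂ) • expMode k)] with x hx
  rw [modeLp, hx]
  rfl

lemma inner_modeLp (k : Fin 2 → ℤ) (f : L2C) :
    inner ℂ (modeLp k) f = (((2 * Real.pi)⁻¹ : ℝ) : ℂ) * ∫ x, f x * expMode (-k) x := by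
  rw [L2.inner_def, ← integral_const_mul]
  refine integral_congr_ae ?_
  filter_upwards [coeFn_modeLp k] with x hx
  simp only [RCLike.inner_apply, hx, map_mul, Complex.conj_ofReal, expMode_neg]
  ring

lemma orthonormal_modeLp : Orthonormal ℂ modeLp := by
  rw [orthonormal_iff_ite]
  intro k l
  rw [inner_modeLp]
  have h : ∫ x, modeLp l x * expMode (-k) x
      = ∫ x, (((2 * Real.pi)⁻¹ : ℝ) : ℂ) * expMode (l - k) x := by
    refine integral_congr_ae ?_
    filter_upwards [coeFn_modeLp l] with x hx
    rw [hx, sub_eq_add_neg, expMode_add]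
    ring
  rw [h, integral_const_mul, integral_expMode]
  have hpi := Real.pi_pos.ne'
  by_cases hkl : k = l
  · subst hkl
    simp only [sub_self, if_true]
    norm_cast
    field_simp
  · rw [if_neg hkl, if_neg (sub_ne_zero.mpr (Ne.symm hkl))]
    simp

/-- The exponentials span a star subalgebra of `C(𝕋²; ℂ)`. -/
def expModeSubalgebra : StarSubalgebra ℂ C(Torus, ℂ) where
  toSubalgebra := Algebra.adjoin ℂ (range expMode)
  star_mem' := by
    change Algebra.adjoin ℂ (range expMode) ≤ star (Algebra.adjoin ℂ (range expMode))
    refine Algebra.adjoin_le ?_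
    rintro _ ⟨n, rfl⟩
    refine Algebra.subset_adjoin ⟨-n, ?_⟩
    ext1 x
    simp only [expMode_neg, starRingEnd_apply, ContinuousMap.star_apply]

lemma expModeSubalgebra_coe :
    Subalgebra.toSubmodule expModeSubalgebra.toSubalgebra = Submodule.span ℂ (range expMode) := by
  apply Algebra.adjoin_eq_span_of_subset
  refine .trans (fun x ↦ Submonoid.closure_induction (fun _ ↦ id) ⟨0, ?_⟩ ?_)
    Submodule.subset_span
  · exact expMode_zero
  · rintro _ _ _ _ ⟨m, rfl⟩ ⟨n, rfl⟩
    refine ⟨m + n, ?_⟩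
    ext z
    exact expMode_add m n z

lemma expModeSubalgebra_separatesPoints : expModeSubalgebra.SeparatesPoints := by
  intro x y hxy
  obtain ⟨i, hi⟩ := Function.ne_iff.mp hxy
  refine ⟨_, ⟨expMode (Pi.single i 1), Algebra.subset_adjoin ⟨Pi.single i 1, rfl⟩, rfl⟩, ?_⟩
  have h : ∀ z : Torus, expMode (Pi.single i 1) z = AddCircle.toCircle (z i) := by
    intro z
    rw [expMode_apply]
    fin_cases i <;> simp [Fin.prod_univ_two, fourier_apply]
  simp only [h, ne_eq]
  rw [Circle.coe_inj]
  exact fun h' => hi (AddCircle.injective_toCircle Real.two_pi_pos.ne' h')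

lemma span_expMode_closure_eq_top :
    (Submodule.span ℂ (range expMode)).topologicalClosure = ⊤ := by
  rw [← expModeSubalgebra_coe]
  exact congr_arg (Subalgebra.toSubmodule <| StarSubalgebra.toSubalgebra ·)
    (ContinuousMap.starSubalgebra_topologicalClosure_eq_top_of_separatesPoints _
      expModeSubalgebra_separatesPoints)

lemma span_modeLp_closure_eq_top : (Submodule.span ℂ (range modeLp)).topologicalClosure = ⊤ := by
  have h := (ContinuousMap.toLp_denseRange (p := 2) ℂ (volume : Measure Torus) ℂ
    (by simp)).topologicalClosure_map_submodule span_expMode_closure_eq_top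
  rw [Submodule.map_span, ← range_comp] at h
  rw [eq_top_iff, ← h]
  refine Submodule.topologicalClosure_mono (Submodule.span_le.mpr ?_)
  rintro _ ⟨k, rfl⟩
  have h2 : modeLp k ∈ Submodule.span ℂ (range modeLp) := Submodule.subset_span ⟨k, rfl⟩
  have h3 := Submodule.smul_mem _ ((2 * Real.pi : ℝ) : ℂ) h2
  convert h3 using 1
  rw [modeLp, map_smul, smul_smul, ← Complex.ofReal_mul, mul_inv_cancel₀ Real.two_pi_pos.ne']
  simp

/-- The Hilbert basis of normalised exponentials in `L²(𝕋²; ℂ)`. -/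
def modeBasis : HilbertBasis (Fin 2 → ℤ) ℂ L2C :=
  HilbertBasis.mk orthonormal_modeLp span_modeLp_closure_eq_top.ge

lemma modeBasis_apply (k : Fin 2 → ℤ) : modeBasis k = modeLp k := by
  simp [modeBasis]

/-- A real `L²` function viewed as a complex one. -/
def cplx (f : L2) : L2C := Complex.ofRealCLM.compLp f

lemma coeFn_cplx (f : L2) : cplx f =ᵐ[volume] fun x => (f x : ℂ) :=
  Complex.ofRealCLM.coeFn_compLp f

lemma repr_cplx (f : L2) (k : Fin 2 → ℤ) :
    modeBasis.repr (cplx f) k = ((2 * Real.pi : ℝ) : ℂ) * fcoeff f k := by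
  rw [HilbertBasis.repr_apply_apply, modeBasis_apply, inner_modeLp, fcoeff_eq, ← mul_assoc]
  congr 1
  · have := Real.pi_pos.ne'
    rw [← Complex.ofReal_mul]
    congr 1
    field_simp
  · refine integral_congr_ae ?_
    filter_upwards [coeFn_cplx f] with x hx
    rw [hx]

lemma inner_cplx (f g : L2) : inner ℂ (cplx g) (cplx f) = ((∫ x, f x * g x : ℝ) : ℂ) := by
  rw [L2.inner_def, ← integral_complex_ofReal]
  refine integral_congr_ae ?_
  filter_upwards [coeFn_cplx f, coeFn_cplx g] with x hf hg
  simp [RCLike.inner_apply, hf, hg]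

/-- **Parseval's identity** for real `L²` functions on the torus. -/
lemma hasSum_fcoeff_mul_conj (f g : L2) :
    HasSum (fun k => fcoeff f k * conj (fcoeff g k))
      (((((2 * Real.pi) ^ 2)⁻¹ * ∫ x, f x * g x : ℝ)) : ℂ) := by
  have h := modeBasis.hasSum_inner_mul_inner (cplx g) (cplx f)
  rw [inner_cplx] at h
  have h2 := h.mul_left (((((2 * Real.pi) ^ 2)⁻¹ : ℝ)) : ℂ)
  rw [← Complex.ofReal_mul] at h2
  refine h2.congr_fun fun k => ?_
  have hpi : (Real.pi : ℂ) ≠ 0 := by exact_mod_cast Real.pi_pos.ne'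
  rw [← inner_conj_symm, ← HilbertBasis.repr_apply_apply, ← HilbertBasis.repr_apply_apply,
    repr_cplx, repr_cplx, map_mul, Complex.conj_ofReal]
  push_cast
  field_simp

lemma fcoeff_neg (f : Torus → ℝ) (k : Fin 2 → ℤ) : fcoeff f (-k) = conj (fcoeff f k) := by
  rw [fcoeff_eq, fcoeff_eq, map_mul, Complex.conj_ofReal, ← integral_conj]
  simp only [map_mul, Complex.conj_ofReal, expMode_neg, neg_neg, Complex.conj_conj]

/-- **Riesz–Fischer**: a square summable family with the reality symmetry is the family of Fourier
coefficients of a real `L²` function. -/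
lemma exists_fcoeff_eq {c : (Fin 2 → ℤ) → ℂ} (hc : Memℓp c 2) (hs : ∀ k, c (-k) = conj (c k)) :
    ∃ f : L2, ∀ k, fcoeff f k = c k := by
  have hpi : (Real.pi : ℂ) ≠ 0 := by exact_mod_cast Real.pi_pos.ne'
  set F : L2C := modeBasis.repr.symm (⟨c, hc⟩ : lp (fun _ : Fin 2 → ℤ => ℂ) 2) with hF
  have h1 : ∀ k, ∫ x, F x * expMode (-k) x = ((2 * Real.pi : ℝ) : ℂ) * c k := by
    intro k
    have h2 : modeBasis.repr F k = c k := by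
      rw [hF, LinearIsometryEquiv.apply_symm_apply]
    rw [HilbertBasis.repr_apply_apply, modeBasis_apply, inner_modeLp] at h2
    rw [← h2]
    push_cast
    field_simp
  have hFint : Integrable F := (Lp.memLp F).integrable (by norm_num)
  have hint : ∀ k, Integrable (fun x => F x * expMode (-k) x) := fun k =>
    hFint.mul_bdd (c := 1) (expMode (-k)).continuous.aestronglyMeasurable
      (Filter.Eventually.of_forall fun x => (norm_expMode _ x).le)
  have hint' : ∀ k, Integrable (fun x => conj (F x) * expMode (-k) x) := fun k => by
    have h : Integrable (fun x => conj (F x)) := by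
      exact (Complex.conjCLE.toContinuousLinearMap.integrable_comp hFint)
    exact h.mul_bdd (c := 1) (expMode (-k)).continuous.aestronglyMeasurable
      (Filter.Eventually.of_forall fun x => (norm_expMode _ x).le)
  set f : L2 := Complex.reCLM.compLp F with hf
  refine ⟨(2 * Real.pi) • f, fun k => ?_⟩
  have h3 : ∫ x, ((((2 * Real.pi) • f : L2) x : ℝ) : ℂ) * expMode (-k) x
      = ∫ x, (Real.pi : ℂ) * (F x * expMode (-k) x + conj (F x) * expMode (-k) x) := by
    refine integral_congr_ae ?_
    filter_upwards [Complex.reCLM.coeFn_compLp F, Lp.coeFn_smul (2 * Real.pi) f] with x hx hx2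
    rw [hx2, Pi.smul_apply, hf, hx, Complex.reCLM_apply, smul_eq_mul, Complex.ofReal_mul,
      Complex.re_eq_add_conj]
    push_cast
    ring
  have h4 : ∫ x, conj (F x) * expMode (-k) x = ((2 * Real.pi : ℝ) : ℂ) * c k := by
    have h5 : ∫ x, conj (F x) * expMode (-k) x = conj (∫ x, F x * expMode (-(-k)) x) := by
      rw [← integral_conj]
      simp only [map_mul, ← expMode_neg, neg_neg]
    rw [h5, h1, hs, map_mul, Complex.conj_ofReal, Complex.conj_conj]
  rw [fcoeff_eq, h3, integral_const_mul, integral_add (hint k) (hint' k), h1, h4]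
  push_cast
  field_simp
  ring

lemma fcoeff_congr {f g : Torus → ℝ} (h : f =ᵐ[volume] g) (k : Fin 2 → ℤ) :
    fcoeff f k = fcoeff g k := by
  rw [fcoeff_eq, fcoeff_eq]
  congr 1
  refine integral_congr_ae ?_
  filter_upwards [h] with x hx
  rw [hx]

lemma fcoeff_add {f g : Torus → ℝ} (hf : Integrable f) (hg : Integrable g) (k : Fin 2 → ℤ) :
    fcoeff (fun x => f x + g x) k = fcoeff f k + fcoeff g k := by
  have h : ∀ f : Torus → ℝ, Integrable f → Integrable (fun x => (f x : ℂ) * expMode (-k) x) :=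
    fun f hf => hf.ofReal.mul_bdd (c := 1) (expMode (-k)).continuous.aestronglyMeasurable
      (Filter.Eventually.of_forall fun x => (norm_expMode _ x).le)
  simp only [fcoeff_eq]
  rw [← mul_add, ← integral_add (h f hf) (h g hg)]
  congr 2
  funext x
  push_cast
  ring

lemma fcoeff_const_mul (f : Torus → ℝ) (r : ℝ) (k : Fin 2 → ℤ) :
    fcoeff (fun x => r * f x) k = r * fcoeff f k := by
  simp only [fcoeff_eq]
  rw [mul_left_comm]
  congr 1
  rw [← integral_const_mul]
  congr 1
  funext x
  push_cast
  ring

lemma L2.integrable (f : L2) : Integrable f := (Lp.memLp f).integrable (by norm_num)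

/-- The `k`-th Fourier coefficient as a linear functional on `L²`. -/
def fcoeffLM (k : Fin 2 → ℤ) : L2 →ₗ[ℝ] ℂ where
  toFun f := fcoeff f k
  map_add' f g := by
    rw [fcoeff_congr (Lp.coeFn_add f g)]
    exact fcoeff_add (L2.integrable f) (L2.integrable g) k
  map_smul' r f := by
    rw [fcoeff_congr (Lp.coeFn_smul r f)]
    exact fcoeff_const_mul f r k

lemma L2.norm_sq (f : L2) : ‖f‖ ^ 2 = ∫ x, f x * f x := by
  rw [← real_inner_self_eq_norm_sq, L2.inner_def]
  simp [sq]

lemma hasSum_norm_fcoeff_sq (f : L2) :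
    HasSum (fun k => ‖fcoeff f k‖ ^ 2) (((2 * Real.pi) ^ 2)⁻¹ * ‖f‖ ^ 2) := by
  have h := Complex.hasSum_re (hasSum_fcoeff_mul_conj f f)
  rw [Complex.ofReal_re, ← L2.norm_sq] at h
  convert h using 1
  funext k
  rw [Complex.mul_conj, Complex.ofReal_re, Complex.normSq_eq_norm_sq]

lemma norm_fcoeff_le (f : L2) (k : Fin 2 → ℤ) : ‖fcoeff f k‖ ≤ ‖f‖ := by
  have h1 := (hasSum_norm_fcoeff_sq f).summable.le_tsum k (fun _ _ => by positivity)
  rw [(hasSum_norm_fcoeff_sq f).tsum_eq] at h1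
  have h2 : ((2 * Real.pi) ^ 2)⁻¹ ≤ 1 := by
    apply inv_le_one_of_one_le₀
    nlinarith [Real.pi_gt_three]
  have h3 : ‖fcoeff f k‖ ^ 2 ≤ ‖f‖ ^ 2 := h1.trans (by nlinarith [sq_nonneg ‖f‖])
  exact (pow_le_pow_iff_left₀ (norm_nonneg _) (norm_nonneg _) two_ne_zero).mp h3

/-- The `k`-th Fourier coefficient as a continuous linear functional on `L²`. -/
def fcoeffCLM (k : Fin 2 → ℤ) : L2 →L[ℝ] ℂ :=
  (fcoeffLM k).mkContinuous 1 fun f => by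
    rw [one_mul]
    exact norm_fcoeff_le f k

lemma fcoeffCLM_apply (k : Fin 2 → ℤ) (f : L2) : fcoeffCLM k f = fcoeff f k := rfl

lemma fcoeff_sub (f g : L2) (k : Fin 2 → ℤ) :
    fcoeff (f - g : L2) k = fcoeff f k - fcoeff g k := (fcoeffCLM k).map_sub f g

lemma L2.ext_fcoeff {f g : L2} (h : ∀ k, fcoeff f k = fcoeff g k) : f = g := by
  rw [← sub_eq_zero, ← norm_eq_zero]
  have h1 := (hasSum_norm_fcoeff_sq (f - g)).tsum_eq
  simp only [fcoeff_sub, h, sub_self, norm_zero, ne_eq, OfNat.ofNat_ne_zero, not_false_eq_true,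
    zero_pow, tsum_zero] at h1
  have h2 : (((2 * Real.pi) ^ 2)⁻¹) ≠ 0 := by positivity
  rcases mul_eq_zero.mp h1.symm with h3 | h3
  · exact absurd h3 h2
  · exact pow_eq_zero_iff two_ne_zero |>.mp h3

lemma fcoeff_toLp {F : Torus → ℝ} (hF : MemLp F 2 volume) (k : Fin 2 → ℤ) :
    fcoeff (hF.toLp F) k = fcoeff F k := fcoeff_congr hF.coeFn_toLp k

lemma HasPD.fcoeff_eq {φ ψ : Torus → ℝ} {j : Fin 2} (h : HasPD j φ ψ) (hφ : Continuous φ)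
    (hψ : Continuous ψ) (k : Fin 2 → ℤ) : fcoeff ψ k = Complex.I * k j * fcoeff φ k := by
  have h1 := (h.clm Complex.ofRealCLM).mul (hasPD_expMode (-k) j)
  have hc1 : Continuous fun x : Torus => (φ x : ℂ) := Complex.continuous_ofReal.comp hφ
  have hc2 : Continuous fun x : Torus => (ψ x : ℂ) := Complex.continuous_ofReal.comp hψ
  have h2 := h1.integral_eq_zero (hc1.mul (expMode (-k)).continuous)
    ((hc2.mul (expMode (-k)).continuous).add
      (hc1.mul (continuous_const.mul (expMode (-k)).continuous)))
  simp only [Complex.ofRealCLM_apply] at h2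
  rw [integral_add (continuous_integrable (by fun_prop)) (continuous_integrable (by fun_prop))]
    at h2
  have h3 : ∫ x, (φ x : ℂ) * (Complex.I * ((-k) j : ℤ) * expMode (-k) x)
      = -(Complex.I * k j) * ∫ x, (φ x : ℂ) * expMode (-k) x := by
    rw [← integral_const_mul]
    congr 1
    funext x
    simp only [Pi.neg_apply, Int.cast_neg]
    ring
  rw [h3] at h2
  rw [RKSE.fcoeff_eq, RKSE.fcoeff_eq]
  linear_combination (((((2 * Real.pi) ^ 2)⁻¹ : ℝ)) : ℂ) * h2

/-! ### Smooth functions and weak derivatives -/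

lemma exists_lift (x : Torus) :
    ∃ y : Fin 2 → ℝ, x = fun i => (y i : AddCircle (2 * Real.pi)) := by
  choose y hy using fun i => QuotientAddGroup.mk_surjective (x i)
  exact ⟨y, funext fun i => (hy i).symm⟩

lemma lift_add_single (y : Fin 2 → ℝ) (j : Fin 2) (h : ℝ) :
    (fun i => ((y i : ℝ) : AddCircle (2 * Real.pi))) + Pi.single j (h : AddCircle (2 * Real.pi))
      = fun i => (((y + Pi.single j h : Fin 2 → ℝ) i : ℝ) : AddCircle (2 * Real.pi)) := by
  funext i
  by_cases hi : i = j
  · subst hi; simp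
  · simp [Pi.single_eq_of_ne hi]

lemma IsSmooth.continuous {φ : Torus → ℝ} (hφ : IsSmooth φ) : Continuous φ := by
  have hq : IsOpenQuotientMap
      (Pi.map fun (_ : Fin 2) (t : ℝ) => (t : AddCircle (2 * Real.pi))) :=
    IsOpenQuotientMap.piMap fun _ => QuotientAddGroup.isOpenQuotientMap_mk
  exact hq.isQuotientMap.continuous_iff.mpr (ContDiff.continuous hφ)

lemma IsSmooth.hasDerivAt_lift {φ : Torus → ℝ} (hφ : IsSmooth φ) (j : Fin 2) (y : Fin 2 → ℝ) :
    HasDerivAt (fun h : ℝ => φ ((fun i => ((y i : ℝ) : AddCircle (2 * Real.pi)))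
        + Pi.single j (h : AddCircle (2 * Real.pi))))
      (fderiv ℝ (fun x : Fin 2 → ℝ => φ (fun i => (x i : AddCircle (2 * Real.pi)))) y
        (Pi.single j 1)) 0 := by
  have hd : Differentiable ℝ (fun x : Fin 2 → ℝ => φ (fun i => (x i : AddCircle (2 * Real.pi)))) :=
    ContDiff.differentiable hφ (by simp)
  have h1 := (hd (y + (0 : ℝ) • Pi.single j 1)).hasFDerivAt
  have h2 : HasDerivAt (fun h : ℝ => y + h • (Pi.single j 1 : Fin 2 → ℝ)) (Pi.single j 1) 0 := by
    simpa using ((hasDerivAt_id (0 : ℝ)).smul_const (Pi.single j 1 : Fin 2 → ℝ)).const_add y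
  have h3 := h1.comp_hasDerivAt (0 : ℝ) h2
  rw [zero_smul, add_zero] at h3
  refine h3.congr_of_eventuallyEq (Filter.Eventually.of_forall fun h => ?_)
  simp only [lift_add_single, Function.comp_apply]
  congr 1
  funext i
  congr 3
  rw [← Pi.single_smul, smul_eq_mul, mul_one]

lemma IsSmooth.hasPD {φ : Torus → ℝ} (hφ : IsSmooth φ) (j : Fin 2) : HasPD j φ (pderiv j φ) := by
  intro x
  obtain ⟨y, rfl⟩ := exists_lift x
  have h := hφ.hasDerivAt_lift j y
  have h2 : pderiv j φ (fun i => ((y i : ℝ) : AddCircle (2 * Real.pi))) = _ := h.deriv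
  rw [h2]
  exact h

lemma IsSmooth.pderiv {φ : Torus → ℝ} (hφ : IsSmooth φ) (j : Fin 2) : IsSmooth (pderiv j φ) := by
  have h1 : (fun y : Fin 2 → ℝ => RKSE.pderiv j φ (fun i => (y i : AddCircle (2 * Real.pi)))) =
      fun y => fderiv ℝ (fun x : Fin 2 → ℝ => φ (fun i => (x i : AddCircle (2 * Real.pi)))) y
        (Pi.single j 1) := funext fun y => (hφ.hasDerivAt_lift j y).deriv
  rw [IsSmooth, h1]
  exact (ContDiff.fderiv_right hφ (m := ∞) (by simp)).clm_apply contDiff_const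

lemma IsSmooth.fcoeff_pderiv {φ : Torus → ℝ} (hφ : IsSmooth φ) (j : Fin 2) (k : Fin 2 → ℤ) :
    fcoeff (RKSE.pderiv j φ) k = Complex.I * k j * fcoeff φ k :=
  (hφ.hasPD j).fcoeff_eq hφ.continuous (hφ.pderiv j).continuous k

lemma memLp_of_continuous {g : Torus → ℝ} (hg : Continuous g) (p : ℝ≥0∞) : MemLp g p volume := by
  obtain ⟨C, hC⟩ := isCompact_univ.exists_bound_of_continuousOn (hg.continuousOn (s := univ))
  exact MemLp.of_bound hg.aestronglyMeasurable C
    (Filter.Eventually.of_forall fun x => hC x (mem_univ x))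

lemma expMode_lift (k : Fin 2 → ℤ) (y : Fin 2 → ℝ) :
    expMode k (fun i => (y i : AddCircle (2 * Real.pi)))
      = Complex.exp (Complex.I * k 0 * y 0) * Complex.exp (Complex.I * k 1 * y 1) := by
  rw [← expMode_single_smul, ← expMode_single_smul, ← expMode_shift]
  congr 1
  funext i
  fin_cases i <;> simp

lemma isSmooth_re_expMode (c : ℂ) (k : Fin 2 → ℤ) : IsSmooth fun x => (c * expMode k x).re := by
  rw [IsSmooth]
  have h0 : (fun y : Fin 2 → ℝ => (c * expMode k (fun i => (y i : AddCircle (2 * Real.pi)))).re)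
      = fun y => (c * (Complex.exp (Complex.I * k 0 * y 0)
        * Complex.exp (Complex.I * k 1 * y 1))).re := funext fun y => by rw [← expMode_lift]
  change ContDiff ℝ ∞ (fun y : Fin 2 → ℝ =>
    (c * expMode k (fun i => (y i : AddCircle (2 * Real.pi)))).re)
  rw [h0]
  have h : ∀ j : Fin 2, ContDiff ℝ ∞ fun y : Fin 2 → ℝ => Complex.exp (Complex.I * k j * y j) :=
    fun j => (contDiff_const.mul (Complex.ofRealCLM.contDiff.comp (contDiff_apply ℝ ℝ j))).cexp
  exact Complex.reCLM.contDiff.comp (contDiff_const.mul ((h 0).mul (h 1)))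

lemma hasPD_re_expMode (c : ℂ) (k : Fin 2 → ℤ) (j : Fin 2) :
    HasPD j (fun x => (c * expMode k x).re) (fun x => (c * (Complex.I * k j) * expMode k x).re) := by
  have h := (hasPD_const_mul_expMode c k j).clm Complex.reCLM
  have h2 : (fun x => (c * (Complex.I * k j) * expMode k x).re)
      = fun x => Complex.reCLM (Complex.I * k j * (c * expMode k x)) := by
    funext x
    rw [Complex.reCLM_apply]
    congr 1
    ring
  rw [h2]
  exact h

lemma integral_mul_re_expMode {f : Torus → ℝ} (hf : Integrable f) (c : ℂ) (k : Fin 2 → ℤ) :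
    ∫ x, f x * (c * expMode (-k) x).re = (2 * Real.pi) ^ 2 * (c * fcoeff f k).re := by
  have h1 : Integrable fun x => c * ((f x : ℂ) * expMode (-k) x) :=
    (hf.ofReal.mul_bdd (c := 1) (expMode (-k)).continuous.aestronglyMeasurable
      (Filter.Eventually.of_forall fun x => (norm_expMode _ x).le)).const_mul c
  have h2 : ∫ x, f x * (c * expMode (-k) x).re
      = ∫ x, (c * ((f x : ℂ) * expMode (-k) x)).re := by
    congr 1
    funext x
    rw [mul_left_comm, Complex.re_ofReal_mul]
  have h3 := Complex.reCLM.integral_comp_comm h1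
  simp only [Complex.reCLM_apply] at h3
  rw [h2, h3, integral_const_mul, fcoeff_eq, mul_left_comm c, Complex.re_ofReal_mul, ← mul_assoc,
    mul_inv_cancel₀ (by positivity), one_mul]

/-- Parseval's identity for two square integrable functions. -/
lemma hasSum_fcoeff_mul {f g : Torus → ℝ} (hf : MemLp f 2 volume) (hg : MemLp g 2 volume) :
    HasSum (fun k => fcoeff f k * conj (fcoeff g k))
      (((((2 * Real.pi) ^ 2)⁻¹ * ∫ x, f x * g x : ℝ)) : ℂ) := by
  have h := hasSum_fcoeff_mul_conj (hf.toLp f) (hg.toLp g)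
  simp only [fcoeff_toLp] at h
  have h2 : ∫ x, (hf.toLp f) x * (hg.toLp g) x = ∫ x, f x * g x := by
    refine integral_congr_ae ?_
    filter_upwards [hf.coeFn_toLp, hg.coeFn_toLp] with x h1 h2
    rw [h1, h2]
  rwa [h2] at h

lemma integral_mul_eq_tsum {f g : Torus → ℝ} (hf : MemLp f 2 volume) (hg : MemLp g 2 volume) :
    ∫ x, f x * g x = (2 * Real.pi) ^ 2 * (∑' k, fcoeff f k * conj (fcoeff g k)).re := by
  rw [(hasSum_fcoeff_mul hf hg).tsum_eq, Complex.ofReal_re, ← mul_assoc,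
    mul_inv_cancel₀ (by positivity), one_mul]

lemma isWeakPartial_iff {j : Fin 2} {f g : L2} :
    IsWeakPartial j f g ↔ ∀ k, fcoeff g k = Complex.I * k j * fcoeff f k := by
  constructor
  · intro h k
    have h1 : ∀ c : ℂ, (c * (fcoeff g k - Complex.I * k j * fcoeff f k)).re = 0 := by
      intro c
      have h2 := h _ (isSmooth_re_expMode c (-k))
      rw [(hasPD_re_expMode c (-k) j).pderiv_eq, integral_mul_re_expMode (L2.integrable f),
        integral_mul_re_expMode (L2.integrable g), ← mul_neg] at h2
      have h3 := mul_left_cancel₀ (by positivity) h2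
      rw [mul_sub, Complex.sub_re, sub_eq_zero, eq_comm, ← neg_inj, ← h3, ← Complex.neg_re]
      congr 1
      push_cast [Pi.neg_apply]
      ring
    have h4 := h1 (conj (fcoeff g k - Complex.I * k j * fcoeff f k))
    rw [mul_comm, Complex.mul_conj, Complex.ofReal_re, Complex.normSq_eq_zero] at h4
    exact sub_eq_zero.mp h4
  · intro h φ hφ
    rw [integral_mul_eq_tsum (Lp.memLp f) (memLp_of_continuous (hφ.pderiv j).continuous 2),
      integral_mul_eq_tsum (Lp.memLp g) (memLp_of_continuous hφ.continuous 2), ← mul_neg,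
      ← Complex.neg_re, ← tsum_neg]
    congr 3
    funext k
    rw [hφ.fcoeff_pderiv, h k]
    simp only [map_mul, Complex.conj_I, map_intCast]
    ring

/-! ### Sums of squares of Fourier coefficients -/

/-- The squared Japanese bracket `1 + |k|²` of a frequency. -/
def jb (k : Fin 2 → ℤ) : ℝ := 1 + ∑ j : Fin 2, (k j : ℝ) ^ 2

lemma one_le_jb (k : Fin 2 → ℤ) : 1 ≤ jb k := by
  have : 0 ≤ ∑ j : Fin 2, (k j : ℝ) ^ 2 := by positivity
  rw [jb]; linarith

lemma jb_pos (k : Fin 2 → ℤ) : 0 < jb k := zero_lt_one.trans_le (one_le_jb k)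

lemma jb_neg (k : Fin 2 → ℤ) : jb (-k) = jb k := by simp [jb]

lemma sq_le_jb (k : Fin 2 → ℤ) (j : Fin 2) : (k j : ℝ) ^ 2 ≤ jb k := by
  have := Finset.single_le_sum (f := fun j => (k j : ℝ) ^ 2) (fun i _ => sq_nonneg _)
    (Finset.mem_univ j)
  rw [jb]; linarith

/-- The squared `H^s` norm `∑ₖ (1 + |k|²)^s |c(k)|²` of a family of Fourier coefficients, with
value `∞` if the sum diverges. -/
def sobSq (s : ℝ) (c : (Fin 2 → ℤ) → ℂ) : ℝ≥0∞ := ∑' k, ENNReal.ofReal (jb k ^ s * ‖c k‖ ^ 2)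

lemma weight_sq (s : ℝ) (k : Fin 2 → ℤ) : weight s k ^ 2 = jb k ^ s := by
  rw [weight, ← jb, ← Real.rpow_natCast, ← Real.rpow_mul (jb_pos k).le]
  congr 1
  push_cast
  ring

lemma sobSq_mono {s t : ℝ} (h : s ≤ t) (c : (Fin 2 → ℤ) → ℂ) : sobSq s c ≤ sobSq t c := by
  refine ENNReal.tsum_le_tsum fun k => ENNReal.ofReal_le_ofReal ?_
  gcongr
  exact one_le_jb k

lemma summable_of_sobSq_ne_top {s : ℝ} {c : (Fin 2 → ℤ) → ℂ} (h : sobSq s c ≠ ⊤) :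
    Summable fun k => jb k ^ s * ‖c k‖ ^ 2 := by
  have h1 := ENNReal.summable_toReal h
  refine h1.congr fun k => ?_
  rw [ENNReal.toReal_ofReal]
  have := jb_pos k
  positivity

lemma sobSq_ne_top_of_summable {s : ℝ} {c : (Fin 2 → ℤ) → ℂ}
    (h : Summable fun k => jb k ^ s * ‖c k‖ ^ 2) : sobSq s c ≠ ⊤ := by
  rw [sobSq, ← ENNReal.ofReal_tsum_of_nonneg (fun k => by have := jb_pos k; positivity) h]
  exact ENNReal.ofReal_ne_top

lemma sobSq_zero_fcoeff (f : L2) :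
    sobSq 0 (fcoeff f) = ENNReal.ofReal (((2 * Real.pi) ^ 2)⁻¹ * ‖f‖ ^ 2) := by
  have h := hasSum_norm_fcoeff_sq f
  rw [sobSq, ← h.tsum_eq, ENNReal.ofReal_tsum_of_nonneg (fun k => by positivity) h.summable]
  simp

lemma memℓp_of_sobSq_zero {c : (Fin 2 → ℤ) → ℂ} (h : sobSq 0 c ≠ ⊤) : Memℓp c 2 := by
  rw [memℓp_gen_iff (by norm_num)]
  have := summable_of_sobSq_ne_top h
  simpa using this

lemma exists_isWeakPartial {f : L2} (h : sobSq 1 (fcoeff f) ≠ ⊤) (j : Fin 2) :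
    ∃ g, IsWeakPartial j f g := by
  have h1 : sobSq 0 (fun k => Complex.I * k j * fcoeff f k) ≠ ⊤ := by
    refine ne_top_of_le_ne_top h (ENNReal.tsum_le_tsum fun k => ENNReal.ofReal_le_ofReal ?_)
    simp only [Real.rpow_zero, one_mul, Real.rpow_one, norm_mul, Complex.norm_I, mul_pow]
    gcongr
    simpa using sq_le_jb k j
  obtain ⟨g, hg⟩ := exists_fcoeff_eq (memℓp_of_sobSq_zero h1) (fun k => by
    simp only [Pi.neg_apply, fcoeff_neg, map_mul, Complex.conj_I, map_intCast]
    push_cast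
    ring)
  exact ⟨g, isWeakPartial_iff.mpr hg⟩

lemma wpartial_eq {f g : L2} {j : Fin 2} (h : IsWeakPartial j f g) : wpartial j f = g := by
  have hex : ∃ g, IsWeakPartial j f g := ⟨g, h⟩
  rw [wpartial, dif_pos hex]
  refine L2.ext_fcoeff fun k => ?_
  rw [isWeakPartial_iff.mp hex.choose_spec, isWeakPartial_iff.mp h]

lemma fcoeff_wpartial {f : L2} (h : sobSq 1 (fcoeff f) ≠ ⊤) (j : Fin 2) (k : Fin 2 → ℤ) :
    fcoeff (wpartial j f) k = Complex.I * k j * fcoeff f k := by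
  obtain ⟨g, hg⟩ := exists_isWeakPartial h j
  rw [wpartial_eq hg]
  exact isWeakPartial_iff.mp hg k

/-- An `L²` function with absolutely summable Fourier coefficients is bounded by their sum. -/
lemma ae_abs_le_tsum {f : L2} (h : Summable fun k => ‖fcoeff f k‖) :
    ∀ᵐ x, |f x| ≤ ∑' k, ‖fcoeff f k‖ := by
  have h0 : ∀ k, ‖fcoeff f k • expMode k‖ = ‖fcoeff f k‖ := by
    intro k
    rw [norm_smul]
    have h1 : ‖expMode k‖ = 1 := le_antisymm
      ((ContinuousMap.norm_le _ zero_le_one).mpr fun x => (norm_expMode k x).le)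
      ((norm_expMode k 0).symm.le.trans ((expMode k).norm_coe_le_norm 0))
    rw [h1, mul_one]
  have hs : Summable fun k => fcoeff f k • expMode k :=
    Summable.of_norm (by simpa only [h0] using h)
  set L := ContinuousMap.toLp (E := ℂ) 2 (volume : Measure Torus) ℂ
  have h1 := hs.hasSum.mapL L
  have h2 := modeBasis.hasSum_repr (cplx f)
  have h3 : (fun k => modeBasis.repr (cplx f) k • modeBasis k)
      = fun k => L (fcoeff f k • expMode k) := by
    funext k
    rw [repr_cplx, modeBasis_apply, modeLp, map_smul, map_smul, smul_smul]
    congr 1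
    have hpi : (Real.pi : ℂ) ≠ 0 := by exact_mod_cast Real.pi_pos.ne'
    push_cast
    field_simp
  rw [h3] at h2
  have h4 := h2.unique h1
  filter_upwards [coeFn_cplx f, ContinuousMap.coeFn_toLp (p := 2) (𝕜 := ℂ)
    (volume : Measure Torus) (∑' k, fcoeff f k • expMode k)] with x hx1 hx2
  rw [← h4] at hx2
  rw [hx1] at hx2
  have h5 : |f x| = ‖((f x : ℝ) : ℂ)‖ := by simp
  rw [h5, hx2]
  refine ((∑' k, fcoeff f k • expMode k).norm_coe_le_norm x).trans ?_
  refine (norm_tsum_le_tsum_norm (by simpa only [h0] using h)).trans (le_of_eq ?_)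
  simp only [h0]

lemma summable_jb_rpow {s : ℝ} (hs : 1 < s) : Summable fun k : Fin 2 → ℤ => jb k ^ (-s) := by
  have h := EisensteinSeries.summable_one_div_norm_rpow (k := 2 * s) (by linarith)
  have h2 : Summable fun k : Fin 2 → ℤ => ‖k‖ ^ (-(2 * s)) + if k = 0 then (1 : ℝ) else 0 :=
    h.add (summable_of_hasFiniteSupport ((Set.finite_singleton 0).subset (by
      intro k hk
      by_contra h'
      simp [Set.mem_singleton_iff.not.mp h'] at hk)))
  refine Summable.of_nonneg_of_le (fun k => (Real.rpow_pos_of_pos (jb_pos k) _).le) (fun k => ?_) h2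
  by_cases hk : k = 0
  · subst hk
    have : jb 0 = 1 := by simp [jb]
    rw [this, Real.one_rpow]
    simp only [if_true]
    have : 0 ≤ ‖(0 : Fin 2 → ℤ)‖ ^ (-(2 * s)) := by positivity
    linarith
  · rw [if_neg hk, add_zero]
    have hk0 : 0 < ‖k‖ := norm_pos_iff.mpr hk
    have h3 : ‖k‖ ^ 2 ≤ jb k := by
      obtain ⟨j, hj⟩ : ∃ j, ‖k‖ = ‖k j‖ := by
        rcases max_choice ‖k 0‖ ‖k 1‖ with h | h
        · exact ⟨0, by rw [← h, Pi.norm_def]; simp [Fin.univ_succ]⟩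
        · exact ⟨1, by rw [← h, Pi.norm_def]; simp [Fin.univ_succ]⟩
      rw [hj, Int.norm_eq_abs, sq_abs]
      exact sq_le_jb k j
    calc jb k ^ (-s) ≤ (‖k‖ ^ 2) ^ (-s) :=
          Real.rpow_le_rpow_of_nonpos (by positivity) h3 (by linarith)
      _ = ‖k‖ ^ (-(2 * s)) := by
          rw [← Real.rpow_natCast, ← Real.rpow_mul hk0.le]
          congr 1
          push_cast
          ring

/-- The constant of the embedding `H^{5/4} ⊆ L^∞`. -/
def embC : ℝ := ∑' k : Fin 2 → ℤ, jb k ^ (-(5 / 4) : ℝ)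

lemma embC_nonneg : 0 ≤ embC := tsum_nonneg fun k => (Real.rpow_pos_of_pos (jb_pos k) _).le

/-- The embedding `H^{5/4} ⊆ L^∞`. -/
lemma ae_sq_le_sobSq {f : L2} (h : sobSq (5 / 4) (fcoeff f) ≠ ⊤) :
    ∀ᵐ x, f x ^ 2 ≤ embC * (sobSq (5 / 4) (fcoeff f)).toReal := by
  have h1 := summable_of_sobSq_ne_top h
  have h0 := summable_jb_rpow (s := 5 / 4) (by norm_num)
  set a : (Fin 2 → ℤ) → ℝ := fun k => jb k ^ (-(5 / 8) : ℝ)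
  set b : (Fin 2 → ℤ) → ℝ := fun k => jb k ^ (5 / 8 : ℝ) * ‖fcoeff f k‖
  have ha : ∀ k, a k ^ (2 : ℝ) = jb k ^ (-(5 / 4) : ℝ) := fun k => by
    rw [← Real.rpow_mul (jb_pos k).le]; norm_num
  have hb : ∀ k, b k ^ (2 : ℝ) = jb k ^ (5 / 4 : ℝ) * ‖fcoeff f k‖ ^ 2 := fun k => by
    have := jb_pos k
    rw [Real.mul_rpow (by positivity) (by positivity), ← Real.rpow_mul (jb_pos k).le]; norm_num
  have hab : ∀ k, a k * b k = ‖fcoeff f k‖ := fun k => by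
    simp only [a, b]
    rw [← mul_assoc, ← Real.rpow_add (jb_pos k)]; norm_num
  have hpq : (2 : ℝ).HolderConjugate 2 := Real.HolderConjugate.two_two
  have key := Real.inner_le_Lp_mul_Lq_tsum_of_nonneg hpq (f := a) (g := b)
    (fun k => (Real.rpow_pos_of_pos (jb_pos k) _).le)
    (fun k => by have := jb_pos k; positivity)
    (by simpa only [ha] using h0) (by simpa only [hb] using h1)
  have key1 := Real.summable_mul_of_Lp_Lq_of_nonneg hpq (f := a) (g := b)
    (fun k => (Real.rpow_pos_of_pos (jb_pos k) _).le)
    (fun k => by have := jb_pos k; positivity)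
    (by simpa only [ha] using h0) (by simpa only [hb] using h1)
  simp only [hab] at key1
  simp only [ha, hb, hab] at key
  have h3 : (∑' k, jb k ^ (5 / 4 : ℝ) * ‖fcoeff f k‖ ^ 2) = (sobSq (5 / 4) (fcoeff f)).toReal := by
    rw [sobSq, ← ENNReal.ofReal_tsum_of_nonneg (fun k => by have := jb_pos k; positivity) h1,
      ENNReal.toReal_ofReal (tsum_nonneg fun k => by have := jb_pos k; positivity)]
  rw [h3, ← embC] at key
  filter_upwards [ae_abs_le_tsum key1] with x hx
  have h4 := hx.trans key
  have h5 := pow_le_pow_left₀ (abs_nonneg _) h4 2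
  have h6 : ∀ r : ℝ, 0 ≤ r → (r ^ (1 / 2 : ℝ)) ^ 2 = r := fun r hr => by
    rw [← Real.sqrt_eq_rpow, Real.sq_sqrt hr]
  rw [sq_abs, mul_pow, h6 _ embC_nonneg, h6 _ ENNReal.toReal_nonneg] at h5
  exact h5

/-! ### Trigonometric polynomials -/

/-- The real part of the trigonometric polynomial `∑_{k ∈ S} c(k) e^{i k·x}`. -/
def trigPoly (S : Finset (Fin 2 → ℤ)) (c : (Fin 2 → ℤ) → ℂ) (x : Torus) : ℝ :=
  ∑ k ∈ S, (c k * expMode k x).re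

lemma continuous_trigPoly (S : Finset (Fin 2 → ℤ)) (c : (Fin 2 → ℤ) → ℂ) :
    Continuous (trigPoly S c) :=
  continuous_finsetSum _ fun k _ =>
    Complex.continuous_re.comp (continuous_const.mul (expMode k).continuous)

lemma hasPD_trigPoly (S : Finset (Fin 2 → ℤ)) (c : (Fin 2 → ℤ) → ℂ) (j : Fin 2) :
    HasPD j (trigPoly S c) (trigPoly S fun k => Complex.I * k j * c k) := by
  have h := HasPD.sum (s := S) fun k (_ : k ∈ S) => hasPD_re_expMode (c k) k j
  convert! h using 2 with x
  refine Finset.sum_congr rfl fun k _ => ?_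
  congr 2
  ring

lemma fcoeff_re_expMode (c : ℂ) (k l : Fin 2 → ℤ) :
    fcoeff (fun x => (c * expMode k x).re) l
      = (1 / 2 : ℂ) * ((if k = l then c else 0) + if k = -l then conj c else 0) := by
  have h1 : ∫ x, (((c * expMode k x).re : ℝ) : ℂ) * expMode (-l) x
      = ∫ x, ((c / 2) * expMode (k - l) x + (conj c / 2) * expMode (-(k + l)) x) := by
    congr 1
    funext x
    rw [Complex.re_eq_add_conj, map_mul, sub_eq_add_neg, neg_add, expMode_add, expMode_add,
      expMode_neg k]
    ring
  rw [fcoeff_eq, h1, integral_add (continuous_integrable (by fun_prop))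
    (continuous_integrable (by fun_prop)), integral_const_mul, integral_const_mul,
    integral_expMode, integral_expMode]
  simp only [neg_eq_zero, sub_eq_zero, add_eq_zero_iff_eq_neg]
  have hpi : (Real.pi : ℂ) ≠ 0 := by exact_mod_cast Real.pi_pos.ne'
  split_ifs <;> push_cast <;> field_simp <;> ring

lemma fcoeff_finset_sum {ι : Type*} (s : Finset ι) {f : ι → Torus → ℝ}
    (hf : ∀ i ∈ s, Integrable (f i)) (k : Fin 2 → ℤ) :
    fcoeff (fun x => ∑ i ∈ s, f i x) k = ∑ i ∈ s, fcoeff (f i) k := by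
  classical
  induction s using Finset.induction_on with
  | empty => simp [fcoeff]
  | insert a s ha ih =>
    simp only [Finset.sum_insert ha]
    rw [fcoeff_add (hf a (Finset.mem_insert_self a s))
      (integrable_finsetSum s fun i hi => hf i (Finset.mem_insert_of_mem hi)),
      ih fun i hi => hf i (Finset.mem_insert_of_mem hi)]

lemma fcoeff_trigPoly {S : Finset (Fin 2 → ℤ)} (hS : ∀ k ∈ S, -k ∈ S) {c : (Fin 2 → ℤ) → ℂ}
    (hc : ∀ k, c (-k) = conj (c k)) (l : Fin 2 → ℤ) :
    fcoeff (trigPoly S c) l = if l ∈ S then c l else 0 := by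
  have h1 : fcoeff (trigPoly S c) l = ∑ k ∈ S, fcoeff (fun x => (c k * expMode k x).re) l :=
    fcoeff_finset_sum S (fun k _ => continuous_integrable
      (Complex.continuous_re.comp (continuous_const.mul (expMode k).continuous))) l
  have h2 : -l ∈ S ↔ l ∈ S := ⟨fun h => by simpa using hS _ h, hS l⟩
  rw [h1]
  simp only [fcoeff_re_expMode, ← Finset.mul_sum, Finset.sum_add_distrib, Finset.sum_ite_eq',
    h2, hc]
  split_ifs
  · rw [Complex.conj_conj]; ring
  · ring

/-! ### Primitives of integrable functions of time -/

/-- `x` is a primitive of the integrable function `x'` on `[0,T]`. Nothing is said about `x` outside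
`[0,T]`. -/
structure IsPrim (T : ℝ) (x x' : ℝ → ℝ) : Prop where
  integrable : IntervalIntegrable x' volume 0 T
  eq : ∀ t ∈ Icc 0 T, x t = x 0 + ∫ s in (0)..t, x' s

lemma IsPrim.of_ac {T : ℝ} (hT : 0 ≤ T) {x x' : ℝ → ℝ}
    (hx : AbsolutelyContinuousOnInterval x 0 T)
    (hd : ∀ᵐ t, t ∈ Icc 0 T → HasDerivAt x (x' t) t) : IsPrim T x x' := by
  have h0 : ∀ t ∈ Icc 0 T, ∀ᵐ s, s ∈ uIoc 0 t → deriv x s = x' s := fun t ht => by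
    filter_upwards [hd] with s hs hs'
    rw [uIoc_of_le ht.1] at hs'
    exact (hs ⟨hs'.1.le, hs'.2.trans ht.2⟩).deriv
  refine ⟨?_, fun t ht => ?_⟩
  · refine hx.intervalIntegrable_deriv.congr_ae ?_
    rw [Filter.EventuallyEq, ae_restrict_iff' measurableSet_uIoc]
    exact h0 T ⟨hT, le_rfl⟩
  · have h1 : AbsolutelyContinuousOnInterval x 0 t := hx.mono (by
      rw [uIcc_of_le ht.1, uIcc_of_le hT]; exact Icc_subset_Icc_right ht.2)
    rw [← intervalIntegral.integral_congr_ae (h0 t ht), h1.integral_deriv_eq_sub]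
    ring

/-- A primitive is absolutely continuous on `[0,T]`, with `x'` as its derivative almost everywhere.
Products of primitives are handled through this characterisation, of which `IsPrim.of_ac` is the
converse. -/
lemma IsPrim.exists_ac {T : ℝ} {x x' : ℝ → ℝ} (h : IsPrim T x x') (hT : 0 ≤ T) :
    AbsolutelyContinuousOnInterval x 0 T ∧ ∀ᵐ t, t ∈ Icc 0 T → HasDerivAt x (x' t) t := by
  have h1 := h.integrable.absolutelyContinuousOnInterval_intervalIntegral (c := 0) (by simp)
  have h2 : ∀ᵐ t, t ∈ Icc 0 T → HasDerivAt x (x' t) t := by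
    have h3 := h.integrable.ae_hasDerivAt_integral
    have h4 : ∀ᵐ t : ℝ, t ≠ 0 := by simp [ae_iff]
    have h5 : ∀ᵐ t : ℝ, t ≠ T := by simp [ae_iff]
    filter_upwards [h3, h4, h5] with t ht ht0 htT htm
    have h6 := (ht (by rwa [uIcc_of_le hT]) 0 (by simp)).const_add (x 0)
    refine h6.congr_of_eventuallyEq ?_
    filter_upwards [Ioo_mem_nhds (lt_of_le_of_ne htm.1 (Ne.symm ht0)) (lt_of_le_of_ne htm.2 htT)]
      with s hs
    exact h.eq s ⟨hs.1.le, hs.2.le⟩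
  refine ⟨?_, h2⟩
  have h7 : AbsolutelyContinuousOnInterval (fun t => x 0 + ∫ s in (0)..t, x' s) 0 T :=
    ((LipschitzWith.const (x 0)).lipschitzOnWith.absolutelyContinuousOnInterval).add h1
  rw [absolutelyContinuousOnInterval_iff] at h7 ⊢
  intro ε hε
  obtain ⟨δ, hδ, H⟩ := h7 ε hε
  refine ⟨δ, hδ, fun E hE hE' => ?_⟩
  refine lt_of_eq_of_lt (Finset.sum_congr rfl fun i hi => ?_) (H E hE hE')
  have h8 := hE.1 i hi
  rw [uIcc_of_le hT] at h8
  rw [h.eq _ h8.1, h.eq _ h8.2]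

lemma IsPrim.mul {T : ℝ} (hT : 0 ≤ T) {x x' y y' : ℝ → ℝ} (hx : IsPrim T x x')
    (hy : IsPrim T y y') : IsPrim T (fun t => x t * y t) (fun t => x' t * y t + x t * y' t) := by
  obtain ⟨h1, h2⟩ := hx.exists_ac hT
  obtain ⟨h3, h4⟩ := hy.exists_ac hT
  refine IsPrim.of_ac hT (h1.fun_mul h3) ?_
  filter_upwards [h2, h4] with t h5 h6 ht
  exact (h5 ht).mul (h6 ht)

lemma IsPrim.add {T : ℝ} (hT : 0 ≤ T) {x x' y y' : ℝ → ℝ} (hx : IsPrim T x x')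
    (hy : IsPrim T y y') : IsPrim T (fun t => x t + y t) (fun t => x' t + y' t) := by
  obtain ⟨h1, h2⟩ := hx.exists_ac hT
  obtain ⟨h3, h4⟩ := hy.exists_ac hT
  refine IsPrim.of_ac hT (h1.fun_add h3) ?_
  filter_upwards [h2, h4] with t h5 h6 ht
  exact (h5 ht).add (h6 ht)

lemma IsPrim.of_contDiff {T : ℝ} (hT : 0 ≤ T) {x x' : ℝ → ℝ} (hd : ∀ t, HasDerivAt x (x' t) t)
    (hc : Continuous x') : IsPrim T x x' := by
  refine IsPrim.of_ac hT ?_ (Filter.Eventually.of_forall fun t _ => hd t)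
  refine ContDiffOn.absolutelyContinuousOnInterval (ContDiff.contDiffOn ?_)
  rw [contDiff_one_iff_deriv]
  refine ⟨fun t => (hd t).differentiableAt, ?_⟩
  rwa [show deriv x = x' from funext fun t => (hd t).deriv]

lemma IsPrim.exp_neg {T : ℝ} (hT : 0 ≤ T) {A a : ℝ → ℝ} (hA : IsPrim T A a)
    (h0 : ∀ t ∈ Icc 0 T, 0 ≤ A t) :
    IsPrim T (fun t => Real.exp (-A t)) (fun t => Real.exp (-A t) * -a t) := by
  obtain ⟨h1, h2⟩ := hA.exists_ac hT
  refine IsPrim.of_ac hT ?_ ?_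
  · have hL : ∀ x y : ℝ, 0 ≤ x → 0 ≤ y → |Real.exp (-x) - Real.exp (-y)| ≤ |x - y| := by
      have key : ∀ x y : ℝ, 0 ≤ x → x ≤ y → |Real.exp (-x) - Real.exp (-y)| ≤ |x - y| := by
        intro x y hx hxy
        rw [abs_of_nonneg (sub_nonneg.mpr (Real.exp_le_exp.mpr (by linarith))), abs_sub_comm,
          abs_of_nonneg (sub_nonneg.mpr hxy)]
        have e1 : Real.exp (-y) = Real.exp (-x) * Real.exp (-(y - x)) := by
          rw [← Real.exp_add]; congr 1; ring
        have e2 := Real.add_one_le_exp (-(y - x))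
        have e3 : Real.exp (-x) ≤ 1 := Real.exp_le_one_iff.mpr (by linarith)
        have e4 := Real.exp_pos (-x)
        rw [e1]
        nlinarith
      intro x y hx hy
      rcases le_total x y with h | h
      · exact key x y hx h
      · rw [abs_sub_comm, abs_sub_comm x]; exact key y x hy h
    rw [absolutelyContinuousOnInterval_iff] at h1 ⊢
    intro ε hε
    obtain ⟨δ, hδ, H⟩ := h1 ε hε
    refine ⟨δ, hδ, fun E hE hE' => ?_⟩
    refine lt_of_le_of_lt (Finset.sum_le_sum fun i hi => ?_) (H E hE hE')
    have h8 := hE.1 i hi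
    rw [uIcc_of_le hT] at h8
    simp only [Real.dist_eq]
    exact hL _ _ (h0 _ h8.1) (h0 _ h8.2)
  · filter_upwards [h2] with t h5 ht
    exact (h5 ht).neg.exp

lemma IsPrim.le_of_nonpos {T : ℝ} {x x' : ℝ → ℝ} (h : IsPrim T x x')
    (hn : ∀ᵐ t ∂(timeMeasure T), x' t ≤ 0) {t : ℝ} (ht : t ∈ Icc 0 T) : x t ≤ x 0 := by
  rw [h.eq t ht]
  have : ∫ s in (0)..t, x' s ≤ 0 := by
    rw [intervalIntegral.integral_of_le ht.1]
    refine integral_nonpos_of_ae ?_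
    exact ae_restrict_of_ae_restrict_of_subset
      (fun s hs => ⟨hs.1.le, hs.2.trans ht.2⟩ : Ioc 0 t ⊆ Icc 0 T) hn
  linarith

lemma IsPrim.congr {T : ℝ} {x x' y' : ℝ → ℝ} (h : IsPrim T x x')
    (h' : ∀ᵐ t ∂(timeMeasure T), x' t = y' t) (hT : 0 ≤ T) : IsPrim T x y' := by
  have hsub : ∀ t ∈ Icc 0 T, Ioc 0 t ⊆ Icc 0 T :=
    fun t ht s hs => ⟨hs.1.le, hs.2.trans ht.2⟩
  refine ⟨h.integrable.congr_ae ?_, fun t ht => ?_⟩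
  · rw [uIoc_of_le hT]
    exact ae_restrict_of_ae_restrict_of_subset (hsub T ⟨hT, le_rfl⟩) h'
  · rw [h.eq t ht, intervalIntegral.integral_of_le ht.1, intervalIntegral.integral_of_le ht.1]
    congr 1
    exact integral_congr_ae (ae_restrict_of_ae_restrict_of_subset (hsub t ht) h')

/-! ### Grönwall's inequality with an integrable coefficient -/

/-- Grönwall's inequality in integrated form: the product of `c + ∫₀ᵗ a Φ` with `exp (-∫₀ᵗ a)` is
nonincreasing. No continuity is required of `a` or `Φ`. -/
lemma gronwall_real {T c : ℝ} (hT : 0 ≤ T) {Φ a : ℝ → ℝ} (ha : IntegrableOn a (Icc 0 T))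
    (ha0 : ∀ t, 0 ≤ a t) (haΦ : IntegrableOn (fun s => a s * Φ s) (Icc 0 T))
    (h : ∀ t ∈ Icc 0 T, Φ t ≤ c + ∫ s in (0)..t, a s * Φ s) {t : ℝ} (ht : t ∈ Icc 0 T) :
    Φ t ≤ c * Real.exp (∫ s in (0)..t, a s) := by
  have hii : ∀ {f : ℝ → ℝ}, IntegrableOn f (Icc 0 T) → IntervalIntegrable f volume 0 T :=
    fun hf => (intervalIntegrable_iff_integrableOn_Icc_of_le hT).mpr hf
  have hA : IsPrim T (fun t => ∫ s in (0)..t, a s) a := ⟨hii ha, fun t _ => by simp⟩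
  have hY : IsPrim T (fun t => c + ∫ s in (0)..t, a s * Φ s) (fun s => a s * Φ s) :=
    ⟨hii haΦ, fun t _ => by simp⟩
  have hA0 : ∀ t ∈ Icc 0 T, 0 ≤ ∫ s in (0)..t, a s := fun t ht =>
    intervalIntegral.integral_nonneg ht.1 fun s _ => ha0 s
  have hZ := hY.mul hT (hA.exp_neg hT hA0)
  have h1 := hZ.le_of_nonpos (t := t) (by
    rw [ae_restrict_iff' measurableSet_Icc]
    refine Filter.Eventually.of_forall fun s hs => ?_
    have e1 := Real.exp_pos (-∫ r in (0)..s, a r)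
    have e2 := mul_le_mul_of_nonneg_left (h s hs) (ha0 s)
    have e3 := mul_le_mul_of_nonneg_left e2 e1.le
    linarith) ht
  simp only [intervalIntegral.integral_same, add_zero, neg_zero, Real.exp_zero, mul_one] at h1
  refine (h t ht).trans ?_
  have e1 := Real.exp_pos (∫ r in (0)..t, a r)
  have e2 : Real.exp (-∫ r in (0)..t, a r) * Real.exp (∫ r in (0)..t, a r) = 1 := by
    rw [← Real.exp_add]; simp
  calc _ = (c + ∫ s in (0)..t, a s * Φ s) * Real.exp (-∫ r in (0)..t, a r)
        * Real.exp (∫ r in (0)..t, a r) := by rw [mul_assoc, e2, mul_one]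
    _ ≤ _ := mul_le_mul_of_nonneg_right h1 e1.le

/-- Grönwall's inequality for extended nonnegative functions. The crude bound `B` does not enter the
conclusion; it makes `∫ a Φ` finite. -/
lemma gronwall {T : ℝ} (hT : 0 ≤ T) {Φ a : ℝ → ℝ≥0∞} {c B : ℝ≥0∞} (hc : c ≠ ⊤) (hB : B ≠ ⊤)
    (hΦm : AEMeasurable Φ (timeMeasure T)) (hΦ : ∀ᵐ t ∂(timeMeasure T), Φ t ≤ B)
    (ham : AEMeasurable a (timeMeasure T)) (ha : ∫⁻ s in Icc 0 T, a s ≠ ⊤)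
    (h : ∀ t ∈ Icc 0 T, Φ t ≤ c + ∫⁻ s in Icc 0 t, a s * Φ s) {t : ℝ} (ht : t ∈ Icc 0 T) :
    Φ t ≤ c * ENNReal.ofReal (Real.exp (∫⁻ s in Icc 0 T, a s).toReal) := by
  have hsub : ∀ t ∈ Icc 0 T, Icc 0 t ⊆ Icc 0 T := fun t ht => Icc_subset_Icc_right ht.2
  have ha' : ∀ᵐ s ∂(timeMeasure T), a s < ⊤ := ae_lt_top' ham ha
  have haB : ∫⁻ s in Icc 0 T, a s * Φ s ≠ ⊤ := by
    refine ne_top_of_le_ne_top (ENNReal.mul_ne_top ha hB)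
      ((lintegral_mono_ae ?_).trans_eq (lintegral_mul_const'' B ham))
    filter_upwards [hΦ] with s hs
    gcongr
  have hΦfin : ∀ t ∈ Icc 0 T, Φ t ≠ ⊤ := fun t ht => by
    refine ne_top_of_le_ne_top (ENNReal.add_ne_top.mpr ⟨hc, ?_⟩) (h t ht)
    exact ne_top_of_le_ne_top haB (lintegral_mono_set (hsub t ht))
  have hia : IntegrableOn (fun s => (a s).toReal) (Icc 0 T) := integrable_toReal_of_lintegral_ne_top ham ha
  have hiaΦ : IntegrableOn (fun s => (a s).toReal * (Φ s).toReal) (Icc 0 T) := by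
    have := integrable_toReal_of_lintegral_ne_top (ham.mul hΦm) haB
    simp only [Pi.mul_apply, ENNReal.toReal_mul] at this
    exact this
  have hint : ∀ {b : ℝ → ℝ≥0∞}, AEMeasurable b (timeMeasure T) →
      ∫⁻ s in Icc 0 T, b s ≠ ⊤ → ∀ t ∈ Icc 0 T,
      ∫ s in (0)..t, (b s).toReal = (∫⁻ s in Icc 0 t, b s).toReal := by
    intro b hb hb' t ht
    have hbt : AEMeasurable b (volume.restrict (Icc 0 t)) :=
      hb.mono_measure (Measure.restrict_mono (hsub t ht) le_rfl)
    rw [intervalIntegral.integral_of_le ht.1, ← integral_Icc_eq_integral_Ioc,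
      integral_toReal hbt (ae_lt_top' hbt
        (ne_top_of_le_ne_top hb' (lintegral_mono_set (hsub t ht))))]
  have key := gronwall_real (c := c.toReal) (Φ := fun s => (Φ s).toReal) hT hia
    (fun s => ENNReal.toReal_nonneg) hiaΦ (fun t ht => by
      simp only [← ENNReal.toReal_mul]
      rw [hint (b := fun s => a s * Φ s) (ham.mul hΦm) haB t ht, ← ENNReal.toReal_add hc
        (ne_top_of_le_ne_top haB (lintegral_mono_set (hsub t ht)))]
      refine ENNReal.toReal_mono (ENNReal.add_ne_top.mpr ⟨hc, ?_⟩) (h t ht)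
      exact ne_top_of_le_ne_top haB (lintegral_mono_set (hsub t ht))) ht
  rw [hint ham ha t ht] at key
  have h2 : (∫⁻ s in Icc 0 t, a s).toReal ≤ (∫⁻ s in Icc 0 T, a s).toReal :=
    ENNReal.toReal_mono ha (lintegral_mono_set (hsub t ht))
  rw [← ENNReal.ofReal_toReal (hΦfin t ht), ← ENNReal.ofReal_toReal hc,
    ← ENNReal.ofReal_mul ENNReal.toReal_nonneg]
  exact ENNReal.ofReal_le_ofReal (key.trans (mul_le_mul_of_nonneg_left (Real.exp_le_exp.mpr h2)
    ENNReal.toReal_nonneg))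

/-! ### The linear estimate for one Fourier mode -/

/-- `z` solves `z' = -(a z + f)` on `[0,T]`, in integrated form. -/
structure ModeSol (T a : ℝ) (z f : ℝ → ℂ) : Prop where
  cont : ContinuousOn z (Icc 0 T)
  integrable : IntegrableOn f (Icc 0 T)
  eq : ∀ t ∈ Icc 0 T, z t = z 0 - ∫ s in (0)..t, (a * z s + f s)

lemma ModeSol.integrableOn {T a : ℝ} {z f : ℝ → ℂ} (h : ModeSol T a z f) :
    IntegrableOn (fun s => a * z s + f s) (Icc 0 T) :=
  ((continuousOn_const.mul h.cont).integrableOn_Icc).add h.integrable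

lemma ModeSol.isPrim_clm {T a : ℝ} {z f : ℝ → ℂ} (hT : 0 ≤ T) (h : ModeSol T a z f)
    (L : ℂ →L[ℝ] ℝ) : IsPrim T (fun t => L (z t)) (fun t => -L (a * z t + f t)) := by
  have hi := (intervalIntegrable_iff_integrableOn_Icc_of_le hT).mpr h.integrableOn
  have hi2 : IntervalIntegrable (fun t => L (a * z t + f t)) volume 0 T :=
    (intervalIntegrable_iff_integrableOn_Icc_of_le hT).mpr (L.integrable_comp h.integrableOn)
  refine ⟨hi2.neg, fun t ht => ?_⟩
  have hit : IntervalIntegrable (fun s => a * z s + f s) volume 0 t :=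
    hi.mono_set (by rw [uIcc_of_le ht.1, uIcc_of_le hT]; exact Icc_subset_Icc_right ht.2)
  rw [h.eq t ht, map_sub, intervalIntegral.integral_neg, ← L.intervalIntegral_comp_comm hit]
  ring

lemma ModeSol.mono {T t a : ℝ} {z f : ℝ → ℂ} (h : ModeSol T a z f) (ht : t ≤ T) :
    ModeSol t a z f :=
  ⟨h.cont.mono (Icc_subset_Icc_right ht), h.integrable.mono_set (Icc_subset_Icc_right ht),
    fun s hs => h.eq s ⟨hs.1, hs.2.trans ht⟩⟩

lemma ModeSol.sub {T a : ℝ} {z f z' f' : ℝ → ℂ} (h : ModeSol T a z f)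
    (h' : ModeSol T a z' f') : ModeSol T a (fun t => z t - z' t) (fun t => f t - f' t) := by
  refine ⟨h.cont.sub h'.cont, h.integrable.sub h'.integrable, fun t ht => ?_⟩
  have hi : ∀ {z f : ℝ → ℂ}, ModeSol T a z f →
      IntervalIntegrable (fun s => a * z s + f s) volume 0 t := fun h =>
    (intervalIntegrable_iff_integrableOn_Icc_of_le ht.1).mpr
      (h.integrableOn.mono_set (Icc_subset_Icc_right ht.2))
  have h1 : ∫ s in (0)..t, (a * (z s - z' s) + (f s - f' s))
      = (∫ s in (0)..t, (a * z s + f s)) - ∫ s in (0)..t, (a * z' s + f' s) := by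
    rw [← intervalIntegral.integral_sub (hi h) (hi h')]
    congr 1
    funext s
    ring
  rw [h1, h.eq t ht, h'.eq t ht]
  ring

lemma ModeSol.isPrim_normSq {T a : ℝ} {z f : ℝ → ℂ} (hT : 0 ≤ T) (h : ModeSol T a z f) (C : ℝ) :
    IsPrim T (fun t => Real.exp (-(C * t)) * ‖z t‖ ^ 2)
      (fun t => Real.exp (-(C * t)) *
        (-C * ‖z t‖ ^ 2 - 2 * a * ‖z t‖ ^ 2 - 2 * (conj (z t) * f t).re)) := by
  have h1 := h.isPrim_clm hT Complex.reCLM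
  have h2 := h.isPrim_clm hT Complex.imCLM
  have h3 : IsPrim T (fun t => Real.exp (-(C * t))) (fun t => Real.exp (-(C * t)) * (-C)) :=
    IsPrim.of_contDiff hT (fun t => by
      simpa using ((hasDerivAt_id t).const_mul C).neg.exp) (by fun_prop)
  have h4 := h3.mul hT ((h1.mul hT h1).add hT (h2.mul hT h2))
  have e1 : ∀ w : ℂ, ‖w‖ ^ 2 = w.re * w.re + w.im * w.im := fun w => by
    rw [← Complex.normSq_eq_norm_sq, Complex.normSq_apply]
  convert! h4 using 1
  · funext t
    simp [e1]
  · funext t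
    simp only [e1, Complex.reCLM_apply, Complex.imCLM_apply, Complex.add_re, Complex.add_im,
      Complex.mul_re, Complex.mul_im, Complex.ofReal_re, Complex.ofReal_im, Complex.conj_re,
      Complex.conj_im]
    ring

/-- The energy estimate for a single mode `z' = -(a z + f)` whose rate satisfies `a ≥ c p - C`. -/
lemma ModeSol.energy {T a c p C : ℝ} {z f : ℝ → ℂ} (hC : 0 ≤ C) (hc : 0 < c)
    (hp : 0 < p) (ha : c * p - C ≤ a) (h : ModeSol T a z f) {t : ℝ} (ht : t ∈ Icc 0 T) :
    ENNReal.ofReal (‖z t‖ ^ 2) + ENNReal.ofReal (c * p) * ∫⁻ s in Icc 0 t, ENNReal.ofReal (‖z s‖ ^ 2)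
      ≤ ENNReal.ofReal (Real.exp (2 * C * T)) * (ENNReal.ofReal (‖z 0‖ ^ 2) +
        ENNReal.ofReal ((c * p)⁻¹) * ∫⁻ s in Icc 0 t, ENNReal.ofReal (‖f s‖ ^ 2)) := by
  have hcp : 0 < c * p := mul_pos hc hp
  by_cases hfin : ∫⁻ s in Icc 0 t, ENNReal.ofReal (‖f s‖ ^ 2) = ⊤
  · rw [hfin, ENNReal.mul_top (ENNReal.ofReal_pos.mpr (inv_pos.mpr hcp)).ne', add_top,
      ENNReal.mul_top (by simpa using Real.exp_pos _)]
    exact le_top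
  have h' := h.mono ht.2
  have hzi : IntegrableOn (fun s => ‖z s‖ ^ 2) (Icc 0 t) := (h'.cont.norm.pow 2).integrableOn_Icc
  have hfi : IntegrableOn (fun s => ‖f s‖ ^ 2) (Icc 0 t) := by
    refine ⟨(h'.integrable.aestronglyMeasurable.norm.pow 2), ?_⟩
    rw [hasFiniteIntegral_iff_ofReal (Filter.Eventually.of_forall fun s => by positivity)]
    exact lt_top_iff_ne_top.mpr hfin
  have hP := h'.isPrim_normSq ht.1 (2 * C)
  have h1 := hP.eq t ⟨ht.1, le_rfl⟩
  have hii : ∀ {f : ℝ → ℝ}, IntegrableOn f (Icc 0 t) → IntervalIntegrable f volume 0 t :=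
    fun hf => (intervalIntegrable_iff_integrableOn_Icc_of_le ht.1).mpr hf
  have hE : Continuous fun s : ℝ => Real.exp (-(2 * C * s)) := by fun_prop
  have h2 : ∫ s in (0)..t, Real.exp (-(2 * C * s)) *
        (-(2 * C) * ‖z s‖ ^ 2 - 2 * a * ‖z s‖ ^ 2 - 2 * (conj (z s) * f s).re)
      ≤ ∫ s in (0)..t, ((c * p)⁻¹ * ‖f s‖ ^ 2
        - Real.exp (-(2 * C * t)) * (c * p) * ‖z s‖ ^ 2) := by
    refine intervalIntegral.integral_mono_on ht.1 hP.integrable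
      ((hii hfi).const_mul _ |>.sub ((hii hzi).const_mul _)) fun s hs => ?_
    have e1 : Real.exp (-(2 * C * s)) ≤ 1 := Real.exp_le_one_iff.mpr (by nlinarith [hs.1])
    have e2 : Real.exp (-(2 * C * t)) ≤ Real.exp (-(2 * C * s)) :=
      Real.exp_le_exp.mpr (by nlinarith [hs.2])
    have e3 : -2 * (conj (z s) * f s).re ≤ 2 * (‖z s‖ * ‖f s‖) := by
      have := (abs_le.mp (Complex.abs_re_le_norm (conj (z s) * f s))).1
      rw [norm_mul, RCLike.norm_conj] at this
      linarith
    have e4 : 2 * (‖z s‖ * ‖f s‖) ≤ c * p * ‖z s‖ ^ 2 + (c * p)⁻¹ * ‖f s‖ ^ 2 := by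
      have e5 : 0 ≤ (c * p)⁻¹ * (c * p * ‖z s‖ - ‖f s‖) ^ 2 := by positivity
      have e6 : (c * p)⁻¹ * (c * p * ‖z s‖ - ‖f s‖) ^ 2
          = c * p * ‖z s‖ ^ 2 + (c * p)⁻¹ * ‖f s‖ ^ 2 - 2 * (‖z s‖ * ‖f s‖) := by
        field_simp
        ring
      linarith
    have e7 : -(2 * C) * ‖z s‖ ^ 2 - 2 * a * ‖z s‖ ^ 2 - 2 * (conj (z s) * f s).re
        ≤ (c * p)⁻¹ * ‖f s‖ ^ 2 - c * p * ‖z s‖ ^ 2 := by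
      have : (c * p) * ‖z s‖ ^ 2 ≤ (a + C) * ‖z s‖ ^ 2 :=
        mul_le_mul_of_nonneg_right (by linarith) (by positivity)
      linarith
    have e8 : 0 ≤ (c * p)⁻¹ * ‖f s‖ ^ 2 := by positivity
    have e9 : 0 ≤ c * p * ‖z s‖ ^ 2 := by positivity
    refine (mul_le_mul_of_nonneg_left e7 (Real.exp_pos _).le).trans ?_
    nlinarith [Real.exp_pos (-(2 * C * s))]
  have hIcc : ∀ g : ℝ → ℝ, ∫ s in (0)..t, g s = ∫ s in Icc 0 t, g s := fun g => by
    rw [intervalIntegral.integral_of_le ht.1, integral_Icc_eq_integral_Ioc]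
  rw [intervalIntegral.integral_sub ((hii hfi).const_mul _) ((hii hzi).const_mul _),
    intervalIntegral.integral_const_mul, intervalIntegral.integral_const_mul,
    hIcc (fun s => ‖f s‖ ^ 2), hIcc (fun s => ‖z s‖ ^ 2)] at h2
  rw [mul_zero, neg_zero, Real.exp_zero, one_mul] at h1
  have e10 : Real.exp (-(2 * C * t)) * Real.exp (2 * C * t) = 1 := by
    rw [← Real.exp_add]; simp
  have e11 : Real.exp (2 * C * t) ≤ Real.exp (2 * C * T) :=
    Real.exp_le_exp.mpr (by nlinarith [ht.2])
  set I := ∫ s in Icc 0 t, ‖z s‖ ^ 2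
  set J := ∫ s in Icc 0 t, ‖f s‖ ^ 2
  have hI : 0 ≤ I := integral_nonneg fun s => by positivity
  have hJ : 0 ≤ J := integral_nonneg fun s => by positivity
  have h3 : ‖z t‖ ^ 2 + c * p * I ≤ Real.exp (2 * C * T) * (‖z 0‖ ^ 2 + (c * p)⁻¹ * J) := by
    have h4 : Real.exp (-(2 * C * t)) * (‖z t‖ ^ 2 + c * p * I) ≤ ‖z 0‖ ^ 2 + (c * p)⁻¹ * J := by
      linarith
    calc ‖z t‖ ^ 2 + c * p * I
        = Real.exp (2 * C * t) * (Real.exp (-(2 * C * t)) * (‖z t‖ ^ 2 + c * p * I)) := by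
          rw [← mul_assoc, mul_comm (Real.exp (2 * C * t)), e10, one_mul]
      _ ≤ Real.exp (2 * C * t) * (‖z 0‖ ^ 2 + (c * p)⁻¹ * J) :=
          mul_le_mul_of_nonneg_left h4 (Real.exp_pos _).le
      _ ≤ _ := mul_le_mul_of_nonneg_right e11 (by positivity)
  rw [← ofReal_integral_eq_lintegral_ofReal hzi
      (Filter.Eventually.of_forall fun s => by positivity),
    ← ofReal_integral_eq_lintegral_ofReal hfi
      (Filter.Eventually.of_forall fun s => by positivity),
    ← ENNReal.ofReal_mul hcp.le, ← ENNReal.ofReal_mul (by positivity),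
    ← ENNReal.ofReal_add (by positivity) (by positivity),
    ← ENNReal.ofReal_add (by positivity) (by positivity), ← ENNReal.ofReal_mul (by positivity)]
  exact ENNReal.ofReal_le_ofReal h3

/-! ### Energy estimate for families of modes -/

lemma aemeasurable_ofReal_norm_sq {T : ℝ} {z : ℝ → ℂ}
    (hz : AEStronglyMeasurable z (timeMeasure T)) (c : ℝ) :
    AEMeasurable (fun t => ENNReal.ofReal (c * ‖z t‖ ^ 2)) (timeMeasure T) :=
  ((hz.norm.aemeasurable.pow_const 2).const_mul c).ennreal_ofReal

lemma aemeasurable_sobSq {T : ℝ} {z : ℝ → (Fin 2 → ℤ) → ℂ}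
    (hz : ∀ k, AEStronglyMeasurable (fun t => z t k) (timeMeasure T)) (s : ℝ) :
    AEMeasurable (fun t => sobSq s (z t)) (timeMeasure T) :=
  AEMeasurable.tsum fun k => aemeasurable_ofReal_norm_sq (hz k) _

lemma lintegral_sobSq {T : ℝ} {z : ℝ → (Fin 2 → ℤ) → ℂ}
    (hz : ∀ k, AEStronglyMeasurable (fun t => z t k) (timeMeasure T)) (s : ℝ) {t : ℝ}
    (ht : t ∈ Icc 0 T) :
    ∫⁻ r in Icc 0 t, sobSq s (z r)
      = ∑' k, ENNReal.ofReal (jb k ^ s) * ∫⁻ r in Icc 0 t, ENNReal.ofReal (‖z r k‖ ^ 2) := by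
  have hm : ∀ k, ∀ c : ℝ, AEMeasurable (fun r => ENNReal.ofReal (c * ‖z r k‖ ^ 2))
      (volume.restrict (Icc 0 t)) := fun k c =>
    (aemeasurable_ofReal_norm_sq (hz k) c).mono_measure
      (Measure.restrict_mono (Icc_subset_Icc_right ht.2) le_rfl)
  simp only [sobSq]
  rw [lintegral_tsum fun k => hm k _]
  refine tsum_congr fun k => ?_
  have h1 := hm k 1
  simp only [one_mul] at h1
  rw [← lintegral_const_mul'' _ h1]
  refine lintegral_congr fun r => ?_
  rw [ENNReal.ofReal_mul (by have := jb_pos k; positivity)]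

/-- The parabolic energy estimate in `H^s` for `z' = -(a z + f)`, where the rates satisfy
`a(k) ≥ c (1 + |k|²)^r - C`. -/
lemma energy_sobSq {T c C r : ℝ} (hC : 0 ≤ C) (hc : 0 < c) {a : (Fin 2 → ℤ) → ℝ}
    (ha : ∀ k, c * jb k ^ r - C ≤ a k) {z f : ℝ → (Fin 2 → ℤ) → ℂ}
    (h : ∀ k, ModeSol T (a k) (fun t => z t k) (fun t => f t k)) (s : ℝ) {t : ℝ}
    (ht : t ∈ Icc 0 T) :
    sobSq s (z t) + ENNReal.ofReal c * ∫⁻ τ in Icc 0 t, sobSq (s + r) (z τ)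
      ≤ ENNReal.ofReal (Real.exp (2 * C * T)) * (sobSq s (z 0) +
        ENNReal.ofReal c⁻¹ * ∫⁻ τ in Icc 0 t, sobSq (s - r) (f τ)) := by
  have hzm : ∀ k, AEStronglyMeasurable (fun t => z t k) (timeMeasure T) := fun k =>
    (h k).cont.aestronglyMeasurable measurableSet_Icc
  have hfm : ∀ k, AEStronglyMeasurable (fun t => f t k) (timeMeasure T) := fun k =>
    (h k).integrable.aestronglyMeasurable
  rw [lintegral_sobSq hzm _ ht, lintegral_sobSq hfm _ ht, sobSq, sobSq, ← ENNReal.tsum_mul_left,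
    ← ENNReal.tsum_mul_left, ← ENNReal.tsum_add, ← ENNReal.tsum_add, ← ENNReal.tsum_mul_left]
  refine ENNReal.tsum_le_tsum fun k => ?_
  have hj := jb_pos k
  have h1 := (h k).energy hC hc (Real.rpow_pos_of_pos hj r) (ha k) ht
  have h2 := mul_le_mul_right h1 (ENNReal.ofReal (jb k ^ s))
  have e1 : jb k ^ (s + r) = jb k ^ s * jb k ^ r := Real.rpow_add hj _ _
  have e2 : jb k ^ (s - r) = jb k ^ s * (jb k ^ r)⁻¹ := by
    rw [sub_eq_add_neg, Real.rpow_add hj, Real.rpow_neg hj.le]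
  have hs : 0 ≤ jb k ^ s := by positivity
  have hr : 0 ≤ jb k ^ r := by positivity
  rw [e1, e2, ENNReal.ofReal_mul hs, ENNReal.ofReal_mul hs, ENNReal.ofReal_mul hs,
    ENNReal.ofReal_mul hs]
  rw [mul_inv, ENNReal.ofReal_mul hc.le, ENNReal.ofReal_mul (inv_nonneg.mpr hc.le)] at h2
  convert! h2 using 1 <;> ring

/-! ### The transport nonlinearity -/

/-- The advection term `θ(u₀) ∂₀f + u₁ ∂₁f`, the components and the variables being numbered from `0`.
For `θ` the identity this is `(u·∇) f`; otherwise `θ` cuts off the first component of the velocity. -/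
def adv (θ : ℝ → ℝ) (u : Fin 2 → L2) (f : L2) (x : Torus) : ℝ :=
  θ (u 0 x) * wpartial 0 f x + u 1 x * wpartial 1 f x

/-- The squared `H^s` norm of a pair of functions. -/
def pairSq (s : ℝ) (u : Fin 2 → L2) : ℝ≥0∞ := ∑ i : Fin 2, sobSq s (fcoeff (u i))

lemma sobSq_le_pairSq (s : ℝ) (u : Fin 2 → L2) (i : Fin 2) : sobSq s (fcoeff (u i)) ≤ pairSq s u :=
  Finset.single_le_sum (f := fun i => sobSq s (fcoeff (u i))) (fun _ _ => zero_le)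
    (Finset.mem_univ i)

lemma pairSq_mono {s t : ℝ} (h : s ≤ t) (u : Fin 2 → L2) : pairSq s u ≤ pairSq t u :=
  Finset.sum_le_sum fun _ _ => sobSq_mono h _

lemma sobSq_add_le (s : ℝ) (c d : (Fin 2 → ℤ) → ℂ) :
    sobSq s (fun k => c k + d k) ≤ 2 * (sobSq s c + sobSq s d) := by
  rw [sobSq, sobSq, sobSq, ← ENNReal.tsum_add, ← ENNReal.tsum_mul_left]
  refine ENNReal.tsum_le_tsum fun k => ?_
  have hj := jb_pos k
  rw [← ENNReal.ofReal_add (by positivity) (by positivity),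
    show (2 : ℝ≥0∞) = ENNReal.ofReal 2 by simp, ← ENNReal.ofReal_mul (by norm_num)]
  refine ENNReal.ofReal_le_ofReal ?_
  rw [← mul_add, mul_left_comm]
  refine mul_le_mul_of_nonneg_left ?_ (by positivity)
  have := norm_add_le (c k) (d k)
  nlinarith [sq_nonneg (‖c k‖ - ‖d k‖), norm_nonneg (c k + d k)]

lemma sobSq_neg (s : ℝ) (c : (Fin 2 → ℤ) → ℂ) : sobSq s (fun k => -c k) = sobSq s c := by
  simp [sobSq]

lemma sobSq_sub_le (s : ℝ) (c d : (Fin 2 → ℤ) → ℂ) :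
    sobSq s (fun k => c k - d k) ≤ 2 * (sobSq s c + sobSq s d) := by
  have h := sobSq_add_le s c (fun k => -d k)
  rw [sobSq_neg] at h
  simpa only [sub_eq_add_neg] using h

lemma sobSq_zero_fcoeff_eq_lintegral {F : Torus → ℝ} (hF : MemLp F 2 volume) :
    sobSq 0 (fcoeff F) = ENNReal.ofReal ((2 * Real.pi) ^ 2)⁻¹ * ∫⁻ x, ENNReal.ofReal (F x ^ 2) := by
  have h1 : fcoeff F = fcoeff (hF.toLp F) := funext fun k => (fcoeff_toLp hF k).symm
  have h2 : ‖hF.toLp F‖ ^ 2 = ∫ x, F x ^ 2 := by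
    rw [L2.norm_sq]
    refine integral_congr_ae ?_
    filter_upwards [hF.coeFn_toLp] with x hx
    rw [hx, sq]
  rw [h1, sobSq_zero_fcoeff, ENNReal.ofReal_mul (by positivity), h2,
    ofReal_integral_eq_lintegral_ofReal hF.integrable_sq
      (Filter.Eventually.of_forall fun x => sq_nonneg _)]

/-- Multiplication by a bounded function. -/
lemma memLp_bdd_mul {b : Torus → ℝ} {g : L2} {B : ℝ} (hb : AEStronglyMeasurable b volume)
    (hB : ∀ᵐ x, b x ^ 2 ≤ B) : MemLp (fun x => b x * g x) 2 volume := by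
  refine (Lp.memLp g).of_le_mul (c := Real.sqrt B) (hb.mul (Lp.memLp g).1) ?_
  filter_upwards [hB] with x hx
  rw [norm_mul]
  gcongr
  exact Real.abs_le_sqrt hx

lemma sobSq_bdd_mul_le {b : Torus → ℝ} {g : L2} {B : ℝ} (hb : AEStronglyMeasurable b volume)
    (hB : ∀ᵐ x, b x ^ 2 ≤ B) :
    sobSq 0 (fcoeff fun x => b x * g x) ≤ ENNReal.ofReal B * sobSq 0 (fcoeff g) := by
  rw [sobSq_zero_fcoeff_eq_lintegral (memLp_bdd_mul hb hB),
    sobSq_zero_fcoeff_eq_lintegral (Lp.memLp g), mul_left_comm]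
  gcongr
  rw [← lintegral_const_mul' _ _ ENNReal.ofReal_ne_top]
  refine lintegral_mono_ae ?_
  filter_upwards [hB] with x hx
  have hB0 : 0 ≤ B := (sq_nonneg _).trans hx
  rw [← ENNReal.ofReal_mul hB0, mul_pow]
  exact ENNReal.ofReal_le_ofReal (mul_le_mul_of_nonneg_right hx (sq_nonneg _))

lemma sobSq_zero_wpartial_le {f : L2} (h : sobSq 1 (fcoeff f) ≠ ⊤) (j : Fin 2) :
    sobSq 0 (fcoeff (wpartial j f)) ≤ sobSq 1 (fcoeff f) := by
  refine ENNReal.tsum_le_tsum fun k => ENNReal.ofReal_le_ofReal ?_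
  rw [fcoeff_wpartial h]
  simp only [Real.rpow_zero, one_mul, Real.rpow_one, norm_mul, Complex.norm_I, mul_pow]
  gcongr
  simpa using sq_le_jb k j

section adv

variable {θ : ℝ → ℝ}

lemma abs_theta_le (hθ : LipschitzWith 1 θ) (h0 : θ 0 = 0) (s : ℝ) : |θ s| ≤ |s| := by
  simpa [h0] using hθ.dist_le_mul s 0

lemma theta_sq_le (hθ : LipschitzWith 1 θ) (h0 : θ 0 = 0) (s : ℝ) : θ s ^ 2 ≤ s ^ 2 :=
  sq_le_sq.mpr (abs_theta_le hθ h0 s)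

lemma aesm_theta (hθ : LipschitzWith 1 θ) (f : L2) :
    AEStronglyMeasurable (fun x => θ (f x)) volume :=
  hθ.continuous.comp_aestronglyMeasurable (Lp.aestronglyMeasurable f)

lemma memLp_adv (hθ : LipschitzWith 1 θ) {u : Fin 2 → L2} (f : L2) {A B : ℝ}
    (hA : ∀ᵐ x, θ (u 0 x) ^ 2 ≤ A) (hB : ∀ᵐ x, u 1 x ^ 2 ≤ B) : MemLp (adv θ u f) 2 volume :=
  (memLp_bdd_mul (aesm_theta hθ _) hA).add (memLp_bdd_mul (Lp.aestronglyMeasurable _) hB)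

lemma sobSq_adv_le (hθ : LipschitzWith 1 θ) {u : Fin 2 → L2} {f : L2} {A B : ℝ}
    (hA : ∀ᵐ x, θ (u 0 x) ^ 2 ≤ A) (hB : ∀ᵐ x, u 1 x ^ 2 ≤ B) (hf : sobSq 1 (fcoeff f) ≠ ⊤) :
    sobSq 0 (fcoeff (adv θ u f))
      ≤ 2 * (ENNReal.ofReal A + ENNReal.ofReal B) * sobSq 1 (fcoeff f) := by
  have h1 : fcoeff (adv θ u f) = fun k => fcoeff (fun x => θ (u 0 x) * wpartial 0 f x) k
      + fcoeff (fun x => u 1 x * wpartial 1 f x) k := funext fun k =>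
    fcoeff_add ((memLp_bdd_mul (aesm_theta hθ _) hA).integrable (by norm_num))
      ((memLp_bdd_mul (Lp.aestronglyMeasurable _) hB).integrable (by norm_num)) k
  rw [h1, mul_assoc, add_mul]
  refine (sobSq_add_le _ _ _).trans ?_
  gcongr
  · exact (sobSq_bdd_mul_le (aesm_theta hθ _) hA).trans
      (by gcongr; exact sobSq_zero_wpartial_le hf 0)
  · exact (sobSq_bdd_mul_le (Lp.aestronglyMeasurable _) hB).trans
      (by gcongr; exact sobSq_zero_wpartial_le hf 1)

lemma wpartial_sub {f g : L2} (hf : sobSq 1 (fcoeff f) ≠ ⊤) (hg : sobSq 1 (fcoeff g) ≠ ⊤)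
    (j : Fin 2) : wpartial j (f - g) = wpartial j f - wpartial j g := by
  refine wpartial_eq (isWeakPartial_iff.mpr fun k => ?_)
  rw [fcoeff_sub, fcoeff_sub, fcoeff_wpartial hf, fcoeff_wpartial hg]
  ring

lemma sobSq_fcoeff_sub_ne_top {s : ℝ} {f g : L2} (hf : sobSq s (fcoeff f) ≠ ⊤)
    (hg : sobSq s (fcoeff g) ≠ ⊤) : sobSq s (fcoeff (f - g : L2)) ≠ ⊤ := by
  have h : fcoeff (f - g : L2) = fun k => fcoeff f k - fcoeff g k := funext (fcoeff_sub f g)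
  rw [h]
  exact ne_top_of_le_ne_top (ENNReal.mul_ne_top (by simp) (ENNReal.add_ne_top.mpr ⟨hf, hg⟩))
    (sobSq_sub_le s _ _)

lemma ae_sq_le_toReal_mul {f : L2} (h : sobSq (5 / 4) (fcoeff f) ≠ ⊤) :
    ∀ᵐ x, f x ^ 2 ≤ (ENNReal.ofReal embC * sobSq (5 / 4) (fcoeff f)).toReal := by
  filter_upwards [ae_sq_le_sobSq h] with x hx
  rwa [ENNReal.toReal_mul, ENNReal.toReal_ofReal embC_nonneg]

/-- The difference of two advection terms, estimated by Hölder's inequality and the embedding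
`H^{5/4} ⊆ L^∞`. -/
lemma sobSq_adv_sub_le (hθ : LipschitzWith 1 θ) (h0 : θ 0 = 0) {u v : Fin 2 → L2}
    (hu : pairSq 2 u ≠ ⊤) (hv : pairSq 2 v ≠ ⊤) (i : Fin 2) :
    sobSq 0 (fun k => fcoeff (adv θ u (u i)) k - fcoeff (adv θ v (v i)) k)
      ≤ 4 * ENNReal.ofReal embC * (pairSq (5 / 4) (u - v) * pairSq 1 u
        + pairSq (5 / 4) v * pairSq 1 (u - v)) := by
  have fin : ∀ {u : Fin 2 → L2}, pairSq 2 u ≠ ⊤ → ∀ s ≤ (2 : ℝ), ∀ i, sobSq s (fcoeff (u i)) ≠ ⊤ :=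
    fun h s hs i => ne_top_of_le_ne_top h ((sobSq_le_pairSq s _ i).trans (pairSq_mono hs _))
  set w : Fin 2 → L2 := u - v with hw
  have hwf : ∀ s ≤ (2 : ℝ), ∀ i, sobSq s (fcoeff (w i)) ≠ ⊤ := fun s hs i =>
    sobSq_fcoeff_sub_ne_top (fin hu s hs i) (fin hv s hs i)
  have hwx : ∀ i, ∀ᵐ x, w i x = u i x - v i x := fun i => Lp.coeFn_sub (u i) (v i)
  have hu1 := fin hu 1 (by norm_num) i
  have hv1 := fin hv 1 (by norm_num) i
  have hw1 := hwf 1 (by norm_num) i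
  have hub : ∀ j, ∀ᵐ x, u j x ^ 2 ≤ _ := fun j => ae_sq_le_toReal_mul (fin hu (5 / 4) (by norm_num) j)
  have hvb : ∀ j, ∀ᵐ x, v j x ^ 2 ≤ _ := fun j => ae_sq_le_toReal_mul (fin hv (5 / 4) (by norm_num) j)
  have hwb : ∀ j, ∀ᵐ x, w j x ^ 2 ≤ _ := fun j => ae_sq_le_toReal_mul (hwf (5 / 4) (by norm_num) j)
  have htop : ∀ {f : L2}, sobSq (5 / 4) (fcoeff f) ≠ ⊤ →
      ENNReal.ofReal (ENNReal.ofReal embC * sobSq (5 / 4) (fcoeff f)).toReal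
        = ENNReal.ofReal embC * sobSq (5 / 4) (fcoeff f) := fun h =>
    ENNReal.ofReal_toReal (ENNReal.mul_ne_top ENNReal.ofReal_ne_top h)
  have m1 : AEStronglyMeasurable (fun x => θ (u 0 x) - θ (v 0 x)) volume :=
    (aesm_theta hθ _).sub (aesm_theta hθ _)
  have b1 : ∀ᵐ x, (θ (u 0 x) - θ (v 0 x)) ^ 2
      ≤ (ENNReal.ofReal embC * sobSq (5 / 4) (fcoeff (w 0))).toReal := by
    filter_upwards [hwb 0, hwx 0] with x hx hx2
    refine le_trans ?_ hx
    rw [hx2]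
    refine sq_le_sq.mpr ?_
    simpa [Real.dist_eq] using hθ.dist_le_mul (u 0 x) (v 0 x)
  have b3 : ∀ᵐ x, θ (v 0 x) ^ 2
      ≤ (ENNReal.ofReal embC * sobSq (5 / 4) (fcoeff (v 0))).toReal := by
    filter_upwards [hvb 0] with x hx
    exact (theta_sq_le hθ h0 _).trans hx
  have M1 := memLp_bdd_mul (g := wpartial 0 (u i)) m1 b1
  have M2 := memLp_bdd_mul (g := wpartial 1 (u i)) (Lp.aestronglyMeasurable (w 1)) (hwb 1)
  have M3 := memLp_bdd_mul (g := wpartial 0 (w i)) (aesm_theta hθ (v 0)) b3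
  have M4 := memLp_bdd_mul (g := wpartial 1 (w i)) (Lp.aestronglyMeasurable (v 1)) (hvb 1)
  have hadvu : MemLp (adv θ u (u i)) 2 volume := memLp_adv hθ _ (by
    filter_upwards [hub 0] with x hx
    exact (theta_sq_le hθ h0 _).trans hx) (hub 1)
  have hadvv : MemLp (adv θ v (v i)) 2 volume := memLp_adv hθ _ b3 (hvb 1)
  have key : ∀ k, fcoeff (adv θ u (u i)) k - fcoeff (adv θ v (v i)) k
      = (fcoeff (fun x => (θ (u 0 x) - θ (v 0 x)) * wpartial 0 (u i) x) k
        + fcoeff (fun x => w 1 x * wpartial 1 (u i) x) k)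
        + (fcoeff (fun x => θ (v 0 x) * wpartial 0 (w i) x) k
        + fcoeff (fun x => v 1 x * wpartial 1 (w i) x) k) := by
    intro k
    have i1 := M1.integrable (by norm_num : (1 : ℝ≥0∞) ≤ 2)
    have i2 := M2.integrable (by norm_num : (1 : ℝ≥0∞) ≤ 2)
    have i3 := M3.integrable (by norm_num : (1 : ℝ≥0∞) ≤ 2)
    have i4 := M4.integrable (by norm_num : (1 : ℝ≥0∞) ≤ 2)
    have hadd : ∀ {f g : Torus → ℝ}, Integrable f → Integrable g →
        fcoeff f k + fcoeff g k = fcoeff (f + g) k := fun hf hg => (fcoeff_add hf hg k).symm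
    rw [sub_eq_iff_eq_add, hadd i1 i2, hadd i3 i4, hadd (i1.add i2) (i3.add i4),
      hadd ((i1.add i2).add (i3.add i4)) (hadvv.integrable (by norm_num))]
    refine fcoeff_congr ?_ k
    have hd : ∀ j, ∀ᵐ x, wpartial j (w i) x = wpartial j (u i) x - wpartial j (v i) x := fun j => by
      have : w i = u i - v i := rfl
      rw [this, wpartial_sub hu1 hv1]
      exact Lp.coeFn_sub _ _
    filter_upwards [hd 0, hd 1, hwx 1] with x h1 h2 h3
    simp only [h1, h2, h3, adv, Pi.add_apply]
    ring
  have S1 := sobSq_bdd_mul_le (g := wpartial 0 (u i)) m1 b1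
  have S2 := sobSq_bdd_mul_le (g := wpartial 1 (u i)) (Lp.aestronglyMeasurable (w 1)) (hwb 1)
  have S3 := sobSq_bdd_mul_le (g := wpartial 0 (w i)) (aesm_theta hθ (v 0)) b3
  have S4 := sobSq_bdd_mul_le (g := wpartial 1 (w i)) (Lp.aestronglyMeasurable (v 1)) (hvb 1)
  rw [htop (hwf _ (by norm_num) _)] at S1 S2
  rw [htop (fin hv _ (by norm_num) _)] at S3 S4
  simp only [key]
  have e4 : (4 : ℝ≥0∞) = 2 * 2 := by norm_num
  have p1 : ∀ s, pairSq s w = sobSq s (fcoeff (w 0)) + sobSq s (fcoeff (w 1)) := fun s => by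
    simp [pairSq]
  have p2 : pairSq (5 / 4) v = sobSq (5 / 4) (fcoeff (v 0)) + sobSq (5 / 4) (fcoeff (v 1)) := by
    simp [pairSq]
  calc _ ≤ 2 * (2 * (_ + _) + 2 * (_ + _)) := (sobSq_add_le _ _ _).trans (by
          gcongr 2 * (?_ + ?_)
          · exact sobSq_add_le _ _ _
          · exact sobSq_add_le _ _ _)
    _ ≤ 2 * (2 * (ENNReal.ofReal embC * sobSq (5 / 4) (fcoeff (w 0)) * pairSq 1 u
          + ENNReal.ofReal embC * sobSq (5 / 4) (fcoeff (w 1)) * pairSq 1 u)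
        + 2 * (ENNReal.ofReal embC * sobSq (5 / 4) (fcoeff (v 0)) * pairSq 1 w
          + ENNReal.ofReal embC * sobSq (5 / 4) (fcoeff (v 1)) * pairSq 1 w)) := by
        gcongr
        · exact S1.trans (by gcongr; exact (sobSq_zero_wpartial_le hu1 0).trans (sobSq_le_pairSq 1 u i))
        · exact S2.trans (by gcongr; exact (sobSq_zero_wpartial_le hu1 1).trans (sobSq_le_pairSq 1 u i))
        · exact S3.trans (by gcongr; exact (sobSq_zero_wpartial_le hw1 0).trans (sobSq_le_pairSq 1 w i))
        · exact S4.trans (by gcongr; exact (sobSq_zero_wpartial_le hw1 1).trans (sobSq_le_pairSq 1 w i))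
    _ = _ := by rw [p1 (5 / 4), p2, e4]; ring

end adv

/-! ### Interpolation -/

lemma sobSq_le_of_forall {s a b α β : ℝ} (hα : 0 ≤ α) (hβ : 0 ≤ β)
    (h : ∀ x : ℝ, 1 ≤ x → x ^ s ≤ α * x ^ a + β * x ^ b) (c : (Fin 2 → ℤ) → ℂ) :
    sobSq s c ≤ ENNReal.ofReal α * sobSq a c + ENNReal.ofReal β * sobSq b c := by
  rw [sobSq, sobSq, sobSq, ← ENNReal.tsum_mul_left, ← ENNReal.tsum_mul_left, ← ENNReal.tsum_add]
  refine ENNReal.tsum_le_tsum fun k => ?_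
  have hj := jb_pos k
  rw [← ENNReal.ofReal_mul hα, ← ENNReal.ofReal_mul hβ,
    ← ENNReal.ofReal_add (by positivity) (by positivity)]
  refine ENNReal.ofReal_le_ofReal ?_
  have := mul_le_mul_of_nonneg_right (h _ (one_le_jb k)) (sq_nonneg ‖c k‖)
  linarith

lemma pairSq_le_of_forall {s a b α β : ℝ} (hα : 0 ≤ α) (hβ : 0 ≤ β)
    (h : ∀ x : ℝ, 1 ≤ x → x ^ s ≤ α * x ^ a + β * x ^ b) (u : Fin 2 → L2) :
    pairSq s u ≤ ENNReal.ofReal α * pairSq a u + ENNReal.ofReal β * pairSq b u := by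
  simp only [pairSq, Finset.mul_sum, ← Finset.sum_add_distrib]
  exact Finset.sum_le_sum fun i _ => sobSq_le_of_forall hα hβ h _

/-- Interpolation of `H^{5/4}` between `H^{1/2}` and `H^{3/2}`, for a single frequency with
`x = 1 + |k|²`. -/
lemma interp_five_fourths {δ : ℝ} (hδ : 0 < δ) (x : ℝ) (hx : 1 ≤ x) :
    x ^ (5 / 4 : ℝ) ≤ δ * x ^ (3 / 2 : ℝ) + δ⁻¹ ^ 3 * x ^ (1 / 2 : ℝ) := by
  have hx0 : 0 ≤ x := by linarith
  set y := x ^ (1 / 4 : ℝ) with hy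
  have hy0 : 0 < y := Real.rpow_pos_of_pos (by linarith) _
  have e : ∀ n : ℕ, x ^ ((n : ℝ) / 4) = y ^ n := fun n => by
    rw [hy, ← Real.rpow_natCast, ← Real.rpow_mul hx0]
    congr 1
    ring
  have e5 := e 5
  have e6 := e 6
  have e2 := e 2
  norm_num at e5 e6 e2
  rw [e5, e6, show (1 / 2 : ℝ) = 1 / 2 from rfl, e2]
  have key : y ^ 3 ≤ δ * y ^ 4 + δ⁻¹ ^ 3 := by
    rcases le_total δ⁻¹ y with h | h
    · have : 1 ≤ δ * y := by
        have := mul_le_mul_of_nonneg_left h hδ.le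
        rwa [mul_inv_cancel₀ hδ.ne'] at this
      have h3 : 0 < y ^ 3 := by positivity
      have h4 : 0 < δ⁻¹ ^ 3 := by positivity
      nlinarith
    · have h3 : y ^ 3 ≤ δ⁻¹ ^ 3 := pow_le_pow_left₀ hy0.le h 3
      have h4 : 0 < δ * y ^ 4 := by positivity
      linarith
  have h2 : 0 < y ^ 2 := by positivity
  nlinarith

/-- Interpolation of `H^1` between `H^{1/2}` and `H^{3/2}`, for a single frequency with
`x = 1 + |k|²`. -/
lemma interp_one {δ b : ℝ} (hδ : 0 < δ) (x : ℝ) (hx : 1 ≤ x) :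
    b * x ^ (1 : ℝ) ≤ δ * x ^ (3 / 2 : ℝ) + b ^ 2 * δ⁻¹ * x ^ (1 / 2 : ℝ) := by
  have hx0 : 0 ≤ x := by linarith
  set y := x ^ (1 / 2 : ℝ) with hy
  have hy0 : 0 < y := Real.rpow_pos_of_pos (by linarith) _
  have e : ∀ n : ℕ, x ^ ((n : ℝ) / 2) = y ^ n := fun n => by
    rw [hy, ← Real.rpow_natCast, ← Real.rpow_mul hx0]
    congr 1
    ring
  have e2 := e 2
  have e3 := e 3
  norm_num at e2 e3
  rw [e3, Real.rpow_one, e2]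
  have h1 : 0 ≤ δ⁻¹ * (δ * y - b) ^ 2 := by positivity
  have h2 : δ⁻¹ * (δ * y - b) ^ 2 = δ * y ^ 2 - 2 * (b * y) + b ^ 2 * δ⁻¹ := by
    field_simp
    ring
  have h3 : 0 ≤ δ * y ^ 2 + b ^ 2 * δ⁻¹ := by positivity
  have h4 : b * y ≤ δ * y ^ 2 + b ^ 2 * δ⁻¹ := by linarith
  nlinarith

/-- The interpolation inequality `‖c‖_{3/2}² ≤ ‖c‖₁ ‖c‖₂`, squared. -/
lemma sobSq_three_halves_sq_le (c : (Fin 2 → ℤ) → ℂ) :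
    sobSq (3 / 2) c ^ 2 ≤ sobSq 1 c * sobSq 2 c := by
  have h := ENNReal.lintegral_mul_le_Lp_mul_Lq (p := 2) (q := 2)
    (Measure.count : Measure (Fin 2 → ℤ)) Real.HolderConjugate.two_two
    (f := fun k => ENNReal.ofReal (jb k ^ (1 / 2 : ℝ) * ‖c k‖))
    (g := fun k => ENNReal.ofReal (jb k * ‖c k‖))
    (measurable_of_countable _).aemeasurable (measurable_of_countable _).aemeasurable
  simp only [Pi.mul_apply, lintegral_count] at h
  have e1 : ∀ k, ENNReal.ofReal (jb k ^ (1 / 2 : ℝ) * ‖c k‖) * ENNReal.ofReal (jb k * ‖c k‖)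
      = ENNReal.ofReal (jb k ^ (3 / 2 : ℝ) * ‖c k‖ ^ 2) := fun k => by
    have := jb_pos k
    rw [← ENNReal.ofReal_mul (by positivity)]
    congr 1
    rw [show (3 / 2 : ℝ) = 1 / 2 + 1 by norm_num, Real.rpow_add this, Real.rpow_one]
    ring
  have e2 : ∀ k, ENNReal.ofReal (jb k ^ (1 / 2 : ℝ) * ‖c k‖) ^ (2 : ℝ)
      = ENNReal.ofReal (jb k ^ (1 : ℝ) * ‖c k‖ ^ 2) := fun k => by
    have := jb_pos k
    rw [ENNReal.rpow_two, ← ENNReal.ofReal_pow (by positivity), mul_pow, ← Real.rpow_natCast,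
      ← Real.rpow_mul this.le]
    norm_num
  have e3 : ∀ k, ENNReal.ofReal (jb k * ‖c k‖) ^ (2 : ℝ)
      = ENNReal.ofReal (jb k ^ (2 : ℝ) * ‖c k‖ ^ 2) := fun k => by
    have := jb_pos k
    rw [ENNReal.rpow_two, ← ENNReal.ofReal_pow (by positivity), mul_pow, Real.rpow_two]
  simp only [e1, e2, e3] at h
  have h2 := pow_le_pow_left' h 2
  have e4 : ∀ a : ℝ≥0∞, (a ^ (1 / 2 : ℝ)) ^ 2 = a := fun a => by
    rw [← ENNReal.rpow_two, ← ENNReal.rpow_mul]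
    norm_num
  rw [mul_pow, e4, e4] at h2
  exact h2

/-- A function in `L^∞H¹ ∩ L²H²` has `‖u‖_{5/4}⁴` integrable in time: this is the coefficient that the
stability estimate hands to Grönwall's inequality. -/
lemma pairSq_five_fourths_sq_le (u : Fin 2 → L2) :
    pairSq (5 / 4) u ^ 2 ≤ 2 * (pairSq 1 u * pairSq 2 u) := by
  have h1 : ∀ i, sobSq (5 / 4) (fcoeff (u i)) ^ 2
      ≤ sobSq 1 (fcoeff (u i)) * sobSq 2 (fcoeff (u i)) := fun i =>
    (pow_le_pow_left' (sobSq_mono (by norm_num) _) 2).trans (sobSq_three_halves_sq_le _)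
  have h2 : ∀ a b : ℝ≥0∞, (a + b) ^ 2 ≤ 2 * (a ^ 2 + b ^ 2) := fun a b => by
    have := ENNReal.rpow_add_le_mul_rpow_add_rpow a b (p := 2) (by norm_num)
    norm_num at this
    exact this
  rw [pairSq, Fin.sum_univ_two]
  refine (h2 _ _).trans ?_
  gcongr
  refine (add_le_add (h1 0) (h1 1)).trans ?_
  rw [pairSq, pairSq, Fin.sum_univ_two, Fin.sum_univ_two, add_mul, mul_add, mul_add]
  exact add_le_add le_self_add le_add_self

/-- The difference of two advection terms in the form used in the stability estimate: the top order
norm comes with a small constant. -/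
lemma exists_adv_sub_le (K : ℝ) {ε : ℝ} (hε : 0 < ε) :
    ∃ C : ℝ, 0 ≤ C ∧ ∀ θ : ℝ → ℝ, LipschitzWith 1 θ → θ 0 = 0 → ∀ u v : Fin 2 → L2,
      pairSq 1 u ≤ ENNReal.ofReal K → pairSq 1 v ≤ ENNReal.ofReal K → pairSq 2 u ≠ ⊤ →
      pairSq 2 v ≠ ⊤ → ∀ i,
      sobSq 0 (fun k => fcoeff (adv θ u (u i)) k - fcoeff (adv θ v (v i)) k)
        ≤ ENNReal.ofReal ε * pairSq (3 / 2) (u - v)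
          + ENNReal.ofReal C * (1 + pairSq 2 v) * pairSq (1 / 2) (u - v) := by
  set E := embC with hE
  have hE0 : 0 ≤ E := embC_nonneg
  set K' := max K 0 with hK'
  have hK0 : 0 ≤ K' := le_max_right _ _
  -- With this `δ` the top order term, which occurs with the factor `4 E (K' + 1) δ`, is at most `ε`.
  set δ : ℝ := ε / (4 * E * (K' + 1) + 1) with hδ
  have hδ0 : 0 < δ := by positivity
  refine ⟨4 * E * (K' * δ⁻¹ ^ 3 + 2 * K' * δ⁻¹), by positivity,
    fun θ hθ h0 u v hu hv hu2 hv2 i => ?_⟩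
  have hKK : ENNReal.ofReal K ≤ ENNReal.ofReal K' := ENNReal.ofReal_le_ofReal (le_max_left _ _)
  have h54 : pairSq (5 / 4) v ≠ ⊤ := ne_top_of_le_ne_top hv2 (pairSq_mono (by norm_num) _)
  set b := (pairSq (5 / 4) v).toReal with hb
  have hbe : ENNReal.ofReal b = pairSq (5 / 4) v := ENNReal.ofReal_toReal h54
  set w := u - v
  have I1 := pairSq_le_of_forall hδ0.le (by positivity) (interp_five_fourths hδ0) w
  have I2 : pairSq (5 / 4) v * pairSq 1 w ≤ ENNReal.ofReal δ * pairSq (3 / 2) w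
      + ENNReal.ofReal (b ^ 2 * δ⁻¹) * pairSq (1 / 2) w := by
    rw [← hbe]
    have hb0 : 0 ≤ b := ENNReal.toReal_nonneg
    -- `interp_one` with `b = ‖v‖²_{5/4}`, whose square is integrable in time.
    rcases eq_or_lt_of_le hb0 with h | h
    · rw [← h]; simp
    · have h3 := pairSq_le_of_forall (s := 1) (a := 3 / 2) (b := 1 / 2) (α := b⁻¹ * δ)
        (β := b⁻¹ * (b ^ 2 * δ⁻¹)) (by positivity) (by positivity) (fun x hx => by
          have h4 := mul_le_mul_of_nonneg_left (interp_one (b := b) hδ0 x hx) (inv_nonneg.mpr h.le)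
          rw [← mul_assoc, inv_mul_cancel₀ h.ne', one_mul] at h4
          linarith) w
      refine (mul_le_mul_right h3 (ENNReal.ofReal b)).trans_eq ?_
      rw [mul_add, ← mul_assoc, ← mul_assoc, ← ENNReal.ofReal_mul h.le, ← ENNReal.ofReal_mul h.le,
        mul_inv_cancel_left₀ h.ne', mul_inv_cancel_left₀ h.ne']
  have I3 : ENNReal.ofReal (b ^ 2 * δ⁻¹) ≤ ENNReal.ofReal (2 * K' * δ⁻¹) * (1 + pairSq 2 v) := by
    rw [ENNReal.ofReal_mul (by positivity), ENNReal.ofReal_pow ENNReal.toReal_nonneg, hbe,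
      ENNReal.ofReal_mul (by positivity), ENNReal.ofReal_mul (by positivity)]
    calc pairSq (5 / 4) v ^ 2 * ENNReal.ofReal δ⁻¹
        ≤ 2 * (ENNReal.ofReal K' * (1 + pairSq 2 v)) * ENNReal.ofReal δ⁻¹ := by
          gcongr
          refine (pairSq_five_fourths_sq_le v).trans ?_
          gcongr
          · exact hv.trans hKK
          · exact le_add_self
      _ = _ := by simp; ring
  refine (sobSq_adv_sub_le hθ h0 hu2 hv2 i).trans ?_
  have e4 : (4 : ℝ≥0∞) * ENNReal.ofReal E = ENNReal.ofReal (4 * E) := by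
    rw [ENNReal.ofReal_mul (by norm_num)]; simp
  rw [e4]
  calc _ ≤ ENNReal.ofReal (4 * E) * ((ENNReal.ofReal δ * pairSq (3 / 2) w
          + ENNReal.ofReal (δ⁻¹ ^ 3) * pairSq (1 / 2) w) * ENNReal.ofReal K'
        + (ENNReal.ofReal δ * pairSq (3 / 2) w
          + ENNReal.ofReal (2 * K' * δ⁻¹) * (1 + pairSq 2 v) * pairSq (1 / 2) w)) := by
        gcongr
        · exact hu.trans hKK
        · exact I2.trans (by gcongr)
    _ = ENNReal.ofReal (4 * E) * (ENNReal.ofReal δ * (ENNReal.ofReal K' + 1)) * pairSq (3 / 2) w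
        + ENNReal.ofReal (4 * E) * (ENNReal.ofReal (δ⁻¹ ^ 3) * ENNReal.ofReal K'
          + ENNReal.ofReal (2 * K' * δ⁻¹) * (1 + pairSq 2 v)) * pairSq (1 / 2) w := by ring
    _ ≤ _ := by
        refine add_le_add (mul_le_mul' ?_ le_rfl) (mul_le_mul' ?_ le_rfl)
        · rw [← ENNReal.ofReal_one, ← ENNReal.ofReal_add hK0 zero_le_one,
            ← ENNReal.ofReal_mul hδ0.le, ← ENNReal.ofReal_mul (by positivity)]
          refine ENNReal.ofReal_le_ofReal ?_
          rw [hδ]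
          have : 4 * E * (ε / (4 * E * (K' + 1) + 1) * (K' + 1))
              = ε * ((4 * E * (K' + 1)) / (4 * E * (K' + 1) + 1)) := by ring
          rw [this]
          refine mul_le_of_le_one_right hε.le ?_
          rw [div_le_one (by positivity)]
          linarith
        · rw [ENNReal.ofReal_mul (p := 4 * E) (by positivity),
            ENNReal.ofReal_add (by positivity) (by positivity), ENNReal.ofReal_mul hK0,
            mul_assoc (ENNReal.ofReal (4 * E)), add_mul]
          refine mul_le_mul' le_rfl (add_le_add ?_ le_rfl)
          rw [mul_comm (ENNReal.ofReal (δ⁻¹ ^ 3))]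
          exact le_mul_of_one_le_right' le_self_add

/-! ### The linear part of the system and the stability estimate -/

/-- The symbols `ν|k|²` of `-νΔ` and `|k|⁴ - λ|k|²` of `Δ² + λΔ`. -/
def rate (ν lam : ℝ) (i : Fin 2) (k : Fin 2 → ℤ) : ℝ :=
  if i = 0 then ν * (jb k - 1) else (jb k - 1) ^ 2 - lam * (jb k - 1)

/-- The second component is parabolic of order four: the constant absorbs the antidiffusion. -/
lemma rate_one_ge (ν lam : ℝ) (k : Fin 2 → ℤ) :
    1 / 2 * jb k ^ (2 : ℝ) - ((2 + lam) ^ 2 + 2) ≤ rate ν lam 1 k := by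
  rw [rate, if_neg (by simp), Real.rpow_two]
  have := one_le_jb k
  nlinarith [sq_nonneg (jb k - (2 + lam)), sq_nonneg (lam + 3)]

/-- Both components are parabolic of order at least two. -/
lemma exists_rate_ge {ν : ℝ} (hν : 0 < ν) (lam : ℝ) :
    ∃ c : ℝ, 0 < c ∧ ∃ C : ℝ, 0 ≤ C ∧ ∀ i k, c * jb k ^ (1 : ℝ) - C ≤ rate ν lam i k := by
  refine ⟨min ν (1 / 2), by positivity, ν + ((2 + lam) ^ 2 + 2), by positivity, fun i k => ?_⟩
  have hj := one_le_jb k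
  rw [Real.rpow_one]
  fin_cases i
  · simp only [rate, Fin.zero_eta, if_true]
    have : min ν (1 / 2) * jb k ≤ ν * jb k := by gcongr; exact min_le_left _ _
    nlinarith [sq_nonneg (2 + lam)]
  · have h := rate_one_ge ν lam k
    rw [Real.rpow_two] at h
    have : min ν (1 / 2) * jb k ≤ 1 / 2 * jb k ^ 2 := by
      calc min ν (1 / 2) * jb k ≤ 1 / 2 * jb k := by gcongr; exact min_le_right _ _
        _ ≤ 1 / 2 * jb k ^ 2 := by nlinarith
    simp only [Fin.mk_one] at *
    linarith

/-- The Fourier coefficients of the pair `u` solve `∂ₜ û = -(rate · û + f)` on `[0,T]`. -/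
def PairSol (ν lam T : ℝ) (u : ℝ → Fin 2 → L2) (f : ℝ → Fin 2 → (Fin 2 → ℤ) → ℂ) : Prop :=
  ∀ i k, ModeSol T (rate ν lam i k) (fun t => fcoeff (u t i) k) (fun t => f t i k)

lemma PairSol.sub {ν lam T : ℝ} {u v : ℝ → Fin 2 → L2} {f g : ℝ → Fin 2 → (Fin 2 → ℤ) → ℂ}
    (hu : PairSol ν lam T u f) (hv : PairSol ν lam T v g) :
    PairSol ν lam T (fun t => u t - v t) (fun t i k => f t i k - g t i k) := by
  intro i k
  have h := (hu i k).sub (hv i k)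
  simp only [← fcoeff_sub] at h
  exact h

lemma PairSol.aesm {ν lam T : ℝ} {u : ℝ → Fin 2 → L2} {f : ℝ → Fin 2 → (Fin 2 → ℤ) → ℂ}
    (hu : PairSol ν lam T u f) (i : Fin 2) (k : Fin 2 → ℤ) :
    AEStronglyMeasurable (fun t => fcoeff (u t i) k) (timeMeasure T) :=
  (hu i k).cont.aestronglyMeasurable measurableSet_Icc

lemma PairSol.aesm_forcing {ν lam T : ℝ} {u : ℝ → Fin 2 → L2} {f : ℝ → Fin 2 → (Fin 2 → ℤ) → ℂ}
    (hu : PairSol ν lam T u f) (i : Fin 2) (k : Fin 2 → ℤ) :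
    AEStronglyMeasurable (fun t => f t i k) (timeMeasure T) :=
  (hu i k).integrable.aestronglyMeasurable

lemma aemeasurable_pairSq {T : ℝ} {u : ℝ → Fin 2 → L2}
    (hu : ∀ i k, AEStronglyMeasurable (fun t => fcoeff (u t i) k) (timeMeasure T)) (s : ℝ) :
    AEMeasurable (fun t => pairSq s (u t)) (timeMeasure T) :=
  Finset.aemeasurable_fun_sum _ fun i _ => aemeasurable_sobSq (hu i) s

lemma AEMeasurable.restrict_Icc {T t : ℝ} {g : ℝ → ℝ≥0∞} (hg : AEMeasurable g (timeMeasure T))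
    (ht : t ∈ Icc 0 T) : AEMeasurable g (volume.restrict (Icc 0 t)) :=
  hg.mono_measure (Measure.restrict_mono (Icc_subset_Icc_right ht.2) le_rfl)

/-- The energy estimate in `H^s`, summed over the two components. The forcing is measured one order
below `s`, so that advection terms bounded in `L²` are admissible for every `s ≤ 1`. -/
lemma PairSol.energy {ν lam T c C : ℝ} (hC : 0 ≤ C) (hc : 0 < c)
    (ha : ∀ i k, c * jb k ^ (1 : ℝ) - C ≤ rate ν lam i k) {u : ℝ → Fin 2 → L2}
    {f : ℝ → Fin 2 → (Fin 2 → ℤ) → ℂ} (hu : PairSol ν lam T u f) (s : ℝ) {t : ℝ}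
    (ht : t ∈ Icc 0 T) :
    pairSq s (u t) + ENNReal.ofReal c * ∫⁻ τ in Icc 0 t, pairSq (s + 1) (u τ)
      ≤ ENNReal.ofReal (Real.exp (2 * C * T)) * (pairSq s (u 0) +
        ENNReal.ofReal c⁻¹ * ∫⁻ τ in Icc 0 t, ∑ i, sobSq (s - 1) (f τ i)) := by
  have h : ∀ i, _ := fun i => energy_sobSq hC hc (ha i) (hu i) s ht
  have h2 := add_le_add (h 0) (h 1)
  have m1 : ∀ i, AEMeasurable (fun τ => sobSq (s + 1) (fcoeff (u τ i)))
      (volume.restrict (Icc 0 t)) :=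
    fun i => AEMeasurable.restrict_Icc (aemeasurable_sobSq (hu.aesm i) _) ht
  have m2 : ∀ i, AEMeasurable (fun τ => sobSq (s - 1) (f τ i)) (volume.restrict (Icc 0 t)) :=
    fun i => AEMeasurable.restrict_Icc (aemeasurable_sobSq (hu.aesm_forcing i) _) ht
  simp only [pairSq, Fin.sum_univ_two]
  rw [lintegral_add_left' (m1 0), lintegral_add_left' (m2 0)]
  convert! h2 using 1 <;> ring

/-- **Stability.** Two solutions whose forcings differ by the difference of their advection terms
up to an error `ρ` stay close in `H^{1/2}`. With `ρ = 0` this gives uniqueness, with `ρ` the error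
of truncation the convergence of Galerkin approximations. In the `H^{1/2}` energy estimate the
forcing is measured in `H^{-1/2}`, hence in `L²` as well. There `(w·∇)u + (v·∇)w`, `w = u - v`, is
bounded by `‖w‖_{L^∞} ‖u‖_{H¹} + ‖v‖_{L^∞} ‖w‖_{H¹}`, and since `L^∞ ⊇ H^{5/4}`, both norms of `w` are of
lower order than the norm of `H^{3/2}` in the dissipation. -/
lemma exists_stability {ν : ℝ} (hν : 0 < ν) (lam : ℝ) {T : ℝ} (hT : 0 ≤ T) (K M : ℝ) :
    ∃ C : ℝ, ∀ θ : ℝ → ℝ, LipschitzWith 1 θ → θ 0 = 0 → ∀ u v : ℝ → Fin 2 → L2,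
      ∀ f g : ℝ → Fin 2 → (Fin 2 → ℤ) → ℂ, ∀ ρ : ℝ → ℝ≥0∞,
      PairSol ν lam T u f → PairSol ν lam T v g →
      (∀ᵐ t ∂(timeMeasure T), pairSq 1 (u t) ≤ ENNReal.ofReal K) →
      (∀ᵐ t ∂(timeMeasure T), pairSq 1 (v t) ≤ ENNReal.ofReal K) →
      ∫⁻ t in Icc 0 T, pairSq 2 (u t) ≤ ENNReal.ofReal M →
      ∫⁻ t in Icc 0 T, pairSq 2 (v t) ≤ ENNReal.ofReal M →
      (∀ᵐ t ∂(timeMeasure T), ∀ i, sobSq (-(1 / 2)) (fun k => f t i k - g t i k)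
        ≤ 2 * sobSq 0 (fun k => fcoeff (adv θ (u t) (u t i)) k - fcoeff (adv θ (v t) (v t i)) k)
          + ρ t) →
      pairSq (1 / 2) (u 0 - v 0) ≠ ⊤ → ∫⁻ t in Icc 0 T, ρ t ≠ ⊤ →
      ∀ t ∈ Icc 0 T, pairSq (1 / 2) (u t - v t)
        ≤ ENNReal.ofReal C * (pairSq (1 / 2) (u 0 - v 0) + ∫⁻ t in Icc 0 T, ρ t) := by
  obtain ⟨c, hc, C₀, hC₀, hrate⟩ := exists_rate_ge hν lam
  set E := Real.exp (2 * C₀ * T) with hE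
  have hE0 : 0 < E := Real.exp_pos _
  -- The energy estimate multiplies the forcing by `E c⁻¹`, and the two components and the factor `2` in
  -- the hypothesis contribute `4`: with this `ε` the top order term of the forcing is `c ∫ ‖w‖²_{3/2}`,
  -- which the dissipation absorbs.
  obtain ⟨C₁, hC₁, hadv⟩ := exists_adv_sub_le K (ε := c ^ 2 / (4 * E)) (by positivity)
  set A : ℝ := 4 * E * c⁻¹ * C₁ with hA
  have hA0 : 0 ≤ A := by positivity
  set B : ℝ := E * (1 + 2 * c⁻¹) with hB
  have hB0 : 0 ≤ B := by positivity
  refine ⟨B * Real.exp (A * (T + max M 0)), fun θ hθ h0 u v f g ρ hu hv huK hvK huM hvM hfg hw0 hρ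
    => ?_⟩
  set w : ℝ → Fin 2 → L2 := fun t => u t - v t with hw
  have hwsol : PairSol ν lam T w _ := hu.sub hv
  have hu2 : ∀ᵐ t ∂(timeMeasure T), pairSq 2 (u t) < ⊤ :=
    ae_lt_top' (aemeasurable_pairSq hu.aesm 2) (ne_top_of_le_ne_top ENNReal.ofReal_ne_top huM)
  have hv2 : ∀ᵐ t ∂(timeMeasure T), pairSq 2 (v t) < ⊤ :=
    ae_lt_top' (aemeasurable_pairSq hv.aesm 2) (ne_top_of_le_ne_top ENNReal.ofReal_ne_top hvM)
  have hwle : ∀ s t, pairSq s (w t) ≤ 2 * (pairSq s (u t) + pairSq s (v t)) := fun s t => by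
    have h1 : ∀ i, sobSq s (fcoeff (w t i)) ≤ 2 * (sobSq s (fcoeff (u t i))
        + sobSq s (fcoeff (v t i))) := fun i => by
      have h : fcoeff (w t i) = fun k => fcoeff (u t i) k - fcoeff (v t i) k :=
        funext (fcoeff_sub _ _)
      rw [h]
      exact sobSq_sub_le s _ _
    rw [pairSq, pairSq, pairSq, ← Finset.sum_add_distrib, Finset.mul_sum]
    exact Finset.sum_le_sum fun i _ => h1 i
  have mw : ∀ s, AEMeasurable (fun t => pairSq s (w t)) (timeMeasure T) :=
    fun s => aemeasurable_pairSq hwsol.aesm s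
  have mv : AEMeasurable (fun t => pairSq 2 (v t)) (timeMeasure T) :=
    aemeasurable_pairSq hv.aesm 2
  have hw32 : ∫⁻ t in Icc 0 T, pairSq (3 / 2) (w t) ≠ ⊤ := by
    have h1 : ∫⁻ t in Icc 0 T, pairSq (3 / 2) (w t)
        ≤ ∫⁻ t in Icc 0 T, 2 * (pairSq 2 (u t) + pairSq 2 (v t)) :=
      lintegral_mono fun t => (pairSq_mono (by norm_num) _).trans (hwle 2 t)
    refine ne_top_of_le_ne_top ?_ h1
    rw [lintegral_const_mul' _ _ (by simp), lintegral_add_right' _ mv]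
    exact ENNReal.mul_ne_top (by simp) (ENNReal.add_ne_top.mpr
      ⟨ne_top_of_le_ne_top ENNReal.ofReal_ne_top huM, ne_top_of_le_ne_top ENNReal.ofReal_ne_top hvM⟩)
  set a : ℝ → ℝ≥0∞ := fun t => ENNReal.ofReal A * (1 + pairSq 2 (v t)) with ha
  have ma : AEMeasurable a (timeMeasure T) := (mv.const_add 1).const_mul _
  have hvol : volume (Icc 0 T) = ENNReal.ofReal T := by simp
  have haint : ∫⁻ t in Icc 0 T, a t ≤ ENNReal.ofReal (A * (T + max M 0)) := by
    rw [ha, lintegral_const_mul' _ _ ENNReal.ofReal_ne_top, lintegral_add_left' aemeasurable_const,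
      lintegral_const, Measure.restrict_apply_univ, hvol, one_mul]
    rw [ENNReal.ofReal_mul hA0]
    gcongr
    rw [ENNReal.ofReal_add hT (le_max_right _ _)]
    gcongr
    exact hvM.trans (ENNReal.ofReal_le_ofReal (le_max_left _ _))
  -- The difference of the forcings costs a small multiple of the top order norm `‖w‖²_{3/2}`, and
  -- `‖w‖²_{1/2}` with a coefficient that is integrable in time.
  have hforce : ∀ᵐ t ∂(timeMeasure T), ∑ i, sobSq (1 / 2 - 1) (fun k => f t i k - g t i k)
      ≤ (ENNReal.ofReal (c ^ 2 / E) * pairSq (3 / 2) (w t)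
        + ENNReal.ofReal (4 * C₁) * (1 + pairSq 2 (v t)) * pairSq (1 / 2) (w t)) + 2 * ρ t := by
    filter_upwards [hfg, huK, hvK, hu2, hv2] with t h1 h2 h3 h4 h5
    have h6 : ∀ i, sobSq (1 / 2 - 1) (fun k => f t i k - g t i k)
        ≤ 2 * (ENNReal.ofReal (c ^ 2 / (4 * E)) * pairSq (3 / 2) (w t)
          + ENNReal.ofReal C₁ * (1 + pairSq 2 (v t)) * pairSq (1 / 2) (w t)) + ρ t := by
      intro i
      have h7 := hadv θ hθ h0 (u t) (v t) h2 h3 h4.ne h5.ne i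
      rw [show (1 / 2 - 1 : ℝ) = -(1 / 2) by norm_num]
      exact (h1 i).trans (by gcongr)
    rw [Fin.sum_univ_two]
    refine (add_le_add (h6 0) (h6 1)).trans_eq ?_
    rw [show c ^ 2 / E = 4 * (c ^ 2 / (4 * E)) by field_simp, ENNReal.ofReal_mul (by norm_num),
      ENNReal.ofReal_mul (by norm_num), show ENNReal.ofReal 4 = 4 by simp]
    ring
  have hmain : ∀ t ∈ Icc 0 T, pairSq (1 / 2) (w t)
      ≤ ENNReal.ofReal B * (pairSq (1 / 2) (w 0) + ∫⁻ t in Icc 0 T, ρ t)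
        + ∫⁻ τ in Icc 0 t, a τ * pairSq (1 / 2) (w τ) := by
    intro t ht
    have e1 := hwsol.energy hC₀ hc hrate (1 / 2) ht
    rw [show (1 / 2 + 1 : ℝ) = 3 / 2 by norm_num] at e1
    have hsub : Icc 0 t ⊆ Icc 0 T := Icc_subset_Icc_right ht.2
    have e2 : ∫⁻ τ in Icc 0 t, ∑ i, sobSq (1 / 2 - 1) (fun k => f τ i k - g τ i k)
        ≤ ENNReal.ofReal (c ^ 2 / E) * (∫⁻ τ in Icc 0 t, pairSq (3 / 2) (w τ))
          + ENNReal.ofReal (4 * C₁)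
            * (∫⁻ τ in Icc 0 t, (1 + pairSq 2 (v τ)) * pairSq (1 / 2) (w τ))
          + 2 * ∫⁻ τ in Icc 0 T, ρ τ := by
      refine (lintegral_mono_ae (ae_restrict_of_ae_restrict_of_subset hsub hforce)).trans ?_
      have m3 := AEMeasurable.restrict_Icc (mw (3 / 2)) ht
      have m4 : AEMeasurable (fun τ => (1 + pairSq 2 (v τ)) * pairSq (1 / 2) (w τ))
          (volume.restrict (Icc 0 t)) := AEMeasurable.restrict_Icc ((mv.const_add 1).mul (mw (1 / 2))) ht
      have m5 : AEMeasurable (fun τ => ENNReal.ofReal (c ^ 2 / E) * pairSq (3 / 2) (w τ)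
          + ENNReal.ofReal (4 * C₁) * ((1 + pairSq 2 (v τ)) * pairSq (1 / 2) (w τ)))
          (volume.restrict (Icc 0 t)) := (m3.const_mul _).add (m4.const_mul _)
      simp only [mul_assoc]
      rw [lintegral_add_left' m5,
        lintegral_add_left' (m3.const_mul _), lintegral_const_mul'' _ m3,
        lintegral_const_mul'' _ m4, lintegral_const_mul' _ _ (by simp)]
      gcongr
    set I := ∫⁻ τ in Icc 0 t, pairSq (3 / 2) (w τ) with hI
    have hI' : I ≠ ⊤ := ne_top_of_le_ne_top hw32 (lintegral_mono_set hsub)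
    set J := ∫⁻ τ in Icc 0 t, (1 + pairSq 2 (v τ)) * pairSq (1 / 2) (w τ) with hJ
    set R := ∫⁻ τ in Icc 0 T, ρ τ with hR
    have e3 : ∫⁻ τ in Icc 0 t, a τ * pairSq (1 / 2) (w τ) = ENNReal.ofReal A * J := by
      rw [hJ, ← lintegral_const_mul' _ _ ENNReal.ofReal_ne_top]
      simp only [ha, mul_assoc]
    rw [e3]
    have e4 : pairSq (1 / 2) (w t) + ENNReal.ofReal c * I
        ≤ (ENNReal.ofReal B * (pairSq (1 / 2) (w 0) + R) + ENNReal.ofReal A * J)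
          + ENNReal.ofReal c * I := by
      refine e1.trans ((mul_le_mul' le_rfl (add_le_add le_rfl (mul_le_mul' le_rfl e2))).trans ?_)
      have x1 : ENNReal.ofReal c = ENNReal.ofReal E * (ENNReal.ofReal c⁻¹ * ENNReal.ofReal (c ^ 2 / E)) := by
        rw [← ENNReal.ofReal_mul (by positivity), ← ENNReal.ofReal_mul (by positivity)]
        congr 1
        field_simp
      have x2 : ENNReal.ofReal A = ENNReal.ofReal E * (ENNReal.ofReal c⁻¹ * ENNReal.ofReal (4 * C₁)) := by
        rw [← ENNReal.ofReal_mul (by positivity), ← ENNReal.ofReal_mul (by positivity)]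
        congr 1
        rw [hA]; ring
      have x3 : ENNReal.ofReal B = ENNReal.ofReal E * (1 + 2 * ENNReal.ofReal c⁻¹) := by
        rw [hB, ENNReal.ofReal_mul hE0.le, ENNReal.ofReal_add zero_le_one (by positivity),
          ENNReal.ofReal_mul zero_le_two]
        simp
      calc ENNReal.ofReal E * (pairSq (1 / 2) (w 0) + ENNReal.ofReal c⁻¹ *
            (ENNReal.ofReal (c ^ 2 / E) * I + ENNReal.ofReal (4 * C₁) * J + 2 * R))
          = ENNReal.ofReal E * (pairSq (1 / 2) (w 0) + 2 * ENNReal.ofReal c⁻¹ * R)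
            + ENNReal.ofReal E * (ENNReal.ofReal c⁻¹ * ENNReal.ofReal (4 * C₁)) * J
            + ENNReal.ofReal E * (ENNReal.ofReal c⁻¹ * ENNReal.ofReal (c ^ 2 / E)) * I := by ring
        _ ≤ (ENNReal.ofReal B * (pairSq (1 / 2) (w 0) + R) + ENNReal.ofReal A * J)
            + ENNReal.ofReal c * I := by
          rw [← x1, ← x2, x3, mul_assoc (ENNReal.ofReal E) (1 + _)]
          have x4 : (1 + 2 * ENNReal.ofReal c⁻¹) * (pairSq (1 / 2) (w 0) + R)
              = (pairSq (1 / 2) (w 0) + 2 * ENNReal.ofReal c⁻¹ * R)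
                + (R + 2 * ENNReal.ofReal c⁻¹ * pairSq (1 / 2) (w 0)) := by ring
          rw [x4]
          exact add_le_add (add_le_add (mul_le_mul' le_rfl le_self_add) le_rfl) le_rfl
    -- The absorption: `I` may be cancelled as it is finite, `u` and `v` being in `L²H²`.
    exact (ENNReal.add_le_add_iff_right (ENNReal.mul_ne_top ENNReal.ofReal_ne_top hI')).mp e4
  intro t ht
  have hwb : ∀ᵐ t ∂(timeMeasure T), pairSq (1 / 2) (w t) ≤ 2 * (ENNReal.ofReal K + ENNReal.ofReal K) := by
    filter_upwards [huK, hvK] with t h1 h2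
    refine (hwle _ t).trans ?_
    gcongr
    · exact (pairSq_mono (by norm_num) _).trans h1
    · exact (pairSq_mono (by norm_num) _).trans h2
  have hfin := gronwall hT (c := ENNReal.ofReal B * (pairSq (1 / 2) (w 0) + ∫⁻ t in Icc 0 T, ρ t))
    (ENNReal.mul_ne_top ENNReal.ofReal_ne_top (ENNReal.add_ne_top.mpr ⟨hw0, hρ⟩))
    (ENNReal.mul_ne_top (by simp) (by simp)) (mw (1 / 2)) hwb ma
    (ne_top_of_le_ne_top ENNReal.ofReal_ne_top haint) hmain ht
  refine hfin.trans ?_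
  rw [ENNReal.ofReal_mul hB0, mul_assoc, mul_assoc, mul_comm (_ + _)]
  gcongr
  refine (ENNReal.toReal_mono ENNReal.ofReal_ne_top haint).trans_eq ?_
  exact ENNReal.toReal_ofReal (by positivity)

/-! ### Ordinary differential equations with a priori bounds -/

/-- `f` is Lipschitz on every ball centred at `0`. -/
def LipOnBalls {E F : Type*} [NormedAddCommGroup E] [NormedAddCommGroup F] (f : E → F) : Prop :=
  ∀ R : ℝ, ∃ L : ℝ, 0 ≤ L ∧ ∀ x y, ‖x‖ ≤ R → ‖y‖ ≤ R → ‖f x - f y‖ ≤ L * ‖x - y‖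

section LipOnBalls

variable {E F : Type*} [NormedAddCommGroup E] [NormedAddCommGroup F]

lemma LipOnBalls.exists_bound {f : E → F} (hf : LipOnBalls f) (R : ℝ) :
    ∃ B : ℝ, 0 ≤ B ∧ ∀ x, ‖x‖ ≤ R → ‖f x‖ ≤ B := by
  obtain ⟨L, hL, h⟩ := hf (max R 0)
  refine ⟨L * max R 0 + ‖f 0‖, by positivity, fun x hx => ?_⟩
  have h1 := h x 0 (hx.trans (le_max_left _ _)) (by simp)
  rw [sub_zero] at h1
  calc ‖f x‖ ≤ ‖f x - f 0‖ + ‖f 0‖ := by simpa using norm_add_le (f x - f 0) (f 0)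
    _ ≤ L * ‖x‖ + ‖f 0‖ := by gcongr
    _ ≤ _ := by gcongr; exact hx.trans (le_max_left _ _)

lemma LipOnBalls.add {f g : E → F} (hf : LipOnBalls f) (hg : LipOnBalls g) :
    LipOnBalls fun x => f x + g x := by
  intro R
  obtain ⟨L, hL, h⟩ := hf R
  obtain ⟨L', hL', h'⟩ := hg R
  refine ⟨L + L', by positivity, fun x y hx hy => ?_⟩
  rw [add_sub_add_comm, add_mul]
  exact (norm_add_le _ _).trans (add_le_add (h x y hx hy) (h' x y hx hy))

lemma LipOnBalls.sum {ι : Type*} {s : Finset ι} {f : ι → E → F} (hf : ∀ i, LipOnBalls (f i)) :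
    LipOnBalls fun x => ∑ i ∈ s, f i x := by
  classical
  induction s using Finset.induction_on with
  | empty => exact fun R => ⟨0, le_rfl, fun x y _ _ => by simp⟩
  | insert a s ha ih =>
    simp only [Finset.sum_insert ha]
    exact (hf a).add ih

lemma LipOnBalls.smul [NormedSpace ℝ F] {c : E → ℝ} {f : E → F} (hc : LipOnBalls c)
    (hf : LipOnBalls f) : LipOnBalls fun x => c x • f x := by
  intro R
  obtain ⟨L, hL, h⟩ := hc R
  obtain ⟨L', hL', h'⟩ := hf R
  obtain ⟨B, hB, hcB⟩ := hc.exists_bound R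
  obtain ⟨B', hB', hfB⟩ := hf.exists_bound R
  refine ⟨L * B' + B * L', by positivity, fun x y hx hy => ?_⟩
  have e : c x • f x - c y • f y = (c x - c y) • f x + c y • (f x - f y) := by
    rw [sub_smul, smul_sub]; abel
  rw [e]
  refine (norm_add_le _ _).trans ?_
  rw [norm_smul, norm_smul]
  have := h x y hx hy
  have := h' x y hx hy
  have := hcB y hy
  have := hfB x hx
  calc _ ≤ (L * ‖x - y‖) * B' + B * (L' * ‖x - y‖) := by gcongr
    _ = _ := by ring

lemma LipOnBalls.mul {A : Type*} [NormedRing A] {f g : E → A} (hf : LipOnBalls f)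
    (hg : LipOnBalls g) : LipOnBalls fun x => f x * g x := by
  intro R
  obtain ⟨L, hL, h⟩ := hf R
  obtain ⟨L', hL', h'⟩ := hg R
  obtain ⟨B, hB, hfB⟩ := hf.exists_bound R
  obtain ⟨B', hB', hgB⟩ := hg.exists_bound R
  refine ⟨L * B' + B * L', by positivity, fun x y hx hy => ?_⟩
  have e : f x * g x - f y * g y = (f x - f y) * g x + f y * (g x - g y) := by noncomm_ring
  rw [e]
  have := h x y hx hy
  have := h' x y hx hy
  have := hfB y hy
  have := hgB x hx
  calc _ ≤ ‖f x - f y‖ * ‖g x‖ + ‖f y‖ * ‖g x - g y‖ :=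
        (norm_add_le _ _).trans (add_le_add (norm_mul_le _ _) (norm_mul_le _ _))
    _ ≤ (L * ‖x - y‖) * B' + B * (L' * ‖x - y‖) := by gcongr
    _ = _ := by ring

lemma LipOnBalls.clm_comp {G : Type*} [NormedAddCommGroup G] [NormedSpace ℝ F] [NormedSpace ℝ G]
    (A : F →L[ℝ] G) {f : E → F} (hf : LipOnBalls f) : LipOnBalls fun x => A (f x) := by
  intro R
  obtain ⟨L, hL, h⟩ := hf R
  refine ⟨‖A‖ * L, by positivity, fun x y hx hy => ?_⟩
  rw [← map_sub, mul_assoc]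
  exact (A.le_opNorm _).trans (by gcongr; exact h x y hx hy)

lemma LipOnBalls.clm [NormedSpace ℝ E] [NormedSpace ℝ F] (A : E →L[ℝ] F) :
    LipOnBalls fun x => A x :=
  fun _ => ⟨‖A‖, by positivity, fun x y _ _ => by rw [← map_sub]; exact A.le_opNorm _⟩

lemma LipOnBalls.pi {ι : Type*} [Fintype ι] {f : E → ι → F} (hf : ∀ i, LipOnBalls fun x => f x i) :
    LipOnBalls f := by
  intro R
  choose L hL h using fun i => hf i R
  refine ⟨∑ i, L i, Finset.sum_nonneg fun i _ => hL i, fun x y hx hy => ?_⟩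
  refine (pi_norm_le_iff_of_nonneg
    (mul_nonneg (Finset.sum_nonneg fun i _ => hL i) (norm_nonneg _))).mpr fun i => ?_
  refine (h i x y hx hy).trans ?_
  gcongr
  exact Finset.single_le_sum (fun i _ => hL i) (Finset.mem_univ i)

/-- An autonomous differential equation has a solution on `[0,T]` as soon as a bound is known for
the solutions of all equations `x' = c(t) V(x)` with `0 ≤ c ≤ 1`: the equation with `V` cut off
outside a large ball is of this kind. -/
theorem exists_solution_of_bound [NormedSpace ℝ E] [CompleteSpace E] {V : E → E}
    (hV : LipOnBalls V) {T : ℝ} (hT : 0 ≤ T) {x₀ : E} {R : ℝ}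
    (hR : ∀ c : ℝ → ℝ, ContinuousOn c (Icc 0 T) → (∀ t, c t ∈ Icc (0 : ℝ) 1) → ∀ x : ℝ → E, x 0 = x₀ →
      (∀ t ∈ Icc 0 T, HasDerivWithinAt x (c t • V (x t)) (Icc 0 T) t) →
      ∀ t ∈ Icc 0 T, ‖x t‖ ≤ R) :
    ∃ x : ℝ → E, x 0 = x₀ ∧ ∀ t ∈ Icc 0 T, HasDerivWithinAt x (V (x t)) (Icc 0 T) t := by
  -- The cut-off is `1` on the ball of radius `R` and `0` outside the ball of radius `R + 1`, so that `χ V`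
  -- is bounded and Picard–Lindelöf gives a solution on all of `[0,T]`.
  set χ : E → ℝ := fun x => max 0 (min 1 (R + 1 - ‖x‖)) with hχ
  have hχ1 : ∀ x, χ x ∈ Icc (0 : ℝ) 1 := fun x =>
    ⟨le_max_left _ _, max_le zero_le_one (min_le_left _ _)⟩
  have hχL : LipOnBalls χ := fun _ => ⟨1, zero_le_one, fun x y _ _ => by
    rw [one_mul, Real.norm_eq_abs]
    calc |χ x - χ y| ≤ |min 1 (R + 1 - ‖x‖) - min 1 (R + 1 - ‖y‖)| := by
          simpa using abs_max_sub_max_le_max 0 (min 1 (R + 1 - ‖x‖)) 0 (min 1 (R + 1 - ‖y‖))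
      _ ≤ |(R + 1 - ‖x‖) - (R + 1 - ‖y‖)| := by
          simpa using abs_min_sub_min_le_max 1 (R + 1 - ‖x‖) 1 (R + 1 - ‖y‖)
      _ = |‖y‖ - ‖x‖| := by congr 1; ring
      _ ≤ ‖y - x‖ := abs_norm_sub_norm_le y x
      _ = ‖x - y‖ := norm_sub_rev y x⟩
  set W : E → E := fun x => χ x • V x with hW
  have hWL : LipOnBalls W := hχL.smul hV
  obtain ⟨B, hB, hVB⟩ := hV.exists_bound (R + 1)
  have hWB : ∀ x, ‖W x‖ ≤ B := fun x => by
    by_cases hx : ‖x‖ ≤ R + 1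
    · rw [hW, norm_smul, Real.norm_of_nonneg (hχ1 x).1]
      calc _ ≤ 1 * B := by gcongr; exacts [(hχ1 x).2, hVB x hx]
        _ = B := one_mul B
    · have : χ x = 0 := max_eq_left (by
        refine (min_le_right _ _).trans ?_
        linarith [not_le.mp hx])
      simp [hW, this, hB]
  set a : NNReal := ⟨B * T, by positivity⟩ with ha
  obtain ⟨L, hL, hLip⟩ := hWL (‖x₀‖ + B * T)
  have hball : ∀ x ∈ Metric.closedBall x₀ a, ‖x‖ ≤ ‖x₀‖ + B * T := fun x hx => by
    rw [mem_closedBall_iff_norm] at hx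
    calc ‖x‖ = ‖x₀ + (x - x₀)‖ := by congr 1; abel
      _ ≤ ‖x₀‖ + ‖x - x₀‖ := norm_add_le _ _
      _ ≤ _ := by gcongr; exact hx
  have hPL : IsPicardLindelof (fun _ => W) (tmin := 0) (tmax := T) ⟨0, le_rfl, hT⟩ x₀ a 0
      ⟨B, hB⟩ ⟨L, hL⟩ := by
    refine ⟨fun t _ => ?_, fun x _ => continuousOn_const, fun t _ x _ => hWB x, ?_⟩
    · refine LipschitzOnWith.of_dist_le_mul fun x hx y hy => ?_
      rw [dist_eq_norm, dist_eq_norm]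
      exact hLip x y (hball x hx) (hball y hy)
    · simp only [sub_zero, sub_self, NNReal.coe_zero, max_eq_left hT]
      exact le_rfl
  obtain ⟨x, hx0, hx⟩ := hPL.exists_eq_forall_mem_Icc_hasDerivWithinAt₀
  have hx0 : x 0 = x₀ := hx0
  have hxc : ContinuousOn x (Icc 0 T) := fun t ht => (hx t ht).continuousWithinAt
  -- Along `x` the cut-off is a coefficient in `[0,1]`: the a priori bound keeps `x` where `χ = 1`.
  have hxR := hR (fun t => χ (x t)) ((by fun_prop : Continuous χ).comp_continuousOn hxc) (fun t => hχ1 _) x hx0 hx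
  refine ⟨x, hx0, fun t ht => ?_⟩
  have h1 : χ (x t) = 1 := by
    have := hxR t ht
    rw [hχ]
    simp only
    rw [min_eq_left (by linarith), max_eq_right zero_le_one]
  have h2 := hx t ht
  simp only [hW, h1, one_smul] at h2
  exact h2

end LipOnBalls

/-! ### The Galerkin vector field -/

/-- The real trigonometric monomial `Re (z e^{ik·x})`. -/
def modeMap (k : Fin 2 → ℤ) : ℂ →L[ℝ] C(Torus, ℝ) :=
  LinearMap.toContinuousLinearMap
    { toFun := fun z => ⟨fun x => (z * expMode k x).re,
        Complex.continuous_re.comp (continuous_const.mul (expMode k).continuous)⟩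
      map_add' := fun z w => by ext x; simp [add_mul]
      map_smul' := fun r z => by ext x; simp [mul_assoc] }

lemma modeMap_apply (k : Fin 2 → ℤ) (z : ℂ) (x : Torus) : modeMap k z x = (z * expMode k x).re := rfl

/-- The Fourier multiplier with symbol `m`, restricted to the frequencies in `S`. -/
def multMap (S : Finset (Fin 2 → ℤ)) (m : (Fin 2 → ℤ) → ℂ) : L2 →L[ℝ] C(Torus, ℝ) :=
  ∑ k ∈ S, (modeMap k).comp (m k • fcoeffCLM k)

lemma multMap_apply (S : Finset (Fin 2 → ℤ)) (m : (Fin 2 → ℤ) → ℂ) (f : L2) :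
    (multMap S m f : Torus → ℝ) = trigPoly S fun k => m k * fcoeff f k := by
  funext x
  simp only [multMap, _root_.sum_apply, ContinuousMap.sum_apply, trigPoly]
  rfl

/-- The inclusion of the continuous functions in `L²`. -/
def toL2 : C(Torus, ℝ) →L[ℝ] L2 := ContinuousMap.toLp 2 volume ℝ

lemma coeFn_toL2 (φ : C(Torus, ℝ)) : toL2 φ =ᵐ[volume] φ := ContinuousMap.coeFn_toLp volume φ

lemma fcoeff_toL2 (φ : C(Torus, ℝ)) (k : Fin 2 → ℤ) : fcoeff (toL2 φ) k = fcoeff φ k :=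
  fcoeff_congr (coeFn_toL2 φ) k

/-- The advection term `θ(u₀) ∂₀ f + u₁ ∂₁ f`, with `u` and `f` restricted to the frequencies in
`S`. -/
def advPoly (S : Finset (Fin 2 → ℤ)) (θ : ℝ → ℝ) (hθ : LipschitzWith 1 θ) (u : Fin 2 → L2) (f : L2) :
    C(Torus, ℝ) :=
  (ContinuousMap.mk θ hθ.continuous).comp (multMap S 1 (u 0)) *
      multMap S (fun k => Complex.I * k 0) f
    + multMap S 1 (u 1) * multMap S (fun k => Complex.I * k 1) f

/-- The trigonometric polynomial with frequencies in `S` and coefficients `c`. -/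
def polyL2 (S : Finset (Fin 2 → ℤ)) (c : (Fin 2 → ℤ) → ℂ) : L2 := toL2 (∑ k ∈ S, modeMap k (c k))

lemma coeFn_polyL2 (S : Finset (Fin 2 → ℤ)) (c : (Fin 2 → ℤ) → ℂ) :
    polyL2 S c =ᵐ[volume] trigPoly S c := by
  refine (coeFn_toL2 _).trans (Filter.Eventually.of_forall fun x => ?_)
  simp only [ContinuousMap.sum_apply, trigPoly]
  rfl

lemma fcoeff_polyL2 {S : Finset (Fin 2 → ℤ)} (hS : ∀ k ∈ S, -k ∈ S) {c : (Fin 2 → ℤ) → ℂ}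
    (hc : ∀ k, c (-k) = conj (c k)) (l : Fin 2 → ℤ) :
    fcoeff (polyL2 S c) l = if l ∈ S then c l else 0 := by
  rw [fcoeff_congr (coeFn_polyL2 S c), fcoeff_trigPoly hS hc]

/-- The vector field of the Galerkin approximation with frequencies in `S`, as a vector field on the
whole of `L² × L²`: its values have frequencies in `S`, and it sees only the frequencies in `S`. -/
def galerkinField (ν lam : ℝ) (S : Finset (Fin 2 → ℤ)) (θ : ℝ → ℝ) (hθ : LipschitzWith 1 θ)
    (u : Fin 2 → L2) (i : Fin 2) : L2 :=
  polyL2 S fun k => -(rate ν lam i k * fcoeff (u i) k + fcoeff (advPoly S θ hθ u (u i)) k)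

lemma rate_neg (ν lam : ℝ) (i : Fin 2) (k : Fin 2 → ℤ) : rate ν lam i (-k) = rate ν lam i k := by
  simp [rate, jb_neg]

lemma fcoeff_galerkinField (ν lam : ℝ) {S : Finset (Fin 2 → ℤ)} (hS : ∀ k ∈ S, -k ∈ S) {θ : ℝ → ℝ}
    (hθ : LipschitzWith 1 θ) (u : Fin 2 → L2) (i : Fin 2) (k : Fin 2 → ℤ) :
    fcoeff (galerkinField ν lam S θ hθ u i) k = if k ∈ S then
      -(rate ν lam i k * fcoeff (u i) k + fcoeff (advPoly S θ hθ u (u i)) k) else 0 := by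
  refine fcoeff_polyL2 hS (fun k => ?_) k
  simp [rate_neg, fcoeff_neg]

lemma lipOnBalls_coord (i : Fin 2) : LipOnBalls fun u : Fin 2 → L2 => u i :=
  LipOnBalls.clm (ContinuousLinearMap.proj (R := ℝ) (φ := fun _ : Fin 2 => L2) i)

lemma lipOnBalls_advPoly (S : Finset (Fin 2 → ℤ)) {θ : ℝ → ℝ} (hθ : LipschitzWith 1 θ) (i : Fin 2) :
    LipOnBalls fun u : Fin 2 → L2 => advPoly S θ hθ u (u i) := by
  have hmult : ∀ m i, LipOnBalls fun u : Fin 2 → L2 => multMap S m (u i) := fun m i =>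
    LipOnBalls.clm_comp _ (lipOnBalls_coord i)
  have hth : LipOnBalls fun u : Fin 2 → L2 =>
      (ContinuousMap.mk θ hθ.continuous).comp (multMap S 1 (u 0)) := by
    intro R
    obtain ⟨L, hL, h⟩ := hmult 1 0 R
    refine ⟨L, hL, fun u v hu hv => le_trans ?_ (h u v hu hv)⟩
    refine (ContinuousMap.norm_le _ (norm_nonneg _)).mpr fun x => ?_
    have h1 := hθ.dist_le_mul (multMap S 1 (u 0) x) (multMap S 1 (v 0) x)
    rw [NNReal.coe_one, one_mul, dist_eq_norm, dist_eq_norm] at h1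
    exact h1.trans ((multMap S 1 (u 0) - multMap S 1 (v 0)).norm_coe_le_norm x)
  exact (hth.mul (hmult _ i)).add ((hmult 1 1).mul (hmult _ i))

lemma lipOnBalls_galerkinField (ν lam : ℝ) (S : Finset (Fin 2 → ℤ)) {θ : ℝ → ℝ}
    (hθ : LipschitzWith 1 θ) : LipOnBalls (galerkinField ν lam S θ hθ) := by
  refine LipOnBalls.pi fun i => ?_
  refine LipOnBalls.clm_comp toL2 (LipOnBalls.sum fun k => LipOnBalls.clm_comp (modeMap k) ?_)
  have h1 : LipOnBalls fun u : Fin 2 → L2 => (rate ν lam i k : ℂ) * fcoeff (u i) k :=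
    LipOnBalls.clm_comp ((rate ν lam i k : ℂ) • fcoeffCLM k) (lipOnBalls_coord i)
  have h2 : LipOnBalls fun u : Fin 2 → L2 => fcoeff (advPoly S θ hθ u (u i)) k := by
    have h4 := LipOnBalls.clm_comp ((fcoeffCLM k).comp toL2) (lipOnBalls_advPoly S hθ i)
    simpa only [ContinuousLinearMap.comp_apply, fcoeffCLM_apply, fcoeff_toL2] using h4
  exact LipOnBalls.clm_comp (-ContinuousLinearMap.id ℝ ℂ) (h1.add h2)

/-! ### Primitives of continuous derivatives -/

lemma LipOnBalls.continuous {E F : Type*} [NormedAddCommGroup E] [NormedAddCommGroup F] {f : E → F}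
    (hf : LipOnBalls f) : Continuous f := by
  refine continuous_iff_continuousAt.mpr fun x => ?_
  obtain ⟨L, hL, h⟩ := hf (‖x‖ + 1)
  have h1 : LipschitzOnWith ⟨L, hL⟩ f (Metric.ball 0 (‖x‖ + 1)) :=
    LipschitzOnWith.of_dist_le_mul fun y hy z hz => by
      rw [dist_eq_norm, dist_eq_norm]
      exact h y z (mem_ball_zero_iff.mp hy).le (mem_ball_zero_iff.mp hz).le
  exact h1.continuousOn.continuousAt (Metric.isOpen_ball.mem_nhds (by simp))

lemma IsPrim.of_hasDerivWithinAt {T : ℝ} (hT : 0 ≤ T) {x x' : ℝ → ℝ}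
    (hd : ∀ t ∈ Icc 0 T, HasDerivWithinAt x (x' t) (Icc 0 T) t) (hc : ContinuousOn x' (Icc 0 T)) :
    IsPrim T x x' := by
  have hi : ∀ t ∈ Icc 0 T, IntervalIntegrable x' volume 0 t := fun t ht =>
    (hc.mono (by rw [uIcc_of_le ht.1]; exact Icc_subset_Icc_right ht.2)).intervalIntegrable
  refine ⟨hi T ⟨hT, le_rfl⟩, fun t ht => ?_⟩
  have hxc : ContinuousOn x (Icc 0 T) := fun t ht => (hd t ht).continuousWithinAt
  rw [intervalIntegral.integral_eq_sub_of_hasDeriv_right_of_le ht.1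
    (hxc.mono (Icc_subset_Icc_right ht.2)) (fun s hs => ?_) (hi t ht)]
  · ring
  · exact (hd s ⟨hs.1.le, hs.2.le.trans ht.2⟩).mono_of_mem_nhdsWithin
      (Icc_mem_nhdsGT_of_mem ⟨hs.1.le, hs.2.trans_le ht.2⟩)

/-- The energy form of Grönwall's inequality, where the dissipation `q` is kept on the left hand side. -/
lemma IsPrim.add_integral_le {T C : ℝ} (hT : 0 ≤ T) (hC : 0 ≤ C) {y y' q : ℝ → ℝ}
    (hy : IsPrim T y y') (hq : IntegrableOn q (Icc 0 T)) (hy0 : ∀ t ∈ Icc 0 T, 0 ≤ y t)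
    (hq0 : ∀ t ∈ Icc 0 T, 0 ≤ q t) (h : ∀ t ∈ Icc 0 T, y' t ≤ C * y t - q t) {t : ℝ}
    (ht : t ∈ Icc 0 T) : y t + ∫ s in (0)..t, q s ≤ Real.exp (C * T) * y 0 := by
  have hQ : IsPrim T (fun t => ∫ s in (0)..t, q s) q :=
    ⟨(intervalIntegrable_iff_integrableOn_Icc_of_le hT).mpr hq, fun t _ => by simp⟩
  have hexp : IsPrim T (fun t => Real.exp (-(C * t))) (fun t => Real.exp (-(C * t)) * (-C)) :=
    IsPrim.of_contDiff hT (fun t => by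
      simpa using ((hasDerivAt_id t).const_mul C).neg.exp) (by fun_prop)
  have hconst : IsPrim T (fun _ => Real.exp (-(C * T))) (fun _ => 0) :=
    IsPrim.of_contDiff hT (fun t => hasDerivAt_const _ _) (by fun_prop)
  have hz := (hexp.mul hT hy).add hT (hconst.mul hT hQ)
  have h1 := hz.le_of_nonpos (t := t) (by
    rw [ae_restrict_iff' measurableSet_Icc]
    refine Filter.Eventually.of_forall fun s hs => ?_
    have e1 : Real.exp (-(C * T)) ≤ Real.exp (-(C * s)) := by
      apply Real.exp_le_exp.mpr
      have := mul_le_mul_of_nonneg_left hs.2 hC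
      linarith
    have e2 := h s hs
    have e3 := mul_le_mul_of_nonneg_right e1 (hq0 s hs)
    have e4 := mul_le_mul_of_nonneg_left e2 (Real.exp_pos (-(C * s))).le
    simp only [zero_mul, zero_add]
    linarith) ht
  simp only [mul_zero, neg_zero, Real.exp_zero, one_mul, intervalIntegral.integral_same,
    add_zero] at h1
  have e1 : Real.exp (-(C * T)) ≤ Real.exp (-(C * t)) := by
    apply Real.exp_le_exp.mpr
    have := mul_le_mul_of_nonneg_left ht.2 hC
    linarith
  have e2 := mul_le_mul_of_nonneg_right e1 (hy0 t ht)
  have e3 : Real.exp (C * T) * Real.exp (-(C * T)) = 1 := by rw [← Real.exp_add]; simp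
  have e4 : Real.exp (C * T) * (Real.exp (-(C * T)) * (y t + ∫ s in (0)..t, q s))
      ≤ Real.exp (C * T) * y 0 := by
    refine mul_le_mul_of_nonneg_left ?_ (Real.exp_pos _).le
    linarith
  rwa [← mul_assoc, e3, one_mul] at e4

/-! ### Energy estimates for the Galerkin vector field -/

lemma polyL2_neg_add (S : Finset (Fin 2 → ℤ)) (a b : (Fin 2 → ℤ) → ℂ) :
    polyL2 S (fun k => -(a k + b k)) = -(polyL2 S a + polyL2 S b) := by
  simp [polyL2, Finset.sum_add_distrib]

/-- Truncation to the frequencies in `S` is symmetric. -/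
lemma integral_polyL2_mul {S : Finset (Fin 2 → ℤ)} (hS : ∀ k ∈ S, -k ∈ S) {F φ : Torus → ℝ}
    (hF : MemLp F 2 volume) (hφ : MemLp φ 2 volume) :
    ∫ x, polyL2 S (fcoeff F) x * φ x = ∫ x, F x * trigPoly S (fcoeff φ) x := by
  rw [integral_mul_eq_tsum (Lp.memLp _) hφ,
    integral_mul_eq_tsum hF (memLp_of_continuous (continuous_trigPoly _ _) 2)]
  congr 3
  funext k
  rw [fcoeff_polyL2 hS (fun k => fcoeff_neg F k), fcoeff_trigPoly hS fun k => fcoeff_neg φ k]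
  split_ifs <;> simp

lemma trigPoly_ae_eq {S : Finset (Fin 2 → ℤ)} (hS : ∀ k ∈ S, -k ∈ S) {f : L2}
    (hf : ∀ k ∉ S, fcoeff f k = 0) : polyL2 S (fcoeff f) = f := by
  refine L2.ext_fcoeff fun k => ?_
  rw [fcoeff_polyL2 hS fun k => fcoeff_neg f k]
  split_ifs with h
  · rfl
  · exact (hf k h).symm

lemma multMap_one_ae_eq {S : Finset (Fin 2 → ℤ)} (hS : ∀ k ∈ S, -k ∈ S) {f : L2}
    (hf : ∀ k ∉ S, fcoeff f k = 0) : multMap S 1 f =ᵐ[volume] f := by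
  have h := coeFn_polyL2 S (fcoeff f)
  rw [trigPoly_ae_eq hS hf] at h
  rw [multMap_apply]
  simp only [Pi.one_apply, one_mul]
  exact h.symm

lemma sobSq_ne_top_of_supp {S : Finset (Fin 2 → ℤ)} {c : (Fin 2 → ℤ) → ℂ} (hc : ∀ k ∉ S, c k = 0)
    (s : ℝ) : sobSq s c ≠ ⊤ := by
  refine sobSq_ne_top_of_summable (summable_of_ne_finset_zero (s := S) fun k hk => ?_)
  simp [hc k hk]

lemma wpartial_ae_eq {S : Finset (Fin 2 → ℤ)} (hS : ∀ k ∈ S, -k ∈ S) {f : L2}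
    (hf : ∀ k ∉ S, fcoeff f k = 0) (j : Fin 2) :
    wpartial j f =ᵐ[volume] multMap S (fun k => Complex.I * k j) f := by
  have h : wpartial j f = polyL2 S fun k => Complex.I * k j * fcoeff f k := by
    refine L2.ext_fcoeff fun k => ?_
    rw [fcoeff_wpartial (sobSq_ne_top_of_supp hf 1), fcoeff_polyL2 hS]
    · split_ifs with h
      · rfl
      · simp [hf k h]
    · intro k
      simp [fcoeff_neg]
  rw [h, multMap_apply]
  exact coeFn_polyL2 S _

lemma adv_ae_eq {S : Finset (Fin 2 → ℤ)} (hS : ∀ k ∈ S, -k ∈ S) {θ : ℝ → ℝ}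
    (hθ : LipschitzWith 1 θ) {u : Fin 2 → L2} (hu : ∀ i, ∀ k ∉ S, fcoeff (u i) k = 0) (i : Fin 2) :
    adv θ u (u i) =ᵐ[volume] advPoly S θ hθ u (u i) := by
  filter_upwards [multMap_one_ae_eq hS (hu 0), multMap_one_ae_eq hS (hu 1),
    wpartial_ae_eq hS (hu i) 0, wpartial_ae_eq hS (hu i) 1] with x h0 h1 h2 h3
  rw [adv, h2, h3, ← h0, ← h1]
  rfl

lemma hasPD_multMap (S : Finset (Fin 2 → ℤ)) (m : (Fin 2 → ℤ) → ℂ) (f : L2) (j : Fin 2) :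
    HasPD j (multMap S m f) (multMap S (fun k => Complex.I * k j * m k) f) := by
  have h := hasPD_trigPoly S (fun k => m k * fcoeff f k) j
  rw [multMap_apply, multMap_apply]
  simpa only [mul_assoc] using h

lemma integral_multMap_sq {S : Finset (Fin 2 → ℤ)} (hS : ∀ k ∈ S, -k ∈ S)
    {m : (Fin 2 → ℤ) → ℂ} (hm : ∀ k, m (-k) = conj (m k)) (f : L2) :
    ∫ x, multMap S m f x * multMap S m f x
      = (2 * Real.pi) ^ 2 * ∑ k ∈ S, ‖m k‖ ^ 2 * ‖fcoeff f k‖ ^ 2 := by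
  have hc : Continuous (multMap S m f) := (multMap S m f).continuous
  rw [integral_mul_eq_tsum (memLp_of_continuous hc 2) (memLp_of_continuous hc 2)]
  congr 1
  have h1 : ∀ k, fcoeff (multMap S m f) k = if k ∈ S then m k * fcoeff f k else 0 := fun k => by
    rw [multMap_apply, fcoeff_trigPoly hS fun k => by rw [hm, fcoeff_neg, map_mul]]
  rw [tsum_eq_sum (s := S) fun k hk => by rw [h1, if_neg hk, zero_mul], Complex.re_sum]
  refine Finset.sum_congr rfl fun k hk => ?_
  rw [h1, if_pos hk, Complex.mul_conj, Complex.ofReal_re, Complex.normSq_eq_norm_sq, norm_mul,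
    mul_pow]

/-- The energy identity of the second component. Tested with `u₁`, its self-advection `u₁ ∂₁ u₁`
drops out, as `3 u₁² ∂₁ u₁ = ∂₁(u₁³)`; the other term is bounded through `|θ| ≤ M`, without any
information on `u₀`. -/
lemma integral_galerkinField_mul_self_le {ν lam M : ℝ} {S : Finset (Fin 2 → ℤ)}
    (hS : ∀ k ∈ S, -k ∈ S) {θ : ℝ → ℝ} (hθ : LipschitzWith 1 θ) (hM : ∀ s, |θ s| ≤ M)
    {u : Fin 2 → L2} (hu : ∀ i, ∀ k ∉ S, fcoeff (u i) k = 0) :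
    2 * ∫ x, galerkinField ν lam S θ hθ u 1 x * u 1 x
      ≤ (2 * ((2 + lam) ^ 2 + 2) + 2 * M ^ 2) * ‖u 1‖ ^ 2
        - (2 * Real.pi) ^ 2 / 2 * ∑ k ∈ S, jb k ^ 2 * ‖fcoeff (u 1) k‖ ^ 2 := by
  set p := multMap S 1 (u 1) with hp
  set d₀ := multMap S (fun k => Complex.I * k 0) (u 1) with hd₀
  set d₁ := multMap S (fun k => Complex.I * k 1) (u 1) with hd₁
  set p₀ := multMap S 1 (u 0) with hp₀
  set F := advPoly S θ hθ u (u 1) with hF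
  have hpu : p =ᵐ[volume] u 1 := multMap_one_ae_eq hS (hu 1)
  have hFx : ∀ x, F x = θ (p₀ x) * d₀ x + p x * d₁ x := fun x => rfl
  have hθc := hθ.continuous
  -- The linear part is diagonal in Fourier space.
  have hlin : ∫ x, polyL2 S (fun k => rate ν lam 1 k * fcoeff (u 1) k) x * u 1 x
      = (2 * Real.pi) ^ 2 * ∑ k ∈ S, rate ν lam 1 k * ‖fcoeff (u 1) k‖ ^ 2 := by
    rw [integral_mul_eq_tsum (Lp.memLp _) (Lp.memLp _), tsum_eq_sum (s := S) fun k hk => by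
      rw [hu 1 k hk, map_zero, mul_zero], Complex.re_sum]
    congr 1
    refine Finset.sum_congr rfl fun k hk => ?_
    rw [fcoeff_polyL2 hS (fun k => by simp [rate_neg, fcoeff_neg]), if_pos hk, mul_assoc,
      Complex.mul_conj, ← Complex.ofReal_mul, Complex.ofReal_re, Complex.normSq_eq_norm_sq]
  -- As `u₁` has frequencies in `S`, the truncation of the advection term is not seen by it.
  have hadv : ∫ x, polyL2 S (fcoeff F) x * u 1 x = ∫ x, F x * p x := by
    rw [integral_polyL2_mul hS (memLp_of_continuous F.continuous 2) (Lp.memLp _)]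
    rw [hp, multMap_apply]
    simp
  have hcancel : ∫ x, p x * d₁ x * p x = 0 := by
    have h1 := hasPD_multMap S 1 (u 1) 1
    simp only [Pi.one_apply, mul_one] at h1
    have h2 := ((h1.mul h1).mul h1).integral_eq_zero (by fun_prop) (by fun_prop)
    have h3 : ∫ x, 3 * (p x * d₁ x * p x) = 0 := by
      rw [← h2]
      refine integral_congr_ae (Filter.Eventually.of_forall fun x => ?_)
      simp only [← hp, ← hd₁]
      ring
    rw [integral_const_mul] at h3
    linarith
  have hnl : -(2 * ∫ x, F x * p x) ≤ 1 / 2 * (∫ x, d₀ x * d₀ x) + 2 * M ^ 2 * ∫ x, p x * p x := by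
    have e1 : ∫ x, F x * p x = ∫ x, θ (p₀ x) * d₀ x * p x := by
      have : ∀ x, F x * p x = θ (p₀ x) * d₀ x * p x + p x * d₁ x * p x := fun x => by
        rw [hFx]; ring
      simp only [this]
      rw [integral_add (continuous_integrable (by fun_prop)) (continuous_integrable (by fun_prop)),
        hcancel, add_zero]
    rw [e1, ← integral_const_mul, ← integral_const_mul, ← integral_const_mul, ← integral_neg,
      ← integral_add (continuous_integrable (by fun_prop)) (continuous_integrable (by fun_prop))]
    refine integral_mono (continuous_integrable (by fun_prop)) (continuous_integrable (by fun_prop))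
      fun x => ?_
    have h1 : θ (p₀ x) ^ 2 ≤ M ^ 2 := sq_le_sq' (by linarith [neg_le_of_abs_le (hM (p₀ x))])
      (le_of_abs_le (hM (p₀ x)))
    have h2 := mul_le_mul_of_nonneg_right h1 (sq_nonneg (p x))
    simp only
    nlinarith [sq_nonneg (d₀ x + 2 * (θ (p₀ x) * p x))]
  have hpp : ∫ x, p x * p x = ‖u 1‖ ^ 2 := by
    rw [L2.norm_sq]
    exact integral_congr_ae (by filter_upwards [hpu] with x hx; rw [hx])
  have hpp' : ‖u 1‖ ^ 2 = (2 * Real.pi) ^ 2 * ∑ k ∈ S, ‖fcoeff (u 1) k‖ ^ 2 := by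
    rw [← hpp, hp, integral_multMap_sq hS (by simp)]
    simp
  have hdd : ∫ x, d₀ x * d₀ x ≤ (2 * Real.pi) ^ 2 * ∑ k ∈ S, jb k ^ 2 * ‖fcoeff (u 1) k‖ ^ 2 := by
    rw [hd₀, integral_multMap_sq hS (fun k => by simp)]
    gcongr with k hk
    have h1 := sq_le_jb k 0
    have h2 := one_le_jb k
    simp only [norm_mul, Complex.norm_I, one_mul, Complex.norm_intCast]
    nlinarith [sq_abs (k 0 : ℝ), abs_nonneg (k 0 : ℝ)]
  have htot : ∫ x, galerkinField ν lam S θ hθ u 1 x * u 1 x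
      = -((2 * Real.pi) ^ 2 * ∑ k ∈ S, rate ν lam 1 k * ‖fcoeff (u 1) k‖ ^ 2)
        - ∫ x, F x * p x := by
    rw [← hlin, ← hadv, galerkinField, polyL2_neg_add]
    rw [← integral_neg, ← integral_sub]
    · refine integral_congr_ae ?_
      filter_upwards [Lp.coeFn_neg (polyL2 S (fun k => rate ν lam 1 k * fcoeff (u 1) k)
        + polyL2 S (fcoeff F)), Lp.coeFn_add (polyL2 S (fun k => rate ν lam 1 k * fcoeff (u 1) k))
          (polyL2 S (fcoeff F))] with x h1 h2
      rw [h1, Pi.neg_apply, h2, Pi.add_apply]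
      ring
    · exact ((Lp.memLp _).integrable_mul (Lp.memLp _)).neg
    · exact (Lp.memLp _).integrable_mul (Lp.memLp _)
  have hrate : ∑ k ∈ S, (1 / 2 * (jb k ^ 2 * ‖fcoeff (u 1) k‖ ^ 2)
      - ((2 + lam) ^ 2 + 2) * ‖fcoeff (u 1) k‖ ^ 2)
        ≤ ∑ k ∈ S, rate ν lam 1 k * ‖fcoeff (u 1) k‖ ^ 2 := by
    refine Finset.sum_le_sum fun k _ => ?_
    have h1 := rate_one_ge ν lam k
    rw [Real.rpow_two] at h1
    have h2 := mul_le_mul_of_nonneg_right h1 (sq_nonneg ‖fcoeff (u 1) k‖)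
    linarith
  rw [Finset.sum_sub_distrib, ← Finset.mul_sum, ← Finset.mul_sum] at hrate
  have hpi : 0 < (2 * Real.pi) ^ 2 := by positivity
  have h1 := mul_le_mul_of_nonneg_left hrate hpi.le
  rw [htot]
  rw [hpp] at hnl
  nlinarith [hpp']

/-! ### Galerkin approximations -/

/-- `u` solves the Galerkin equations with frequencies in `S` on `[0,T]`, its initial value being
the truncation of `uin`. -/
structure IsGalerkin (ν lam T : ℝ) (S : Finset (Fin 2 → ℤ)) (θ : ℝ → ℝ) (hθ : LipschitzWith 1 θ)
    (uin : Fin 2 → L2) (u : ℝ → Fin 2 → L2) : Prop where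
  initial : ∀ i, u 0 i = polyL2 S (fcoeff (uin i))
  supp : ∀ t ∈ Icc 0 T, ∀ i, ∀ k ∉ S, fcoeff (u t i) k = 0
  deriv : ∀ t ∈ Icc 0 T, HasDerivWithinAt u (galerkinField ν lam S θ hθ (u t)) (Icc 0 T) t

lemma norm_polyL2_le (S : Finset (Fin 2 → ℤ)) (c : (Fin 2 → ℤ) → ℂ) :
    ‖polyL2 S c‖ ≤ ‖toL2‖ * ∑ k ∈ S, ‖modeMap k‖ * ‖c k‖ := by
  refine (toL2.le_opNorm _).trans ?_
  gcongr
  exact (norm_sum_le _ _).trans (Finset.sum_le_sum fun k _ => (modeMap k).le_opNorm _)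

/-- When the second component is bounded, the field of the first grows at most linearly in the first
component, with a constant depending on `S`. This is enough for global existence. -/
lemma exists_norm_galerkinField_zero_le (ν lam : ℝ) {M : ℝ} (S : Finset (Fin 2 → ℤ)) {θ : ℝ → ℝ}
    (hθ : LipschitzWith 1 θ) (hM : ∀ s, |θ s| ≤ M) (R : ℝ) :
    ∃ K : ℝ, 0 ≤ K ∧ ∀ u : Fin 2 → L2, ‖u 1‖ ≤ R → ‖galerkinField ν lam S θ hθ u 0‖ ≤ K * ‖u 0‖ := by
  have hM0 : 0 ≤ M := (abs_nonneg _).trans (hM 0)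
  set D : Fin 2 → ℝ := fun j => ‖multMap S (fun k => Complex.I * k j)‖ with hD
  set A : ℝ := M * D 0 + ‖multMap S 1‖ * max R 0 * D 1 with hA
  have hA0 : 0 ≤ A := by simp only [hA, hD]; positivity
  refine ⟨‖toL2‖ * ∑ k ∈ S, ‖modeMap k‖ * (|rate ν lam 0 k| + ‖(fcoeffCLM k).comp toL2‖ * A),
    by positivity, fun u hu => ?_⟩
  have hadv : ‖advPoly S θ hθ u (u 0)‖ ≤ A * ‖u 0‖ := by
    refine (norm_add_le _ _).trans ?_
    have h1 : ‖(ContinuousMap.mk θ hθ.continuous).comp (multMap S 1 (u 0))‖ ≤ M :=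
      (ContinuousMap.norm_le _ hM0).mpr fun x => hM _
    have h2 : ‖multMap S 1 (u 1)‖ ≤ ‖multMap S 1‖ * max R 0 :=
      ((multMap S 1).le_opNorm _).trans (by gcongr; exact hu.trans (le_max_left _ _))
    have h3 : ∀ j : Fin 2, ‖multMap S (fun k => Complex.I * k j) (u 0)‖ ≤ D j * ‖u 0‖ :=
      fun j => (multMap S _).le_opNorm _
    calc _ ≤ M * (D 0 * ‖u 0‖) + (‖multMap S 1‖ * max R 0) * (D 1 * ‖u 0‖) := by
          refine add_le_add ((norm_mul_le _ _).trans ?_) ((norm_mul_le _ _).trans ?_)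
          · exact mul_le_mul h1 (h3 0) (norm_nonneg _) hM0
          · exact mul_le_mul h2 (h3 1) (norm_nonneg _) (by positivity)
      _ = A * ‖u 0‖ := by rw [hA]; ring
  refine (norm_polyL2_le S _).trans ?_
  rw [mul_assoc, Finset.sum_mul]
  refine mul_le_mul_of_nonneg_left (Finset.sum_le_sum fun k _ => ?_) (by positivity)
  rw [mul_assoc]
  refine mul_le_mul_of_nonneg_left ?_ (by positivity)
  rw [norm_neg, add_mul]
  refine (norm_add_le _ _).trans (add_le_add ?_ ?_)
  · rw [norm_mul, Complex.norm_real, Real.norm_eq_abs]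
    gcongr
    exact norm_fcoeff_le _ _
  · rw [← fcoeff_toL2]
    refine (((fcoeffCLM k).comp toL2).le_opNorm _).trans ?_
    rw [mul_assoc]
    gcongr

lemma continuousOn_fcoeff {s : Set ℝ} {x : ℝ → L2} (hx : ContinuousOn x s) (k : Fin 2 → ℤ) :
    ContinuousOn (fun t => fcoeff (x t) k) s := by
  simpa only [fcoeffCLM_apply] using (fcoeffCLM k).continuous.comp_continuousOn' hx

lemma hasDerivWithinAt_norm_sq {T : ℝ} {x : ℝ → L2} {x' : L2} {t : ℝ}
    (h : HasDerivWithinAt x x' (Icc 0 T) t) :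
    HasDerivWithinAt (fun s => ‖x s‖ ^ 2) (2 * ∫ y, x' y * x t y) (Icc 0 T) t := by
  have h1 := h.norm_sq
  convert! h1 using 2

/-- Galerkin solutions exist on all of `[0,T]`. The a priori bound comes from the energy of the second
component, which does not involve the first, and then from the linear growth of the field of the
first component. The bound for the latter depends on `S`. -/
theorem exists_isGalerkin (ν lam : ℝ) {M T : ℝ} (hT : 0 ≤ T) {S : Finset (Fin 2 → ℤ)}
    (hS : ∀ k ∈ S, -k ∈ S) {θ : ℝ → ℝ} (hθ : LipschitzWith 1 θ) (hM : ∀ s, |θ s| ≤ M)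
    (uin : Fin 2 → L2) : ∃ u, IsGalerkin ν lam T S θ hθ uin u := by
  set V := galerkinField ν lam S θ hθ with hV
  have hVL : LipOnBalls V := lipOnBalls_galerkinField ν lam S hθ
  set x₀ : Fin 2 → L2 := fun i => polyL2 S (fcoeff (uin i)) with hx₀
  have h0T : (0 : ℝ) ∈ Icc 0 T := ⟨le_rfl, hT⟩
  -- The field has no coefficients outside `S`, so those of a solution stay zero.
  have hsupp : ∀ c : ℝ → ℝ, ∀ x : ℝ → Fin 2 → L2, x 0 = x₀ →
      (∀ t ∈ Icc 0 T, HasDerivWithinAt x (c t • V (x t)) (Icc 0 T) t) →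
      ∀ t ∈ Icc 0 T, ∀ i, ∀ k ∉ S, fcoeff (x t i) k = 0 := by
    intro c x hx0 hx t ht i k hk
    have hd : ∀ t ∈ Icc 0 T, HasDerivWithinAt (fun t => fcoeff (x t i) k) 0 (Icc 0 T) t := by
      intro t ht
      have h1 := (hasDerivWithinAt_pi.mp (hx t ht)) i
      have h2 := (fcoeffCLM k).hasFDerivAt.comp_hasDerivWithinAt t h1
      have h3 : fcoeffCLM k ((c t • V (x t)) i) = 0 := by
        rw [Pi.smul_apply, map_smul, fcoeffCLM_apply, hV, fcoeff_galerkinField ν lam hS, if_neg hk,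
          smul_zero]
      rw [h3] at h2
      exact h2
    have hc : ContinuousOn (fun t => fcoeff (x t i) k) (Icc 0 T) :=
      fun t ht => (hd t ht).continuousWithinAt
    have h1 := constant_of_has_deriv_right_zero hc (fun t ht =>
      (hd t ⟨ht.1, ht.2.le⟩).mono_of_mem_nhdsWithin (Icc_mem_nhdsGE_of_mem ht)) t ht
    rw [h1, hx0, hx₀, fcoeff_polyL2 hS fun k => fcoeff_neg _ k, if_neg hk]
  set C₁ := 2 * ((2 + lam) ^ 2 + 2) + 2 * M ^ 2 with hC₁
  have hC₁0 : 0 ≤ C₁ := by positivity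
  set R₁ : ℝ := Real.sqrt (Real.exp (C₁ * T) * ‖x₀ 1‖ ^ 2) with hR₁
  obtain ⟨K, hK, hVK⟩ := exists_norm_galerkinField_zero_le ν lam S hθ hM R₁
  set R₀ : ℝ := Real.sqrt (Real.exp (2 * K * T) * ‖x₀ 0‖ ^ 2) with hR₀
  have hbound : ∀ c : ℝ → ℝ, ContinuousOn c (Icc 0 T) → (∀ t, c t ∈ Icc (0 : ℝ) 1) →
      ∀ x : ℝ → Fin 2 → L2, x 0 = x₀ →
      (∀ t ∈ Icc 0 T, HasDerivWithinAt x (c t • V (x t)) (Icc 0 T) t) →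
      ∀ t ∈ Icc 0 T, ‖x t‖ ≤ max R₀ R₁ := by
    intro c hc hc1 x hx0 hx
    have hsu := hsupp c x hx0 hx
    have hxc : ContinuousOn x (Icc 0 T) := fun t ht => (hx t ht).continuousWithinAt
    -- A bound for the production of energy bounds the energy; as `0 ≤ c ≤ 1`, the coefficient `c(t)`
    -- does no harm.
    have hgen : ∀ i, ∀ C : ℝ, 0 ≤ C → (∀ t ∈ Icc 0 T,
        2 * ∫ y, V (x t) i y * x t i y ≤ C * ‖x t i‖ ^ 2) →
        ∀ t ∈ Icc 0 T, ‖x t i‖ ≤ Real.sqrt (Real.exp (C * T) * ‖x₀ i‖ ^ 2) := by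
      intro i C hC hle t ht
      have hd : ∀ t ∈ Icc 0 T, HasDerivWithinAt (fun s => ‖x s i‖ ^ 2)
          (c t * (2 * ∫ y, V (x t) i y * x t i y)) (Icc 0 T) t := by
        intro t ht
        have h1 := hasDerivWithinAt_norm_sq ((hasDerivWithinAt_pi.mp (hx t ht)) i)
        convert! h1 using 1
        rw [mul_left_comm, ← integral_const_mul]
        congr 1
        refine integral_congr_ae ?_
        filter_upwards [Lp.coeFn_smul (c t) (V (x t) i)] with y hy
        rw [Pi.smul_apply, hy, Pi.smul_apply, smul_eq_mul, mul_assoc]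
      have hcont : ContinuousOn (fun t => c t * (2 * ∫ y, V (x t) i y * x t i y)) (Icc 0 T) := by
        have h1 : ContinuousOn (fun t => c t * (2 * inner ℝ (x t i) (V (x t) i))) (Icc 0 T) := by
          have h2 : ContinuousOn (fun t => V (x t) i) (Icc 0 T) :=
            ((continuous_apply i).comp hVL.continuous).comp_continuousOn hxc
          have h3 : ContinuousOn (fun t => x t i) (Icc 0 T) :=
            continuousOn_pi.mp hxc i
          exact hc.mul (continuousOn_const.mul (h3.inner (𝕜 := ℝ) h2))
        refine h1.congr fun t _ => ?_
        simp only
        rw [L2.inner_def]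
        simp
      have hp := IsPrim.of_hasDerivWithinAt hT hd hcont
      have h1 := hp.add_integral_le (q := fun _ => 0) hT hC (by simp) (fun t _ => by positivity)
        (fun t _ => le_rfl) (fun t ht => by
          rw [sub_zero]
          have h2 := hle t ht
          have h3 : 0 ≤ C * ‖x t i‖ ^ 2 := by positivity
          have h4 := hc1 t
          nlinarith [h4.1, h4.2]) ht
      simp only [intervalIntegral.integral_zero, add_zero, hx0] at h1
      exact Real.le_sqrt_of_sq_le h1
    have h1 : ∀ t ∈ Icc 0 T, ‖x t 1‖ ≤ R₁ := hgen 1 C₁ hC₁0 fun t ht => by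
      have h2 := integral_galerkinField_mul_self_le (ν := ν) (lam := lam) hS hθ hM (hsu t ht)
      refine h2.trans (sub_le_self _ ?_)
      positivity
    have h0 : ∀ t ∈ Icc 0 T, ‖x t 0‖ ≤ R₀ := hgen 0 (2 * K) (by positivity) fun t ht => by
      have h2 : ∫ y, V (x t) 0 y * x t 0 y = inner ℝ (x t 0) (V (x t) 0) := by
        rw [L2.inner_def]
        simp
      have h3 := hVK (x t) (h1 t ht)
      have h4 := real_inner_le_norm (x t 0) (V (x t) 0)
      have h5 := mul_le_mul_of_nonneg_left h3 (norm_nonneg (x t 0))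
      rw [h2]
      nlinarith
    intro t ht
    refine (pi_norm_le_iff_of_nonneg (le_max_of_le_left (Real.sqrt_nonneg _))).mpr fun i => ?_
    fin_cases i
    · exact (h0 t ht).trans (le_max_left _ _)
    · exact (h1 t ht).trans (le_max_right _ _)
  obtain ⟨u, hu0, hu⟩ := exists_solution_of_bound hVL hT hbound
  refine ⟨u, fun i => by rw [hu0], hsupp (fun _ => 1) u hu0 fun t ht => ?_, hu⟩
  rw [one_smul]
  exact hu t ht

section IsGalerkin

variable {ν lam T M : ℝ} {S : Finset (Fin 2 → ℤ)} {θ : ℝ → ℝ} {hθ : LipschitzWith 1 θ}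
  {uin : Fin 2 → L2} {u : ℝ → Fin 2 → L2}

lemma IsGalerkin.continuousOn (hu : IsGalerkin ν lam T S θ hθ uin u) : ContinuousOn u (Icc 0 T) :=
  fun t ht => (hu.deriv t ht).continuousWithinAt

lemma IsGalerkin.continuousOn_field (hu : IsGalerkin ν lam T S θ hθ uin u) :
    ContinuousOn (fun t => galerkinField ν lam S θ hθ (u t)) (Icc 0 T) :=
  (lipOnBalls_galerkinField ν lam S hθ).continuous.comp_continuousOn hu.continuousOn

lemma IsGalerkin.pairSol (hu : IsGalerkin ν lam T S θ hθ uin u) (hS : ∀ k ∈ S, -k ∈ S) :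
    PairSol ν lam T u fun t i k => if k ∈ S then fcoeff (adv θ (u t) (u t i)) k else 0 := by
  intro i k
  have hzc : ContinuousOn (fun t => fcoeff (u t i) k) (Icc 0 T) :=
    continuousOn_fcoeff (continuousOn_pi.mp hu.continuousOn i) k
  have hVc : ContinuousOn (fun t => fcoeff (galerkinField ν lam S θ hθ (u t) i) k) (Icc 0 T) :=
    continuousOn_fcoeff (continuousOn_pi.mp hu.continuousOn_field i) k
  have hV : ∀ t ∈ Icc 0 T, fcoeff (galerkinField ν lam S θ hθ (u t) i) k
      = -(rate ν lam i k * fcoeff (u t i) k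
        + if k ∈ S then fcoeff (adv θ (u t) (u t i)) k else 0) := by
    intro t ht
    rw [fcoeff_galerkinField ν lam hS]
    split_ifs with hk
    · rw [fcoeff_congr (adv_ae_eq hS hθ (hu.supp t ht) i)]
    · rw [hu.supp t ht i k hk]; simp
  have hfc : ContinuousOn (fun t => if k ∈ S then fcoeff (adv θ (u t) (u t i)) k else 0)
      (Icc 0 T) := by
    have h1 : ContinuousOn (fun t => -fcoeff (galerkinField ν lam S θ hθ (u t) i) k
        - rate ν lam i k * fcoeff (u t i) k) (Icc 0 T) :=
      hVc.neg.sub (continuousOn_const.mul hzc)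
    refine h1.congr fun t ht => ?_
    simp only
    rw [hV t ht]
    ring
  refine ⟨hzc, hfc.integrableOn_Icc, fun t ht => ?_⟩
  have hd : ∀ s ∈ Ioo 0 t, HasDerivWithinAt (fun t => fcoeff (u t i) k)
      (fcoeff (galerkinField ν lam S θ hθ (u s) i) k) (Ioi s) s := fun s hs => by
    have hs' : s ∈ Ico 0 T := ⟨hs.1.le, hs.2.trans_le ht.2⟩
    have h1 := (hasDerivWithinAt_pi.mp (hu.deriv s ⟨hs'.1, hs'.2.le⟩)) i
    exact ((fcoeffCLM k).hasFDerivAt.comp_hasDerivWithinAt s h1).mono_of_mem_nhdsWithin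
      (Icc_mem_nhdsGT_of_mem hs')
  have h1 := intervalIntegral.integral_eq_sub_of_hasDeriv_right_of_le ht.1
    (hzc.mono (Icc_subset_Icc_right ht.2)) hd
    ((hVc.mono (Icc_subset_Icc_right ht.2)).intervalIntegrable_of_Icc ht.1)
  have h2 : ∫ s in (0)..t, fcoeff (galerkinField ν lam S θ hθ (u s) i) k
      = -∫ s in (0)..t, (rate ν lam i k * fcoeff (u s i) k
        + if k ∈ S then fcoeff (adv θ (u s) (u s i)) k else 0) := by
    rw [← intervalIntegral.integral_neg]
    refine intervalIntegral.integral_congr fun s hs => ?_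
    rw [uIcc_of_le ht.1] at hs
    exact hV s ⟨hs.1, hs.2.trans ht.2⟩
  rw [h2] at h1
  simp only at h1 ⊢
  rw [sub_eq_add_neg, h1]
  ring

/-- The energy estimate for the second component: the maximum `M` of `|θ|` is all that it needs
to know of the first component. -/
lemma IsGalerkin.energy_one (hu : IsGalerkin ν lam T S θ hθ uin u) (hS : ∀ k ∈ S, -k ∈ S)
    (hT : 0 ≤ T) (hM : ∀ s, |θ s| ≤ M) :
    ∫⁻ t in Icc 0 T, sobSq 2 (fcoeff (u t 1))
      ≤ ENNReal.ofReal (2 * Real.exp ((2 * ((2 + lam) ^ 2 + 2) + 2 * M ^ 2) * T) * ‖u 0 1‖ ^ 2) := by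
  set C₁ := 2 * ((2 + lam) ^ 2 + 2) + 2 * M ^ 2 with hC₁
  set V := galerkinField ν lam S θ hθ with hV
  set N : ℝ → ℝ := fun t => ∑ k ∈ S, jb k ^ 2 * ‖fcoeff (u t 1) k‖ ^ 2 with hN
  have hNc : ContinuousOn N (Icc 0 T) := continuousOn_finsetSum _ fun k _ =>
    continuousOn_const.mul ((continuousOn_fcoeff (continuousOn_pi.mp hu.continuousOn 1) k).norm.pow 2)
  have hN0 : ∀ t, 0 ≤ N t := fun t => Finset.sum_nonneg fun k _ => by positivity
  have hd : ∀ t ∈ Icc 0 T, HasDerivWithinAt (fun s => ‖u s 1‖ ^ 2)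
      (2 * ∫ y, V (u t) 1 y * u t 1 y) (Icc 0 T) t := fun t ht =>
    hasDerivWithinAt_norm_sq ((hasDerivWithinAt_pi.mp (hu.deriv t ht)) 1)
  have hcont : ContinuousOn (fun t => 2 * ∫ y, V (u t) 1 y * u t 1 y) (Icc 0 T) := by
    have h1 : ContinuousOn (fun t => 2 * inner ℝ (u t 1) (V (u t) 1)) (Icc 0 T) := by
      have h2 : ContinuousOn (fun t => V (u t) 1) (Icc 0 T) :=
        continuousOn_pi.mp hu.continuousOn_field 1
      have h3 : ContinuousOn (fun t => u t 1) (Icc 0 T) :=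
        continuousOn_pi.mp hu.continuousOn 1
      exact continuousOn_const.mul (h3.inner (𝕜 := ℝ) h2)
    refine h1.congr fun t _ => ?_
    simp only
    rw [L2.inner_def]
    simp
  have hp := IsPrim.of_hasDerivWithinAt hT hd hcont
  have h1 := hp.add_integral_le (q := fun t => (2 * Real.pi) ^ 2 / 2 * N t) hT (C := C₁)
    (by positivity) (continuousOn_const.mul hNc).integrableOn_Icc (fun t _ => by positivity)
    (fun t _ => mul_nonneg (by positivity) (hN0 t)) (fun t ht =>
      integral_galerkinField_mul_self_le hS hθ hM (hu.supp t ht)) (t := T) ⟨hT, le_rfl⟩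
  rw [intervalIntegral.integral_const_mul] at h1
  have hI : 0 ≤ ∫ s in (0)..T, N s := intervalIntegral.integral_nonneg hT fun s _ => hN0 s
  have h2 : ∫ s in (0)..T, N s ≤ 2 * Real.exp (C₁ * T) * ‖u 0 1‖ ^ 2 := by
    have h3 : (1 : ℝ) ≤ (2 * Real.pi) ^ 2 := by nlinarith [Real.pi_gt_three]
    nlinarith [sq_nonneg ‖u T 1‖]
  have h3 : ∫⁻ t in Icc 0 T, sobSq 2 (fcoeff (u t 1)) = ENNReal.ofReal (∫ s in (0)..T, N s) := by
    rw [intervalIntegral.integral_of_le hT, ← integral_Icc_eq_integral_Ioc,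
      ofReal_integral_eq_lintegral_ofReal hNc.integrableOn_Icc
        (Filter.Eventually.of_forall fun t => hN0 t)]
    refine setLIntegral_congr_fun measurableSet_Icc fun t ht => ?_
    simp only [hN]
    rw [sobSq, ENNReal.ofReal_sum_of_nonneg fun k _ => by positivity,
      tsum_eq_sum (s := S) fun k hk => by rw [hu.supp t ht 1 k hk]; simp]
    simp only [Real.rpow_two]
  rw [h3]
  exact ENNReal.ofReal_le_ofReal h2

end IsGalerkin

/-! ### Bounds that do not depend on the truncation -/

section bounds

variable {ν lam T M : ℝ} {S : Finset (Fin 2 → ℤ)} {θ : ℝ → ℝ} {hθ : LipschitzWith 1 θ}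
  {uin : Fin 2 → L2} {u : ℝ → Fin 2 → L2}

lemma sobSq_ite_le (S : Finset (Fin 2 → ℤ)) (s : ℝ) (c : (Fin 2 → ℤ) → ℂ) :
    sobSq s (fun k => if k ∈ S then c k else 0) ≤ sobSq s c := by
  refine ENNReal.tsum_le_tsum fun k => ENNReal.ofReal_le_ofReal ?_
  have := jb_pos k
  dsimp only
  split_ifs
  · exact le_rfl
  · rw [norm_zero, zero_pow two_ne_zero, mul_zero]
    positivity

lemma IsGalerkin.fcoeff_initial (hu : IsGalerkin ν lam T S θ hθ uin u) (hS : ∀ k ∈ S, -k ∈ S)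
    (i : Fin 2) : fcoeff (u 0 i) = fun k => if k ∈ S then fcoeff (uin i) k else 0 := by
  funext k
  rw [hu.initial, fcoeff_polyL2 hS fun k => fcoeff_neg _ k]

lemma IsGalerkin.sobSq_initial_le (hu : IsGalerkin ν lam T S θ hθ uin u) (hS : ∀ k ∈ S, -k ∈ S)
    (s : ℝ) (i : Fin 2) : sobSq s (fcoeff (u 0 i)) ≤ sobSq s (fcoeff (uin i)) := by
  rw [hu.fcoeff_initial hS]
  exact sobSq_ite_le _ _ _

lemma IsGalerkin.pairSq_initial_le (hu : IsGalerkin ν lam T S θ hθ uin u) (hS : ∀ k ∈ S, -k ∈ S)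
    (s : ℝ) : pairSq s (u 0) ≤ pairSq s uin :=
  Finset.sum_le_sum fun i _ => hu.sobSq_initial_le hS s i

lemma norm_sq_le_of_sobSq_le {f g : L2} (h : sobSq 0 (fcoeff f) ≤ sobSq 0 (fcoeff g)) :
    ‖f‖ ^ 2 ≤ ‖g‖ ^ 2 := by
  rw [sobSq_zero_fcoeff, sobSq_zero_fcoeff, ENNReal.ofReal_le_ofReal_iff (by positivity)] at h
  exact le_of_mul_le_mul_left h (by positivity)

/-- A bound that depends on the approximation, as needed to apply Grönwall's inequality. -/
lemma IsGalerkin.exists_pairSq_le (hu : IsGalerkin ν lam T S θ hθ uin u) (s : ℝ) :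
    ∃ B : ℝ≥0∞, B ≠ ⊤ ∧ ∀ t ∈ Icc 0 T, pairSq s (u t) ≤ B := by
  have hc : ContinuousOn (fun t => ∑ i, ∑ k ∈ S, jb k ^ s * ‖fcoeff (u t i) k‖ ^ 2) (Icc 0 T) :=
    continuousOn_finsetSum _ fun i _ => continuousOn_finsetSum _ fun k _ =>
      continuousOn_const.mul ((continuousOn_fcoeff (continuousOn_pi.mp hu.continuousOn i) k).norm.pow 2)
  obtain ⟨B, hB⟩ := isCompact_Icc.bddAbove_image hc
  refine ⟨ENNReal.ofReal B, ENNReal.ofReal_ne_top, fun t ht => ?_⟩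
  have h0 : ∀ i k, 0 ≤ jb k ^ s * ‖fcoeff (u t i) k‖ ^ 2 := fun i k => by
    have := jb_pos k
    positivity
  have h1 : pairSq s (u t)
      = ENNReal.ofReal (∑ i, ∑ k ∈ S, jb k ^ s * ‖fcoeff (u t i) k‖ ^ 2) := by
    rw [ENNReal.ofReal_sum_of_nonneg fun i _ => Finset.sum_nonneg fun k _ => h0 i k, pairSq]
    refine Finset.sum_congr rfl fun i _ => ?_
    rw [ENNReal.ofReal_sum_of_nonneg fun k _ => h0 i k, sobSq,
      tsum_eq_sum (s := S) fun k hk => by rw [hu.supp t ht i k hk]; simp]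
  rw [h1]
  exact ENNReal.ofReal_le_ofReal (hB (mem_image_of_mem _ ht))

/-- The `L²` bound for the advection terms, the velocity being bounded in `L^∞`. -/
lemma sum_sobSq_adv_le {v : Fin 2 → L2} (hθ : LipschitzWith 1 θ) (hM : ∀ s, |θ s| ≤ M)
    (h1 : pairSq 1 v ≠ ⊤) (h2 : sobSq 2 (fcoeff (v 1)) ≠ ⊤) (i : Fin 2) :
    sobSq 0 (fcoeff (adv θ v (v i)))
      ≤ 2 * (ENNReal.ofReal (M ^ 2) + ENNReal.ofReal embC * sobSq 2 (fcoeff (v 1)))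
        * sobSq 1 (fcoeff (v i)) := by
  have h3 : sobSq (5 / 4) (fcoeff (v 1)) ≤ sobSq 2 (fcoeff (v 1)) := sobSq_mono (by norm_num) _
  have h4 : sobSq (5 / 4) (fcoeff (v 1)) ≠ ⊤ := ne_top_of_le_ne_top h2 h3
  refine (sobSq_adv_le hθ (A := M ^ 2) (Filter.Eventually.of_forall fun x =>
    sq_le_sq' (by linarith [neg_le_of_abs_le (hM (v 0 x))]) (le_of_abs_le (hM _)))
    (ae_sq_le_toReal_mul h4) (ne_top_of_le_ne_top h1 (sobSq_le_pairSq 1 v i))).trans ?_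
  rw [ENNReal.ofReal_toReal (ENNReal.mul_ne_top ENNReal.ofReal_ne_top h4)]
  gcongr

lemma le_inv_mul_of_ofReal_mul_le {c : ℝ} (hc : 0 < c) {a b : ℝ≥0∞} (h : ENNReal.ofReal c * a ≤ b) :
    a ≤ ENNReal.ofReal c⁻¹ * b := by
  calc a = ENNReal.ofReal c⁻¹ * (ENNReal.ofReal c * a) := by
        rw [← mul_assoc, ← ENNReal.ofReal_mul (by positivity), inv_mul_cancel₀ hc.ne',
          ENNReal.ofReal_one, one_mul]
    _ ≤ _ := by gcongr

/-- Bounds that depend neither on the set of frequencies nor on the cut-off `θ` with `|θ| ≤ M`. The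
`L²` energy of the second component bounds it in `L²H²`, hence in `L²L^∞`; the velocity `(θ(u₀), u₁)`
then lies in `L²L^∞`, and the `H¹` energy estimate of the pair closes by Grönwall's inequality. -/
theorem exists_galerkin_bounds (hν : 0 < ν) (lam : ℝ) (hT : 0 ≤ T) (M : ℝ)
    (huin : pairSq 1 uin ≠ ⊤) :
    ∃ K L : ℝ, ∀ S : Finset (Fin 2 → ℤ), (∀ k ∈ S, -k ∈ S) → ∀ θ : ℝ → ℝ,
      ∀ hθ : LipschitzWith 1 θ, (∀ s, |θ s| ≤ M) → ∀ u, IsGalerkin ν lam T S θ hθ uin u →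
      (∀ t ∈ Icc 0 T, pairSq 1 (u t) ≤ ENNReal.ofReal K) ∧
      ∫⁻ t in Icc 0 T, pairSq 2 (u t) ≤ ENNReal.ofReal L ∧
      ∫⁻ t in Icc 0 T, sobSq 3 (fcoeff (u t 1)) ≤ ENNReal.ofReal L ∧
      ∫⁻ t in Icc 0 T, ∑ i, sobSq 0 (fcoeff (adv θ (u t) (u t i))) ≤ ENNReal.ofReal L := by
  obtain ⟨c, hc, C₀, hC₀, hrate⟩ := exists_rate_ge hν lam
  set E : ℝ≥0∞ := ENNReal.ofReal (Real.exp (2 * C₀ * T)) with hE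
  set I₁ : ℝ≥0∞ := ENNReal.ofReal
    (2 * Real.exp ((2 * ((2 + lam) ^ 2 + 2) + 2 * M ^ 2) * T) * ‖uin 1‖ ^ 2) with hI₁
  set A : ℝ≥0∞ := 2 * (ENNReal.ofReal (M ^ 2) * ENNReal.ofReal T + ENNReal.ofReal embC * I₁) with hA
  have hAt : A ≠ ⊤ := by finiteness
  set K : ℝ≥0∞ := E * pairSq 1 uin
    * ENNReal.ofReal (Real.exp (E * ENNReal.ofReal c⁻¹ * A).toReal) with hK
  have hKt : K ≠ ⊤ := by finiteness
  set L₂ : ℝ≥0∞ := ENNReal.ofReal c⁻¹ * (E * (pairSq 1 uin + ENNReal.ofReal c⁻¹ * (A * K))) with hL₂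
  have hL₂t : L₂ ≠ ⊤ := by finiteness
  set C₃ : ℝ := (2 + lam) ^ 2 + 2 with hC₃
  set L₃ : ℝ≥0∞ := ENNReal.ofReal (1 / 2)⁻¹ * (ENNReal.ofReal (Real.exp (2 * C₃ * T))
    * (pairSq 1 uin + ENNReal.ofReal (1 / 2)⁻¹ * (A * K))) with hL₃
  have hL₃t : L₃ ≠ ⊤ := by finiteness
  refine ⟨K.toReal, (A * K + (L₂ + L₃)).toReal, fun S hS θ hθ hM u hu => ?_⟩
  rw [ENNReal.ofReal_toReal hKt, ENNReal.ofReal_toReal (by finiteness)]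
  have hsol := hu.pairSol hS
  have hfin : ∀ t ∈ Icc 0 T, ∀ s i, sobSq s (fcoeff (u t i)) ≠ ⊤ := fun t ht s i =>
    sobSq_ne_top_of_supp (hu.supp t ht i) s
  -- The coefficient `a(t)` dominates the square of the velocity in `L^∞`; its integral is at most `A`.
  set a : ℝ → ℝ≥0∞ := fun t =>
    2 * (ENNReal.ofReal (M ^ 2) + ENNReal.ofReal embC * sobSq 2 (fcoeff (u t 1))) with ha
  have ma : AEMeasurable a (timeMeasure T) :=
    (((aemeasurable_sobSq (hsol.aesm 1) 2).const_mul _).const_add _).const_mul _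
  have hI : ∫⁻ t in Icc 0 T, sobSq 2 (fcoeff (u t 1)) ≤ I₁ := by
    refine (hu.energy_one hS hT hM).trans (ENNReal.ofReal_le_ofReal ?_)
    refine mul_le_mul_of_nonneg_left ?_ (by positivity)
    exact norm_sq_le_of_sobSq_le (hu.sobSq_initial_le hS 0 1)
  have haint : ∫⁻ t in Icc 0 T, a t ≤ A := by
    rw [ha, lintegral_const_mul' _ _ (by simp), lintegral_add_left' aemeasurable_const,
      lintegral_const_mul' _ _ ENNReal.ofReal_ne_top, lintegral_const, Measure.restrict_apply_univ,
      Real.volume_Icc, sub_zero]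
    exact mul_le_mul' le_rfl (add_le_add le_rfl (mul_le_mul' le_rfl hI))
  have hadv : ∀ t ∈ Icc 0 T, ∀ i,
      sobSq 0 (fcoeff (adv θ (u t) (u t i))) ≤ a t * sobSq 1 (fcoeff (u t i)) := fun t ht i =>
    sum_sobSq_adv_le hθ hM (ENNReal.sum_ne_top.mpr fun i _ => hfin t ht 1 i) (hfin t ht 2 1) i
  have hforce : ∀ t ∈ Icc 0 T, ∀ i,
      sobSq 0 (fun k => if k ∈ S then fcoeff (adv θ (u t) (u t i)) k else 0)
        ≤ a t * sobSq 1 (fcoeff (u t i)) := fun t ht i =>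
    (sobSq_ite_le _ _ _).trans (hadv t ht i)
  have mΦ : AEMeasurable (fun t => pairSq 1 (u t)) (timeMeasure T) := aemeasurable_pairSq hsol.aesm 1
  have hen : ∀ t ∈ Icc 0 T, pairSq 1 (u t) + ENNReal.ofReal c * (∫⁻ τ in Icc 0 t, pairSq 2 (u τ))
      ≤ E * (pairSq 1 uin + ENNReal.ofReal c⁻¹ * ∫⁻ τ in Icc 0 t, a τ * pairSq 1 (u τ)) := by
    intro t ht
    have h1 := hsol.energy hC₀ hc hrate 1 ht
    rw [show (1 : ℝ) + 1 = 2 by norm_num, sub_self] at h1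
    refine h1.trans ?_
    refine mul_le_mul' le_rfl (add_le_add ?_ (mul_le_mul' le_rfl ?_))
    · exact hu.pairSq_initial_le hS 1
    · refine setLIntegral_mono_ae' measurableSet_Icc (Filter.Eventually.of_forall fun τ hτ => ?_)
      rw [pairSq, Finset.mul_sum]
      exact Finset.sum_le_sum fun i _ => hforce τ ⟨hτ.1, hτ.2.trans ht.2⟩ i
  obtain ⟨B, hB, hBle⟩ := hu.exists_pairSq_le 1
  have hinfin : ∀ {t}, t ∈ Icc 0 T → ∫⁻ τ in Icc 0 t, a τ ≤ A := fun ht =>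
    (lintegral_mono_set (Icc_subset_Icc_right ht.2)).trans haint
  have hKle : ∀ t ∈ Icc 0 T, pairSq 1 (u t) ≤ K := by
    intro t ht
    have h2 := gronwall hT (Φ := fun t => pairSq 1 (u t)) (a := fun t => E * ENNReal.ofReal c⁻¹ * a t)
      (c := E * pairSq 1 uin) (by finiteness) hB mΦ
      ((ae_restrict_iff' measurableSet_Icc).mpr (Filter.Eventually.of_forall hBle))
      (ma.const_mul _) (by
        rw [lintegral_const_mul' _ _ (by finiteness)]
        exact ENNReal.mul_ne_top (by finiteness) (ne_top_of_le_ne_top hAt haint))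
      (fun t ht => by
        refine le_self_add.trans ((hen t ht).trans_eq ?_)
        rw [mul_add, ← mul_assoc]
        congr 1
        rw [← lintegral_const_mul' _ _ (by finiteness)]
        simp only [mul_assoc]) ht
    refine h2.trans ?_
    rw [hK, lintegral_const_mul' _ _ (by finiteness)]
    gcongr
    finiteness
  have haK : ∫⁻ τ in Icc 0 T, a τ * pairSq 1 (u τ) ≤ A * K := by
    calc ∫⁻ τ in Icc 0 T, a τ * pairSq 1 (u τ) ≤ ∫⁻ τ in Icc 0 T, a τ * K :=
          setLIntegral_mono_ae' measurableSet_Icc (Filter.Eventually.of_forall fun τ hτ => by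
            gcongr
            exact hKle τ hτ)
      _ = (∫⁻ τ in Icc 0 T, a τ) * K := lintegral_mul_const' _ _ hKt
      _ ≤ A * K := by gcongr
  -- It remains to read off the dissipation: in `H¹` for the pair at order two, and in `H¹` for the second
  -- component at order four.
  have hTT : T ∈ Icc 0 T := ⟨hT, le_rfl⟩
  refine ⟨hKle, le_trans ?_ (le_self_add.trans le_add_self),
    le_trans ?_ (le_add_self.trans le_add_self), le_trans ?_ le_self_add⟩
  · refine le_inv_mul_of_ofReal_mul_le hc (le_add_self.trans ((hen T hTT).trans ?_))
    gcongr
  · have h1 := energy_sobSq (by positivity : 0 ≤ C₃) (by norm_num : (0 : ℝ) < 1 / 2)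
      (rate_one_ge ν lam) (hsol 1) 1 hTT
    rw [show (1 : ℝ) + 2 = 3 by norm_num] at h1
    refine le_inv_mul_of_ofReal_mul_le (by norm_num) (le_add_self.trans (h1.trans ?_))
    refine mul_le_mul' le_rfl (add_le_add ?_ (mul_le_mul' le_rfl ?_))
    · exact (sobSq_le_pairSq 1 _ 1).trans (hu.pairSq_initial_le hS 1)
    · refine le_trans ?_ haK
      refine setLIntegral_mono_ae' measurableSet_Icc (Filter.Eventually.of_forall fun τ hτ => ?_)
      refine (sobSq_mono (by norm_num : (1 : ℝ) - 2 ≤ 0) _).trans ((hforce τ hτ 1).trans ?_)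
      gcongr
      exact sobSq_le_pairSq 1 _ 1
  · refine le_trans ?_ haK
    refine setLIntegral_mono_ae' measurableSet_Icc (Filter.Eventually.of_forall fun τ hτ => ?_)
    rw [pairSq, Finset.mul_sum]
    exact Finset.sum_le_sum fun i _ => hadv τ hτ i

end bounds

/-! ### Truncation, and the passage to the limit in the advection terms -/

/-- The frequencies `k` with `|k₀|, |k₁| ≤ n`. -/
def box (n : ℕ) : Finset (Fin 2 → ℤ) := Fintype.piFinset fun _ => Finset.Icc (-(n : ℤ)) n

lemma mem_box {n : ℕ} {k : Fin 2 → ℤ} : k ∈ box n ↔ ∀ j, |k j| ≤ n := by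
  simp [box, Fintype.mem_piFinset, abs_le]

lemma neg_mem_box {n : ℕ} : ∀ k ∈ box n, -k ∈ box n := fun k hk => by
  simpa [mem_box] using hk

lemma box_mono {n m : ℕ} (h : n ≤ m) {k : Fin 2 → ℤ} (hk : k ∈ box n) : k ∈ box m :=
  mem_box.mpr fun j => (mem_box.mp hk j).trans (by exact_mod_cast h)

lemma exists_mem_box (k : Fin 2 → ℤ) : ∃ n, k ∈ box n :=
  ⟨(|k 0| + |k 1|).toNat, mem_box.mpr fun j => by
    have h0 := abs_nonneg (k 0)
    have h1 := abs_nonneg (k 1)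
    rw [Int.toNat_of_nonneg (by positivity)]
    fin_cases j <;> simp⟩

lemma le_jb_of_notMem_box {n : ℕ} {k : Fin 2 → ℤ} (hk : k ∉ box n) : (n : ℝ) + 1 ≤ jb k := by
  rw [mem_box] at hk
  push Not at hk
  obtain ⟨j, hj⟩ := hk
  have h1 : ((n : ℝ) + 1) ≤ |(k j : ℝ)| := by
    have : (n : ℤ) + 1 ≤ |k j| := hj
    exact_mod_cast this
  have h2 := sq_le_jb k j
  have h3 : (0 : ℝ) ≤ n := by positivity
  nlinarith [sq_abs (k j : ℝ)]

lemma tendsto_polyL2_box (f : L2) :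
    Filter.Tendsto (fun n => polyL2 (box n) (fcoeff f)) Filter.atTop (nhds f) := by
  rw [tendsto_iff_norm_sub_tendsto_zero]
  have h1 : ∀ n, ‖polyL2 (box n) (fcoeff f) - f‖ ^ 2
      = (2 * Real.pi) ^ 2 * ∑' k, ‖(if k ∈ box n then 0 else fcoeff f k : ℂ)‖ ^ 2 := fun n => by
    have h := (hasSum_norm_fcoeff_sq (polyL2 (box n) (fcoeff f) - f)).tsum_eq
    have h2 : ∀ k, ‖fcoeff (polyL2 (box n) (fcoeff f) - f : L2) k‖
        = ‖(if k ∈ box n then 0 else fcoeff f k : ℂ)‖ := fun k => by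
      rw [fcoeff_sub, fcoeff_polyL2 neg_mem_box fun k => fcoeff_neg _ k]
      split_ifs <;> simp
    simp only [h2] at h
    rw [h, ← mul_assoc, mul_inv_cancel₀ (by positivity), one_mul]
  have h2 : Filter.Tendsto (fun n => ∑' k, ‖(if k ∈ box n then 0 else fcoeff f k : ℂ)‖ ^ 2)
      Filter.atTop (nhds (∑' _ : Fin 2 → ℤ, (0 : ℝ))) := by
    refine tendsto_tsum_of_dominated_convergence (hasSum_norm_fcoeff_sq f).summable (fun k => ?_)
      (Filter.Eventually.of_forall fun n k => ?_)
    · obtain ⟨n, hn⟩ := exists_mem_box k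
      refine tendsto_const_nhds.congr' ?_
      filter_upwards [Filter.eventually_ge_atTop n] with m hm
      simp [box_mono hm hn]
    · split_ifs <;> simp
  rw [tsum_zero] at h2
  have h3 : Filter.Tendsto (fun n => ‖polyL2 (box n) (fcoeff f) - f‖ ^ 2) Filter.atTop (nhds 0) := by
    simp only [h1]
    simpa using h2.const_mul ((2 * Real.pi) ^ 2)
  have h4 := h3.sqrt
  simpa [Real.sqrt_sq] using h4

lemma L2.inner_eq_integral (f g : L2) : inner ℝ f g = ∫ x, f x * g x := by
  rw [L2.inner_def]
  refine integral_congr_ae (Filter.Eventually.of_forall fun x => ?_)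
  simp [mul_comm]

/-- A bounded sequence in `L²` whose Fourier coefficients converge is weakly convergent. The product
with a strongly convergent sequence passes to the limit. -/
lemma tendsto_inner_of_tendsto_fcoeff {a b : ℕ → L2} {a' b' : L2} {B : ℝ} (hB : ∀ n, ‖b n‖ ≤ B)
    (hb : ∀ k, Filter.Tendsto (fun n => fcoeff (b n) k) Filter.atTop (nhds (fcoeff b' k)))
    (ha : Filter.Tendsto a Filter.atTop (nhds a')) :
    Filter.Tendsto (fun n => inner ℝ (a n) (b n)) Filter.atTop (nhds (inner ℝ a' b')) := by
  have hB0 : 0 ≤ B := (norm_nonneg _).trans (hB 0)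
  have hpoly : ∀ N, Filter.Tendsto (fun n => inner ℝ (polyL2 (box N) (fcoeff a')) (b n - b'))
      Filter.atTop (nhds 0) := fun N => by
    have h1 : ∀ n, inner ℝ (polyL2 (box N) (fcoeff a')) (b n - b')
        = (2 * Real.pi) ^ 2 * (∑ k ∈ box N, fcoeff a' k * conj (fcoeff (b n) k - fcoeff b' k)).re :=
      fun n => by
        rw [L2.inner_eq_integral, integral_mul_eq_tsum (Lp.memLp _) (Lp.memLp _),
          tsum_eq_sum (s := box N) fun k hk => by
            rw [fcoeff_polyL2 neg_mem_box fun k => fcoeff_neg _ k, if_neg hk, zero_mul]]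
        congr 2
        refine Finset.sum_congr rfl fun k hk => ?_
        rw [fcoeff_polyL2 neg_mem_box fun k => fcoeff_neg _ k, if_pos hk, fcoeff_sub]
    simp only [h1]
    have h2 : Filter.Tendsto (fun n => ∑ k ∈ box N, fcoeff a' k *
        conj (fcoeff (b n) k - fcoeff b' k)) Filter.atTop
        (nhds (∑ k ∈ box N, fcoeff a' k * conj (fcoeff b' k - fcoeff b' k))) :=
      tendsto_finsetSum _ fun k _ => (Complex.continuous_conj.continuousAt.tendsto.comp
        ((hb k).sub_const _)).const_mul _
    have h3 := (Complex.continuous_re.continuousAt.tendsto.comp h2).const_mul ((2 * Real.pi) ^ 2)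
    simpa using h3
  have hbd : ∀ n, ‖b n - b'‖ ≤ B + ‖b'‖ := fun n => (norm_sub_le _ _).trans (by gcongr; exact hB n)
  have hweak : Filter.Tendsto (fun n => inner ℝ a' (b n - b')) Filter.atTop (nhds 0) := by
    rw [Metric.tendsto_atTop]
    intro ε hε
    have hN := (tendsto_iff_norm_sub_tendsto_zero.mp (tendsto_polyL2_box a'))
    obtain ⟨N, hN⟩ := (hN.eventually (gt_mem_nhds
      (show (0 : ℝ) < ε / (2 * (B + ‖b'‖ + 1)) by positivity))).exists
    obtain ⟨n₀, hn₀⟩ := Metric.tendsto_atTop.mp (hpoly N) (ε / 2) (by positivity)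
    refine ⟨n₀, fun n hn => ?_⟩
    have h1 := hn₀ n hn
    rw [Real.dist_eq, sub_zero] at h1 ⊢
    have h2 : inner ℝ a' (b n - b') = inner ℝ (polyL2 (box N) (fcoeff a')) (b n - b')
        - inner ℝ (polyL2 (box N) (fcoeff a') - a') (b n - b') := by
      rw [inner_sub_left]; ring
    have h3 := abs_real_inner_le_norm (polyL2 (box N) (fcoeff a') - a') (b n - b')
    have h4 : ‖polyL2 (box N) (fcoeff a') - a'‖ * ‖b n - b'‖ ≤ ε / 2 := by
      calc _ ≤ ε / (2 * (B + ‖b'‖ + 1)) * (B + ‖b'‖ + 1) := by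
            gcongr
            exact (hbd n).trans (by linarith)
        _ = ε / 2 := by field_simp
    rw [h2]
    have h5 := abs_sub (inner ℝ (polyL2 (box N) (fcoeff a')) (b n - b'))
      (inner ℝ (polyL2 (box N) (fcoeff a') - a') (b n - b'))
    linarith
  have hstrong : Filter.Tendsto (fun n => inner ℝ (a n - a') (b n)) Filter.atTop (nhds 0) := by
    have h1 := (tendsto_iff_norm_sub_tendsto_zero.mp ha).mul_const B
    rw [zero_mul] at h1
    refine squeeze_zero_norm (fun n => ?_) h1
    exact (abs_real_inner_le_norm _ _).trans (by gcongr; exact hB n)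
  have h := (hstrong.add hweak).add_const (inner ℝ a' b')
  simp only [add_zero, zero_add] at h
  refine h.congr fun n => ?_
  rw [inner_sub_left, inner_sub_right]
  ring

section adv

variable {θ : ℝ → ℝ}

lemma memLp_theta_mul (hθ : LipschitzWith 1 θ) (h0 : θ 0 = 0) (φ : C(Torus, ℝ)) (f : L2) :
    MemLp (fun x => φ x * θ (f x)) 2 volume := by
  refine (Lp.memLp f).of_le_mul (c := ‖φ‖)
    (φ.continuous.aestronglyMeasurable.mul (aesm_theta hθ f)) (Filter.Eventually.of_forall fun x => ?_)
  rw [norm_mul]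
  gcongr
  · exact φ.norm_coe_le_norm x
  · exact abs_theta_le hθ h0 _

/-- The function `φ · θ(f)`. -/
def thetaMul (hθ : LipschitzWith 1 θ) (h0 : θ 0 = 0) (φ : C(Torus, ℝ)) (f : L2) : L2 :=
  (memLp_theta_mul hθ h0 φ f).toLp _

lemma coeFn_thetaMul (hθ : LipschitzWith 1 θ) (h0 : θ 0 = 0) (φ : C(Torus, ℝ)) (f : L2) :
    thetaMul hθ h0 φ f =ᵐ[volume] fun x => φ x * θ (f x) := MemLp.coeFn_toLp _

lemma norm_thetaMul_sub_le (hθ : LipschitzWith 1 θ) (h0 : θ 0 = 0) (φ : C(Torus, ℝ)) (f g : L2) :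
    ‖thetaMul hθ h0 φ f - thetaMul hθ h0 φ g‖ ≤ ‖φ‖ * ‖f - g‖ := by
  refine Lp.norm_le_mul_norm_of_ae_le_mul ?_
  filter_upwards [Lp.coeFn_sub (thetaMul hθ h0 φ f) (thetaMul hθ h0 φ g), Lp.coeFn_sub f g,
    coeFn_thetaMul hθ h0 φ f, coeFn_thetaMul hθ h0 φ g] with x h1 h2 h3 h4
  rw [h1, h2, Pi.sub_apply, Pi.sub_apply, h3, h4, ← mul_sub, norm_mul]
  gcongr
  · exact φ.norm_coe_le_norm x
  · simpa [dist_eq_norm] using hθ.dist_le_mul (f x) (g x)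

lemma norm_thetaMul_le (hθ : LipschitzWith 1 θ) (h0 : θ 0 = 0) (φ : C(Torus, ℝ)) (f : L2) :
    ‖thetaMul hθ h0 φ f‖ ≤ ‖φ‖ * ‖f‖ := by
  refine Lp.norm_le_mul_norm_of_ae_le_mul ?_
  filter_upwards [coeFn_thetaMul hθ h0 φ f] with x h1
  rw [h1, norm_mul]
  gcongr
  · exact φ.norm_coe_le_norm x
  · exact abs_theta_le hθ h0 _

lemma integrable_adv (hθ : LipschitzWith 1 θ) (h0 : θ 0 = 0) (u : Fin 2 → L2) (f : L2) :
    Integrable (adv θ u f) := by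
  refine Integrable.add ?_ ((Lp.memLp (u 1)).integrable_mul (Lp.memLp (wpartial 1 f)))
  have h := memLp_theta_mul hθ h0 1 (u 0)
  simp only [ContinuousMap.one_apply, one_mul] at h
  exact h.integrable_mul (Lp.memLp (wpartial 0 f))

/-- The Fourier coefficients of the advection term are inner products of `θ(u₀) e_k` and `u₁ e_k`, which
converge strongly when `u` does, with derivatives, which converge weakly. -/
lemma re_mul_fcoeff_adv (hθ : LipschitzWith 1 θ) (h0 : θ 0 = 0) (u : Fin 2 → L2) (f : L2) (c : ℂ)
    (k : Fin 2 → ℤ) :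
    (2 * Real.pi) ^ 2 * (c * fcoeff (adv θ u f) k).re
      = inner ℝ (thetaMul hθ h0 (modeMap (-k) c) (u 0)) (wpartial 0 f)
        + inner ℝ (thetaMul LipschitzWith.id rfl (modeMap (-k) c) (u 1)) (wpartial 1 f) := by
  rw [← integral_mul_re_expMode (integrable_adv hθ h0 u f), L2.inner_eq_integral,
    L2.inner_eq_integral,
    ← integral_add ((Lp.memLp _).integrable_mul (Lp.memLp _)) ((Lp.memLp _).integrable_mul (Lp.memLp _))]
  refine integral_congr_ae ?_
  filter_upwards [coeFn_thetaMul hθ h0 (modeMap (-k) c) (u 0),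
    coeFn_thetaMul LipschitzWith.id rfl (modeMap (-k) c) (u 1)] with x h1 h2
  rw [h1, h2, adv, modeMap_apply, id]
  ring

lemma norm_fcoeff_adv_le (hθ : LipschitzWith 1 θ) (h0 : θ 0 = 0) (u : Fin 2 → L2) (f : L2)
    (k : Fin 2 → ℤ) :
    ‖fcoeff (adv θ u f) k‖ ≤ (‖modeMap (-k) 1‖ + ‖modeMap (-k) (-Complex.I)‖)
      * (‖u 0‖ * ‖wpartial 0 f‖ + ‖u 1‖ * ‖wpartial 1 f‖) := by
  have h1 : ∀ c : ℂ, |(c * fcoeff (adv θ u f) k).re| ≤ ‖modeMap (-k) c‖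
      * (‖u 0‖ * ‖wpartial 0 f‖ + ‖u 1‖ * ‖wpartial 1 f‖) := fun c => by
    have h2 := re_mul_fcoeff_adv hθ h0 u f c k
    have h3 := abs_real_inner_le_norm (thetaMul hθ h0 (modeMap (-k) c) (u 0)) (wpartial 0 f)
    have h4 := abs_real_inner_le_norm (thetaMul LipschitzWith.id rfl (modeMap (-k) c) (u 1))
      (wpartial 1 f)
    have h5 := mul_le_mul_of_nonneg_right (norm_thetaMul_le hθ h0 (modeMap (-k) c) (u 0))
      (norm_nonneg (wpartial 0 f))
    have h6 := mul_le_mul_of_nonneg_right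
      (norm_thetaMul_le LipschitzWith.id rfl (modeMap (-k) c) (u 1)) (norm_nonneg (wpartial 1 f))
    have h7 : (1 : ℝ) ≤ (2 * Real.pi) ^ 2 := by nlinarith [Real.pi_gt_three]
    calc |(c * fcoeff (adv θ u f) k).re| ≤ (2 * Real.pi) ^ 2 * |(c * fcoeff (adv θ u f) k).re| :=
          le_mul_of_one_le_left (abs_nonneg _) h7
      _ = |(2 * Real.pi) ^ 2 * (c * fcoeff (adv θ u f) k).re| := by
          rw [abs_mul, abs_of_nonneg (by positivity : (0 : ℝ) ≤ (2 * Real.pi) ^ 2)]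
      _ ≤ _ := by
          rw [h2]
          refine (abs_add_le _ _).trans ?_
          linarith
  refine (Complex.norm_le_abs_re_add_abs_im _).trans ?_
  have h2 := h1 1
  have h3 := h1 (-Complex.I)
  simp only [one_mul, neg_mul, Complex.neg_re, Complex.I_mul_re, neg_neg] at h2 h3
  linarith

/-- The advection terms converge coefficientwise along a sequence that converges in `L²` and is bounded
in `H¹`. -/
lemma tendsto_fcoeff_adv (hθ : LipschitzWith 1 θ) (h0 : θ 0 = 0) {u : ℕ → Fin 2 → L2}
    {u' : Fin 2 → L2} {B : ℝ≥0∞} (hB : B ≠ ⊤) (huB : ∀ n i, sobSq 1 (fcoeff (u n i)) ≤ B)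
    (hu' : ∀ i, sobSq 1 (fcoeff (u' i)) ≠ ⊤)
    (hu : ∀ i, Filter.Tendsto (fun n => u n i) Filter.atTop (nhds (u' i))) (i : Fin 2)
    (k : Fin 2 → ℤ) :
    Filter.Tendsto (fun n => fcoeff (adv θ (u n) (u n i)) k) Filter.atTop
      (nhds (fcoeff (adv θ u' (u' i)) k)) := by
  have hfin : ∀ n i, sobSq 1 (fcoeff (u n i)) ≠ ⊤ := fun n i => ne_top_of_le_ne_top hB (huB n i)
  have hbd : ∀ j n, ‖wpartial j (u n i)‖ ≤ Real.sqrt ((2 * Real.pi) ^ 2 * B.toReal) := fun j n => by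
    refine Real.le_sqrt_of_sq_le ?_
    have h1 := (sobSq_zero_wpartial_le (hfin n i) j).trans (huB n i)
    rw [sobSq_zero_fcoeff] at h1
    have h2 := (ENNReal.ofReal_le_iff_le_toReal hB).mp h1
    rw [inv_mul_le_iff₀ (by positivity)] at h2
    exact h2
  have hconv : ∀ j l, Filter.Tendsto (fun n => fcoeff (wpartial j (u n i)) l) Filter.atTop
      (nhds (fcoeff (wpartial j (u' i)) l)) := fun j l => by
    simp only [fcoeff_wpartial (hfin _ i), fcoeff_wpartial (hu' i)]
    exact (((fcoeffCLM l).continuous.tendsto (u' i)).comp (hu i)).const_mul _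
  have hth : ∀ {θ : ℝ → ℝ} (hθ : LipschitzWith 1 θ) (h0 : θ 0 = 0) (φ : C(Torus, ℝ)) (j : Fin 2),
      Filter.Tendsto (fun n => thetaMul hθ h0 φ (u n j)) Filter.atTop
        (nhds (thetaMul hθ h0 φ (u' j))) := fun hθ h0 φ j => by
    rw [tendsto_iff_norm_sub_tendsto_zero]
    have h1 := (tendsto_iff_norm_sub_tendsto_zero.mp (hu j)).const_mul ‖φ‖
    rw [mul_zero] at h1
    exact squeeze_zero (fun n => norm_nonneg _) (fun n => norm_thetaMul_sub_le hθ h0 φ _ _) h1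
  have hre : ∀ c : ℂ, Filter.Tendsto (fun n => (c * fcoeff (adv θ (u n) (u n i)) k).re) Filter.atTop
      (nhds (c * fcoeff (adv θ u' (u' i)) k).re) := fun c => by
    have h1 := (tendsto_inner_of_tendsto_fcoeff (hbd 0) (hconv 0) (hth hθ h0 (modeMap (-k) c) 0)).add
      (tendsto_inner_of_tendsto_fcoeff (hbd 1) (hconv 1)
        (hth LipschitzWith.id rfl (modeMap (-k) c) 1))
    simp only [← re_mul_fcoeff_adv] at h1
    have h2 := h1.const_mul ((2 * Real.pi) ^ 2)⁻¹
    have h3 : ((2 * Real.pi) ^ 2)⁻¹ * (2 * Real.pi) ^ 2 = 1 := inv_mul_cancel₀ (by positivity)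
    simpa only [← mul_assoc, h3, one_mul] using h2
  have h1 := hre 1
  have h2 := hre (-Complex.I)
  simp only [one_mul, neg_mul, Complex.neg_re, Complex.I_mul_re, neg_neg] at h1 h2
  have h3 := (Complex.continuous_ofReal.tendsto _).comp h1
  have h4 := ((Complex.continuous_ofReal.tendsto _).comp h2).mul_const Complex.I
  have h5 := h3.add h4
  simpa only [Function.comp_def, Complex.re_add_im] using h5

end adv

/-! ### Convergence of the Galerkin approximations -/

lemma jb_rpow_neg_half_le {n : ℕ} {k : Fin 2 → ℤ} (hk : k ∉ box n) :
    jb k ^ (-(1 / 2) : ℝ) ≤ ((n : ℝ) + 1) ^ (-(1 / 2) : ℝ) :=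
  Real.rpow_le_rpow_of_nonpos (by positivity) (le_jb_of_notMem_box hk) (by norm_num)

/-- The difference of two truncated families, in terms of the difference of the families. -/
lemma sobSq_truncate_sub_le {n N N' : ℕ} (hN : n ≤ N) (hN' : n ≤ N') (a b : (Fin 2 → ℤ) → ℂ) :
    sobSq (-(1 / 2)) (fun k => (if k ∈ box N then a k else 0) - if k ∈ box N' then b k else 0)
      ≤ 2 * sobSq 0 (fun k => a k - b k)
        + 2 * ENNReal.ofReal (((n : ℝ) + 1) ^ (-(1 / 2) : ℝ)) * sobSq 0 b := by
  rw [sobSq, sobSq, sobSq, mul_assoc, ← ENNReal.tsum_mul_left, ← ENNReal.tsum_mul_left,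
    ← ENNReal.tsum_mul_left, ← ENNReal.tsum_add]
  refine ENNReal.tsum_le_tsum fun k => ?_
  set r := ((n : ℝ) + 1) ^ (-(1 / 2) : ℝ) with hr
  have hr0 : 0 ≤ r := by positivity
  simp only [Real.rpow_zero, one_mul]
  rw [← ENNReal.ofReal_mul hr0, ← ENNReal.ofReal_ofNat 2, ← ENNReal.ofReal_mul (by norm_num),
    ← ENNReal.ofReal_mul (by norm_num), ← ENNReal.ofReal_add (by positivity) (by positivity)]
  refine ENNReal.ofReal_le_ofReal ?_
  have hj := jb_pos k
  have hj0 : 0 ≤ jb k ^ (-(1 / 2) : ℝ) := by positivity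
  have hj1 : jb k ^ (-(1 / 2) : ℝ) ≤ 1 :=
    Real.rpow_le_one_of_one_le_of_nonpos (one_le_jb k) (by norm_num)
  have h1 : ‖a k‖ ^ 2 ≤ 2 * ‖a k - b k‖ ^ 2 + 2 * ‖b k‖ ^ 2 := by
    have h2 : ‖a k‖ ≤ ‖a k - b k‖ + ‖b k‖ := by simpa using norm_add_le (a k - b k) (b k)
    nlinarith [norm_nonneg (a k), sq_nonneg (‖a k - b k‖ - ‖b k‖)]
  by_cases hk : k ∈ box N <;> by_cases hk' : k ∈ box N'
  · simp only [hk, hk', if_true]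
    have h2 := mul_le_mul_of_nonneg_right hj1 (sq_nonneg ‖a k - b k‖)
    have h3 : 0 ≤ r * ‖b k‖ ^ 2 := by positivity
    nlinarith [sq_nonneg ‖a k - b k‖]
  · simp only [hk, hk', if_true, if_false, sub_zero]
    have hle := jb_rpow_neg_half_le fun h => hk' (box_mono hN' h)
    have h2 := mul_le_mul_of_nonneg_left h1 hj0
    have h3 := mul_le_mul_of_nonneg_right hj1 (sq_nonneg ‖a k - b k‖)
    have h4 := mul_le_mul_of_nonneg_right hle (sq_nonneg ‖b k‖)
    nlinarith
  · simp only [hk, hk', if_true, if_false, zero_sub, norm_neg]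
    have hle := jb_rpow_neg_half_le fun h => hk (box_mono hN h)
    have h4 := mul_le_mul_of_nonneg_right hle (sq_nonneg ‖b k‖)
    have h3 : 0 ≤ r * ‖b k‖ ^ 2 := by positivity
    nlinarith [sq_nonneg ‖a k - b k‖]
  · simp only [hk, hk', if_false, sub_zero, norm_zero, ne_eq, OfNat.ofNat_ne_zero,
      not_false_eq_true, zero_pow, mul_zero]
    positivity

/-- Two truncations of a family bounded in `H¹` are close in `H^{1/2}`. -/
lemma sobSq_half_truncate_sub_le {n N N' : ℕ} (hN : n ≤ N) (hN' : n ≤ N') (a : (Fin 2 → ℤ) → ℂ) :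
    sobSq (1 / 2) (fun k => (if k ∈ box N then a k else 0) - if k ∈ box N' then a k else 0)
      ≤ ENNReal.ofReal (((n : ℝ) + 1) ^ (-(1 / 2) : ℝ)) * sobSq 1 a := by
  rw [sobSq, sobSq, ← ENNReal.tsum_mul_left]
  refine ENNReal.tsum_le_tsum fun k => ?_
  rw [← ENNReal.ofReal_mul (by positivity)]
  refine ENNReal.ofReal_le_ofReal ?_
  have hj := jb_pos k
  have hle : k ∉ box n → jb k ^ (1 / 2 : ℝ) * ‖a k‖ ^ 2
      ≤ ((n : ℝ) + 1) ^ (-(1 / 2) : ℝ) * (jb k ^ (1 : ℝ) * ‖a k‖ ^ 2) := fun hk => by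
    rw [show jb k ^ (1 / 2 : ℝ) = jb k ^ (-(1 / 2) : ℝ) * jb k ^ (1 : ℝ) by
      rw [← Real.rpow_add hj]; norm_num, mul_assoc]
    exact mul_le_mul_of_nonneg_right (jb_rpow_neg_half_le hk) (by positivity)
  by_cases hk : k ∈ box N <;> by_cases hk' : k ∈ box N'
  · simp only [hk, hk', if_true, sub_self, norm_zero, ne_eq, OfNat.ofNat_ne_zero,
      not_false_eq_true, zero_pow, mul_zero]
    positivity
  · simp only [hk, hk', if_true, if_false, sub_zero]
    exact hle fun h => hk' (box_mono hN' h)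
  · simp only [hk, hk', if_true, if_false, zero_sub, norm_neg]
    exact hle fun h => hk (box_mono hN h)
  · simp only [hk, hk', if_false, sub_zero, norm_zero, ne_eq, OfNat.ofNat_ne_zero,
      not_false_eq_true, zero_pow, mul_zero]
    positivity

lemma norm_sq_eq_toReal (f : L2) : ‖f‖ ^ 2 = (2 * Real.pi) ^ 2 * (sobSq 0 (fcoeff f)).toReal := by
  rw [sobSq_zero_fcoeff, ENNReal.toReal_ofReal (by positivity), ← mul_assoc,
    mul_inv_cancel₀ (by positivity), one_mul]

lemma norm_le_of_sobSq_le {f : L2} {B : ℝ≥0∞} (hB : B ≠ ⊤) (h : sobSq 0 (fcoeff f) ≤ B) :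
    ‖f‖ ≤ Real.sqrt ((2 * Real.pi) ^ 2 * B.toReal) := by
  refine Real.le_sqrt_of_sq_le ?_
  rw [norm_sq_eq_toReal]
  gcongr

/-- Lower semicontinuity of the Sobolev norms under convergence of the coefficients. -/
lemma sobSq_le_liminf {s : ℝ} {c : ℕ → (Fin 2 → ℤ) → ℂ} {c' : (Fin 2 → ℤ) → ℂ}
    (h : ∀ k, Filter.Tendsto (fun n => c n k) Filter.atTop (nhds (c' k))) :
    sobSq s c' ≤ Filter.liminf (fun n => sobSq s (c n)) Filter.atTop := by
  have h1 := lintegral_liminf_le (μ := (Measure.count : Measure (Fin 2 → ℤ)))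
    (f := fun (n : ℕ) k => ENNReal.ofReal (jb k ^ s * ‖c n k‖ ^ 2)) (u := Filter.atTop)
    fun n => measurable_of_countable _
  simp only [lintegral_count] at h1
  refine le_trans (le_of_eq ?_) h1
  rw [sobSq]
  refine tsum_congr fun k => Eq.symm (Filter.Tendsto.liminf_eq ?_)
  exact ENNReal.tendsto_ofReal (((h k).norm.pow 2).const_mul _)

lemma tendsto_fcoeff {u : ℕ → L2} {v : L2} (h : Filter.Tendsto u Filter.atTop (nhds v))
    (k : Fin 2 → ℤ) : Filter.Tendsto (fun n => fcoeff (u n) k) Filter.atTop (nhds (fcoeff v k)) :=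
  ((fcoeffCLM k).continuous.tendsto v).comp h

lemma sobSq_le_of_tendsto {s : ℝ} {u : ℕ → L2} {v : L2} {B : ℝ≥0∞}
    (h : Filter.Tendsto u Filter.atTop (nhds v)) (hB : ∀ n, sobSq s (fcoeff (u n)) ≤ B) :
    sobSq s (fcoeff v) ≤ B :=
  (sobSq_le_liminf (tendsto_fcoeff h)).trans ((Filter.liminf_le_liminf
    (Filter.Eventually.of_forall hB)).trans_eq (Filter.liminf_const B))

lemma lintegral_sobSq_le_of_tendsto {T s : ℝ} {u : ℕ → ℝ → L2} {v : ℝ → L2} {B : ℝ≥0∞}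
    (hm : ∀ n k, AEStronglyMeasurable (fun t => fcoeff (u n t) k) (timeMeasure T))
    (h : ∀ t ∈ Icc 0 T, Filter.Tendsto (fun n => u n t) Filter.atTop (nhds (v t)))
    (hB : ∀ n, ∫⁻ t in Icc 0 T, sobSq s (fcoeff (u n t)) ≤ B) :
    ∫⁻ t in Icc 0 T, sobSq s (fcoeff (v t)) ≤ B := by
  calc ∫⁻ t in Icc 0 T, sobSq s (fcoeff (v t))
      ≤ ∫⁻ t in Icc 0 T, Filter.liminf (fun n => sobSq s (fcoeff (u n t))) Filter.atTop :=
        setLIntegral_mono_ae' measurableSet_Icc (Filter.Eventually.of_forall fun t ht =>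
          sobSq_le_liminf (tendsto_fcoeff (h t ht)))
    _ ≤ Filter.liminf (fun n => ∫⁻ t in Icc 0 T, sobSq s (fcoeff (u n t))) Filter.atTop :=
        lintegral_liminf_le' fun n => aemeasurable_sobSq (hm n) s
    _ ≤ B := (Filter.liminf_le_liminf (Filter.Eventually.of_forall hB)).trans_eq
        (Filter.liminf_const B)

/-- The Galerkin approximations converge, and their limit solves the system with the advection
velocity `(θ(u₀), u₁)`. -/
theorem exists_galerkin_limit {ν : ℝ} (hν : 0 < ν) (lam : ℝ) {T : ℝ} (hT : 0 ≤ T) {M : ℝ}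
    {θ : ℝ → ℝ} (hθ : LipschitzWith 1 θ) (h0 : θ 0 = 0) (hM : ∀ s, |θ s| ≤ M) {uin : Fin 2 → L2}
    (huin : pairSq 1 uin ≠ ⊤) :
    ∃ (u : ℕ → ℝ → Fin 2 → L2) (v : ℝ → Fin 2 → L2) (K L : ℝ),
      (∀ n, IsGalerkin ν lam T (box n) θ hθ uin (u n)) ∧
      (∀ n, ∀ t ∈ Icc 0 T, pairSq 1 (u n t) ≤ ENNReal.ofReal K) ∧
      (∀ n, ∫⁻ t in Icc 0 T, pairSq 2 (u n t) ≤ ENNReal.ofReal L) ∧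
      (∀ n, ∫⁻ t in Icc 0 T, ∑ i, sobSq 0 (fcoeff (adv θ (u n t) (u n t i))) ≤ ENNReal.ofReal L) ∧
      (∀ t ∈ Icc 0 T, ∀ i, Filter.Tendsto (fun n => u n t i) Filter.atTop (nhds (v t i))) ∧
      v 0 = uin ∧
      (∀ t ∈ Icc 0 T, ∀ i, sobSq 1 (fcoeff (v t i)) ≤ ENNReal.ofReal K) ∧
      (∀ i, ∫⁻ t in Icc 0 T, sobSq 2 (fcoeff (v t i)) ≤ ENNReal.ofReal L) ∧
      ∫⁻ t in Icc 0 T, sobSq 3 (fcoeff (v t 1)) ≤ ENNReal.ofReal L ∧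
      PairSol ν lam T v fun t i k => fcoeff (adv θ (v t) (v t i)) k := by
  obtain ⟨K, L, hKL⟩ := exists_galerkin_bounds hν lam hT M huin
  obtain ⟨C, hC⟩ := exists_stability hν lam hT K L
  choose u hu using fun n : ℕ => exists_isGalerkin ν lam hT (neg_mem_box (n := n)) hθ hM uin
  have hb := fun n => hKL (box n) neg_mem_box θ hθ hM (u n) (hu n)
  have h0T : (0 : ℝ) ∈ Icc 0 T := ⟨le_rfl, hT⟩
  set r : ℕ → ℝ≥0∞ := fun n => ENNReal.ofReal (((n : ℝ) + 1) ^ (-(1 / 2) : ℝ)) with hr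
  set δ : ℕ → ℝ≥0∞ := fun n => ENNReal.ofReal C * (r n * pairSq 1 uin + 2 * r n * ENNReal.ofReal L)
    with hδ
  have hr0 : Filter.Tendsto r Filter.atTop (nhds 0) := by
    have h1 : Filter.Tendsto (fun n : ℕ => ((n : ℝ) + 1) ^ (-(1 / 2) : ℝ)) Filter.atTop (nhds 0) :=
      (tendsto_rpow_neg_atTop (by norm_num : (0 : ℝ) < 1 / 2)).comp
        (Filter.tendsto_atTop_add_const_right _ _ tendsto_natCast_atTop_atTop)
    have h2 := ENNReal.tendsto_ofReal h1
    rwa [ENNReal.ofReal_zero] at h2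
  have hδ0 : Filter.Tendsto δ Filter.atTop (nhds 0) := by
    have h1 := (ENNReal.Tendsto.mul_const hr0 (Or.inr huin)).add
      (ENNReal.Tendsto.mul_const (ENNReal.Tendsto.const_mul (a := 2) hr0 (Or.inr (by simp)))
        (Or.inr (ENNReal.ofReal_ne_top (r := L))))
    have h2 := ENNReal.Tendsto.const_mul (a := ENNReal.ofReal C) h1 (Or.inr ENNReal.ofReal_ne_top)
    simpa using h2
  have hδt : ∀ n, δ n ≠ ⊤ := fun n => by simp only [hδ, hr]; finiteness
  -- The stability estimate for two approximations: the forcings differ by a truncation of the advection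
  -- terms, which is small in `H^{-1/2}` since the advection terms are bounded in `L²`.
  have hcauchy : ∀ n N N', n ≤ N → n ≤ N' → ∀ t ∈ Icc 0 T,
      pairSq (1 / 2) (u N t - u N' t) ≤ δ n := by
    intro n N N' hN hN' t ht
    have hin : pairSq (1 / 2) (u N 0 - u N' 0) ≤ r n * pairSq 1 uin := by
      rw [pairSq, pairSq, Finset.mul_sum]
      refine Finset.sum_le_sum fun i _ => ?_
      have h1 : fcoeff ((u N 0 - u N' 0) i) = fun k => (if k ∈ box N then fcoeff (uin i) k else 0)
          - if k ∈ box N' then fcoeff (uin i) k else 0 := by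
        funext k
        rw [Pi.sub_apply, fcoeff_sub, (hu N).fcoeff_initial neg_mem_box,
          (hu N').fcoeff_initial neg_mem_box]
      rw [h1]
      exact sobSq_half_truncate_sub_le hN hN' _
    have hρ : ∫⁻ t in Icc 0 T, 2 * r n * ∑ i, sobSq 0 (fcoeff (adv θ (u N' t) (u N' t i)))
        ≤ 2 * r n * ENNReal.ofReal L := by
      rw [lintegral_const_mul' _ _ (by simp only [hr]; finiteness)]
      gcongr
      exact (hb N').2.2.2
    have h1 := hC θ hθ h0 (u N) (u N') _ _
      (fun t => 2 * r n * ∑ i, sobSq 0 (fcoeff (adv θ (u N' t) (u N' t i))))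
      ((hu N).pairSol neg_mem_box) ((hu N').pairSol neg_mem_box)
      ((ae_restrict_iff' measurableSet_Icc).mpr (Filter.Eventually.of_forall (hb N).1))
      ((ae_restrict_iff' measurableSet_Icc).mpr (Filter.Eventually.of_forall (hb N').1))
      (hb N).2.1 (hb N').2.1
      (Filter.Eventually.of_forall fun t i => (sobSq_truncate_sub_le hN hN' _ _).trans (by
        gcongr
        exact Finset.single_le_sum (f := fun i => sobSq 0 (fcoeff (adv θ (u N' t) (u N' t i))))
          (fun _ _ => zero_le) (Finset.mem_univ i)))
      (ne_top_of_le_ne_top (by simp only [hr]; finiteness) hin)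
      (ne_top_of_le_ne_top (by simp only [hr]; finiteness) hρ) t ht
    refine h1.trans ?_
    simp only [hδ]
    gcongr
  have hconv : ∀ t i, ∃ w : L2, t ∈ Icc 0 T →
      Filter.Tendsto (fun n => u n t i) Filter.atTop (nhds w) := by
    intro t i
    by_cases ht : t ∈ Icc 0 T
    · have h1 : CauchySeq fun n => u n t i := by
        refine cauchySeq_of_le_tendsto_0 (fun n => Real.sqrt ((2 * Real.pi) ^ 2 * (δ n).toReal))
          (fun N N' n hN hN' => ?_) ?_
        · rw [dist_eq_norm]
          refine norm_le_of_sobSq_le (hδt n) (le_trans ?_ (hcauchy n N N' hN hN' t ht))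
          exact (sobSq_le_pairSq 0 (u N t - u N' t) i).trans (pairSq_mono (by norm_num) _)
        · have h2 := (((ENNReal.tendsto_toReal ENNReal.zero_ne_top).comp hδ0).const_mul
            ((2 * Real.pi) ^ 2)).sqrt
          simpa using h2
      obtain ⟨w, hw⟩ := cauchySeq_tendsto_of_complete h1
      exact ⟨w, fun _ => hw⟩
    · exact ⟨0, fun h => absurd h ht⟩
  choose v hv using hconv
  have hv' : ∀ t ∈ Icc 0 T, ∀ i, Filter.Tendsto (fun n => u n t i) Filter.atTop (nhds (v t i)) :=
    fun t ht i => hv t i ht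
  have hu1 : ∀ n, ∀ t ∈ Icc 0 T, ∀ i, sobSq 1 (fcoeff (u n t i)) ≤ ENNReal.ofReal K :=
    fun n t ht i => (sobSq_le_pairSq 1 _ i).trans ((hb n).1 t ht)
  have hv1 : ∀ t ∈ Icc 0 T, ∀ i, sobSq 1 (fcoeff (v t i)) ≤ ENNReal.ofReal K := fun t ht i =>
    sobSq_le_of_tendsto (hv' t ht i) fun n => hu1 n t ht i
  have hsol := fun n => (hu n).pairSol neg_mem_box
  refine ⟨u, v, K, L, hu, fun n => (hb n).1, fun n => (hb n).2.1, fun n => (hb n).2.2.2, hv', ?_, hv1,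
    fun i => ?_, ?_, fun i k => ?_⟩
  · funext i
    refine tendsto_nhds_unique (hv' 0 h0T i) ?_
    simp only [(hu _).initial]
    exact tendsto_polyL2_box _
  · refine lintegral_sobSq_le_of_tendsto (fun n k => (hsol n).aesm i k) (fun t ht => hv' t ht i)
      fun n => le_trans (lintegral_mono fun t => ?_) (hb n).2.1
    exact sobSq_le_pairSq 2 (u n t) i
  · exact lintegral_sobSq_le_of_tendsto (fun n k => (hsol n).aesm 1 k) (fun t ht => hv' t ht 1)
      fun n => (hb n).2.2.1
  · -- the equations pass to the limit, by bounded convergence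
    set D := Real.sqrt ((2 * Real.pi) ^ 2 * (ENNReal.ofReal K).toReal) with hD
    have hD0 : 0 ≤ D := Real.sqrt_nonneg _
    have hnu : ∀ n, ∀ t ∈ Icc 0 T, ∀ i, ‖u n t i‖ ≤ D := fun n t ht i =>
      norm_le_of_sobSq_le ENNReal.ofReal_ne_top ((sobSq_mono zero_le_one _).trans (hu1 n t ht i))
    have hnd : ∀ n, ∀ t ∈ Icc 0 T, ∀ i j, ‖wpartial j (u n t i)‖ ≤ D := fun n t ht i j =>
      norm_le_of_sobSq_le ENNReal.ofReal_ne_top ((sobSq_zero_wpartial_le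
        (ne_top_of_le_ne_top ENNReal.ofReal_ne_top (hu1 n t ht i)) j).trans (hu1 n t ht i))
    set f : ℕ → ℝ → ℂ := fun n t => if k ∈ box n then fcoeff (adv θ (u n t) (u n t i)) k else 0 with hf
    set F : ℝ → ℂ := fun t => fcoeff (adv θ (v t) (v t i)) k with hF
    set A := (‖modeMap (-k) 1‖ + ‖modeMap (-k) (-Complex.I)‖) * (D * D + D * D) with hA
    have hfb : ∀ n, ∀ t ∈ Icc 0 T, ‖f n t‖ ≤ A := fun n t ht => by
      simp only [hf]
      split_ifs
      · refine (norm_fcoeff_adv_le hθ h0 _ _ k).trans ?_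
        rw [hA]
        gcongr
        exacts [hnu n t ht 0, hnd n t ht i 0, hnu n t ht 1, hnd n t ht i 1]
      · rw [norm_zero]; positivity
    have hfF : ∀ t ∈ Icc 0 T, Filter.Tendsto (fun n => f n t) Filter.atTop (nhds (F t)) :=
      fun t ht => by
        refine (tendsto_fcoeff_adv hθ h0 ENNReal.ofReal_ne_top (fun n i => hu1 n t ht i)
          (fun i => ne_top_of_le_ne_top ENNReal.ofReal_ne_top (hv1 t ht i)) (hv' t ht) i k).congr' ?_
        obtain ⟨n, hn⟩ := exists_mem_box k
        filter_upwards [Filter.eventually_ge_atTop n] with m hm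
        simp [hf, box_mono hm hn]
    have hzz : ∀ t ∈ Icc 0 T, Filter.Tendsto (fun n => fcoeff (u n t i) k) Filter.atTop
        (nhds (fcoeff (v t i) k)) := fun t ht => tendsto_fcoeff (hv' t ht i) k
    have hae : ∀ {p : ℝ → Prop}, (∀ t ∈ Icc 0 T, p t) → ∀ᵐ t ∂(timeMeasure T), p t := fun h =>
      (ae_restrict_iff' measurableSet_Icc).mpr (Filter.Eventually.of_forall h)
    have hFm : AEStronglyMeasurable F (timeMeasure T) :=
      aestronglyMeasurable_of_tendsto_ae Filter.atTop (fun n => (hsol n).aesm_forcing i k) (hae hfF)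
    have hzm : AEStronglyMeasurable (fun t => fcoeff (v t i) k) (timeMeasure T) :=
      aestronglyMeasurable_of_tendsto_ae Filter.atTop (fun n => (hsol n).aesm i k) (hae hzz)
    have hFb : ∀ t ∈ Icc 0 T, ‖F t‖ ≤ A := fun t ht =>
      le_of_tendsto (hfF t ht).norm (Filter.Eventually.of_forall fun n => hfb n t ht)
    have hzb : ∀ t ∈ Icc 0 T, ‖fcoeff (v t i) k‖ ≤ D := fun t ht =>
      le_of_tendsto (hzz t ht).norm
        (Filter.Eventually.of_forall fun n => (norm_fcoeff_le _ _).trans (hnu n t ht i))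
    have hFi : IntegrableOn F (Icc 0 T) :=
      Integrable.mono' (integrable_const A) hFm (hae hFb)
    have hzi : IntegrableOn (fun t => fcoeff (v t i) k) (Icc 0 T) :=
      Integrable.mono' (integrable_const D) hzm (hae hzb)
    have hgi : IntegrableOn (fun t => rate ν lam i k * fcoeff (v t i) k + F t) (Icc 0 T) :=
      (hzi.const_mul _).add hFi
    have heq : ∀ t ∈ Icc 0 T, fcoeff (v t i) k
        = fcoeff (v 0 i) k - ∫ s in (0)..t, (rate ν lam i k * fcoeff (v s i) k + F s) := by
      intro t ht
      have hsub : Ioc 0 t ⊆ Icc 0 T := fun s hs => ⟨hs.1.le, hs.2.trans ht.2⟩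
      refine tendsto_nhds_unique (hzz t ht) ?_
      simp only [fun n => (hsol n i k).eq t ht]
      refine (hzz 0 h0T).sub ?_
      refine intervalIntegral.tendsto_integral_filter_of_dominated_convergence
        (fun _ => |rate ν lam i k| * D + A) (Filter.Eventually.of_forall fun n => ?_)
        (Filter.Eventually.of_forall fun n => ?_) (by simp) ?_
      · rw [uIoc_of_le ht.1]
        exact ((hsol n i k).integrableOn.mono_set hsub).aestronglyMeasurable
      · refine Filter.Eventually.of_forall fun s hs => ?_
        rw [uIoc_of_le ht.1] at hs
        refine (norm_add_le _ _).trans (add_le_add ?_ (hfb n s (hsub hs)))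
        rw [norm_mul, Complex.norm_real, Real.norm_eq_abs]
        gcongr
        exact (norm_fcoeff_le _ _).trans (hnu n s (hsub hs) i)
      · refine Filter.Eventually.of_forall fun s hs => ?_
        rw [uIoc_of_le ht.1] at hs
        exact ((hzz s (hsub hs)).const_mul _).add (hfF s (hsub hs))
    refine ⟨?_, hFi, heq⟩
    have h1 := intervalIntegral.continuousOn_primitive_interval' (a := 0)
      ((intervalIntegrable_iff_integrableOn_Icc_of_le hT).mpr hgi) (by simp)
    rw [uIcc_of_le hT] at h1
    exact (continuousOn_const.sub h1).congr heq

/-! ### Entropies -/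

/-- A convex function `Γ` of at most quadratic growth, with derivative `γ` and second derivative
`η`, for which the integral `∫ Γ(u)` over solutions of an advection-diffusion equation satisfies
Grönwall's inequality whatever the divergence of the velocity; this is what `γ² ≤ 2ηΓ` is for. -/
structure IsEntropy (Γ γ η : ℝ → ℝ) : Prop where
  deriv : ∀ s, HasDerivAt Γ (γ s) s
  deriv_two : ∀ s, HasDerivAt γ (η s) s
  cont : Continuous η
  nonneg_two : ∀ s, 0 ≤ η s
  le_six : ∀ s, η s ≤ 6
  sq_le : ∀ s, γ s ^ 2 ≤ 2 * (η s * Γ s)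
  nonneg : ∀ s, 0 ≤ Γ s
  zero : Γ 0 = 0
  zero_one : γ 0 = 0

lemma hasDerivAt_max_pow (n : ℕ) (s : ℝ) :
    HasDerivAt (fun s : ℝ => max s 0 ^ (n + 2)) ((n + 2 : ℕ) * max s 0 ^ (n + 1)) s := by
  rcases lt_trichotomy s 0 with h | h | h
  · have h1 : (fun s : ℝ => max s 0 ^ (n + 2)) =ᶠ[nhds s] fun _ => 0 := by
      filter_upwards [Iio_mem_nhds h] with x hx
      rw [max_eq_right (le_of_lt hx)]
      simp
    rw [max_eq_right h.le, zero_pow (by simp), mul_zero]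
    exact (hasDerivAt_const s (0 : ℝ)).congr_of_eventuallyEq h1
  · subst h
    rw [max_self, zero_pow (by simp), mul_zero]
    rw [hasDerivAt_iff_isLittleO]
    simp only [max_self, sub_zero, smul_zero]
    have h1 : (fun x : ℝ => max x 0 ^ (n + 2) - 0 ^ (n + 2)) =O[nhds 0] fun x : ℝ => x ^ (n + 2) :=
      Asymptotics.IsBigO.of_bound 1 (Filter.Eventually.of_forall fun x => by
        rw [zero_pow (by simp), sub_zero, one_mul, norm_pow, norm_pow]
        gcongr
        rw [Real.norm_eq_abs, Real.norm_eq_abs, abs_of_nonneg (le_max_right _ _)]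
        exact max_le (le_abs_self x) (abs_nonneg x))
    refine h1.trans_isLittleO ?_
    have h2 := Asymptotics.isLittleO_pow_pow (𝕜 := ℝ) (m := 1) (n := n + 2) (by omega)
    simpa using h2
  · have h1 : (fun s : ℝ => max s 0 ^ (n + 2)) =ᶠ[nhds s] fun s => s ^ (n + 2) := by
      filter_upwards [Ioi_mem_nhds h] with x hx
      rw [max_eq_left (le_of_lt hx)]
    rw [max_eq_left h.le]
    have h2 := hasDerivAt_pow (n + 2) s
    exact h2.congr_of_eventuallyEq h1

/-- The function `(r⁺)³ - ((r - 1)⁺)³`, which is cubic near `0` and quadratic at infinity, gives with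
`r = s - M` and `r = -s - M` entropies that vanish exactly where `s ≤ M` and where `s ≥ -M`. -/
lemma isEntropy_base (σ M : ℝ) (hσ : σ = 1 ∨ σ = -1) (hM : 0 ≤ M) :
    IsEntropy (fun s => max (σ * s - M) 0 ^ 3 - max (σ * s - M - 1) 0 ^ 3)
      (fun s => σ * (3 * max (σ * s - M) 0 ^ 2 - 3 * max (σ * s - M - 1) 0 ^ 2))
      (fun s => 6 * max (σ * s - M) 0 - 6 * max (σ * s - M - 1) 0) := by
  have hσ2 : σ * σ = 1 := by rcases hσ with h | h <;> simp [h]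
  have hd : ∀ n : ℕ, ∀ c s : ℝ, HasDerivAt (fun s => max (σ * s - M - c) 0 ^ (n + 2))
      ((n + 2 : ℕ) * max (σ * s - M - c) 0 ^ (n + 1) * σ) s := fun n c s => by
    have h1 : HasDerivAt (fun s => σ * s - M - c) σ s := by
      simpa using (((hasDerivAt_id s).const_mul σ).sub_const M).sub_const c
    exact (hasDerivAt_max_pow n (σ * s - M - c)).comp s h1
  have hd0 : ∀ n : ℕ, ∀ s : ℝ, HasDerivAt (fun s => max (σ * s - M) 0 ^ (n + 2))
      ((n + 2 : ℕ) * max (σ * s - M) 0 ^ (n + 1) * σ) s := fun n s => by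
    simpa only [sub_zero] using hd n 0 s
  -- The three regimes: `Γ` is zero, cubic, or quadratic.
  have cases : ∀ x : ℝ, (max x 0 = 0 ∧ max (x - 1) 0 = 0) ∨
      (max x 0 = x ∧ max (x - 1) 0 = 0 ∧ 0 ≤ x ∧ x ≤ 1) ∨
      (max x 0 = x ∧ max (x - 1) 0 = x - 1 ∧ 1 ≤ x) := fun x => by
    rcases le_total x 0 with h | h
    · exact Or.inl ⟨max_eq_right h, max_eq_right (by linarith)⟩
    · rcases le_total x 1 with h1 | h1
      · exact Or.inr (Or.inl ⟨max_eq_left h, max_eq_right (by linarith), h, h1⟩)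
      · exact Or.inr (Or.inr ⟨max_eq_left h, max_eq_left (by linarith), h1⟩)
  refine ⟨fun s => ?_, fun s => ?_, by fun_prop, fun s => ?_, fun s => ?_, fun s => ?_, fun s => ?_,
    ?_, ?_⟩
  · convert! (hd0 1 s).sub (hd 1 1 s) using 1
    push_cast
    ring
  · convert! (((hd0 0 s).const_mul 3).sub ((hd 0 1 s).const_mul 3)).const_mul σ using 1
    push_cast
    linear_combination (-6 * max (σ * s - M) 0 + 6 * max (σ * s - M - 1) 0) * hσ2
  · rcases cases (σ * s - M) with ⟨h1, h2⟩ | ⟨h1, h2, h3, h4⟩ | ⟨h1, h2, h3⟩ <;>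
      simp only [h1, h2] <;> linarith
  · rcases cases (σ * s - M) with ⟨h1, h2⟩ | ⟨h1, h2, h3, h4⟩ | ⟨h1, h2, h3⟩ <;>
      simp only [h1, h2] <;> linarith
  · rw [mul_pow, sq σ, hσ2, one_mul]
    rcases cases (σ * s - M) with ⟨h1, h2⟩ | ⟨h1, h2, h3, h4⟩ | ⟨h1, h2, h3⟩ <;>
      simp only [h1, h2]
    · norm_num
    · nlinarith [pow_nonneg h3 4]
    · nlinarith
  · rcases cases (σ * s - M) with ⟨h1, h2⟩ | ⟨h1, h2, h3, h4⟩ | ⟨h1, h2, h3⟩ <;>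
      simp only [h1, h2]
    · norm_num
    · have := pow_nonneg h3 3
      linarith
    · nlinarith
  · simp [max_eq_right (by linarith : -M ≤ 0), max_eq_right (by linarith : -M - 1 ≤ 0)]
  · simp [max_eq_right (by linarith : -M ≤ 0), max_eq_right (by linarith : -M - 1 ≤ 0)]

section IsEntropy

variable {Γ γ η : ℝ → ℝ}

lemma IsEntropy.lipschitz (h : IsEntropy Γ γ η) : LipschitzWith 6 γ := by
  refine lipschitzWith_of_nnnorm_deriv_le (fun s => (h.deriv_two s).differentiableAt) fun s => ?_
  rw [(h.deriv_two s).deriv, ← NNReal.coe_le_coe, coe_nnnorm, Real.norm_of_nonneg (h.nonneg_two s)]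
  exact h.le_six s

lemma IsEntropy.continuous (h : IsEntropy Γ γ η) : Continuous Γ :=
  continuous_iff_continuousAt.mpr fun s => (h.deriv s).continuousAt

lemma IsEntropy.remainder_le (h : IsEntropy Γ γ η) (a b : ℝ) :
    |Γ b - Γ a - γ a * (b - a)| ≤ 6 * (b - a) ^ 2 := by
  have h1 : ∀ x ∈ uIcc a b, HasDerivWithinAt (fun x => Γ x - γ a * x) (γ x - γ a * 1) (uIcc a b) x :=
    fun x _ => ((h.deriv x).sub ((hasDerivAt_id x).const_mul (γ a))).hasDerivWithinAt
  have h2 := Convex.norm_image_sub_le_of_norm_hasDerivWithin_le (C := 6 * |b - a|) h1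
    (fun x hx => by
      rw [mul_one]
      refine (h.lipschitz.norm_sub_le x a).trans ?_
      simp only [NNReal.coe_ofNat, Real.norm_eq_abs]
      gcongr 6 * ?_
      exact abs_sub_left_of_mem_uIcc hx) (convex_uIcc a b) left_mem_uIcc right_mem_uIcc
  rw [Real.norm_eq_abs, Real.norm_eq_abs, mul_assoc, ← sq, sq_abs] at h2
  refine le_trans (le_of_eq ?_) h2
  congr 1
  ring

lemma IsEntropy.le_sq (h : IsEntropy Γ γ η) (s : ℝ) : Γ s ≤ 6 * s ^ 2 := by
  have h1 := h.remainder_le 0 s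
  rw [h.zero, h.zero_one] at h1
  simpa using (le_abs_self _).trans h1

lemma IsEntropy.integrable (h : IsEntropy Γ γ η) (f : L2) : Integrable fun x => Γ (f x) := by
  refine ((Lp.memLp f).integrable_sq.const_mul 6).mono'
    (h.continuous.comp_aestronglyMeasurable (Lp.aestronglyMeasurable f))
    (Filter.Eventually.of_forall fun x => ?_)
  rw [Real.norm_of_nonneg (h.nonneg _)]
  exact h.le_sq _

/-- The function `γ(f)`, as an element of `L²`. -/
def IsEntropy.grad (h : IsEntropy Γ γ η) (f : L2) : L2 := h.lipschitz.compLp h.zero_one f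

lemma IsEntropy.coeFn_grad (h : IsEntropy Γ γ η) (f : L2) :
    h.grad f =ᵐ[volume] fun x => γ (f x) := h.lipschitz.coeFn_compLp h.zero_one f

/-- The functional `f ↦ ∫ Γ(f)` is differentiable on `L²`, with gradient `γ(f)`, since `η` is bounded. -/
lemma IsEntropy.hasFDerivAt (h : IsEntropy Γ γ η) (f : L2) :
    HasFDerivAt (fun f : L2 => ∫ x, Γ (f x)) (innerSL ℝ (h.grad f)) f := by
  have h1 : HasFDerivAt (fun g : L2 => (∫ x, Γ (g x)) - (∫ x, Γ (f x)) - inner ℝ (h.grad f) (g - f))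
      (0 : L2 →L[ℝ] ℝ) f := by
    refine Asymptotics.IsBigO.hasFDerivAt (n := 2) (Asymptotics.IsBigO.of_bound 6
      (Filter.Eventually.of_forall fun g => ?_)) one_lt_two
    have hi : Integrable fun x => γ (f x) * (g x - f x) := by
      refine ((Lp.memLp (h.grad f)).integrable_mul (Lp.memLp (g - f))).congr ?_
      filter_upwards [h.coeFn_grad f, Lp.coeFn_sub g f] with x h1 h2
      rw [Pi.mul_apply, h1, h2, Pi.sub_apply]
    have e1 : inner ℝ (h.grad f) (g - f) = ∫ x, γ (f x) * (g x - f x) := by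
      rw [L2.inner_eq_integral]
      refine integral_congr_ae ?_
      filter_upwards [h.coeFn_grad f, Lp.coeFn_sub g f] with x h1 h2
      rw [h1, h2, Pi.sub_apply]
    have e2 : ‖g - f‖ ^ 2 = ∫ x, (g x - f x) ^ 2 := by
      rw [L2.norm_sq]
      refine integral_congr_ae ?_
      filter_upwards [Lp.coeFn_sub g f] with x h2
      rw [h2, Pi.sub_apply, sq]
    have hi2 : Integrable fun x => (g x - f x) ^ 2 := by
      refine (Lp.memLp (g - f)).integrable_sq.congr ?_
      filter_upwards [Lp.coeFn_sub g f] with x h2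
      rw [h2, Pi.sub_apply]
    have hi3 : Integrable fun x => Γ (g x) - Γ (f x) := (h.integrable g).sub (h.integrable f)
    rw [norm_pow, norm_norm, e1, e2, ← integral_sub (h.integrable g) (h.integrable f),
      ← integral_sub hi3 hi, ← integral_const_mul]
    refine norm_integral_le_of_norm_le (hi2.const_mul 6) (Filter.Eventually.of_forall fun x => ?_)
    exact h.remainder_le (f x) (g x)
  have h2 : HasFDerivAt (fun g : L2 => (∫ x, Γ (f x)) + innerSL ℝ (h.grad f) (g - f))
      (innerSL ℝ (h.grad f)) f :=
    ((innerSL ℝ (h.grad f)).hasFDerivAt.comp f ((hasFDerivAt_id f).sub_const f)).const_add _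
  have h3 := h1.add h2
  rw [zero_add] at h3
  refine h3.congr_of_eventuallyEq (Filter.Eventually.of_forall fun g => ?_)
  simp only [Pi.add_apply, innerSL_apply_apply]
  ring

end IsEntropy

/-! ### The maximum principle for the first component -/

section entropy

variable {Γ γ η : ℝ → ℝ} {ν lam M : ℝ} {θ : ℝ → ℝ}

/-- The dissipation `ν ∫ η(u₀) |∇u₀|²` of the entropy absorbs the advection term, up to the
truncation error. -/
lemma IsEntropy.inner_grad_field_le (h : IsEntropy Γ γ η) (hν : 0 < ν) {S : Finset (Fin 2 → ℤ)}
    (hS : ∀ k ∈ S, -k ∈ S) (hθ : LipschitzWith 1 θ) (hM : ∀ s, |θ s| ≤ M) {u : Fin 2 → L2}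
    (hu : ∀ i, ∀ k ∉ S, fcoeff (u i) k = 0) {B : ℝ} (hB : ∀ᵐ x, u 1 x ^ 2 ≤ B) :
    inner ℝ (h.grad (u 0)) (galerkinField ν lam S θ hθ u 0)
      ≤ (M ^ 2 + B) / (2 * ν) * (∫ x, Γ (u 0 x)) + ‖toL2 (advPoly S θ hθ u (u 0))‖ *
        ‖h.grad (u 0) - polyL2 S (fcoeff (h.grad (u 0)))‖ := by
  set p := multMap S 1 (u 0) with hp
  set p₁ := multMap S 1 (u 1) with hp₁
  set d : Fin 2 → C(Torus, ℝ) := fun j => multMap S (fun k => Complex.I * k j) (u 0) with hd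
  set e : Fin 2 → C(Torus, ℝ) :=
    fun j => multMap S (fun k => Complex.I * k j * (Complex.I * k j)) (u 0) with he
  set F := advPoly S θ hθ u (u 0) with hF
  set w := h.grad (u 0) with hw
  have hpu : p =ᵐ[volume] u 0 := multMap_one_ae_eq hS (hu 0)
  have hpu₁ : p₁ =ᵐ[volume] u 1 := multMap_one_ae_eq hS (hu 1)
  have hwx : w =ᵐ[volume] fun x => γ (p x) := by
    filter_upwards [h.coeFn_grad (u 0), hpu] with x h1 h2
    rw [h1, h2]
  have hFx : ∀ x, F x = θ (p x) * d 0 x + p₁ x * d 1 x := fun x => rfl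
  have hθc := hθ.continuous
  have hγc : Continuous γ := h.lipschitz.continuous
  have hΓc := h.continuous
  have hηc := h.cont
  -- Integration by parts in the diffusion term gives the dissipation.
  have hparts : ∀ j, ∫ x, γ (p x) * e j x = -∫ x, η (p x) * d j x ^ 2 := by
    intro j
    have h1 : HasPD j p (d j) := by
      have := hasPD_multMap S 1 (u 0) j
      simpa only [Pi.one_apply, mul_one] using this
    have h2 : HasPD j (d j) (e j) := hasPD_multMap S _ (u 0) j
    have h3 := ((h1.comp h.deriv_two).mul h2).integral_eq_zero (by fun_prop) (by fun_prop)
    rw [integral_add (continuous_integrable (by fun_prop)) (continuous_integrable (by fun_prop))] at h3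
    rw [eq_neg_iff_add_eq_zero, add_comm, ← h3]
    congr 1
    refine integral_congr_ae (Filter.Eventually.of_forall fun x => ?_)
    simp only
    ring
  have hlin : inner ℝ w (polyL2 S fun k => rate ν lam 0 k * fcoeff (u 0) k)
      = ν * ((∫ x, η (p x) * d 0 x ^ 2) + ∫ x, η (p x) * d 1 x ^ 2) := by
    have h1 : inner ℝ w (polyL2 S fun k => rate ν lam 0 k * fcoeff (u 0) k)
        = ∫ x, -ν * (γ (p x) * e 0 x + γ (p x) * e 1 x) := by
      rw [L2.inner_eq_integral]
      refine integral_congr_ae ?_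
      filter_upwards [hwx, coeFn_polyL2 S fun k => rate ν lam 0 k * fcoeff (u 0) k] with x h1 h2
      have h3 : trigPoly S (fun k => rate ν lam 0 k * fcoeff (u 0) k) x
          = -ν * (e 0 x + e 1 x) := by
        simp only [he, multMap_apply, trigPoly]
        rw [← Finset.sum_add_distrib, Finset.mul_sum]
        refine Finset.sum_congr rfl fun k _ => ?_
        rw [← Complex.add_re, ← Complex.re_ofReal_mul]
        congr 1
        simp only [rate, if_true, jb, Fin.sum_univ_two]
        push_cast
        linear_combination (ν * fcoeff (u 0) k * expMode k x * ((k 0 : ℂ) ^ 2 + (k 1 : ℂ) ^ 2))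
          * Complex.I_sq
      rw [h1, h2, h3]
      ring
    rw [h1, integral_const_mul, integral_add (continuous_integrable (by fun_prop))
      (continuous_integrable (by fun_prop)), hparts, hparts]
    ring
  -- The truncation is moved from the advection term onto `γ(u₀)`. Since `γ(u₀)` is not a
  -- trigonometric polynomial, an error remains.
  have hadv : inner ℝ w (polyL2 S (fcoeff F))
      = (∫ x, F x * γ (p x)) - inner ℝ (toL2 F) (w - polyL2 S (fcoeff w)) := by
    have h1 : inner ℝ w (polyL2 S (fcoeff F)) = inner ℝ (toL2 F) (polyL2 S (fcoeff w)) := by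
      rw [real_inner_comm, L2.inner_eq_integral, L2.inner_eq_integral,
        integral_polyL2_mul hS (memLp_of_continuous F.continuous 2) (Lp.memLp w)]
      refine integral_congr_ae ?_
      filter_upwards [coeFn_toL2 F, coeFn_polyL2 S (fcoeff w)] with x h1 h2
      rw [h1, h2]
    have h2 : ∫ x, F x * γ (p x) = inner ℝ (toL2 F) w := by
      rw [L2.inner_eq_integral]
      refine integral_congr_ae ?_
      filter_upwards [coeFn_toL2 F, hwx] with x h1 h2
      rw [h1, h2]
    rw [h1, h2, inner_sub_right]
    ring
  -- Young's inequality, with `γ² ≤ 2 η Γ`: no integration by parts in the advection term is needed, and so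
  -- no bound for the divergence of the velocity.
  have hyoung : ∀ b y g s : ℝ, 0 ≤ s → 0 ≤ Γ g → γ g ^ 2 ≤ 2 * (s * Γ g) →
      -(b * y * γ g) ≤ ν * (s * y ^ 2) + b ^ 2 * Γ g / (2 * ν) := by
    intro b y g s hs hg hsq
    have hX : 0 ≤ ν * (s * y ^ 2) := by positivity
    have hY : 0 ≤ b ^ 2 * Γ g / (2 * ν) := by positivity
    refine (neg_le_abs _).trans (abs_le_of_sq_le_sq ?_ (add_nonneg hX hY))
    have h1 : (b * y * γ g) ^ 2 ≤ 4 * (ν * (s * y ^ 2)) * (b ^ 2 * Γ g / (2 * ν)) := by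
      have e1 : 4 * (ν * (s * y ^ 2)) * (b ^ 2 * Γ g / (2 * ν)) = (b * y) ^ 2 * (2 * (s * Γ g)) := by
        field_simp
        ring
      rw [e1, mul_pow]
      exact mul_le_mul_of_nonneg_left hsq (sq_nonneg _)
    nlinarith [sq_nonneg (ν * (s * y ^ 2) - b ^ 2 * Γ g / (2 * ν))]
  have hint : -(∫ x, F x * γ (p x)) ≤ ν * ((∫ x, η (p x) * d 0 x ^ 2) + ∫ x, η (p x) * d 1 x ^ 2)
      + (M ^ 2 + B) / (2 * ν) * ∫ x, Γ (p x) := by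
    rw [← integral_neg, ← integral_add (continuous_integrable (by fun_prop))
      (continuous_integrable (by fun_prop)), ← integral_const_mul, ← integral_const_mul,
      ← integral_add (continuous_integrable (by fun_prop)) (continuous_integrable (by fun_prop))]
    refine integral_mono_ae (continuous_integrable (by fun_prop)) (continuous_integrable (by fun_prop))
      ?_
    filter_upwards [hB, hpu₁] with x hx hx₁
    rw [← hx₁] at hx
    have h1 := hyoung (θ (p x)) (d 0 x) (p x) _ (h.nonneg_two _) (h.nonneg _) (h.sq_le _)
    have h2 := hyoung (p₁ x) (d 1 x) (p x) _ (h.nonneg_two _) (h.nonneg _) (h.sq_le _)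
    have h3 : θ (p x) ^ 2 ≤ M ^ 2 := sq_le_sq' (by linarith [neg_le_of_abs_le (hM (p x))])
      (le_of_abs_le (hM _))
    have h4 : θ (p x) ^ 2 * Γ (p x) / (2 * ν) + p₁ x ^ 2 * Γ (p x) / (2 * ν)
        ≤ (M ^ 2 + B) / (2 * ν) * Γ (p x) := by
      rw [← add_div, ← add_mul, div_mul_eq_mul_div]
      have := h.nonneg (p x)
      gcongr
    rw [hFx]
    linarith
  have hΓ : ∫ x, Γ (p x) = ∫ x, Γ (u 0 x) :=
    integral_congr_ae (by filter_upwards [hpu] with x hx; rw [hx])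
  have hCS := real_inner_le_norm (toL2 F) (w - polyL2 S (fcoeff w))
  rw [galerkinField, polyL2_neg_add, inner_neg_right, inner_add_right]
  change -(inner ℝ w (polyL2 S fun k => rate ν lam 0 k * fcoeff (u 0) k)
    + inner ℝ w (polyL2 S (fcoeff F))) ≤ _
  rw [hlin, hadv, ← hΓ]
  linarith

lemma sobSq_one_eq (c : (Fin 2 → ℤ) → ℂ) :
    sobSq 1 c = sobSq 0 c + ∑ j : Fin 2, sobSq 0 fun k => Complex.I * k j * c k := by
  simp only [sobSq, Fin.sum_univ_two]
  rw [← ENNReal.tsum_add, ← ENNReal.tsum_add]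
  refine tsum_congr fun k => ?_
  rw [← ENNReal.ofReal_add (by positivity) (by positivity),
    ← ENNReal.ofReal_add (by positivity) (by positivity)]
  congr 1
  simp only [Real.rpow_one, Real.rpow_zero, norm_mul, Complex.norm_I, Complex.norm_intCast, mul_pow,
    sq_abs, jb, Fin.sum_univ_two]
  ring

/-- The function `γ(f)` is in `H¹` with a norm controlled by that of `f`; this bounds its truncation
error. -/
lemma IsEntropy.sobSq_grad_le (h : IsEntropy Γ γ η) {S : Finset (Fin 2 → ℤ)}
    (hS : ∀ k ∈ S, -k ∈ S) {f : L2} (hf : ∀ k ∉ S, fcoeff f k = 0) :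
    sobSq 1 (fcoeff (h.grad f)) ≤ 36 * sobSq 1 (fcoeff f) := by
  set p := multMap S 1 f with hp
  have hpf : p =ᵐ[volume] f := multMap_one_ae_eq hS hf
  have hηc := h.cont
  have hγc : Continuous γ := h.lipschitz.continuous
  rw [sobSq_one_eq, sobSq_one_eq (fcoeff f), mul_add, Finset.mul_sum]
  refine add_le_add ?_ (Finset.sum_le_sum fun j _ => ?_)
  · rw [sobSq_zero_fcoeff, sobSq_zero_fcoeff, show (36 : ℝ≥0∞) = ENNReal.ofReal 36 by simp,
      ← ENNReal.ofReal_mul (by norm_num)]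
    refine ENNReal.ofReal_le_ofReal ?_
    have h1 : ‖h.grad f‖ ≤ 6 * ‖f‖ := h.lipschitz.norm_compLp_le h.zero_one f
    have h2 : ‖h.grad f‖ ^ 2 ≤ 36 * ‖f‖ ^ 2 := by nlinarith [norm_nonneg (h.grad f)]
    have h3 : 0 ≤ ((2 * Real.pi) ^ 2)⁻¹ := by positivity
    nlinarith
  · set d := multMap S (fun k => Complex.I * k j) f with hd
    have h1 : HasPD j p d := by
      have := hasPD_multMap S 1 f j
      simpa only [Pi.one_apply, mul_one] using this
    have h2 := h1.comp h.deriv_two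
    have e1 : (fun k => Complex.I * k j * fcoeff (h.grad f) k)
        = fcoeff fun x => η (p x) * toL2 d x := by
      funext k
      have h3 : fcoeff (h.grad f) k = fcoeff (fun x => γ (p x)) k := by
        refine fcoeff_congr ?_ k
        filter_upwards [h.coeFn_grad f, hpf] with x h1 h2
        rw [h1, h2]
      rw [h3, ← h2.fcoeff_eq (by fun_prop) (by fun_prop)]
      refine fcoeff_congr ?_ k
      filter_upwards [coeFn_toL2 d] with x hx
      rw [hx]
    have e2 : fcoeff (toL2 d) = fun k => Complex.I * k j * fcoeff f k := by
      funext k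
      rw [fcoeff_toL2, hd, multMap_apply, fcoeff_trigPoly hS (fun k => by simp [fcoeff_neg])]
      split_ifs with hk
      · rfl
      · rw [hf k hk, mul_zero]
    rw [e1, ← e2, show (36 : ℝ≥0∞) = ENNReal.ofReal 36 by simp]
    refine sobSq_bdd_mul_le (by fun_prop : Continuous fun x => η (p x)).aestronglyMeasurable
      (Filter.Eventually.of_forall fun x => ?_)
    nlinarith [h.nonneg_two (p x), h.le_six (p x)]

/-- The truncation error in `L²` of a function in `H¹`. -/
lemma sobSq_sub_polyL2_le (n : ℕ) (f : L2) :
    sobSq 0 (fcoeff (f - polyL2 (box n) (fcoeff f) : L2))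
      ≤ ENNReal.ofReal ((n : ℝ) + 1)⁻¹ * sobSq 1 (fcoeff f) := by
  rw [sobSq, sobSq, ← ENNReal.tsum_mul_left]
  refine ENNReal.tsum_le_tsum fun k => ?_
  rw [← ENNReal.ofReal_mul (by positivity)]
  refine ENNReal.ofReal_le_ofReal ?_
  rw [fcoeff_sub, fcoeff_polyL2 neg_mem_box fun k => fcoeff_neg _ k, Real.rpow_zero, one_mul,
    Real.rpow_one]
  have hj := jb_pos k
  split_ifs with hk
  · simp only [sub_self, norm_zero, ne_eq, OfNat.ofNat_ne_zero, not_false_eq_true, zero_pow]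
    positivity
  · rw [sub_zero, ← mul_assoc]
    refine le_mul_of_one_le_left (sq_nonneg _) ?_
    rw [inv_mul_eq_div, one_le_div (by positivity)]
    exact le_jb_of_notMem_box hk

end entropy

/-- If `∫ Γ` vanishes for the initial value of the first component, it vanishes at all times for the
limit of the Galerkin approximations. The approximations themselves do not obey the maximum principle,
but the error tends to zero: the truncation error of `γ(u₀)` is small in `L²` by the `H¹` bound, and
the advection term is bounded in `L²` of space-time. -/
theorem integral_entropy_nonpos {ν lam T M : ℝ} (hν : 0 < ν) (hT : 0 ≤ T) {θ : ℝ → ℝ}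
    {hθ : LipschitzWith 1 θ} (hM : ∀ s, |θ s| ≤ M) {uin : Fin 2 → L2} {u : ℕ → ℝ → Fin 2 → L2}
    {v : ℝ → Fin 2 → L2} {K L : ℝ} (hu : ∀ n, IsGalerkin ν lam T (box n) θ hθ uin (u n))
    (hK : ∀ n, ∀ t ∈ Icc 0 T, pairSq 1 (u n t) ≤ ENNReal.ofReal K)
    (hL : ∀ n, ∫⁻ t in Icc 0 T, pairSq 2 (u n t) ≤ ENNReal.ofReal L)
    (hL' : ∀ n, ∫⁻ t in Icc 0 T, ∑ i, sobSq 0 (fcoeff (adv θ (u n t) (u n t i))) ≤ ENNReal.ofReal L)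
    (hv : ∀ t ∈ Icc 0 T, ∀ i, Filter.Tendsto (fun n => u n t i) Filter.atTop (nhds (v t i)))
    {Γ γ η : ℝ → ℝ} (h : IsEntropy Γ γ η) (hin : ∫ x, Γ (uin 0 x) = 0) :
    ∀ t ∈ Icc 0 T, ∫ x, Γ (v t 0 x) ≤ 0 := by
  set L' := max L 0 with hLL
  have hL0 : 0 ≤ L' := le_max_right _ _
  set J : L2 → ℝ := fun f => ∫ x, Γ (f x) with hJ
  have hJc : Continuous J := continuous_iff_continuousAt.mpr fun f => (h.hasFDerivAt f).continuousAt
  have hJ0 : ∀ f, 0 ≤ J f := fun f => integral_nonneg fun x => h.nonneg _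
  -- The bound `q n` for the truncation error of `γ(u₀)` in the `n`-th approximation.
  set q : ℕ → ℝ := fun n => Real.sqrt ((2 * Real.pi) ^ 2 *
    (ENNReal.ofReal ((n : ℝ) + 1)⁻¹ * (36 * ENNReal.ofReal K)).toReal) with hq
  have hq0 : Filter.Tendsto q Filter.atTop (nhds 0) := by
    have h1 : Filter.Tendsto (fun n : ℕ => ((n : ℝ) + 1)⁻¹) Filter.atTop (nhds 0) :=
      tendsto_inv_atTop_zero.comp
        (Filter.tendsto_atTop_add_const_right _ _ tendsto_natCast_atTop_atTop)
    have h2 := ENNReal.tendsto_ofReal h1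
    rw [ENNReal.ofReal_zero] at h2
    have h3 := ENNReal.Tendsto.mul_const (b := 36 * ENNReal.ofReal K) h2 (Or.inr (by finiteness))
    rw [zero_mul] at h3
    have h4 := (((ENNReal.tendsto_toReal ENNReal.zero_ne_top).comp h3).const_mul
      ((2 * Real.pi) ^ 2)).sqrt
    rw [ENNReal.toReal_zero, mul_zero, Real.sqrt_zero] at h4
    exact h4
  set Q : ℝ := T + (2 * Real.pi) ^ 2 * L' with hQ
  set A : ℝ := (M ^ 2 * T + embC * L') / (2 * ν) with hA
  have hmain : ∀ n, ∀ t ∈ Icc 0 T, J (u n t 0) ≤ (J (u n 0 0) + q n * Q) * Real.exp A := by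
    intro n t ht
    have hsol := (hu n).pairSol neg_mem_box
    have huc := (hu n).continuousOn
    set V := galerkinField ν lam (box n) θ hθ with hV
    -- `b(t)` dominates `‖u₁(t)‖²_{L^∞}`.
    set b : ℝ → ℝ := fun t => (ENNReal.ofReal embC * sobSq (5 / 4) (fcoeff (u n t 1))).toReal with hb
    have hfin : ∀ t ∈ Icc 0 T, ∀ s i, sobSq s (fcoeff (u n t i)) ≠ ⊤ := fun t ht s i =>
      sobSq_ne_top_of_supp ((hu n).supp t ht i) s
    have hb0 : ∀ t, 0 ≤ b t := fun t => ENNReal.toReal_nonneg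
    have hbL : ∫⁻ t in Icc 0 T, ENNReal.ofReal embC * sobSq (5 / 4) (fcoeff (u n t 1))
        ≤ ENNReal.ofReal (embC * L') := by
      rw [lintegral_const_mul' _ _ ENNReal.ofReal_ne_top, ENNReal.ofReal_mul embC_nonneg]
      gcongr
      refine le_trans (lintegral_mono fun t => ?_) ((hL n).trans
        (ENNReal.ofReal_le_ofReal (le_max_left _ _)))
      exact (sobSq_mono (by norm_num) _).trans (sobSq_le_pairSq 2 (u n t) 1)
    have hbm : AEMeasurable (fun t => ENNReal.ofReal embC * sobSq (5 / 4) (fcoeff (u n t 1)))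
        (timeMeasure T) := (aemeasurable_sobSq (hsol.aesm 1) _).const_mul _
    have hbi : IntegrableOn b (Icc 0 T) :=
      integrable_toReal_of_lintegral_ne_top hbm (ne_top_of_le_ne_top ENNReal.ofReal_ne_top hbL)
    have hbint : ∫ t in Icc 0 T, b t ≤ embC * L' := by
      rw [integral_toReal hbm (ae_lt_top' hbm (ne_top_of_le_ne_top ENNReal.ofReal_ne_top hbL))]
      refine (ENNReal.toReal_mono ENNReal.ofReal_ne_top hbL).trans_eq ?_
      exact ENNReal.toReal_ofReal (mul_nonneg embC_nonneg hL0)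
    set F : ℝ → L2 := fun t => toL2 (advPoly (box n) θ hθ (u n t) (u n t 0)) with hF
    have hFc : ContinuousOn F (Icc 0 T) := toL2.continuous.comp_continuousOn
      ((lipOnBalls_advPoly (box n) hθ 0).continuous.comp_continuousOn huc)
    -- The error term; `1 + ‖F‖²` replaces `‖F‖`, whose square has an integral bounded in `n`.
    set e : ℝ → ℝ := fun t => q n * (1 + ‖F t‖ ^ 2) with he
    have hec : ContinuousOn e (Icc 0 T) :=
      continuousOn_const.mul (continuousOn_const.add (hFc.norm.pow 2))
    have hqn : 0 ≤ q n := Real.sqrt_nonneg _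
    have hFi : IntegrableOn (fun t => ‖F t‖ ^ 2) (Icc 0 T) := (hFc.norm.pow 2).integrableOn_Icc
    have hFint : ∫ t in Icc 0 T, ‖F t‖ ^ 2 ≤ (2 * Real.pi) ^ 2 * L' := by
      have h1 : ENNReal.ofReal (∫ t in Icc 0 T, ‖F t‖ ^ 2)
          ≤ ENNReal.ofReal ((2 * Real.pi) ^ 2 * L') := by
        rw [ofReal_integral_eq_lintegral_ofReal hFi
          (Filter.Eventually.of_forall fun t => sq_nonneg _), ENNReal.ofReal_mul (by positivity)]
        have h2 : ∀ t ∈ Icc 0 T, ENNReal.ofReal (‖F t‖ ^ 2) ≤ ENNReal.ofReal ((2 * Real.pi) ^ 2) *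
            ∑ i, sobSq 0 (fcoeff (adv θ (u n t) (u n t i))) := fun t ht => by
          have h3 : sobSq 0 (fcoeff (F t)) = sobSq 0 (fcoeff (adv θ (u n t) (u n t 0))) := by
            congr 1
            funext k
            rw [hF, fcoeff_toL2, fcoeff_congr (adv_ae_eq neg_mem_box hθ ((hu n).supp t ht) 0)]
          have h4 : ENNReal.ofReal (‖F t‖ ^ 2)
              = ENNReal.ofReal ((2 * Real.pi) ^ 2) * sobSq 0 (fcoeff (F t)) := by
            rw [sobSq_zero_fcoeff, ← ENNReal.ofReal_mul (by positivity), ← mul_assoc,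
              mul_inv_cancel₀ (by positivity), one_mul]
          rw [h4, h3]
          gcongr
          exact Finset.single_le_sum (f := fun i => sobSq 0 (fcoeff (adv θ (u n t) (u n t i))))
            (fun _ _ => zero_le) (Finset.mem_univ 0)
        refine (setLIntegral_mono_ae' measurableSet_Icc (Filter.Eventually.of_forall h2)).trans ?_
        rw [lintegral_const_mul' _ _ ENNReal.ofReal_ne_top]
        gcongr
        exact (hL' n).trans (ENNReal.ofReal_le_ofReal (le_max_left _ _))
      exact (ENNReal.ofReal_le_ofReal_iff (by positivity)).mp h1
    set a : ℝ → ℝ := fun t => (M ^ 2 + b t) / (2 * ν) with ha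
    have ha0 : ∀ t, 0 ≤ a t := fun t => by have := hb0 t; positivity
    have hai : IntegrableOn a (Icc 0 T) := ((integrable_const _).add hbi).div_const _
    have hJcont : ContinuousOn (fun t => J (u n t 0)) (Icc 0 T) :=
      hJc.comp_continuousOn (continuousOn_pi.mp huc 0)
    have hd : ∀ t ∈ Icc 0 T, HasDerivWithinAt (fun t => J (u n t 0))
        (inner ℝ (h.grad (u n t 0)) (V (u n t) 0)) (Icc 0 T) t := fun t ht => by
      have h1 := (hasDerivWithinAt_pi.mp ((hu n).deriv t ht)) 0
      exact HasFDerivAt.comp_hasDerivWithinAt (f := fun t => u n t 0) t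
        (h.hasFDerivAt (u n t 0)) h1
    have hdc : ContinuousOn (fun t => inner ℝ (h.grad (u n t 0)) (V (u n t) 0)) (Icc 0 T) := by
      have h1 : ContinuousOn (fun t => h.grad (u n t 0)) (Icc 0 T) :=
        (h.lipschitz.continuous_compLp h.zero_one).comp_continuousOn (continuousOn_pi.mp huc 0)
      have h2 : ContinuousOn (fun t => V (u n t) 0) (Icc 0 T) :=
        continuousOn_pi.mp (hu n).continuousOn_field 0
      exact h1.inner (𝕜 := ℝ) h2
    have hprim := IsPrim.of_hasDerivWithinAt hT hd hdc
    have hle : ∀ t ∈ Icc 0 T, inner ℝ (h.grad (u n t 0)) (V (u n t) 0)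
        ≤ a t * J (u n t 0) + e t := by
      intro t ht
      have hsup := (hu n).supp t ht
      have h1 := h.inner_grad_field_le (lam := lam) hν neg_mem_box hθ hM hsup
        (ae_sq_le_toReal_mul (hfin t ht (5 / 4) 1))
      have h2 : ‖h.grad (u n t 0) - polyL2 (box n) (fcoeff (h.grad (u n t 0)))‖ ≤ q n := by
        refine norm_le_of_sobSq_le (by finiteness) ((sobSq_sub_polyL2_le n _).trans ?_)
        gcongr
        refine (h.sobSq_grad_le neg_mem_box (hsup 0)).trans ?_
        gcongr
        exact (sobSq_le_pairSq 1 _ 0).trans (hK n t ht)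
      have h3 : ‖F t‖ ≤ 1 + ‖F t‖ ^ 2 := by nlinarith [sq_nonneg (‖F t‖ - 1)]
      have h4 : ‖F t‖ * ‖h.grad (u n t 0) - polyL2 (box n) (fcoeff (h.grad (u n t 0)))‖ ≤ e t := by
        rw [he, mul_comm]
        exact mul_le_mul h2 h3 (norm_nonneg _) hqn
      exact h1.trans (add_le_add le_rfl h4)
    have haJ : IntegrableOn (fun t => a t * J (u n t 0)) (Icc 0 T) :=
      hai.mul_continuousOn hJcont isCompact_Icc
    have hgr : ∀ t ∈ Icc 0 T, J (u n t 0)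
        ≤ (J (u n 0 0) + q n * Q) + ∫ s in (0)..t, a s * J (u n s 0) := by
      intro t ht
      have hii : ∀ {g : ℝ → ℝ}, IntegrableOn g (Icc 0 T) → IntervalIntegrable g volume 0 t :=
        fun hg => (intervalIntegrable_iff_integrableOn_Icc_of_le ht.1).mpr
          (hg.mono_set (Icc_subset_Icc_right ht.2))
      rw [hprim.eq t ht, add_assoc]
      gcongr
      have h1 : ∫ s in (0)..t, inner ℝ (h.grad (u n s 0)) (V (u n s) 0)
          ≤ ∫ s in (0)..t, (e s + a s * J (u n s 0)) :=
        intervalIntegral.integral_mono_on ht.1 (hii hdc.integrableOn_Icc)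
          ((hii hec.integrableOn_Icc).add (hii haJ)) fun s hs => by
            have := hle s ⟨hs.1, hs.2.trans ht.2⟩
            linarith
      rw [intervalIntegral.integral_add (hii hec.integrableOn_Icc) (hii haJ)] at h1
      have h2 : ∫ s in (0)..t, e s ≤ q n * Q := by
        have he0 : ∀ s, 0 ≤ e s := fun s => by positivity
        rw [intervalIntegral.integral_of_le ht.1, ← integral_Icc_eq_integral_Ioc]
        refine (setIntegral_mono_set hec.integrableOn_Icc (Filter.Eventually.of_forall he0)
          (Icc_subset_Icc_right ht.2).eventuallyLE).trans ?_
        rw [he, integral_const_mul, integral_add (integrable_const _) hFi]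
        refine mul_le_mul_of_nonneg_left ?_ hqn
        rw [hQ]
        gcongr
        simp [hT]
      linarith
    refine (gronwall_real hT hai ha0 haJ hgr ht).trans ?_
    have hpos : 0 ≤ J (u n 0 0) + q n * Q := add_nonneg (hJ0 _) (by positivity)
    gcongr
    rw [intervalIntegral.integral_of_le ht.1, ← integral_Icc_eq_integral_Ioc]
    refine (setIntegral_mono_set hai (Filter.Eventually.of_forall ha0)
      (Icc_subset_Icc_right ht.2).eventuallyLE).trans ?_
    rw [ha, integral_div, integral_add (integrable_const _) hbi, hA]
    gcongr
    simp [hT, mul_comm]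
  intro t ht
  have h1 : Filter.Tendsto (fun n => J (u n t 0)) Filter.atTop (nhds (J (v t 0))) :=
    (hJc.tendsto _).comp (hv t ht 0)
  have h2 : Filter.Tendsto (fun n => (J (u n 0 0) + q n * Q) * Real.exp A) Filter.atTop (nhds 0) := by
    have h3 : Filter.Tendsto (fun n => J (u n 0 0)) Filter.atTop (nhds (J (uin 0))) := by
      simp only [(hu _).initial]
      exact (hJc.tendsto _).comp (tendsto_polyL2_box (uin 0))
    have h4 := (h3.add (hq0.mul_const Q)).mul_const (Real.exp A)
    rw [hJ] at h4 ⊢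
    simpa [hin] using h4
  exact le_of_tendsto_of_tendsto' h1 h2 fun n => hmain n t ht

/-! ### The maximum principle and the solution without cut-off -/

lemma ModeSol.congr {T a : ℝ} {z f g : ℝ → ℂ} (h : ModeSol T a z f)
    (hfg : ∀ᵐ t ∂(timeMeasure T), f t = g t) : ModeSol T a z g := by
  refine ⟨h.cont, h.integrable.congr hfg, fun t ht => ?_⟩
  rw [h.eq t ht]
  congr 1
  refine intervalIntegral.integral_congr_ae ?_
  have h1 := (ae_restrict_iff' measurableSet_Icc).mp hfg
  filter_upwards [h1] with s hs hs'
  rw [uIoc_of_le ht.1] at hs'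
  rw [hs ⟨hs'.1.le, hs'.2.trans ht.2⟩]

/-- Vanishing of the entropies attached to the levels `M` and `-M` is the pointwise bound. -/
lemma ae_abs_le_of_integral_nonpos {M : ℝ} (hM : 0 ≤ M) {f : L2}
    (h : ∀ σ : ℝ, σ = 1 ∨ σ = -1 →
      ∫ x, (max (σ * f x - M) 0 ^ 3 - max (σ * f x - M - 1) 0 ^ 3) ≤ 0) :
    ∀ᵐ x, |f x| ≤ M := by
  have key : ∀ σ : ℝ, σ = 1 ∨ σ = -1 → ∀ᵐ x, σ * f x ≤ M := fun σ hσ => by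
    have hE := isEntropy_base σ M hσ hM
    have h0 := (integral_eq_zero_iff_of_nonneg (fun x => hE.nonneg (f x)) (hE.integrable f)).mp
      (le_antisymm (h σ hσ) (integral_nonneg fun x => hE.nonneg (f x)))
    filter_upwards [h0] with x hx
    by_contra hlt
    push Not at hlt
    simp only [Pi.zero_apply] at hx
    set r := σ * f x - M with hr
    have hr0 : 0 < r := by linarith
    rw [max_eq_left hr0.le] at hx
    rcases le_total (r - 1) 0 with h1 | h1
    · rw [max_eq_right h1] at hx
      have := pow_pos hr0 3
      linarith
    · rw [max_eq_left h1] at hx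
      nlinarith
  filter_upwards [key 1 (Or.inl rfl), key (-1) (Or.inr rfl)] with x h1 h2
  rw [abs_le]
  constructor <;> linarith

/-- The solution without cut-off, in terms of its Fourier coefficients. As the first component
stays below the bound `M` of its initial value, the cut-off at the level `M` has no effect. -/
theorem exists_pairSol {ν : ℝ} (hν : 0 < ν) (lam : ℝ) {T : ℝ} (hT : 0 ≤ T) {uin : Fin 2 → L2}
    (huin : pairSq 1 uin ≠ ⊤) {M : ℝ} (hM : 0 ≤ M) (hbdd : ∀ᵐ x, |uin 0 x| ≤ M) :
    ∃ (v : ℝ → Fin 2 → L2) (K L : ℝ), v 0 = uin ∧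
      (∀ t ∈ Icc 0 T, ∀ i, sobSq 1 (fcoeff (v t i)) ≤ ENNReal.ofReal K) ∧
      (∀ i, ∫⁻ t in Icc 0 T, sobSq 2 (fcoeff (v t i)) ≤ ENNReal.ofReal L) ∧
      ∫⁻ t in Icc 0 T, sobSq 3 (fcoeff (v t 1)) ≤ ENNReal.ofReal L ∧
      (∀ t ∈ Icc 0 T, ∀ᵐ x, |v t 0 x| ≤ M) ∧
      PairSol ν lam T v fun t i k => fcoeff (adv id (v t) (v t i)) k := by
  set θ : ℝ → ℝ := fun s => max (-M) (min M s) with hθd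
  have hθ : LipschitzWith 1 θ := (LipschitzWith.id.const_min M).const_max (-M)
  have h0 : θ 0 = 0 := by simp [hθd, hM]
  have hθM : ∀ s, |θ s| ≤ M := fun s => by
    rw [abs_le]
    exact ⟨le_max_left _ _, max_le (by linarith) (min_le_left _ _)⟩
  obtain ⟨u, v, K, L, hu, hK, hL, hL', hv, hv0, hK', hL2, hL3, hsol⟩ :=
    exists_galerkin_limit hν lam hT hθ h0 hθM huin
  have hvM : ∀ t ∈ Icc 0 T, ∀ᵐ x, |v t 0 x| ≤ M := fun t ht => by
    refine ae_abs_le_of_integral_nonpos hM fun σ hσ => ?_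
    refine integral_entropy_nonpos hν hT hθM hu hK hL hL' hv (isEntropy_base σ M hσ hM) ?_ t ht
    refine integral_eq_zero_of_ae ?_
    filter_upwards [hbdd] with x hx
    have h1 : σ * uin 0 x ≤ M := by
      rw [abs_le] at hx
      rcases hσ with rfl | rfl <;> linarith
    simp [max_eq_right (by linarith : σ * uin 0 x - M ≤ 0),
      max_eq_right (by linarith : σ * uin 0 x - M - 1 ≤ 0)]
  -- Where `|v₀| ≤ M` the clamp `θ` is the identity.
  refine ⟨v, K, L, hv0, hK', hL2, hL3, hvM, fun i k => (hsol i k).congr ?_⟩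
  filter_upwards [ae_restrict_mem measurableSet_Icc] with t ht
  refine fcoeff_congr ?_ k
  filter_upwards [hvM t ht] with x hx
  rw [abs_le] at hx
  rw [adv, adv, hθd, id]
  simp only
  rw [min_eq_right hx.2, max_eq_right hx.1]

/-! ### Elements of the Sobolev spaces -/

section Sobolev

variable {s : ℝ}

lemma sobSq_zero_weight (s : ℝ) (c : (Fin 2 → ℤ) → ℂ) :
    sobSq 0 (fun k => weight s k • c k) = sobSq s c := by
  refine tsum_congr fun k => ?_
  rw [norm_smul, mul_pow, Real.norm_eq_abs, sq_abs, weight_sq, Real.rpow_zero, one_mul]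

lemma Sobolev.ofReal_norm_sq (c : Sobolev s) : ENNReal.ofReal (‖c‖ ^ 2) = sobSq s c.coeff := by
  have h := lp.hasSum_norm (p := 2) (by norm_num) (Sobolev.toSeq s c)
  simp only [ENNReal.toReal_ofNat, Real.rpow_two] at h
  have h1 : ‖c‖ = ‖Sobolev.toSeq s c‖ := rfl
  rw [h1, ← h.tsum_eq, ENNReal.ofReal_tsum_of_nonneg (fun _ => by positivity) h.summable,
    ← sobSq_zero_weight]
  refine tsum_congr fun k => ?_
  rw [Real.rpow_zero, one_mul]
  rfl

lemma Sobolev.sobSq_ne_top (c : Sobolev s) : sobSq s c.coeff ≠ ⊤ := by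
  rw [← c.ofReal_norm_sq]
  exact ENNReal.ofReal_ne_top

lemma Sobolev.enorm_sq (c : Sobolev s) : ‖c‖ₑ ^ 2 = sobSq s c.coeff := by
  rw [← c.ofReal_norm_sq, ← ofReal_norm, ENNReal.ofReal_pow (norm_nonneg _)]

lemma Sobolev.coeff_neg (c : Sobolev s) (k : Fin 2 → ℤ) : c.coeff (-k) = conj (c.coeff k) :=
  c.2.2 k

lemma Sobolev.weight_mul_norm_coeff_le (c : Sobolev s) (k : Fin 2 → ℤ) :
    weight s k * ‖c.coeff k‖ ≤ ‖c‖ := by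
  have h := lp.norm_apply_le_norm (by norm_num) (Sobolev.toSeq s c) k
  have h1 : (Sobolev.toSeq s c) k = weight s k • c.coeff k := rfl
  rw [h1, norm_smul, Real.norm_of_nonneg (weight_pos s k).le] at h
  exact h

/-- The `k`-th Fourier coefficient as a continuous linear functional on `H^s`. -/
def Sobolev.coeffCLM (s : ℝ) (k : Fin 2 → ℤ) : Sobolev s →L[ℝ] ℂ :=
  LinearMap.mkContinuous
    { toFun := fun c => c.coeff k
      map_add' := fun _ _ => rfl
      map_smul' := fun _ _ => rfl } (weight s k)⁻¹ fun c => by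
    rw [le_inv_mul_iff₀ (weight_pos s k)]
    exact c.weight_mul_norm_coeff_le k

/-- An element of `H^s` from its Fourier coefficients. -/
def Sobolev.ofMem (c : (Fin 2 → ℤ) → ℂ) (h : c ∈ sobolevSubmodule s) : Sobolev s := ⟨c, h⟩

open Classical in
/-- The element of `H^s` with the given Fourier coefficients, or zero if there is none. -/
def Sobolev.ofCoeff (s : ℝ) (c : (Fin 2 → ℤ) → ℂ) : Sobolev s :=
  if h : c ∈ sobolevSubmodule s then Sobolev.ofMem c h else 0

lemma Sobolev.coeff_ofCoeff {c : (Fin 2 → ℤ) → ℂ} (h : sobSq s c ≠ ⊤)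
    (hs : ∀ k, c (-k) = conj (c k)) : (Sobolev.ofCoeff s c).coeff = c := by
  have h1 : c ∈ sobolevSubmodule s :=
    ⟨memℓp_of_sobSq_zero (by rwa [sobSq_zero_weight]), hs⟩
  rw [Sobolev.ofCoeff, dif_pos h1]
  rfl

lemma Represents.sobSq_ne_top {c : Sobolev s} {f : L2} (h : Represents c f) :
    sobSq s (fcoeff f) ≠ ⊤ := by
  rw [← funext h]
  exact c.sobSq_ne_top

lemma represents_ofCoeff {f : L2} (h : sobSq s (fcoeff f) ≠ ⊤) :
    Represents (Sobolev.ofCoeff s (fcoeff f)) f := fun k => by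
  rw [Sobolev.coeff_ofCoeff h (fcoeff_neg _)]

/-! ### Measurability, integrability and continuity in time -/

lemma Sobolev.isEmbedding_toSeq (s : ℝ) : Topology.IsEmbedding (Sobolev.toSeq s) := by
  have h : Isometry (Sobolev.toSeq s) :=
    AddMonoidHomClass.isometry_of_norm (Sobolev.toSeq s) fun _ => rfl
  exact h.isEmbedding

lemma Sobolev.continuous_single (s : ℝ) (k : Fin 2 → ℤ) : Continuous fun z : ℂ =>
    (lp.single 2 k (weight s k • z) : lp (fun _ : Fin 2 → ℤ => ℂ) 2) := by
  have h : Isometry fun z : ℂ => (lp.single 2 k z : lp (fun _ : Fin 2 → ℤ => ℂ) 2) :=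
    Isometry.of_dist_eq fun a b => by
      rw [dist_eq_norm, dist_eq_norm, ← lp.single_sub, lp.norm_single (by norm_num)]
  exact h.continuous.comp (continuous_const_smul _)

lemma Sobolev.aestronglyMeasurable {α : Type*} [MeasurableSpace α] {μ : Measure α}
    {c : α → Sobolev s} (h : ∀ k, AEStronglyMeasurable (fun t => (c t).coeff k) μ) :
    AEStronglyMeasurable c μ := by
  rw [← (Sobolev.isEmbedding_toSeq s).aestronglyMeasurable_comp_iff]
  refine aestronglyMeasurable_of_tendsto_ae Filter.atTop
    (f := fun (S : Finset (Fin 2 → ℤ)) t =>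
      ∑ k ∈ S, (lp.single 2 k (weight s k • (c t).coeff k) : lp (fun _ : Fin 2 → ℤ => ℂ) 2))
    (fun S => Finset.aestronglyMeasurable_fun_sum S fun k _ =>
      (Sobolev.continuous_single s k).comp_aestronglyMeasurable (h k))
    (Filter.Eventually.of_forall fun t => ?_)
  exact lp.hasSum_single (by norm_num) (Sobolev.toSeq s (c t))

lemma memLp_two_of_coeff {T : ℝ} {c : ℝ → Sobolev s}
    (h : ∀ k, AEStronglyMeasurable (fun t => (c t).coeff k) (timeMeasure T))
    (hi : ∫⁻ t in Icc 0 T, sobSq s (c t).coeff ≠ ⊤) : MemLp c 2 (timeMeasure T) := by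
  refine ⟨Sobolev.aestronglyMeasurable h, ?_⟩
  rw [eLpNorm_lt_top_iff_lintegral_rpow_enorm_lt_top (by norm_num) (by norm_num)]
  simp only [ENNReal.toReal_ofNat, ENNReal.rpow_two, Sobolev.enorm_sq]
  exact hi.lt_top

lemma lintegral_sobSq_ne_top_of_memLp {T : ℝ} {c : ℝ → Sobolev s}
    (h : MemLp c 2 (timeMeasure T)) : ∫⁻ t in Icc 0 T, sobSq s (c t).coeff ≠ ⊤ := by
  have h1 := h.2
  rw [eLpNorm_lt_top_iff_lintegral_rpow_enorm_lt_top (by norm_num) (by norm_num)] at h1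
  simp only [ENNReal.toReal_ofNat, ENNReal.rpow_two, Sobolev.enorm_sq] at h1
  exact h1.ne

lemma memBochner_two {T : ℝ} {f : ℝ → L2}
    (hm : ∀ k, AEStronglyMeasurable (fun t => fcoeff (f t) k) (timeMeasure T))
    (hi : ∫⁻ t in Icc 0 T, sobSq s (fcoeff (f t)) ≠ ⊤) : MemBochner 2 T s f := by
  have h1 : ∀ᵐ t ∂(timeMeasure T), sobSq s (fcoeff (f t)) < ⊤ :=
    ae_lt_top' (aemeasurable_sobSq hm s) hi
  have h2 : ∀ᵐ t ∂(timeMeasure T), (Sobolev.ofCoeff s (fcoeff (f t))).coeff = fcoeff (f t) := by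
    filter_upwards [h1] with t ht
    exact Sobolev.coeff_ofCoeff ht.ne (fcoeff_neg _)
  refine ⟨fun t => Sobolev.ofCoeff s (fcoeff (f t)), memLp_two_of_coeff (fun k => ?_) ?_, ?_⟩
  · refine (hm k).congr ?_
    filter_upwards [h2] with t ht
    rw [ht]
  · rw [lintegral_congr_ae (g := fun t => sobSq s (fcoeff (f t)))]
    · exact hi
    filter_upwards [h2] with t ht
    rw [ht]
  · filter_upwards [h1] with t ht
    exact represents_ofCoeff ht.ne

lemma memBochner_top {T : ℝ} {f : ℝ → L2} {K : ℝ}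
    (hm : ∀ k, AEStronglyMeasurable (fun t => fcoeff (f t) k) (timeMeasure T))
    (hb : ∀ t ∈ Icc 0 T, sobSq s (fcoeff (f t)) ≤ ENNReal.ofReal K) : MemBochner ⊤ T s f := by
  have hfin : ∀ t ∈ Icc 0 T, sobSq s (fcoeff (f t)) ≠ ⊤ := fun t ht =>
    ne_top_of_le_ne_top ENNReal.ofReal_ne_top (hb t ht)
  refine ⟨fun t => Sobolev.ofCoeff s (fcoeff (f t)), memLp_top_of_bound
    (Sobolev.aestronglyMeasurable fun k => (hm k).congr ?_) (Real.sqrt (max K 0)) ?_, ?_⟩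
  · filter_upwards [ae_restrict_mem measurableSet_Icc] with t ht
    rw [Sobolev.coeff_ofCoeff (hfin t ht) (fcoeff_neg _)]
  · filter_upwards [ae_restrict_mem measurableSet_Icc] with t ht
    refine Real.le_sqrt_of_sq_le ?_
    have h1 := hb t ht
    rw [← Sobolev.coeff_ofCoeff (hfin t ht) (fcoeff_neg _), ← Sobolev.ofReal_norm_sq] at h1
    exact (ENNReal.ofReal_le_ofReal_iff (le_max_right K 0)).mp
      (h1.trans (ENNReal.ofReal_le_ofReal (le_max_left _ _)))
  · filter_upwards [ae_restrict_mem measurableSet_Icc] with t ht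
    exact represents_ofCoeff (hfin t ht)

/-- A function bounded in `H¹` whose Fourier coefficients are continuous is continuous in `H^s`,
`s < 1`, since its Fourier series converges in `H^s` uniformly in time. -/
lemma memCont_of_lt_one {T K : ℝ} {f : ℝ → L2} (hs : s < 1)
    (hc : ∀ k, ContinuousOn (fun t => fcoeff (f t) k) (Icc 0 T))
    (hb : ∀ t ∈ Icc 0 T, sobSq 1 (fcoeff (f t)) ≤ ENNReal.ofReal K) : MemCont T s f := by
  have hfin : ∀ t ∈ Icc 0 T, sobSq s (fcoeff (f t)) ≠ ⊤ := fun t ht =>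
    ne_top_of_le_ne_top ENNReal.ofReal_ne_top ((sobSq_mono hs.le _).trans (hb t ht))
  refine ⟨fun t => Sobolev.ofCoeff s (fcoeff (f t)), ?_, fun t ht => represents_ofCoeff (hfin t ht)⟩
  rw [(Sobolev.isEmbedding_toSeq s).continuousOn_iff]
  set F : ℕ → ℝ → lp (fun _ : Fin 2 → ℤ => ℂ) 2 := fun n t =>
    ∑ k ∈ box n, lp.single 2 k (weight s k • fcoeff (f t) k) with hF
  have hFc : ∀ n, ContinuousOn (F n) (Icc 0 T) := fun n => continuousOn_finsetSum _ fun k _ =>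
    (Sobolev.continuous_single s k).comp_continuousOn (hc k)
  set K' := max K 0 with hK'
  have hlim : Filter.Tendsto (fun n : ℕ => Real.sqrt (((n : ℝ) + 1) ^ (s - 1) * K')) Filter.atTop
      (nhds 0) := by
    have h1 : Filter.Tendsto (fun n : ℕ => ((n : ℝ) + 1) ^ (-(1 - s))) Filter.atTop (nhds 0) :=
      (tendsto_rpow_neg_atTop (by linarith : 0 < 1 - s)).comp
        (Filter.tendsto_atTop_add_const_right _ _ tendsto_natCast_atTop_atTop)
    have h2 := (h1.mul_const K').sqrt
    rw [zero_mul, Real.sqrt_zero] at h2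
    simpa only [neg_sub] using h2
  refine TendstoUniformlyOn.continuousOn (F := F) (p := Filter.atTop) ?_
    (Filter.Eventually.of_forall hFc).frequently
  rw [Metric.tendstoUniformlyOn_iff]
  intro ε hε
  filter_upwards [hlim.eventually (gt_mem_nhds hε)] with n hn t ht
  refine lt_of_le_of_lt (Real.le_sqrt_of_sq_le ?_) hn
  rw [dist_eq_norm]
  set G := (Sobolev.toSeq s ∘ fun t => Sobolev.ofCoeff s (fcoeff (f t))) t - F n t with hG
  have hGk : ∀ k, G k = if k ∈ box n then 0 else weight s k • fcoeff (f t) k := fun k => by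
    have e1 : (Sobolev.toSeq s (Sobolev.ofCoeff s (fcoeff (f t)))) k
        = weight s k • fcoeff (f t) k := by
      exact congrArg (fun c => weight s k • c k) (Sobolev.coeff_ofCoeff (hfin t ht) (fcoeff_neg _))
    have e2 : (F n t) k = if k ∈ box n then weight s k • fcoeff (f t) k else 0 := by
      rw [hF]
      simp only [lp.coeFn_sum, Finset.sum_apply, lp.single_apply, Pi.single_apply]
      rw [Finset.sum_ite_eq]
    rw [hG, lp.coeFn_sub, Pi.sub_apply, Function.comp, e1, e2]
    split_ifs <;> simp
  have h := lp.hasSum_norm (p := 2) (by norm_num) G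
  simp only [ENNReal.toReal_ofNat, Real.rpow_two] at h
  rw [← ENNReal.ofReal_le_ofReal_iff (by positivity), ← h.tsum_eq,
    ENNReal.ofReal_tsum_of_nonneg (fun _ => by positivity) h.summable,
    ENNReal.ofReal_mul (by positivity)]
  calc ∑' k, ENNReal.ofReal (‖G k‖ ^ 2)
      ≤ ∑' k, ENNReal.ofReal (((n : ℝ) + 1) ^ (s - 1))
          * ENNReal.ofReal (jb k ^ (1 : ℝ) * ‖fcoeff (f t) k‖ ^ 2) := by
        refine ENNReal.tsum_le_tsum fun k => ?_
        rw [← ENNReal.ofReal_mul (by positivity), hGk]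
        refine ENNReal.ofReal_le_ofReal ?_
        have hj := jb_pos k
        split_ifs with hk
        · rw [norm_zero, zero_pow two_ne_zero]
          positivity
        · rw [norm_smul, mul_pow, Real.norm_eq_abs, sq_abs, weight_sq, ← mul_assoc]
          refine mul_le_mul_of_nonneg_right ?_ (sq_nonneg _)
          rw [show s = (s - 1) + 1 by ring, Real.rpow_add hj, show s - 1 + 1 - 1 = s - 1 by ring]
          refine mul_le_mul_of_nonneg_right ?_ (by positivity)
          exact Real.rpow_le_rpow_of_nonpos (by positivity) (le_jb_of_notMem_box hk) (by linarith)
    _ = ENNReal.ofReal (((n : ℝ) + 1) ^ (s - 1)) * sobSq 1 (fcoeff (f t)) := ENNReal.tsum_mul_left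
    _ ≤ _ := by
        gcongr
        exact (hb t ht).trans (ENNReal.ofReal_le_ofReal (le_max_left _ _))

end Sobolev

/-! ### The weak form of the equations in Fourier coefficients -/

lemma jb_sub_one (k : Fin 2 → ℤ) : jb k - 1 = (k 0 : ℝ) ^ 2 + (k 1 : ℝ) ^ 2 := by
  rw [jb, Fin.sum_univ_two]
  ring

lemma IsSmooth.lap {φ : Torus → ℝ} (hφ : IsSmooth φ) : IsSmooth (RKSE.lap φ) := by
  have h : ∀ j, IsSmooth (RKSE.pderiv j (RKSE.pderiv j φ)) := fun j => (hφ.pderiv j).pderiv j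
  exact ContDiff.sum fun j _ => h j

lemma IsSmooth.fcoeff_lap {φ : Torus → ℝ} (hφ : IsSmooth φ) (k : Fin 2 → ℤ) :
    fcoeff (RKSE.lap φ) k = -(jb k - 1) * fcoeff φ k := by
  have h : ∀ j, Integrable (RKSE.pderiv j (RKSE.pderiv j φ)) := fun j =>
    continuous_integrable ((hφ.pderiv j).pderiv j).continuous
  have h1 : RKSE.lap φ = fun x => RKSE.pderiv 0 (RKSE.pderiv 0 φ) x
      + RKSE.pderiv 1 (RKSE.pderiv 1 φ) x := by
    funext x
    rw [RKSE.lap, Fin.sum_univ_two]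
  rw [h1]
  refine (fcoeff_add (h 0) (h 1) k).trans ?_
  rw [(hφ.pderiv 0).fcoeff_pderiv, (hφ.pderiv 1).fcoeff_pderiv, hφ.fcoeff_pderiv, hφ.fcoeff_pderiv]
  have := jb_sub_one k
  have h2 : ((jb k : ℂ) - 1) = (k 0 : ℂ) ^ 2 + (k 1 : ℂ) ^ 2 := by exact_mod_cast this
  rw [h2]
  linear_combination ((k 0 : ℂ) ^ 2 * fcoeff φ k + (k 1 : ℂ) ^ 2 * fcoeff φ k) * Complex.I_sq

/-- The coefficients `(1 + |k|²) φ̂(k)` are those of the smooth function `φ - Δφ`. -/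
lemma IsSmooth.exists_jb_mul {φ : Torus → ℝ} (hφ : IsSmooth φ) :
    ∃ ψ, IsSmooth ψ ∧ ∀ k, fcoeff ψ k = jb k * fcoeff φ k := by
  refine ⟨fun x => φ x + (-1) * RKSE.lap φ x, ContDiff.add hφ (contDiff_const.mul hφ.lap),
    fun k => ?_⟩
  rw [fcoeff_add (continuous_integrable hφ.continuous)
    ((continuous_integrable hφ.lap.continuous).const_mul _), fcoeff_const_mul, hφ.fcoeff_lap]
  push_cast
  ring

lemma IsSmooth.summable_sqrt_jb_mul {φ : Torus → ℝ} (hφ : IsSmooth φ) :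
    Summable fun k => jb k ^ (1 / 2 : ℝ) * ‖fcoeff φ k‖ := by
  obtain ⟨ψ, hψ, h1⟩ := hφ.exists_jb_mul
  obtain ⟨χ, hχ, h2⟩ := hψ.exists_jb_mul
  have hm := memLp_of_continuous hχ.continuous 2
  refine Summable.of_nonneg_of_le (fun k => ?_) (fun k => ?_)
    ((summable_jb_rpow (s := 3 / 2) (by norm_num)).mul_right ‖hm.toLp χ‖)
  · have := jb_pos k
    positivity
  have h3 := norm_fcoeff_le (hm.toLp χ) k
  have hj := jb_pos k
  rw [fcoeff_toLp, h2, h1, norm_mul, norm_mul, Complex.norm_real, Real.norm_of_nonneg hj.le] at h3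
  have h4 : jb k ^ (1 / 2 : ℝ) = jb k ^ (-(3 / 2) : ℝ) * (jb k * jb k) := by
    rw [← sq, ← Real.rpow_two, ← Real.rpow_add hj]
    norm_num
  rw [h4, mul_assoc, mul_assoc]
  exact mul_le_mul_of_nonneg_left h3 (by positivity)

lemma IsSmooth.summable_norm_fcoeff {φ : Torus → ℝ} (hφ : IsSmooth φ) :
    Summable fun k => ‖fcoeff φ k‖ :=
  Summable.of_nonneg_of_le (fun k => norm_nonneg _) (fun k => by
    have := Real.one_le_rpow (one_le_jb k) (by norm_num : (0 : ℝ) ≤ 1 / 2)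
    nlinarith [norm_nonneg (fcoeff φ k)]) hφ.summable_sqrt_jb_mul

lemma Sobolev.norm_coeff_le (c : Sobolev (-1)) (k : Fin 2 → ℤ) :
    ‖c.coeff k‖ ≤ jb k ^ (1 / 2 : ℝ) * ‖c‖ := by
  have h := c.weight_mul_norm_coeff_le k
  have h1 : weight (-1) k = (jb k ^ (1 / 2 : ℝ))⁻¹ := by
    rw [← Real.rpow_neg (jb_pos k).le, weight, jb]
    norm_num
  have := Real.rpow_pos_of_pos (jb_pos k) (1 / 2)
  rwa [h1, inv_mul_le_iff₀ this] at h

lemma Sobolev.summable_pairing (c : Sobolev (-1)) {φ : Torus → ℝ} (hφ : IsSmooth φ) :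
    Summable fun k => c.coeff k * conj (fcoeff φ k) := by
  refine Summable.of_norm_bounded (hφ.summable_sqrt_jb_mul.mul_left ‖c‖) fun k => ?_
  rw [norm_mul, Complex.norm_conj]
  have := mul_le_mul_of_nonneg_right (c.norm_coeff_le k) (norm_nonneg (fcoeff φ k))
  linarith

/-- The constant `(2π)⁻²` of Parseval's identity. -/
def parsevalC : ℝ := ((2 * Real.pi) ^ 2)⁻¹

lemma hasSum_gradInner {f : L2} (hf : sobSq 1 (fcoeff f) ≠ ⊤) {φ : Torus → ℝ} (hφ : IsSmooth φ) :
    HasSum (fun k => ((jb k - 1 : ℝ) : ℂ) * fcoeff f k * conj (fcoeff φ k))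
      ((parsevalC * gradInner f φ : ℝ) : ℂ) := by
  have h : ∀ j, HasSum (fun k => fcoeff (wpartial j f) k * conj (fcoeff (pderiv j φ) k))
      (((parsevalC * ∫ x, wpartial j f x * pderiv j φ x : ℝ)) : ℂ) := fun j =>
    hasSum_fcoeff_mul (Lp.memLp _) (memLp_of_continuous (hφ.pderiv j).continuous 2)
  have h1 := (h 0).add (h 1)
  rw [gradInner, Fin.sum_univ_two, mul_add, Complex.ofReal_add]
  convert! h1 using 1
  funext k
  rw [fcoeff_wpartial hf, fcoeff_wpartial hf, hφ.fcoeff_pderiv, hφ.fcoeff_pderiv, jb_sub_one]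
  simp only [map_mul, Complex.conj_I, map_intCast]
  push_cast
  linear_combination ((k 0 : ℂ) ^ 2 + (k 1 : ℂ) ^ 2) * fcoeff f k * conj (fcoeff φ k) * Complex.I_sq

lemma sobSq_one_wpartial_ne_top {f : L2} (hf : sobSq 2 (fcoeff f) ≠ ⊤) (j : Fin 2) :
    sobSq 1 (fcoeff (wpartial j f)) ≠ ⊤ := by
  have h1 : sobSq 1 (fcoeff f) ≠ ⊤ := ne_top_of_le_ne_top hf (sobSq_mono (by norm_num) _)
  refine ne_top_of_le_ne_top hf (ENNReal.tsum_le_tsum fun k => ENNReal.ofReal_le_ofReal ?_)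
  have := jb_pos k
  rw [fcoeff_wpartial h1, norm_mul, norm_mul, Complex.norm_I, one_mul, mul_pow, Complex.norm_intCast,
    sq_abs, Real.rpow_one, Real.rpow_two, sq (jb k), mul_assoc]
  gcongr
  exact sq_le_jb k j

lemma fcoeff_wlap {f : L2} (hf : sobSq 2 (fcoeff f) ≠ ⊤) (k : Fin 2 → ℤ) :
    fcoeff (wlap f) k = -(jb k - 1) * fcoeff f k := by
  have h1 : sobSq 1 (fcoeff f) ≠ ⊤ := ne_top_of_le_ne_top hf (sobSq_mono (by norm_num) _)
  rw [wlap, ← fcoeffCLM_apply, map_sum, Fin.sum_univ_two, fcoeffCLM_apply, fcoeffCLM_apply,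
    fcoeff_wpartial (sobSq_one_wpartial_ne_top hf 0), fcoeff_wpartial (sobSq_one_wpartial_ne_top hf 1),
    fcoeff_wpartial h1, fcoeff_wpartial h1]
  have h2 : ((jb k : ℂ) - 1) = (k 0 : ℂ) ^ 2 + (k 1 : ℂ) ^ 2 := by exact_mod_cast jb_sub_one k
  rw [h2]
  linear_combination ((k 0 : ℂ) ^ 2 * fcoeff f k + (k 1 : ℂ) ^ 2 * fcoeff f k) * Complex.I_sq

lemma hasSum_lapInner {f : L2} (hf : sobSq 2 (fcoeff f) ≠ ⊤) {φ : Torus → ℝ} (hφ : IsSmooth φ) :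
    HasSum (fun k => (((jb k - 1) ^ 2 : ℝ) : ℂ) * fcoeff f k * conj (fcoeff φ k))
      ((parsevalC * lapInner f φ : ℝ) : ℂ) := by
  have h : HasSum (fun k => fcoeff (wlap f) k * conj (fcoeff (lap φ) k))
      (((parsevalC * ∫ x, wlap f x * lap φ x : ℝ)) : ℂ) :=
    hasSum_fcoeff_mul (Lp.memLp _) (memLp_of_continuous hφ.lap.continuous 2)
  rw [lapInner]
  convert! h using 1
  funext k
  rw [fcoeff_wlap hf, hφ.fcoeff_lap]
  simp only [map_mul, map_neg, map_sub, Complex.conj_ofReal, map_one]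
  push_cast
  ring

lemma hasSum_advInner {u : Fin 2 → L2} {f : L2} (hf : MemLp (adv id u f) 2 volume)
    {φ : Torus → ℝ} (hφ : IsSmooth φ) :
    HasSum (fun k => fcoeff (adv id u f) k * conj (fcoeff φ k))
      ((parsevalC * advInner u f φ : ℝ) : ℂ) := by
  have h : HasSum (fun k => fcoeff (adv id u f) k * conj (fcoeff φ k))
      (((parsevalC * ∫ x, adv id u f x * φ x : ℝ)) : ℂ) :=
    hasSum_fcoeff_mul hf (memLp_of_continuous hφ.continuous 2)
  have h1 : advInner u f φ = ∫ x, adv id u f x * φ x := by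
    simp only [advInner, Fin.sum_univ_two]
    rfl
  rwa [h1]

lemma eq_re_tsum {F : (Fin 2 → ℤ) → ℂ} {a : ℝ} {z : ℂ} (h : HasSum F z)
    (hz : z = ((parsevalC * a : ℝ) : ℂ)) :
    a = (2 * Real.pi) ^ 2 * (∑' k, F k).re := by
  rw [h.tsum_eq, hz, Complex.ofReal_re, parsevalC, ← mul_assoc, mul_inv_cancel₀ (by positivity), one_mul]

/-- The weak form of the first equation, tested with `φ`. -/
lemma weak_form_zero (ν lam : ℝ) {u : Fin 2 → L2} (hu : sobSq 1 (fcoeff (u 0)) ≠ ⊤)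
    (ha : MemLp (adv id u (u 0)) 2 volume) (g : Sobolev (-1)) {φ : Torus → ℝ} (hφ : IsSmooth φ) :
    g.pairing φ + ν * gradInner (u 0) φ + advInner u (u 0) φ
      = (2 * Real.pi) ^ 2 * (∑' k, (g.coeff k + rate ν lam 0 k * fcoeff (u 0) k
          + fcoeff (adv id u (u 0)) k) * conj (fcoeff φ k)).re := by
  have h := ((hasSum_gradInner hu hφ).mul_left (ν : ℂ)).add (hasSum_advInner ha hφ)
  have h1 : ν * gradInner (u 0) φ + advInner u (u 0) φ = _ := eq_re_tsum h (by
    push_cast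
    ring)
  rw [add_assoc, h1, Sobolev.pairing, ← mul_add, ← Complex.add_re,
    ← (g.summable_pairing hφ).tsum_add h.summable]
  congr 3
  funext k
  rw [rate, if_pos rfl]
  push_cast
  ring

/-- The weak form of the second equation, tested with `φ`. -/
lemma weak_form_one (ν lam : ℝ) {u : Fin 2 → L2} (hu : sobSq 2 (fcoeff (u 1)) ≠ ⊤)
    (ha : MemLp (adv id u (u 1)) 2 volume) (g : Sobolev (-1)) {φ : Torus → ℝ} (hφ : IsSmooth φ) :
    g.pairing φ + lapInner (u 1) φ + advInner u (u 1) φ - lam * gradInner (u 1) φ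
      = (2 * Real.pi) ^ 2 * (∑' k, (g.coeff k + rate ν lam 1 k * fcoeff (u 1) k
          + fcoeff (adv id u (u 1)) k) * conj (fcoeff φ k)).re := by
  have hu1 : sobSq 1 (fcoeff (u 1)) ≠ ⊤ := ne_top_of_le_ne_top hu (sobSq_mono (by norm_num) _)
  have h := (((hasSum_lapInner hu hφ).add (hasSum_advInner ha hφ)).sub
    ((hasSum_gradInner hu1 hφ).mul_left (lam : ℂ)))
  have h1 : lapInner (u 1) φ + advInner u (u 1) φ - lam * gradInner (u 1) φ = _ :=
    eq_re_tsum h (by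
      push_cast
      ring)
  rw [add_assoc, add_sub_assoc, h1, Sobolev.pairing, ← mul_add, ← Complex.add_re,
    ← (g.summable_pairing hφ).tsum_add h.summable]
  congr 3
  funext k
  rw [rate, if_neg (by simp)]
  push_cast
  ring

/-- The test function `Re (c e^{i k·x})` picks out the coefficient of frequency `k` of a family with the
reality symmetry. -/
lemma re_tsum_mul_conj_fcoeff_re_expMode {d : (Fin 2 → ℤ) → ℂ} (hd : ∀ k, d (-k) = conj (d k))
    (c : ℂ) (k : Fin 2 → ℤ) :
    (∑' l, d l * conj (fcoeff (fun x => (c * expMode k x).re) l)).re = (d k * conj c).re := by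
  have h1 : ∀ l, d l * conj (fcoeff (fun x => (c * expMode k x).re) l)
      = (if l = k then d k * conj c / 2 else 0) + if l = -k then d (-k) * c / 2 else 0 := fun l => by
    rw [fcoeff_re_expMode]
    have e1 : k = l ↔ l = k := eq_comm
    have e2 : k = -l ↔ l = -k := by rw [eq_neg_iff_add_eq_zero, eq_neg_iff_add_eq_zero, add_comm]
    simp only [e1, e2, map_mul, map_add, apply_ite conj, map_zero, Complex.conj_conj]
    have e3 : conj (1 / 2 : ℂ) = 1 / 2 := by
      rw [show (1 / 2 : ℂ) = ((1 / 2 : ℝ) : ℂ) by push_cast; rfl, Complex.conj_ofReal]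
    rw [e3]
    split_ifs with h h' h'
    · rw [← h', ← h]; ring
    · rw [← h]; ring
    · rw [← h']; ring
    · ring
  simp only [h1]
  rw [Summable.tsum_add (summable_of_hasFiniteSupport ((finite_singleton k).subset fun l hl => by
      by_contra h
      exact hl (if_neg h)))
    (summable_of_hasFiniteSupport ((finite_singleton (-k)).subset fun l hl => by
      by_contra h
      exact hl (if_neg h))), tsum_ite_eq, tsum_ite_eq, hd, Complex.add_re]
  have e : (conj (d k) * c / 2).re = (d k * conj c / 2).re := by
    rw [Complex.div_ofNat_re, Complex.div_ofNat_re]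
    simp [Complex.mul_re]
  rw [e, ← Complex.add_re, add_halves]

/-! ### Distributional time derivatives -/

/-- `ψ` is a test function on the open interval `(0,T)`. -/
structure IsTest (T : ℝ) (ψ : ℝ → ℝ) : Prop where
  smooth : ContDiff ℝ ∞ ψ
  compact : HasCompactSupport ψ
  supp : tsupport ψ ⊆ Ioo 0 T

lemma IsTest.eq_zero {T : ℝ} {ψ : ℝ → ℝ} (h : IsTest T ψ) {t : ℝ} (ht : t ∉ Ioo 0 T) : ψ t = 0 :=
  image_eq_zero_of_notMem_tsupport fun h' => ht (h.supp h')

lemma IsTest.continuous_deriv {T : ℝ} {ψ : ℝ → ℝ} (h : IsTest T ψ) : Continuous (deriv ψ) :=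
  h.smooth.continuous_deriv (by simp)

/-- Integration by parts against a test function. -/
lemma IsPrim.integral_deriv_mul {T : ℝ} (hT : 0 ≤ T) {x x' ψ : ℝ → ℝ} (h : IsPrim T x x')
    (hψ : IsTest T ψ) :
    ∫ t in Icc 0 T, deriv ψ t * x t = -∫ t in Icc 0 T, ψ t * x' t := by
  have h1 : IsPrim T ψ (deriv ψ) := IsPrim.of_contDiff hT (fun t =>
    (hψ.smooth.differentiable (by simp) t).hasDerivAt) hψ.continuous_deriv
  have h2 := (h1.mul hT h).eq T ⟨hT, le_rfl⟩
  rw [hψ.eq_zero (by simp), hψ.eq_zero (by simp), zero_mul, zero_mul, zero_add,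
    intervalIntegral.integral_of_le hT, ← integral_Icc_eq_integral_Ioc] at h2
  obtain ⟨h3, -⟩ := h.exists_ac hT
  have hx : ContinuousOn x (Icc 0 T) := by
    have := h3.continuousOn
    rwa [uIcc_of_le hT] at this
  have hx' : IntegrableOn x' (Icc 0 T) :=
    (intervalIntegrable_iff_integrableOn_Icc_of_le hT).mp h.integrable
  have i1 : IntegrableOn (fun t => deriv ψ t * x t) (Icc 0 T) :=
    (hψ.continuous_deriv.continuousOn.mul hx).integrableOn_Icc
  have i2 : IntegrableOn (fun t => ψ t * x' t) (Icc 0 T) :=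
    hx'.continuousOn_mul hψ.smooth.continuous.continuousOn isCompact_Icc
  rw [integral_add i1 i2] at h2
  linarith

/-- A test function with vanishing integral is the derivative of a test function. -/
lemma IsTest.exists_deriv_eq {T : ℝ} (hT : 0 < T) {w : ℝ → ℝ} (h : IsTest T w)
    (h0 : ∫ t, w t = 0) : ∃ ψ, IsTest T ψ ∧ deriv ψ = w := by
  -- The primitive of `w` that vanishes at `0` vanishes outside every interval that contains the support
  -- of `w`, since `∫ w = 0`. The point `T / 2` is added for the case that the support is empty.
  obtain ⟨a, ha, b, hb, hab⟩ : ∃ a, 0 < a ∧ ∃ b, b < T ∧ tsupport w ⊆ Icc a b := by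
    set S := insert (T / 2) (tsupport w) with hS
    have hSc : IsCompact S := h.compact.isCompact.insert _
    have hSn : S.Nonempty := insert_nonempty _ _
    have hSs : S ⊆ Ioo 0 T := insert_subset ⟨by linarith, by linarith⟩ h.supp
    exact ⟨sInf S, (hSs (hSc.sInf_mem hSn)).1, sSup S, (hSs (hSc.sSup_mem hSn)).2,
      fun x hx => ⟨csInf_le hSc.bddBelow (mem_insert_of_mem _ hx),
        le_csSup hSc.bddAbove (mem_insert_of_mem _ hx)⟩⟩
  have hw0 : ∀ t, t ∉ Icc a b → w t = 0 := fun t ht =>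
    image_eq_zero_of_notMem_tsupport fun h' => ht (hab h')
  have hd : ∀ t, HasDerivAt (fun t => ∫ s in (0)..t, w s) (w t) t := fun t =>
    h.smooth.continuous.integral_hasStrictDerivAt 0 t |>.hasDerivAt
  have hde : deriv (fun t => ∫ s in (0)..t, w s) = w := funext fun t => (hd t).deriv
  have hz : ∀ t, t ∉ Icc a b → ∫ s in (0)..t, w s = 0 := by
    intro t ht
    rcases lt_or_ge t a with h1 | h1
    · refine intervalIntegral.integral_zero_ae (Filter.Eventually.of_forall fun s hs => hw0 s ?_)
      intro hs'
      have : s ≤ max 0 t := hs.2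
      exact absurd (hs'.1.trans this) (not_le.mpr (max_lt ha h1))
    · have h2 : b < t := by
        by_contra h3
        exact ht ⟨h1, not_lt.mp h3⟩
      rw [intervalIntegral.integral_eq_integral_of_support_subset, h0]
      intro s hs
      have h3 : s ∈ Icc a b := by
        by_contra h4
        exact hs (hw0 s h4)
      exact ⟨ha.trans_le h3.1, h3.2.trans h2.le⟩
  have hts : tsupport (fun t => ∫ s in (0)..t, w s) ⊆ Icc a b :=
    closure_minimal (fun t ht => by
      by_contra h1
      exact ht (hz t h1)) isClosed_Icc
  refine ⟨fun t => ∫ s in (0)..t, w s, ⟨?_, ?_, fun t ht => ?_⟩, hde⟩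
  · rw [contDiff_infty_iff_deriv]
    exact ⟨fun t => (hd t).differentiableAt, by rw [hde]; exact h.smooth⟩
  · exact IsCompact.of_isClosed_subset isCompact_Icc (isClosed_tsupport _) hts
  · exact ⟨ha.trans_le (hts ht).1, (hts ht).2.trans_lt hb⟩

lemma exists_isTest_integral_one {T : ℝ} (hT : 0 < T) : ∃ χ, IsTest T χ ∧ ∫ t, χ t = 1 := by
  let f : ContDiffBump (T / 2) := ⟨T / 8, T / 4, by linarith, by linarith⟩
  refine ⟨f.normed volume, ⟨f.contDiff_normed, f.hasCompactSupport_normed, ?_⟩, f.integral_normed⟩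
  rw [f.tsupport_normed_eq, Real.closedBall_eq_Icc]
  have : f.rOut = T / 4 := rfl
  rw [this]
  exact Icc_subset_Ioo (by linarith) (by linarith)

/-- **The lemma of du Bois-Reymond**: a continuous function with an integrable distributional
derivative is a primitive of it. -/
lemma IsPrim.of_integral_deriv_mul {T : ℝ} (hT : 0 < T) {x x' : ℝ → ℝ}
    (hx : ContinuousOn x (Icc 0 T)) (hx' : IntegrableOn x' (Icc 0 T))
    (h : ∀ ψ, IsTest T ψ → ∫ t in Icc 0 T, deriv ψ t * x t = -∫ t in Icc 0 T, ψ t * x' t) :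
    IsPrim T x x' := by
  have hii := (intervalIntegrable_iff_integrableOn_Icc_of_le hT.le).mpr hx'
  refine ⟨hii, ?_⟩
  set X : ℝ → ℝ := fun t => ∫ s in (0)..t, x' s with hX
  have hXp : IsPrim T X x' := ⟨hii, fun t _ => by simp [hX]⟩
  have hXc : ContinuousOn X (Icc 0 T) := by
    have := (hXp.exists_ac hT.le).1.continuousOn
    rwa [uIcc_of_le hT.le] at this
  set y : ℝ → ℝ := fun t => x t - X t with hy
  have hyc : ContinuousOn y (Icc 0 T) := hx.sub hXc
  have hy0 : ∀ ψ, IsTest T ψ → ∫ t in Icc 0 T, deriv ψ t * y t = 0 := fun ψ hψ => by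
    have i1 : IntegrableOn (fun t => deriv ψ t * x t) (Icc 0 T) :=
      (hψ.continuous_deriv.continuousOn.mul hx).integrableOn_Icc
    have i2 : IntegrableOn (fun t => deriv ψ t * X t) (Icc 0 T) :=
      (hψ.continuous_deriv.continuousOn.mul hXc).integrableOn_Icc
    simp only [hy, mul_sub]
    rw [integral_sub i1 i2, h ψ hψ, hXp.integral_deriv_mul hT.le hψ, sub_self]
  -- After subtraction of a multiple of `χ` every test function is a derivative, so `y` is orthogonal to it.
  obtain ⟨χ, hχ, hχ1⟩ := exists_isTest_integral_one hT
  set c := ∫ t in Icc 0 T, χ t * y t with hc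
  have hloc : LocallyIntegrableOn (fun t => y t - c) (Ioo 0 T) :=
    ((hyc.sub continuousOn_const).mono Ioo_subset_Icc_self).locallyIntegrableOn measurableSet_Ioo
  have hae := isOpen_Ioo.ae_eq_zero_of_integral_contDiff_smul_eq_zero hloc fun φ h1 h2 h3 => by
    have hφ : IsTest T φ := ⟨h1, h2, h3⟩
    set m := ∫ t, φ t with hm
    have hwt : IsTest T fun t => φ t - m * χ t := by
      refine ⟨h1.sub (contDiff_const.mul hχ.smooth), ?_, ?_⟩
      · exact h2.sub (hχ.compact.mul_left (f := fun _ => m))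
      · refine (tsupport_sub _ _).trans (union_subset h3 ?_)
        exact (tsupport_mul_subset_right (f := fun _ => m)).trans hχ.supp
    obtain ⟨ψ, hψ, hψd⟩ := hwt.exists_deriv_eq hT (by
      rw [integral_sub (h1.continuous.integrable_of_hasCompactSupport h2)
        ((hχ.smooth.continuous.integrable_of_hasCompactSupport hχ.compact).const_mul _),
        integral_const_mul, hχ1, mul_one, sub_self])
    have h4 := hy0 ψ hψ
    rw [hψd] at h4
    have i1 : IntegrableOn (fun t => φ t * y t) (Icc 0 T) :=
      (h1.continuous.continuousOn.mul hyc).integrableOn_Icc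
    have i2 : IntegrableOn (fun t => m * (χ t * y t)) (Icc 0 T) :=
      (continuousOn_const.mul (hχ.smooth.continuous.continuousOn.mul hyc)).integrableOn_Icc
    have h5 : ∀ t, (φ t - m * χ t) * y t = φ t * y t - m * (χ t * y t) := fun t => by ring
    simp only [h5] at h4
    rw [integral_sub i1 i2, integral_const_mul, ← hc] at h4
    have h6 : ∫ t, φ t • (y t - c) = ∫ t in Icc 0 T, φ t • (y t - c) :=
      (setIntegral_eq_integral_of_forall_compl_eq_zero fun t ht => by
        rw [hφ.eq_zero fun h' => ht (Ioo_subset_Icc_self h'), zero_smul]).symm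
    have h7 : m = ∫ t in Icc 0 T, φ t :=
      (setIntegral_eq_integral_of_forall_compl_eq_zero fun t ht =>
        hφ.eq_zero fun h' => ht (Ioo_subset_Icc_self h')).symm
    have i3 : IntegrableOn (fun t => φ t * c) (Icc 0 T) :=
      (h1.continuous.continuousOn.mul continuousOn_const).integrableOn_Icc
    rw [h6]
    simp only [smul_eq_mul, mul_sub]
    rw [integral_sub i1 i3, integral_mul_const, ← h7]
    linarith
  have heq : EqOn y (fun _ => c) (Icc 0 T) := by
    refine Measure.eqOn_Icc_of_ae_eq volume hT.ne ?_ hyc continuousOn_const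
    rw [Filter.EventuallyEq, ← restrict_Ioo_eq_restrict_Icc, ae_restrict_iff' measurableSet_Ioo]
    filter_upwards [hae] with t ht hm
    exact sub_eq_zero.mp (ht hm)
  intro t ht
  have h1 := heq ht
  have h2 := heq (⟨le_rfl, hT.le⟩ : (0 : ℝ) ∈ Icc 0 T)
  simp only [hy, hX, intervalIntegral.integral_same, sub_zero] at h1 h2
  linarith

/-- A family with values in `L²` has a time derivative in `H⁻¹` if its Fourier coefficients do. -/
lemma isTimeDeriv_of_coeff {T : ℝ} (hT : 0 ≤ T) {f : ℝ → L2} {g : ℝ → Sobolev (-1)} {K : ℝ}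
    (hc : ∀ k, ContinuousOn (fun t => fcoeff (f t) k) (Icc 0 T))
    (hK : ∀ t ∈ Icc 0 T, ‖f t‖ ≤ K) (hg : Integrable g (timeMeasure T))
    (h : ∀ k (c : ℂ), IsPrim T (fun t => (fcoeff (f t) k * c).re)
      (fun t => ((g t).coeff k * c).re)) : IsTimeDeriv T f g := by
  intro φ hφ ψ h1 h2 h3
  have hψ : IsTest T ψ := ⟨h1, h2, h3⟩
  set p : ℝ := (2 * Real.pi) ^ 2 with hp
  have hgk : ∀ k, Integrable (fun t => (g t).coeff k) (timeMeasure T) := fun k =>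
    (Sobolev.coeffCLM (-1) k).integrable_comp hg
  -- the two sides are summed over the frequencies
  set F : (Fin 2 → ℤ) → ℝ → ℝ := fun k t => deriv ψ t * (fcoeff (f t) k * (p * conj (fcoeff φ k))).re
    with hF
  set G : (Fin 2 → ℤ) → ℝ → ℝ := fun k t => ψ t * ((g t).coeff k * (p * conj (fcoeff φ k))).re with hG
  have hp0 : 0 ≤ p := by positivity
  have hre : ∀ (z : ℂ) k, |(z * (p * conj (fcoeff φ k))).re| ≤ p * (‖z‖ * ‖fcoeff φ k‖) := fun z k => by
    refine (Complex.abs_re_le_norm _).trans_eq ?_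
    rw [norm_mul, norm_mul, Complex.norm_conj, Complex.norm_real, Real.norm_of_nonneg hp0]
    ring
  have hFi : ∀ k, Integrable (F k) (timeMeasure T) := fun k =>
    (hψ.continuous_deriv.continuousOn.mul
      (Complex.continuous_re.comp_continuousOn ((hc k).mul continuousOn_const))).integrableOn_Icc
  have hGi : ∀ k, Integrable (G k) (timeMeasure T) := fun k =>
    IntegrableOn.continuousOn_mul h1.continuous.continuousOn ((hgk k).mul_const _).re isCompact_Icc
  have hFs : Summable fun k => ∫ t in Icc 0 T, ‖F k t‖ := by
    have i1 : IntegrableOn (fun t => |deriv ψ t|) (Icc 0 T) :=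
      hψ.continuous_deriv.abs.continuousOn.integrableOn_Icc
    refine Summable.of_nonneg_of_le (fun k => integral_nonneg fun t => norm_nonneg _) (fun k => ?_)
      (hφ.summable_norm_fcoeff.mul_left ((∫ t in Icc 0 T, |deriv ψ t|) * (p * K)))
    rw [← integral_mul_const, ← integral_mul_const]
    refine setIntegral_mono_on (hFi k).norm ((i1.mul_const _).mul_const _) measurableSet_Icc
      fun t ht => ?_
    rw [hF, norm_mul, Real.norm_eq_abs, Real.norm_eq_abs, mul_assoc, mul_assoc]
    refine mul_le_mul_of_nonneg_left ((hre _ k).trans ?_) (abs_nonneg _)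
    refine mul_le_mul_of_nonneg_left (mul_le_mul_of_nonneg_right ?_ (norm_nonneg _)) hp0
    exact (norm_fcoeff_le _ k).trans (hK t ht)
  have hGs : Summable fun k => ∫ t in Icc 0 T, ‖G k t‖ := by
    have i1 : IntegrableOn (fun t => |ψ t| * ‖g t‖) (Icc 0 T) :=
      IntegrableOn.continuousOn_mul h1.continuous.abs.continuousOn hg.norm isCompact_Icc
    refine Summable.of_nonneg_of_le (fun k => integral_nonneg fun t => norm_nonneg _) (fun k => ?_)
      (hφ.summable_sqrt_jb_mul.mul_left ((∫ t in Icc 0 T, |ψ t| * ‖g t‖) * p))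
    rw [← integral_mul_const, ← integral_mul_const]
    refine setIntegral_mono_on (hGi k).norm ((i1.mul_const _).mul_const _) measurableSet_Icc
      fun t ht => ?_
    rw [hG, norm_mul, Real.norm_eq_abs, Real.norm_eq_abs]
    have h4 := mul_le_mul_of_nonneg_left ((hre ((g t).coeff k) k).trans
      (mul_le_mul_of_nonneg_left (mul_le_mul_of_nonneg_right ((g t).norm_coeff_le k)
        (norm_nonneg _)) hp0)) (abs_nonneg (ψ t))
    refine h4.trans_eq ?_
    ring
  have e1 : ∀ t, deriv ψ t * ∫ x, f t x * φ x = ∑' k, F k t := fun t => by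
    have hs := hasSum_fcoeff_mul (Lp.memLp (f t)) (memLp_of_continuous hφ.continuous 2)
    have h5 := ((Complex.hasSum_re hs).mul_left p).mul_left (deriv ψ t)
    rw [integral_mul_eq_tsum (Lp.memLp (f t)) (memLp_of_continuous hφ.continuous 2),
      hs.tsum_eq, ← hp, ← h5.tsum_eq]
    refine tsum_congr fun k => ?_
    simp only [hF]
    rw [mul_left_comm (fcoeff (f t) k), Complex.re_ofReal_mul]
  have e2 : ∀ t, ψ t * (g t).pairing φ = ∑' k, G k t := fun t => by
    have h5 := ((Complex.hasSum_re ((g t).summable_pairing hφ).hasSum).mul_left p).mul_left (ψ t)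
    rw [Sobolev.pairing, ← hp, ← h5.tsum_eq]
    refine tsum_congr fun k => ?_
    simp only [hG]
    rw [mul_left_comm ((g t).coeff k), Complex.re_ofReal_mul]
  simp only [e1, e2]
  rw [← (hasSum_integral_of_summable_integral_norm hFi hFs).tsum_eq,
    ← (hasSum_integral_of_summable_integral_norm hGi hGs).tsum_eq, ← tsum_neg]
  exact tsum_congr fun k => (h k _).integral_deriv_mul hT hψ

/-! ### Strong solutions in terms of Fourier coefficients -/

/-- For a velocity in `H²`, the advection term is square integrable. -/
lemma memLp_adv_id {u : Fin 2 → L2} (h : ∀ i, sobSq 2 (fcoeff (u i)) ≠ ⊤) (f : L2) :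
    MemLp (adv id u f) 2 volume := by
  have h1 : ∀ i, sobSq (5 / 4) (fcoeff (u i)) ≠ ⊤ := fun i =>
    ne_top_of_le_ne_top (h i) (sobSq_mono (by norm_num) _)
  exact memLp_adv LipschitzWith.id f (ae_sq_le_toReal_mul (h1 0)) (ae_sq_le_toReal_mul (h1 1))

lemma abs_rate_zero_le (ν lam : ℝ) (k : Fin 2 → ℤ) : |rate ν lam 0 k| ≤ |ν| * jb k := by
  have := one_le_jb k
  rw [rate, if_pos rfl, abs_mul, abs_of_nonneg (by linarith : 0 ≤ jb k - 1)]
  exact mul_le_mul_of_nonneg_left (by linarith) (abs_nonneg _)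

lemma abs_rate_one_le (ν lam : ℝ) (k : Fin 2 → ℤ) : |rate ν lam 1 k| ≤ (1 + |lam|) * jb k ^ 2 := by
  have := one_le_jb k
  rw [rate, if_neg (by simp)]
  refine (abs_sub _ _).trans ?_
  rw [abs_mul, abs_of_nonneg (sq_nonneg _), abs_of_nonneg (by linarith : 0 ≤ jb k - 1), add_mul]
  refine add_le_add (by nlinarith) (mul_le_mul_of_nonneg_left (by nlinarith) (abs_nonneg _))

/-- A Fourier multiplier whose symbol is of order `2n` maps `H^{s+2n}` to `H^s`. -/
lemma sobSq_mul_le {s : ℝ} {n : ℕ} {C : ℝ} {a : (Fin 2 → ℤ) → ℝ} (ha : ∀ k, |a k| ≤ C * jb k ^ n)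
    (c : (Fin 2 → ℤ) → ℂ) :
    sobSq s (fun k => a k * c k) ≤ ENNReal.ofReal (C ^ 2) * sobSq (s + 2 * n) c := by
  rw [sobSq, sobSq, ← ENNReal.tsum_mul_left]
  refine ENNReal.tsum_le_tsum fun k => ?_
  have hj := jb_pos k
  rw [← ENNReal.ofReal_mul (sq_nonneg C)]
  refine ENNReal.ofReal_le_ofReal ?_
  rw [norm_mul, Complex.norm_real, Real.norm_eq_abs, mul_pow, Real.rpow_add hj,
    show (2 * n : ℝ) = ((2 * n : ℕ) : ℝ) by push_cast; ring, Real.rpow_natCast]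
  have h1 := pow_le_pow_left₀ (abs_nonneg _) (ha k) 2
  have h2 := mul_le_mul_of_nonneg_left (mul_le_mul_of_nonneg_right h1 (sq_nonneg ‖c k‖))
    (Real.rpow_nonneg hj.le s)
  refine h2.trans_eq ?_
  ring

/-- The Fourier coefficients of `-∂ₜ u`. -/
def residual (ν lam : ℝ) (u : Fin 2 → L2) (i : Fin 2) (k : Fin 2 → ℤ) : ℂ :=
  rate ν lam i k * fcoeff (u i) k + fcoeff (adv id u (u i)) k

/-- The time derivative is in `L²H⁻¹` for a function in `L^∞H¹` with second component in `L²H³` and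
bounded first component. -/
lemma sobSq_residual_le (ν lam : ℝ) {u : Fin 2 → L2} {K M : ℝ} (hM : ∀ᵐ x, |u 0 x| ≤ M)
    (hK : ∀ i, sobSq 1 (fcoeff (u i)) ≤ ENNReal.ofReal K) (h2 : sobSq 2 (fcoeff (u 1)) ≠ ⊤)
    (i : Fin 2) :
    sobSq (-1) (residual ν lam u i)
      ≤ 2 * (ENNReal.ofReal (ν ^ 2) * ENNReal.ofReal K
          + ENNReal.ofReal ((1 + |lam|) ^ 2) * sobSq 3 (fcoeff (u 1))
        + 2 * (ENNReal.ofReal (M ^ 2) + ENNReal.ofReal embC * sobSq 2 (fcoeff (u 1)))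
          * ENNReal.ofReal K) := by
  refine (sobSq_add_le (-1) _ _).trans ?_
  gcongr
  · fin_cases i
    · refine le_add_of_le_left ((sobSq_mul_le (n := 1) (C := |ν|) (fun k => ?_) _).trans ?_)
      · rw [pow_one]
        exact abs_rate_zero_le ν lam k
      · rw [sq_abs]
        norm_num
        gcongr
        exact hK 0
    · refine le_add_of_le_right ((sobSq_mul_le (n := 2) (abs_rate_one_le ν lam) _).trans ?_)
      norm_num
  · have h5 : sobSq (5 / 4) (fcoeff (u 1)) ≠ ⊤ :=
      ne_top_of_le_ne_top h2 (sobSq_mono (by norm_num) _)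
    refine (sobSq_mono (by norm_num : (-1 : ℝ) ≤ 0) _).trans ?_
    refine (sobSq_adv_le LipschitzWith.id (A := M ^ 2) ?_ (ae_sq_le_toReal_mul h5)
      (ne_top_of_le_ne_top ENNReal.ofReal_ne_top (hK i))).trans ?_
    · filter_upwards [hM] with x hx
      exact sq_le_sq' (abs_le.mp hx).1 (abs_le.mp hx).2
    · rw [ENNReal.ofReal_toReal (by finiteness)]
      gcongr
      · exact sobSq_mono (by norm_num) _
      · exact hK i

/-- A solution in terms of Fourier coefficients, with the bounds that the construction provides, is a
strong solution. -/
theorem PairSol.isStrongSolution {ν lam T K L M : ℝ} (hT : 0 ≤ T) {uin : Fin 2 → L2}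
    {v : ℝ → Fin 2 → L2} (h0 : v 0 = uin)
    (hK : ∀ t ∈ Icc 0 T, ∀ i, sobSq 1 (fcoeff (v t i)) ≤ ENNReal.ofReal K)
    (hL2 : ∀ i, ∫⁻ t in Icc 0 T, sobSq 2 (fcoeff (v t i)) ≤ ENNReal.ofReal L)
    (hL3 : ∫⁻ t in Icc 0 T, sobSq 3 (fcoeff (v t 1)) ≤ ENNReal.ofReal L)
    (hM : ∀ t ∈ Icc 0 T, ∀ᵐ x, |v t 0 x| ≤ M)
    (hsol : PairSol ν lam T v fun t i k => fcoeff (adv id (v t) (v t i)) k) :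
    IsStrongSolution ν lam T uin v := by
  have hL2' : ∀ i, ∫⁻ t in Icc 0 T, sobSq 2 (fcoeff (v t i)) ≠ ⊤ := fun i =>
    ne_top_of_le_ne_top ENNReal.ofReal_ne_top (hL2 i)
  have hL3' : ∫⁻ t in Icc 0 T, sobSq 3 (fcoeff (v t 1)) ≠ ⊤ :=
    ne_top_of_le_ne_top ENNReal.ofReal_ne_top hL3
  have hfin2 : ∀ᵐ t ∂(timeMeasure T), ∀ i, sobSq 2 (fcoeff (v t i)) ≠ ⊤ := by
    rw [ae_all_iff]
    intro i
    filter_upwards [ae_lt_top' (aemeasurable_sobSq (hsol.aesm i) 2) (hL2' i)] with t ht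
    exact ht.ne
  have hfin3 : ∀ᵐ t ∂(timeMeasure T), sobSq 3 (fcoeff (v t 1)) ≠ ⊤ := by
    filter_upwards [ae_lt_top' (aemeasurable_sobSq (hsol.aesm 1) 3) hL3'] with t ht
    exact ht.ne
  set R : ℝ → Fin 2 → (Fin 2 → ℤ) → ℂ := fun t => residual ν lam (v t) with hR
  have hRsymm : ∀ t i k, -R t i (-k) = conj (-R t i k) := fun t i k => by
    simp only [hR, residual]
    rw [rate_neg, fcoeff_neg, fcoeff_neg]
    simp
  have hRm : ∀ i k, AEStronglyMeasurable (fun t => R t i k) (timeMeasure T) := fun i k =>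
    ((hsol.aesm i k).const_mul _).add (hsol.aesm_forcing i k)
  have hRle : ∀ᵐ t ∂(timeMeasure T), ∀ i, sobSq (-1) (R t i)
      ≤ 2 * (ENNReal.ofReal (ν ^ 2) * ENNReal.ofReal K
          + ENNReal.ofReal ((1 + |lam|) ^ 2) * sobSq 3 (fcoeff (v t 1))
        + 2 * (ENNReal.ofReal (M ^ 2) + ENNReal.ofReal embC * sobSq 2 (fcoeff (v t 1)))
          * ENNReal.ofReal K) := by
    filter_upwards [hfin2, ae_restrict_mem measurableSet_Icc] with t h2 ht i
    exact sobSq_residual_le ν lam (hM t ht) (hK t ht) (h2 1) i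
  have hRfin : ∀ᵐ t ∂(timeMeasure T), ∀ i, sobSq (-1) (fun k => -R t i k) ≠ ⊤ := by
    filter_upwards [hRle, hfin2, hfin3] with t h1 h2 h3 i
    rw [sobSq_neg]
    have := h2 1
    exact ne_top_of_le_ne_top (by finiteness) (h1 i)
  set g : ℝ → Fin 2 → Sobolev (-1) := fun t i => Sobolev.ofCoeff (-1) fun k => -R t i k with hg
  have hgc : ∀ᵐ t ∂(timeMeasure T), ∀ i, (g t i).coeff = fun k => -R t i k := by
    filter_upwards [hRfin] with t ht i
    exact Sobolev.coeff_ofCoeff (ht i) (hRsymm t i)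
  have hgLp : ∀ i, MemLp (fun t => g t i) 2 (timeMeasure T) := fun i => by
    refine memLp_two_of_coeff (fun k => (hRm i k).neg.congr ?_) ?_
    · filter_upwards [hgc] with t ht
      rw [ht i]
      rfl
    have hm3 := aemeasurable_sobSq (hsol.aesm 1) 3
    have hm2 := aemeasurable_sobSq (hsol.aesm 1) 2
    refine ne_top_of_le_ne_top ?_ (lintegral_mono_ae (g := fun t =>
      2 * (ENNReal.ofReal (ν ^ 2) * ENNReal.ofReal K
          + ENNReal.ofReal ((1 + |lam|) ^ 2) * sobSq 3 (fcoeff (v t 1))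
        + 2 * (ENNReal.ofReal (M ^ 2) + ENNReal.ofReal embC * sobSq 2 (fcoeff (v t 1)))
          * ENNReal.ofReal K)) ?_)
    · rw [lintegral_const_mul' _ _ (by simp), lintegral_add_left' (by fun_prop),
        lintegral_add_left' (by fun_prop), lintegral_const, lintegral_const_mul' _ _ (by simp),
        lintegral_mul_const' _ _ (by simp), lintegral_const_mul' _ _ (by simp),
        lintegral_add_left' (by fun_prop), lintegral_const, lintegral_const_mul' _ _ (by simp)]
      have h3 := hL2' 1
      finiteness
    · filter_upwards [hgc, hRle] with t h1 h2
      rw [h1 i, sobSq_neg]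
      exact h2 i
  refine ⟨h0, fun i => memBochner_top (hsol.aesm i) fun t ht => hK t ht i,
    memBochner_two (hsol.aesm 0) (hL2' 0), memBochner_two (hsol.aesm 1) hL3',
    fun s _ hs i => memCont_of_lt_one hs (fun k => (hsol i k).cont) fun t ht => hK t ht i,
    g, hgLp, fun i => ?_, fun φ hφ => ?_⟩
  · refine isTimeDeriv_of_coeff hT (fun k => (hsol i k).cont)
      (fun t ht => norm_le_of_sobSq_le ENNReal.ofReal_ne_top
        ((sobSq_mono zero_le_one _).trans (hK t ht i)))
      ((hgLp i).integrable (by norm_num)) fun k c => ?_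
    have h1 := (hsol i k).isPrim_clm hT
      (Complex.reCLM.comp ((ContinuousLinearMap.mul ℝ ℂ).flip c))
    refine IsPrim.congr h1 ?_ hT
    filter_upwards [hgc] with t ht
    rw [ht i]
    simp only [hR, residual, ContinuousLinearMap.comp_apply, ContinuousLinearMap.flip_apply,
      ContinuousLinearMap.mul_apply', Complex.reCLM_apply]
    rw [neg_mul, Complex.neg_re]
  · filter_upwards [hgc, hfin2, ae_restrict_mem measurableSet_Icc] with t h1 h2 ht
    have hu1 : sobSq 1 (fcoeff (v t 0)) ≠ ⊤ := ne_top_of_le_ne_top ENNReal.ofReal_ne_top (hK t ht 0)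
    have hz : ∀ i k, (g t i).coeff k + rate ν lam i k * fcoeff (v t i) k
        + fcoeff (adv id (v t) (v t i)) k = 0 := fun i k => by
      rw [h1 i]
      simp only [hR, residual]
      ring
    constructor
    · rw [weak_form_zero ν lam hu1 (memLp_adv_id h2 _) (g t 0) (hφ 0)]
      simp [hz]
    · rw [← sub_eq_zero, weak_form_one ν lam (h2 1) (memLp_adv_id h2 _) (g t 1) (hφ 1)]
      simp [hz]

/-- The Fourier coefficients of a function with a distributional time derivative in `H⁻¹` are
primitives of those of the derivative. -/
lemma IsTimeDeriv.isPrim_coeff {T : ℝ} (hT : 0 < T) {f : ℝ → L2} {g : ℝ → Sobolev (-1)}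
    (h : IsTimeDeriv T f g) {k : Fin 2 → ℤ} (hc : ContinuousOn (fun t => fcoeff (f t) k) (Icc 0 T))
    (hg : Integrable g (timeMeasure T)) (c : ℂ) :
    IsPrim T (fun t => (c * fcoeff (f t) k).re) (fun t => (c * (g t).coeff k).re) := by
  have hgk : Integrable (fun t => (g t).coeff k) (timeMeasure T) :=
    (Sobolev.coeffCLM (-1) k).integrable_comp hg
  refine IsPrim.of_integral_deriv_mul hT
    (Complex.continuous_re.comp_continuousOn (continuousOn_const.mul hc)) (hgk.const_mul c).re
    fun ψ hψ => ?_
  have h1 := h _ (isSmooth_re_expMode c (-k)) ψ hψ.smooth hψ.compact hψ.supp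
  have e1 : ∀ t, ∫ x, f t x * (c * expMode (-k) x).re
      = (2 * Real.pi) ^ 2 * (c * fcoeff (f t) k).re := fun t =>
    integral_mul_re_expMode (L2.integrable _) c k
  have e2 : ∀ t, (g t).pairing (fun x => (c * expMode (-k) x).re)
      = (2 * Real.pi) ^ 2 * (c * (g t).coeff k).re := fun t => by
    rw [Sobolev.pairing, re_tsum_mul_conj_fcoeff_re_expMode (g t).coeff_neg, (g t).coeff_neg,
      ← map_mul, Complex.conj_re, mul_comm c]
  simp only [e1, e2, mul_left_comm _ ((2 * Real.pi) ^ 2)] at h1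
  rw [integral_const_mul, integral_const_mul, ← mul_neg] at h1
  exact mul_left_cancel₀ (by positivity) h1

lemma MemBochner.exists_bound {T s : ℝ} {f : ℝ → L2} (h : MemBochner ⊤ T s f) :
    ∃ K : ℝ, ∀ᵐ t ∂(timeMeasure T), sobSq s (fcoeff (f t)) ≤ ENNReal.ofReal K := by
  obtain ⟨c, hc, hr⟩ := h
  have h1 := hc.2
  rw [eLpNorm_exponent_top] at h1
  refine ⟨((eLpNormEssSup c (timeMeasure T)) ^ 2).toReal, ?_⟩
  filter_upwards [hr, ae_le_eLpNormEssSup (f := c) (μ := timeMeasure T)] with t h2 h3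
  rw [ENNReal.ofReal_toReal (ENNReal.pow_ne_top h1.ne), ← funext h2, ← Sobolev.enorm_sq]
  exact pow_le_pow_left' h3 2

lemma MemBochner.lintegral_ne_top {T s : ℝ} {f : ℝ → L2} (h : MemBochner 2 T s f) :
    ∫⁻ t in Icc 0 T, sobSq s (fcoeff (f t)) ≠ ⊤ := by
  obtain ⟨c, hc, hr⟩ := h
  have h1 := lintegral_sobSq_ne_top_of_memLp hc
  rwa [lintegral_congr_ae (g := fun t => sobSq s (fcoeff (f t)))] at h1
  filter_upwards [hr] with t ht
  rw [← funext ht]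

lemma MemCont.continuousOn_fcoeff {T s : ℝ} {f : ℝ → L2} (h : MemCont T s f) (k : Fin 2 → ℤ) :
    ContinuousOn (fun t => fcoeff (f t) k) (Icc 0 T) := by
  obtain ⟨c, hc, hr⟩ := h
  refine ((Sobolev.coeffCLM s k).continuous.comp_continuousOn hc).congr fun t ht => ?_
  exact (hr t ht k).symm

/-- The bounds and the equations for the Fourier coefficients of a strong solution. -/
theorem IsStrongSolution.pairSol {ν lam T : ℝ} (hT : 0 < T) {uin : Fin 2 → L2}
    {v : ℝ → Fin 2 → L2} (h : IsStrongSolution ν lam T uin v) :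
    ∃ K L : ℝ, (∀ᵐ t ∂(timeMeasure T), pairSq 1 (v t) ≤ ENNReal.ofReal K) ∧
      ∫⁻ t in Icc 0 T, pairSq 2 (v t) ≤ ENNReal.ofReal L ∧
      PairSol ν lam T v fun t i k => fcoeff (adv id (v t) (v t i)) k := by
  have hc : ∀ i k, ContinuousOn (fun t => fcoeff (v t i) k) (Icc 0 T) := fun i =>
    (h.mem_cont 0 le_rfl zero_lt_one i).continuousOn_fcoeff
  have hm : ∀ i k, AEStronglyMeasurable (fun t => fcoeff (v t i) k) (timeMeasure T) := fun i k =>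
    (hc i k).aestronglyMeasurable measurableSet_Icc
  choose K hK using fun i => (h.mem_H1 i).exists_bound
  have hL : ∀ i, ∫⁻ t in Icc 0 T, sobSq 2 (fcoeff (v t i)) ≠ ⊤ := fun i => by
    fin_cases i
    · exact h.mem_H2.lintegral_ne_top
    · exact ne_top_of_le_ne_top h.mem_H3.lintegral_ne_top
        (lintegral_mono fun t => sobSq_mono (by norm_num) _)
  have hfin2 : ∀ᵐ t ∂(timeMeasure T), ∀ i, sobSq 2 (fcoeff (v t i)) ≠ ⊤ := by
    rw [ae_all_iff]
    intro i
    filter_upwards [ae_lt_top' (aemeasurable_sobSq (hm i) 2) (hL i)] with t ht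
    exact ht.ne
  obtain ⟨g, hgLp, hgd, hgeq⟩ := h.equation
  have hgi : ∀ i, Integrable (fun t => g t i) (timeMeasure T) := fun i =>
    (hgLp i).integrable (by norm_num)
  refine ⟨(∑ i, ENNReal.ofReal (K i)).toReal, (∫⁻ t in Icc 0 T, pairSq 2 (v t)).toReal,
    ?_, ?_, fun i k => ?_⟩
  · rw [ENNReal.ofReal_toReal (ENNReal.sum_ne_top.mpr fun i _ => ENNReal.ofReal_ne_top)]
    filter_upwards [hK 0, hK 1] with t h1 h2
    rw [pairSq, Fin.sum_univ_two, Fin.sum_univ_two]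
    exact add_le_add h1 h2
  · refine (ENNReal.ofReal_toReal ?_).ge
    simp only [pairSq]
    rw [lintegral_finsetSum' _ fun i _ => aemeasurable_sobSq (hm i) 2]
    exact ENNReal.sum_ne_top.mpr fun i _ => hL i
  set a : ℝ := rate ν lam i k with ha
  have hgk : Integrable (fun t => (g t i).coeff k) (timeMeasure T) :=
    (Sobolev.coeffCLM (-1) k).integrable_comp (hgi i)
  -- testing with the real part of `c e^{i k·x}`, `c = 1, i`, shows that every coefficient vanishes
  have hd : ∀ᵐ t ∂(timeMeasure T), (g t i).coeff k + a * fcoeff (v t i) k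
      + fcoeff (adv id (v t) (v t i)) k = 0 := by
    have hφ : ∀ c : ℂ, ∀ j : Fin 2, IsSmooth ((fun _ x => (c * expMode k x).re : Fin 2 → Torus → ℝ) j) :=
      fun c _ => isSmooth_re_expMode c k
    filter_upwards [hgeq _ (hφ 1), hgeq _ (hφ Complex.I), hfin2] with t h1 h2 h3
    have hsymm : ∀ j l, (g t j).coeff (-l) + rate ν lam j (-l) * fcoeff (v t j) (-l)
        + fcoeff (adv id (v t) (v t j)) (-l)
        = conj ((g t j).coeff l + rate ν lam j l * fcoeff (v t j) l
          + fcoeff (adv id (v t) (v t j)) l) := fun j l => by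
      rw [(g t j).coeff_neg, rate_neg, fcoeff_neg, fcoeff_neg]
      simp
    have hu1 : sobSq 1 (fcoeff (v t 0)) ≠ ⊤ :=
      ne_top_of_le_ne_top (h3 0) (sobSq_mono (by norm_num) _)
    have hre : ∀ j, ∀ c : ℂ, ((g t 0).pairing (fun x => (c * expMode k x).re)
          + ν * gradInner (v t 0) (fun x => (c * expMode k x).re)
          + advInner (v t) (v t 0) (fun x => (c * expMode k x).re) = 0 ∧
        (g t 1).pairing (fun x => (c * expMode k x).re)
          + lapInner (v t 1) (fun x => (c * expMode k x).re)
          + advInner (v t) (v t 1) (fun x => (c * expMode k x).re)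
          = lam * gradInner (v t 1) (fun x => (c * expMode k x).re)) →
        (((g t j).coeff k + rate ν lam j k * fcoeff (v t j) k
          + fcoeff (adv id (v t) (v t j)) k) * conj c).re = 0 := fun j c hj => by
      rw [← re_tsum_mul_conj_fcoeff_re_expMode (d := fun l => (g t j).coeff l
        + rate ν lam j l * fcoeff (v t j) l + fcoeff (adv id (v t) (v t j)) l) (hsymm j) c k]
      have hpi : ((2 * Real.pi) ^ 2 : ℝ) ≠ 0 := by positivity
      fin_cases j
      · have h4 := hj.1
        rw [weak_form_zero ν lam hu1 (memLp_adv_id h3 _) (g t 0) (isSmooth_re_expMode c k)] at h4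
        exact (mul_eq_zero.mp h4).resolve_left hpi
      · have h4 := sub_eq_zero.mpr hj.2
        rw [weak_form_one ν lam (h3 1) (memLp_adv_id h3 _) (g t 1) (isSmooth_re_expMode c k)] at h4
        exact (mul_eq_zero.mp h4).resolve_left hpi
    have hr := hre i 1 h1
    have hi := hre i Complex.I h2
    rw [map_one, mul_one] at hr
    rw [Complex.conj_I, mul_neg, Complex.neg_re, neg_eq_zero, Complex.mul_I_re, neg_eq_zero] at hi
    exact Complex.ext hr hi
  -- The forcing is written through `∂ₜ v` first; the equation identifies it with the advection term.
  have hsol : ModeSol T a (fun t => fcoeff (v t i) k)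
      (fun t => -(g t i).coeff k - a * fcoeff (v t i) k) := by
    have hzi : IntegrableOn (fun t => (a : ℂ) * fcoeff (v t i) k) (Icc 0 T) :=
      (continuousOn_const.mul (hc i k)).integrableOn_Icc
    refine ⟨hc i k, hgk.neg.sub hzi, fun t ht => ?_⟩
    have hit : IntervalIntegrable (fun t => (g t i).coeff k) volume 0 t :=
      (intervalIntegrable_iff_integrableOn_Icc_of_le ht.1).mpr
        (IntegrableOn.mono_set hgk (Icc_subset_Icc_right ht.2))
    have e0 : ∀ s, (a : ℂ) * fcoeff (v s i) k + (-(g s i).coeff k - a * fcoeff (v s i) k)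
        = -(g s i).coeff k := fun s => by ring
    simp only [e0]
    rw [intervalIntegral.integral_neg, sub_neg_eq_add]
    have h1 := ((hgd i).isPrim_coeff hT (hc i k) (hgi i) 1).eq t ht
    have h2 := ((hgd i).isPrim_coeff hT (hc i k) (hgi i) (-Complex.I)).eq t ht
    have hI : ∀ z : ℂ, (-Complex.I * z).re = z.im := fun z => by simp
    simp only [one_mul, hI] at h1 h2
    have h3 := Complex.reCLM.intervalIntegral_comp_comm hit
    have h4 := Complex.imCLM.intervalIntegral_comp_comm hit
    simp only [Complex.reCLM_apply, Complex.imCLM_apply] at h3 h4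
    refine Complex.ext ?_ ?_
    · rw [Complex.add_re, ← h3, h1]
    · rw [Complex.add_im, ← h4, h2]
  refine hsol.congr ?_
  filter_upwards [hd] with t ht
  linear_combination -ht

/-- Strong solutions with the same initial data coincide. -/
theorem IsStrongSolution.eq {ν lam T : ℝ} (hν : 0 < ν) (hT : 0 < T) {uin : Fin 2 → L2}
    {u v : ℝ → Fin 2 → L2} (hu : IsStrongSolution ν lam T uin u)
    (hv : IsStrongSolution ν lam T uin v) {t : ℝ} (ht : t ∈ Icc 0 T) : v t = u t := by
  obtain ⟨K, L, hK, hL, hsol⟩ := hu.pairSol hT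
  obtain ⟨K', L', hK', hL', hsol'⟩ := hv.pairSol hT
  obtain ⟨C, hC⟩ := exists_stability hν lam hT.le (max K K') (max L L')
  have h0 : pairSq (1 / 2) (v 0 - u 0) = 0 := by
    have hz : ∀ i k, fcoeff ((v 0 - u 0) i) k = 0 := fun i k => by
      rw [Pi.sub_apply, fcoeff_sub, hv.initial, hu.initial, sub_self]
    simp only [pairSq, sobSq, hz]
    simp
  have h1 := hC id LipschitzWith.id rfl v u _ _ (fun _ => 0) hsol' hsol
    (hK'.mono fun t h => h.trans (ENNReal.ofReal_le_ofReal (le_max_right _ _)))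
    (hK.mono fun t h => h.trans (ENNReal.ofReal_le_ofReal (le_max_left _ _)))
    (hL'.trans (ENNReal.ofReal_le_ofReal (le_max_right _ _)))
    (hL.trans (ENNReal.ofReal_le_ofReal (le_max_left _ _)))
    (Filter.Eventually.of_forall fun t i => by
      rw [add_zero]
      refine (sobSq_mono (by norm_num) _).trans (le_mul_of_one_le_left zero_le one_le_two))
    (by rw [h0]; simp) (by simp) t ht
  rw [h0, lintegral_zero, add_zero, mul_zero, nonpos_iff_eq_zero] at h1
  funext i
  refine L2.ext_fcoeff fun k => ?_
  have h2 : sobSq (1 / 2) (fcoeff ((v t - u t) i)) = 0 :=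
    le_antisymm (h1 ▸ sobSq_le_pairSq (1 / 2) (v t - u t) i) zero_le
  rw [sobSq, ENNReal.tsum_eq_zero] at h2
  have h3 := ENNReal.ofReal_eq_zero.mp (h2 k)
  have hj := Real.rpow_pos_of_pos (jb_pos k) (1 / 2)
  have h4 : ‖fcoeff ((v t - u t) i) k‖ ^ 2 = 0 :=
    le_antisymm (by
      by_contra h5
      exact absurd h3 (not_le.mpr (mul_pos hj (not_le.mp h5)))) (sq_nonneg _)
  rw [Pi.sub_apply, fcoeff_sub, sq_eq_zero_iff, norm_eq_zero, sub_eq_zero] at h4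
  exact h4

end

end RKSE

theorem theorem3p2 (ν lam T : ℝ) (hν : 0 < ν) (hlam : 0 < lam) (hT : 0 < T)
    (uin : Fin 2 → RKSE.L2) (huin : ∀ i, RKSE.MemSobolev 1 (uin i))
    (huin_bdd : MemLp (uin 0) ∞ volume) :
    ∃ u : ℝ → Fin 2 → RKSE.L2, RKSE.IsStrongSolution ν lam T uin u ∧
      ∀ v : ℝ → Fin 2 → RKSE.L2, RKSE.IsStrongSolution ν lam T uin v →
        ∀ t ∈ Icc 0 T, v t = u t := by
  have hpair : RKSE.pairSq 1 uin ≠ ⊤ := ENNReal.sum_ne_top.mpr fun i _ => by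
    obtain ⟨c, hc⟩ := huin i
    exact hc.sobSq_ne_top
  have hfin : eLpNormEssSup (uin 0) volume ≠ ⊤ := by
    rw [← eLpNorm_exponent_top]
    exact huin_bdd.2.ne
  have hbdd : ∀ᵐ x, |uin 0 x| ≤ (eLpNormEssSup (uin 0) volume).toReal := by
    filter_upwards [ae_le_eLpNormEssSup (f := uin 0) (μ := volume)] with x hx
    rw [← Real.norm_eq_abs, ← toReal_enorm]
    exact ENNReal.toReal_mono hfin hx
  obtain ⟨v, K, L, h0, hK, hL2, hL3, hM, hsol⟩ :=
    RKSE.exists_pairSol hν lam hT.le hpair ENNReal.toReal_nonneg hbdd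
  have hv := hsol.isStrongSolution hT.le h0 hK hL2 hL3 hM
  exact ⟨v, hv, fun w hw t ht => hv.eq hν hT hw ht⟩
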